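/- Let $b\in\mathbb C$, $b\neq 0$, let $i=\sqrt{-1}$, and let $\varphi:\mathbb P^1\times\mathbb P^1\dashrightarrow\mathbb P^1\times\mathbb P^1$ be the rational map $(x,y)\mapsto(\bar x,\bar y)$, $$\bar x=\frac{x\bigl(-ix(x+1)+y(bx+1)\bigr)}{y\bigl(x(x-b)+iby(x-1)\bigr)},\qquad \bar y=\frac{x\bigl(x(x+1)+iby(x-1)\bigr)}{b\bigl(x(x+1)-iy(x-1)\bigr)}.$$ Let $X$ be the surface obtained from $\mathbb P^1\times\mathbb P^1$ by successively blowing up the eight points $(x,y)=(-1,0)$, $(0,1/b)$, $(1,\infty)$, $(\infty,1)$, $(0,0)$, $(x,y/x)=(0,i)$, $(x,y)=(\infty,\infty)$, $(x,x/y)=(\infty,-ib)$ (the sixth is infinitely near to the fifth, the eighth to the seventh). (1) $\varphi$ is birational and lifts to an automorphism of $X$. (2) $\dim|-K_X|=0$ and $\dim|-2K_X|=1$. The pencil $|-2K_X|$ is spanned by $f_0=x^2y^2$ and $$f_1=\bigl(ix(x+1)^2-i(x+i)(x^2-1)y+b(x-1)^2y^2\bigr)\bigl(-ix(y-1)+y(by-1)\bigr).$$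 (3) The function $k=f_1/f_0$ is an elliptic fibration $X\to\mathbb P^1$ which makes $X$ a rational elliptic surface: $k$ is a morphism, all but finitely many fibres are elliptic curves, $k$ is not birational to a projection $E\times\mathbb P^1\to\mathbb P^1$ with $E$ an elliptic curve, and no fibre contains an exceptional curve of the first kind. (4) $k\circ\varphi=-k$. Hence $k^2$ is invariant under $\varphi$, and $\varphi$ is of type ii-2. Here an automorphism $\varphi$ of $X$ is of type ii-$m$ ($m\ge1$) if $\dim|-jK_X|=0$ for $0<j<m$, $\dim|-mK_X|=1$, the pencil $|-mK_X|$ is an elliptic fibration as in (3), and $\varphi$ preserves this fibration but does not act trivially on its parameter. Moreover $\varphi$ has infinite order if $b^2\neq1$. (5) For $b_0,b_1,b_2,c\in\mathbb C\setminus\{0\}$ let $X_{b_0,b_1,b_2,c}$ be $\mathbb P^1\times\mathbb P^1$ blown up at $(b_1,0)$, $(0,1/b_2)$, $(1,\infty)$, $(\infty,1)$, $(0,0)$, $(x,y/x)=(0,c)$, $(\infty,\infty)$, $(x,x/y)=(\infty,1/(cb_0))$ (the family of surfaces of type $A_5^{(1)}$), let $q=(b_0b_1b_2)^{-1}$, and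 let $w_{\alpha_1},w_{\alpha_2},\rho,\sigma$ send $(x,y;b_0,b_1,b_2,c)$ to $$\begin{aligned} w_{\alpha_1}:&\ \Bigl(\tfrac{x}{b_1},\tfrac{y(x-1)}{x-b_1};\,b_0b_1,\tfrac1{b_1},b_1b_2,c\Bigr),& w_{\alpha_2}:&\ \Bigl(\tfrac{b_2x(y-1)}{b_2y-1},b_2y;\,b_0b_2,b_1b_2,\tfrac1{b_2},c\Bigr),\\ \rho:&\ \Bigl(\tfrac1y,\tfrac{cx}{y};\,b_1,b_2,b_0,c\Bigr),& \sigma:&\ \Bigl(\tfrac{b_1}{x},\tfrac1{b_2y};\,b_0,b_1,b_2,\tfrac1{b_0b_1b_2c}\Bigr). \end{aligned}$$ For all nonzero values of the parameters, $\sigma\circ(w_{\alpha_1}\circ w_{\alpha_2}\circ\rho)^2$ lifts to an isomorphism from $X_{b_0,b_1,b_2,c}$ onto the member of the family with the transformed parameters; it leaves the parameters unchanged if $q=-1$ and $c=i$. At $(b_0,b_1,b_2,c)=(1/b,-1,b,i)$, where $q=-1$, one has $X_{1/b,-1,b,i}=X$ and $\sigma\circ(w_{\alpha_1}\circ w_{\alpha_2}\circ\rho)^2=\varphi$.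 -/

import Mathlib

/-!
Surfaces birational to the plane are described, in the sense of Zariski, by the set of local rings
of their closed points, all of them being subalgebras of the common field of rational functions.
-/

open scoped KaehlerDifferential

noncomputable section

namespace HalphenSurface

section Models

variable {K : Type*} [Field K] [Algebra ℂ K]

/-- The localization `A_p` of a subalgebra `A` of the field `K` at a prime ideal `p`,
as a subalgebra of `K`. -/
def localizationAt (A : Subalgebra ℂ K) (p : Ideal A) [hp : p.IsPrime] : Subalgebra ℂ K where
  carrier := {z | ∃ a s : A, s ∉ p ∧ z = (a : K) / (s : K)}
  mul_mem' := by
    rintro _ _ ⟨a, s, hs, rfl⟩ ⟨a', s', hs', rfl⟩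
    refine ⟨a * a', s * s', fun h => ?_, ?_⟩
    · rcases hp.mem_or_mem h with h | h
      exacts [hs h, hs' h]
    · push_cast
      exact div_mul_div_comm _ _ _ _
  add_mem' := by
    rintro _ _ ⟨a, s, hs, rfl⟩ ⟨a', s', hs', rfl⟩
    have h0 : (s : K) ≠ 0 := fun h => hs (by
      have : s = 0 := Subtype.ext h
      rw [this]; exact p.zero_mem)
    have h0' : (s' : K) ≠ 0 := fun h => hs' (by
      have : s' = 0 := Subtype.ext h
      rw [this]; exact p.zero_mem)
    refine ⟨a * s' + s * a', s * s', fun h => ?_, ?_⟩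
    · rcases hp.mem_or_mem h with h | h
      exacts [hs h, hs' h]
    · push_cast
      exact div_add_div _ _ h0 h0'
  algebraMap_mem' := by
    intro r
    refine ⟨algebraMap ℂ A r, 1, fun h => hp.ne_top ((Ideal.eq_top_iff_one p).mpr h), ?_⟩
    simp

/-- The maximal ideal of a local ring `R` (its Jacobson radical). It is only used for local `R`. -/
def maxIdeal (R : Subalgebra ℂ K) : Ideal R := Ideal.jacobson ⊥

/-- The rational function `f` is regular at the point with local ring `R` and vanishes there. -/
def VanishesAt (f : K) (R : Subalgebra ℂ K) : Prop :=
  ∃ h : f ∈ R, (⟨f, h⟩ : R) ∈ maxIdeal R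

/-- The local rings of the closed points of the affine surface with coordinate ring `A`. -/
def closedPoints (A : Subalgebra ℂ K) : Set (Subalgebra ℂ K) :=
  {R | ∃ (m : Ideal A) (_ : m.IsMaximal), R = localizationAt A m}

/-- The local rings of the closed points of `ℙ¹ × ℙ¹` with affine coordinates `x`, `y`: the union
of the four affine planes `(x, y)`, `(1/x, y)`, `(x, 1/y)`, `(1/x, 1/y)`. -/
def projLineSq (x y : K) : Set (Subalgebra ℂ K) :=
  {R | ∃ u v : K, (u = x ∨ u = x⁻¹) ∧ (v = y ∨ v = y⁻¹) ∧
    R ∈ closedPoints (Algebra.adjoin ℂ {u, v})}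

/-- The affine chart `R[𝔪/t]` of the blow-up of the closed point of `Spec R`, `0 ≠ t ∈ 𝔪`. -/
def blowUpChart (R : Subalgebra ℂ K) (t : K) : Subalgebra ℂ K :=
  Algebra.adjoin ℂ {z | VanishesAt (t * z) R}

/-- The closed points of the exceptional curve of the blow-up of the closed point of `Spec R`
(the quadratic transforms of `R`). In the chart `R[𝔪/t]` this curve is `t = 0`. -/
def exceptionalPoints (R : Subalgebra ℂ K) : Set (Subalgebra ℂ K) :=
  {S | ∃ t : K, t ≠ 0 ∧ VanishesAt t R ∧ S ∈ closedPoints (blowUpChart R t) ∧ VanishesAt t S}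

/-- The blow-up of the surface `X` at its point at which `u` and `v` both vanish: the local ring of
that point is replaced by its quadratic transforms. -/
def blowUp (X : Set (Subalgebra ℂ K)) (u v : K) : Set (Subalgebra ℂ K) :=
  {R | R ∈ X ∧ ¬ (VanishesAt u R ∧ VanishesAt v R)} ∪
    {S | ∃ R ∈ X, (VanishesAt u R ∧ VanishesAt v R) ∧ S ∈ exceptionalPoints R}

/-- The birational map `X ⇢ Y` whose pull-back of rational functions is `Φ` is an isomorphism of
surfaces `X ≃ Y`: `Φ` carries the local rings of the points of `Y` exactly onto those of the points
of `X`. -/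
def LiftsToIso (Φ : K ≃ₐ[ℂ] K) (X Y : Set (Subalgebra ℂ K)) : Prop :=
  (fun R : Subalgebra ℂ K => R.map (Φ : K →ₐ[ℂ] K)) '' Y = X

/-- The prime divisors (irreducible curves) of `X`, each given by the local ring of its generic
point. -/
def primeDivisors (X : Set (Subalgebra ℂ K)) : Set (Subalgebra ℂ K) :=
  {V | ∃ R ∈ X, ∃ (p : Ideal R) (_ : p.IsPrime), p.height = 1 ∧ V = localizationAt R p}

/-- The regular differentials of a function field `F` over `ℂ`: those elements of `Ω[F⁄ℂ]` which,
for every valuation ring `O` of `F` over `ℂ`, are sums of `a • dg` with `a, g ∈ O`. -/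
def regularDifferentials (F : Type*) [Field F] [Algebra ℂ F] : Submodule ℂ Ω[F⁄ℂ] :=
  ⨅ (O : ValuationSubring F) (_ : ∀ z : ℂ, algebraMap ℂ F z ∈ O),
    Submodule.span ℂ {η | ∃ a ∈ O, ∃ g ∈ O, η = a • KaehlerDifferential.D ℂ F g}

/-- The genus of a function field in one variable over `ℂ`. -/
def geometricGenus (F : Type*) [Field F] [Algebra ℂ F] : ℕ :=
  Module.finrank ℂ (regularDifferentials F)

/-- The fibre of the rational function `k` on `X` over `c` is an elliptic curve: it is nonsingular
(the local equation `k - c` never lies in `𝔪²`), irreducible, and of genus one. -/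
def IsEllipticFibre (X : Set (Subalgebra ℂ K)) (k : K) (c : ℂ) : Prop :=
  (∀ R ∈ X, ∀ h : k - algebraMap ℂ K c ∈ R,
    (⟨k - algebraMap ℂ K c, h⟩ : R) ∉ maxIdeal R ^ 2) ∧
  ∃ V ∈ primeDivisors X, VanishesAt (k - algebraMap ℂ K c) V ∧
    (∀ W ∈ primeDivisors X, VanishesAt (k - algebraMap ℂ K c) W → W = V) ∧
    ∃ _ : IsLocalRing V, geometricGenus (IsLocalRing.ResidueField V) = 1

/-- `C` is (the set of closed points of) an exceptional curve of the first kind on `X`: it arises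
from blowing up a nonsingular point of a surface. -/
def IsExceptionalCurve (X C : Set (Subalgebra ℂ K)) : Prop :=
  ∃ S : Subalgebra ℂ K, IsRegularLocalRing S ∧ ringKrullDim S = 2 ∧ IsFractionRing S K ∧
    C = exceptionalPoints S ∧ C ⊆ X

/-- The rational function `k` is an elliptic fibration `X → ℙ¹` making `X` a rational elliptic
surface. -/
structure IsEllipticFibration (X : Set (Subalgebra ℂ K)) (k : K) : Prop where
  /-- `k` is a morphism to `ℙ¹` -/
  morphism : ∀ R ∈ X, k ∈ R ∨ k⁻¹ ∈ R
  /-- all but finitely many fibres are elliptic curves -/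
  elliptic : {c : ℂ | ¬ IsEllipticFibre X k c}.Finite
  /-- `k` is not birational to a projection `E × ℙ¹ → ℙ¹` with `E` an elliptic curve -/
  not_product : ¬ ∃ E : IntermediateField ℂ K, Algebra.trdeg ℂ E = 1 ∧ geometricGenus E = 1 ∧
    IntermediateField.adjoin E {k} = ⊤
  /-- no fibre contains an exceptional curve of the first kind -/
  minimal : ∀ C, IsExceptionalCurve X C →
    ¬ (∃ c : ℂ, ∀ R ∈ C, VanishesAt (k - algebraMap ℂ K c) R) ∧ ¬ (∀ R ∈ C, VanishesAt k⁻¹ R)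

end Models

/-- The field `ℂ(x, y)` of rational functions of `ℙ¹ × ℙ¹`. -/
abbrev PlaneField : Type := FractionRing (MvPolynomial (Fin 2) ℂ)

/-- The coordinate `x`. -/
def xc : PlaneField := algebraMap (MvPolynomial (Fin 2) ℂ) PlaneField (MvPolynomial.X 0)

/-- The coordinate `y`. -/
def yc : PlaneField := algebraMap (MvPolynomial (Fin 2) ℂ) PlaneField (MvPolynomial.X 1)

/-- The constants of `ℂ(x, y)`. -/
abbrev cst (z : ℂ) : PlaneField := algebraMap ℂ PlaneField z

instance : Algebra.FormallyEtale (MvPolynomial (Fin 2) ℂ) PlaneField :=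
  Algebra.FormallyEtale.of_isLocalization (nonZeroDivisors (MvPolynomial (Fin 2) ℂ))

/-- The basis `dx, dy` of the differentials of `ℂ(x, y)`. -/
def differentialBasis : Module.Basis (Fin 2) PlaneField Ω[PlaneField⁄ℂ] :=
  ((KaehlerDifferential.mvPolynomialBasis ℂ (Fin 2)).baseChange PlaneField).map
    (KaehlerDifferential.tensorKaehlerEquivOfFormallyEtale ℂ (MvPolynomial (Fin 2) ℂ) PlaneField)

theorem differentialBasis_apply (i : Fin 2) :
    differentialBasis i = KaehlerDifferential.D ℂ PlaneField
      (algebraMap (MvPolynomial (Fin 2) ℂ) PlaneField (MvPolynomial.X i)) := by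
  simp [differentialBasis, KaehlerDifferential.tensorKaehlerEquivOfFormallyEtale_apply]

/-- The Jacobian `∂(u, v)/∂(x, y)`, that is, `du ∧ dv = jacobian u v • dx ∧ dy`. -/
def jacobian (u v : PlaneField) : PlaneField :=
  differentialBasis.det ![KaehlerDifferential.D ℂ PlaneField u, KaehlerDifferential.D ℂ PlaneField v]

/-- The space `H⁰(X, -n K_X)`: the `f` for which `f (∂x ∧ ∂y)^n` is regular on `X`. If `u, v` are
local parameters at a point, this tensor is `f * jacobian u v ^ n` times `(∂u ∧ ∂v)^n`. -/
def antiPluricanonical (X : Set (Subalgebra ℂ PlaneField)) (n : ℕ) : Submodule ℂ PlaneField where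
  carrier := {f | ∀ R ∈ X, ∀ u v : R, Ideal.span {u, v} = maxIdeal R →
    f * jacobian u v ^ n ∈ R}
  add_mem' := by
    intro f g hf hg R hR u v h
    rw [add_mul]
    exact R.add_mem (hf R hR u v h) (hg R hR u v h)
  zero_mem' := by
    intro R _ u v _
    rw [zero_mul]
    exact R.zero_mem
  smul_mem' := by
    intro c f hf R hR u v h
    rw [smul_mul_assoc]
    exact R.smul_mem (hf R hR u v h) c

/-- `dim |-n K_X| = dim H⁰(X, -n K_X) - 1`. -/
def antiPluricanonicalDim (X : Set (Subalgebra ℂ PlaneField)) (n : ℕ) : ℤ :=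
  (Module.finrank ℂ (antiPluricanonical X n) : ℤ) - 1

/-- Type `ii-m`: `X` is a Halphen surface of index `m`, the pencil `|-m K_X|`, spanned by `f` and
`g`, is an elliptic fibration (so that the fibres have the class `-m K_X`, that is, degree `3m` in
`ℙ²`), and the map with pull-back `Φ` is an automorphism of `X` which preserves this fibration but
acts nontrivially on its parameter `g / f`. -/
def IsTypeII (m : ℕ) (X : Set (Subalgebra ℂ PlaneField)) (Φ : PlaneField ≃ₐ[ℂ] PlaneField) : Prop :=
  0 < m ∧ LiftsToIso Φ X X ∧
  (∀ j, 0 < j → j < m → antiPluricanonicalDim X j = 0) ∧ antiPluricanonicalDim X m = 1 ∧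
  ∃ f g : PlaneField, antiPluricanonical X m = Submodule.span ℂ {f, g} ∧
    IsEllipticFibration X (g / f) ∧
    (∃ α β γ δ : ℂ, α * δ - β * γ ≠ 0 ∧
      Φ (g / f) = (cst α * (g / f) + cst β) / (cst γ * (g / f) + cst δ)) ∧
    Φ (g / f) ≠ g / f

/-- `ℙ¹ × ℙ¹` blown up at the eight points of the example (the sixth is infinitely near to the
fifth, and the eighth to the seventh). -/
def exampleSurface (b : ℂ) : Set (Subalgebra ℂ PlaneField) :=
  let X₁ := blowUp (projLineSq xc yc) (xc + 1) yc
  let X₂ := blowUp X₁ xc (yc - cst (1 / b))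
  let X₃ := blowUp X₂ (xc - 1) yc⁻¹
  let X₄ := blowUp X₃ xc⁻¹ (yc - 1)
  let X₅ := blowUp X₄ xc yc
  let X₆ := blowUp X₅ xc (yc / xc - cst Complex.I)
  let X₇ := blowUp X₆ xc⁻¹ yc⁻¹
  blowUp X₇ xc⁻¹ (xc / yc + cst (Complex.I * b))

/-- The first component of the map `φ`. -/
def phiX (b : ℂ) : PlaneField :=
  xc * (-cst Complex.I * xc * (xc + 1) + yc * (cst b * xc + 1)) /
    (yc * (xc * (xc - cst b) + cst Complex.I * cst b * yc * (xc - 1)))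

/-- The second component of the map `φ`. -/
def phiY (b : ℂ) : PlaneField :=
  xc * (xc * (xc + 1) + cst Complex.I * cst b * yc * (xc - 1)) /
    (cst b * (xc * (xc + 1) - cst Complex.I * yc * (xc - 1)))

/-- The polynomial `f₀`. -/
def f₀ : PlaneField := xc ^ 2 * yc ^ 2

/-- The polynomial `f₁`. -/
def f₁ (b : ℂ) : PlaneField :=
  (cst Complex.I * xc * (xc + 1) ^ 2 - cst Complex.I * (xc + cst Complex.I) * (xc ^ 2 - 1) * yc
      + cst b * (xc - 1) ^ 2 * yc ^ 2) *
    (-cst Complex.I * xc * (yc - 1) + yc * (cst b * yc - 1))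

/-- A pair of rational functions together with values of the parameters `b₀, b₁, b₂, c`. -/
@[ext] structure FamilyPoint where
  x : PlaneField
  y : PlaneField
  b₀ : ℂ
  b₁ : ℂ
  b₂ : ℂ
  c : ℂ

/-- The family of surfaces of type `A₅⁽¹⁾`: `ℙ¹ × ℙ¹` blown up at
`(b₁, 0)`, `(0, 1/b₂)`, `(1, ∞)`, `(∞, 1)`, `(0, 0)`, `(x, y/x) = (0, c)`, `(∞, ∞)`,
`(x, x/y) = (∞, 1/(c b₀))`. -/
def familySurface (b₀ b₁ b₂ c : ℂ) : Set (Subalgebra ℂ PlaneField) :=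
  let X₁ := blowUp (projLineSq xc yc) (xc - cst b₁) yc
  let X₂ := blowUp X₁ xc (yc - cst (1 / b₂))
  let X₃ := blowUp X₂ (xc - 1) yc⁻¹
  let X₄ := blowUp X₃ xc⁻¹ (yc - 1)
  let X₅ := blowUp X₄ xc yc
  let X₆ := blowUp X₅ xc (yc / xc - cst c)
  let X₇ := blowUp X₆ xc⁻¹ yc⁻¹
  blowUp X₇ xc⁻¹ (xc / yc - cst (1 / (c * b₀)))

/-- The generator `w_{α₁}`. -/
def wAlpha₁ (s : FamilyPoint) : FamilyPoint where
  x := s.x / cst s.b₁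
  y := s.y * (s.x - 1) / (s.x - cst s.b₁)
  b₀ := s.b₀ * s.b₁
  b₁ := 1 / s.b₁
  b₂ := s.b₁ * s.b₂
  c := s.c

/-- The generator `w_{α₂}`. -/
def wAlpha₂ (s : FamilyPoint) : FamilyPoint where
  x := cst s.b₂ * s.x * (s.y - 1) / (cst s.b₂ * s.y - 1)
  y := cst s.b₂ * s.y
  b₀ := s.b₀ * s.b₂
  b₁ := s.b₁ * s.b₂
  b₂ := 1 / s.b₂
  c := s.c

/-- The generator `ρ`. -/
def rho (s : FamilyPoint) : FamilyPoint where
  x := 1 / s.y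
  y := cst s.c * s.x / s.y
  b₀ := s.b₁
  b₁ := s.b₂
  b₂ := s.b₀
  c := s.c

/-- The generator `σ`. -/
def sigma (s : FamilyPoint) : FamilyPoint where
  x := cst s.b₁ / s.x
  y := 1 / (cst s.b₂ * s.y)
  b₀ := s.b₀
  b₁ := s.b₁
  b₂ := s.b₂
  c := 1 / (s.b₀ * s.b₁ * s.b₂ * s.c)

/-- The map `σ ∘ (w_{α₁} ∘ w_{α₂} ∘ ρ)²` of the family. -/
def familyMap : FamilyPoint → FamilyPoint :=
  sigma ∘ (wAlpha₁ ∘ wAlpha₂ ∘ rho)^[2]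

end HalphenSurface

end

open HalphenSurface

noncomputable section
namespace HalphenSurface

open Complex (I I_sq I_ne_zero)
open IntermediateField (adjoin)

section LocalSubalgebra

variable {K : Type*} [Field K] [Algebra ℂ K] {R S : Subalgebra ℂ K} {z w : K} {c d : ℂ}

lemma isUnit_mk_iff (h : z ∈ R) : IsUnit (⟨z, h⟩ : R) ↔ z ≠ 0 ∧ z⁻¹ ∈ R := by
  constructor
  · rintro ⟨u, hu⟩
    have h1 : z * ((u⁻¹ : Rˣ) : R) = 1 := by
      have := congrArg (Subtype.val) u.mul_inv
      rw [hu] at this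
      simpa using this
    have h0 : z ≠ 0 := by rintro rfl; simp at h1
    refine ⟨h0, ?_⟩
    rw [show z⁻¹ = ((u⁻¹ : Rˣ) : R) from inv_eq_of_mul_eq_one_right h1]
    exact Subtype.mem _
  · rintro ⟨h0, h1⟩
    exact IsUnit.of_mul_eq_one ⟨z⁻¹, h1⟩ (Subtype.ext (mul_inv_cancel₀ h0))

lemma maxIdeal_eq [IsLocalRing R] : maxIdeal R = IsLocalRing.maximalIdeal R :=
  IsLocalRing.jacobson_eq_maximalIdeal _ bot_ne_top

lemma vanishesAt_iff [IsLocalRing R] : VanishesAt z R ↔ z ∈ R ∧ (z ≠ 0 → z⁻¹ ∉ R) := by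
  unfold VanishesAt
  rw [maxIdeal_eq]
  constructor
  · rintro ⟨h, h1⟩
    rw [IsLocalRing.mem_maximalIdeal, mem_nonunits_iff, isUnit_mk_iff h] at h1
    exact ⟨h, fun h2 h3 => h1 ⟨h2, h3⟩⟩
  · rintro ⟨h, h1⟩
    refine ⟨h, ?_⟩
    rw [IsLocalRing.mem_maximalIdeal, mem_nonunits_iff, isUnit_mk_iff h]
    exact fun h2 => h1 h2.1 h2.2

lemma VanishesAt.mem (h : VanishesAt z R) : z ∈ R := h.1

lemma VanishesAt.add (h : VanishesAt z R) (h' : VanishesAt w R) : VanishesAt (z + w) R :=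
  ⟨R.add_mem h.1 h'.1, (maxIdeal R).add_mem h.2 h'.2⟩

lemma VanishesAt.neg (h : VanishesAt z R) : VanishesAt (-z) R :=
  ⟨R.neg_mem h.1, (maxIdeal R).neg_mem h.2⟩

lemma VanishesAt.sub (h : VanishesAt z R) (h' : VanishesAt w R) : VanishesAt (z - w) R :=
  sub_eq_add_neg z w ▸ h.add h'.neg

lemma VanishesAt.mul_left (h : VanishesAt z R) (hw : w ∈ R) : VanishesAt (w * z) R :=
  ⟨R.mul_mem hw h.1, (maxIdeal R).mul_mem_left ⟨w, hw⟩ h.2⟩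

lemma VanishesAt.mul_right (h : VanishesAt z R) (hw : w ∈ R) : VanishesAt (z * w) R :=
  mul_comm z w ▸ h.mul_left hw

lemma vanishesAt_zero : VanishesAt 0 R := ⟨R.zero_mem, (maxIdeal R).zero_mem⟩

lemma inv_mem_of_not_vanishesAt [IsLocalRing R] (h : z ∈ R) (h' : ¬ VanishesAt z R) :
    z⁻¹ ∈ R := by
  rw [vanishesAt_iff] at h'
  by_contra h2
  exact h' ⟨h, fun _ => h2⟩

lemma not_vanishesAt_one [IsLocalRing R] : ¬ VanishesAt (1 : K) R := by
  rw [vanishesAt_iff]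
  rintro ⟨_, h⟩
  exact h one_ne_zero (by rw [inv_one]; exact R.one_mem)

lemma VanishesAt.inv_notMem [IsLocalRing R] (h : VanishesAt z R) (h0 : z ≠ 0) : z⁻¹ ∉ R :=
  (vanishesAt_iff.mp h).2 h0

lemma not_vanishesAt_of_inv_mem [IsLocalRing R] (h0 : z ≠ 0) (h : z⁻¹ ∈ R) :
    ¬ VanishesAt z R := fun h' => h'.inv_notMem h0 h

lemma vanishesAt_mul_iff [IsLocalRing R] (hz : z ∈ R) (hw : w ∈ R) :
    VanishesAt (z * w) R ↔ VanishesAt z R ∨ VanishesAt w R := by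
  refine ⟨fun h => ?_, fun h => h.elim (·.mul_right hw) (·.mul_left hz)⟩
  by_contra! hc
  have h1 := inv_mem_of_not_vanishesAt hz hc.1
  have hz0 : z ≠ 0 := by rintro rfl; exact hc.1 vanishesAt_zero
  apply hc.2
  have := h.mul_left h1
  rwa [inv_mul_cancel_left₀ hz0] at this

/-- The rational function `z` is regular at the local ring `R`, with value `c`. -/
def HasValueAt (z : K) (c : ℂ) (R : Subalgebra ℂ K) : Prop := VanishesAt (z - algebraMap ℂ K c) R

lemma HasValueAt.mem (h : HasValueAt z c R) : z ∈ R := by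
  have := R.add_mem h.1 (R.algebraMap_mem c)
  simpa using this

lemma hasValueAt_zero_iff : HasValueAt z 0 R ↔ VanishesAt z R := by
  simp [HasValueAt]

lemma VanishesAt.hasValueAt (h : VanishesAt z R) : HasValueAt z 0 R := hasValueAt_zero_iff.mpr h

lemma HasValueAt.vanishesAt (h : HasValueAt z 0 R) : VanishesAt z R := hasValueAt_zero_iff.mp h

lemma hasValueAt_const (c : ℂ) : HasValueAt (algebraMap ℂ K c) c R := by
  simp [HasValueAt, vanishesAt_zero]

lemma hasValueAt_one : HasValueAt (1 : K) 1 R := by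
  simpa using hasValueAt_const (R := R) (K := K) 1

lemma HasValueAt.add (h : HasValueAt z c R) (h' : HasValueAt w d R) :
    HasValueAt (z + w) (c + d) R := by
  have := VanishesAt.add h h'
  unfold HasValueAt
  convert this using 1
  rw [map_add]; ring

lemma HasValueAt.neg (h : HasValueAt z c R) : HasValueAt (-z) (-c) R := by
  have := VanishesAt.neg h
  unfold HasValueAt
  convert this using 1
  rw [map_neg]; ring

lemma HasValueAt.sub (h : HasValueAt z c R) (h' : HasValueAt w d R) :
    HasValueAt (z - w) (c - d) R := by
  rw [sub_eq_add_neg, sub_eq_add_neg]; exact h.add h'.neg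

lemma HasValueAt.mul (h : HasValueAt z c R) (h' : HasValueAt w d R) :
    HasValueAt (z * w) (c * d) R := by
  have := (VanishesAt.mul_right h h'.mem).add (VanishesAt.mul_left h' (R.algebraMap_mem c))
  unfold HasValueAt
  convert this using 1
  rw [map_mul]; ring

lemma HasValueAt.pow (h : HasValueAt z c R) (n : ℕ) : HasValueAt (z ^ n) (c ^ n) R := by
  induction n with
  | zero => simpa using hasValueAt_one
  | succ n ih => rw [pow_succ, pow_succ]; exact ih.mul h

lemma HasValueAt.eq [IsLocalRing R] (h : HasValueAt z c R) (h' : HasValueAt z d R) : c = d := by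
  have h1 := VanishesAt.sub h' h
  rw [sub_sub_sub_cancel_left, ← map_sub] at h1
  by_contra hne
  refine h1.inv_notMem ?_ ?_
  · rw [Ne, map_eq_zero]; exact sub_ne_zero.mpr hne
  · rw [← map_inv₀]; exact R.algebraMap_mem _

lemma HasValueAt.not_vanishesAt [IsLocalRing R] (h : HasValueAt z c R) (hc : c ≠ 0) :
    ¬ VanishesAt z R := fun h' => hc (h.eq h'.hasValueAt)

lemma HasValueAt.ne_zero [IsLocalRing R] (h : HasValueAt z c R) (hc : c ≠ 0) : z ≠ 0 := by
  rintro rfl; exact h.not_vanishesAt hc vanishesAt_zero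

lemma HasValueAt.inv_mem [IsLocalRing R] (h : HasValueAt z c R) (hc : c ≠ 0) : z⁻¹ ∈ R :=
  inv_mem_of_not_vanishesAt h.mem (h.not_vanishesAt hc)

lemma HasValueAt.inv [IsLocalRing R] (h : HasValueAt z c R) (hc : c ≠ 0) :
    HasValueAt z⁻¹ c⁻¹ R := by
  have h0 := h.ne_zero hc
  have hc' : algebraMap ℂ K c ≠ 0 := by rwa [Ne, map_eq_zero]
  have := (VanishesAt.neg h).mul_right
    (R.mul_mem (h.inv_mem hc) (R.algebraMap_mem c⁻¹))
  unfold HasValueAt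
  convert this using 1
  rw [map_inv₀]; field_simp; ring

lemma HasValueAt.div [IsLocalRing R] (h : HasValueAt z c R) (h' : HasValueAt w d R)
    (hd : d ≠ 0) : HasValueAt (z / w) (c / d) R := by
  rw [div_eq_mul_inv, div_eq_mul_inv]; exact h.mul (h'.inv hd)

lemma HasValueAt.congr (h : HasValueAt z c R) (hz : z = w) (hc : c = d) : HasValueAt w d R :=
  hz ▸ hc ▸ h

lemma HasValueAt.vanishesAt_of_eq (h : HasValueAt z c R) (hz : z = w) (hc : c = 0) :
    VanishesAt w R := (h.congr hz hc).vanishesAt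

lemma HasValueAt.vanishesAt_sub_const (h : HasValueAt z c R) :
    VanishesAt (z - algebraMap ℂ K c) R := h

/-- `S` dominates `R`. -/
def Dominates (S R : Subalgebra ℂ K) : Prop := R ≤ S ∧ ∀ z, VanishesAt z R → VanishesAt z S

lemma Dominates.refl (R : Subalgebra ℂ K) : Dominates R R := ⟨le_rfl, fun _ h => h⟩

lemma Dominates.trans {T : Subalgebra ℂ K} (h : Dominates T S) (h' : Dominates S R) :
    Dominates T R := ⟨h'.1.trans h.1, fun z hz => h.2 z (h'.2 z hz)⟩

lemma Dominates.hasValueAt (h : Dominates S R) (hz : HasValueAt z c R) : HasValueAt z c S :=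
  h.2 _ hz

end LocalSubalgebra

section LocalizationAt

variable {K : Type*} [Field K] [Algebra ℂ K]

lemma le_localizationAt (A : Subalgebra ℂ K) (p : Ideal A) [hp : p.IsPrime] :
    A ≤ localizationAt A p := fun z hz =>
  ⟨⟨z, hz⟩, 1, fun h => hp.ne_top ((Ideal.eq_top_iff_one p).mpr h), by simp⟩

lemma coe_ne_zero_of_notMem {A : Subalgebra ℂ K} {p : Ideal A} {s : A} (hs : s ∉ p) :
    (s : K) ≠ 0 := fun h => hs (by
  have : s = 0 := Subtype.ext h
  rw [this]; exact p.zero_mem)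

instance isLocalRing_localizationAt (A : Subalgebra ℂ K) (p : Ideal A) [hp : p.IsPrime] :
    IsLocalRing (localizationAt A p) := by
  refine IsLocalRing.of_nonunits_add ?_
  have key : ∀ z : localizationAt A p, z ∈ nonunits (localizationAt A p) ↔
      ∃ a s : A, a ∈ p ∧ s ∉ p ∧ (z : K) = (a : K) / (s : K) := by
    rintro ⟨z, hz⟩
    rw [mem_nonunits_iff, isUnit_mk_iff]
    constructor
    · intro h
      obtain ⟨a, s, hs, rfl⟩ := hz
      refine ⟨a, s, ?_, hs, rfl⟩
      by_contra ha
      exact h ⟨div_ne_zero (coe_ne_zero_of_notMem ha) (coe_ne_zero_of_notMem hs),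
        s, a, ha, inv_div _ _⟩
    · rintro ⟨a, s, ha, hs, h⟩ ⟨h0, b, t, ht, h1⟩
      simp only at h
      have hs0 := coe_ne_zero_of_notMem hs
      have ht0 := coe_ne_zero_of_notMem ht
      have ha0 : (a : K) ≠ 0 := by intro h2; rw [h, h2, zero_div] at h0; exact h0 rfl
      have h2 : s * t = a * b := by
        apply Subtype.ext
        push_cast
        rw [h, inv_div, div_eq_div_iff ha0 ht0] at h1
        rw [h1, mul_comm]
      rcases hp.mem_or_mem (h2 ▸ p.mul_mem_right b ha : s * t ∈ p) with h3 | h3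
      exacts [hs h3, ht h3]
  intro x y hx hy
  rw [key] at hx hy ⊢
  obtain ⟨a, s, ha, hs, hx⟩ := hx
  obtain ⟨b, t, hb, ht, hy⟩ := hy
  refine ⟨a * t + s * b, s * t, p.add_mem (p.mul_mem_right _ ha) (p.mul_mem_left _ hb),
    fun h => (hp.mem_or_mem h).elim hs ht, ?_⟩
  push_cast
  rw [hx, hy, div_add_div _ _ (coe_ne_zero_of_notMem hs) (coe_ne_zero_of_notMem ht)]

lemma vanishesAt_localizationAt {A : Subalgebra ℂ K} {p : Ideal A} [hp : p.IsPrime] {z : K} :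
    VanishesAt z (localizationAt A p) ↔ ∃ a s : A, a ∈ p ∧ s ∉ p ∧ z = (a : K) / (s : K) := by
  rw [vanishesAt_iff]
  constructor
  · rintro ⟨⟨a, s, hs, rfl⟩, h⟩
    refine ⟨a, s, ?_, hs, rfl⟩
    by_contra ha
    exact h (div_ne_zero (coe_ne_zero_of_notMem ha) (coe_ne_zero_of_notMem hs))
      ⟨s, a, ha, inv_div _ _⟩
  · rintro ⟨a, s, ha, hs, rfl⟩
    refine ⟨⟨a, s, hs, rfl⟩, ?_⟩
    rintro h0 ⟨b, t, ht, h1⟩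
    have hs0 := coe_ne_zero_of_notMem hs
    have ht0 := coe_ne_zero_of_notMem ht
    have ha0 : (a : K) ≠ 0 := by intro h2; rw [h2, zero_div] at h0; exact h0 rfl
    have h2 : s * t = a * b := by
      apply Subtype.ext
      push_cast
      rw [inv_div, div_eq_div_iff ha0 ht0] at h1
      rw [h1, mul_comm]
    rcases hp.mem_or_mem (h2 ▸ p.mul_mem_right b ha : s * t ∈ p) with h3 | h3
    exacts [hs h3, ht h3]

lemma vanishesAt_localizationAt_coe {A : Subalgebra ℂ K} {p : Ideal A} [hp : p.IsPrime] {a : A} :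
    VanishesAt (a : K) (localizationAt A p) ↔ a ∈ p := by
  rw [vanishesAt_localizationAt]
  constructor
  · rintro ⟨b, s, hb, hs, h⟩
    have h2 : a * s = b := by
      apply Subtype.ext
      push_cast
      rw [h, div_mul_cancel₀ _ (coe_ne_zero_of_notMem hs)]
    exact (hp.mem_or_mem (h2 ▸ hb : a * s ∈ p)).resolve_right hs
  · intro h
    exact ⟨a, 1, h, fun h1 => hp.ne_top ((Ideal.eq_top_iff_one p).mpr h1), by simp⟩

/-- A localization of `A` that dominates a local ring containing `A` equals that ring. -/
lemma eq_localizationAt_of_dominates {A P : Subalgebra ℂ K} [IsLocalRing P] {p : Ideal A}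
    [p.IsPrime] (hA : A ≤ P) (h : Dominates (localizationAt A p) P) : P = localizationAt A p := by
  refine le_antisymm h.1 ?_
  rintro _ ⟨a, s, hs, rfl⟩
  rw [div_eq_mul_inv]
  refine P.mul_mem (hA a.2) (inv_mem_of_not_vanishesAt (hA s.2) fun hv => ?_)
  exact hs (vanishesAt_localizationAt_coe.mp (h.2 _ hv))

end LocalizationAt

section Transport

variable {K : Type*} [Field K] [Algebra ℂ K] (Φ : K ≃ₐ[ℂ] K) {R : Subalgebra ℂ K} {z : K}

/-- The image of a local ring under an automorphism of the function field. -/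
abbrev transport (R : Subalgebra ℂ K) : Subalgebra ℂ K := R.map (Φ : K →ₐ[ℂ] K)

lemma map_mem_transport : Φ z ∈ transport Φ R ↔ z ∈ R := by
  constructor
  · rintro ⟨w, hw, h⟩
    have : w = z := Φ.injective h
    exact this ▸ hw
  · exact fun h => ⟨z, h, rfl⟩

end Transport

section

open MvPolynomial

section Points

variable {K : Type*} [Field K] [Algebra ℂ K]

/-- The local ring at the origin of the plane with coordinates `u`, `v`. -/
def Pt (u v : K) : Subalgebra ℂ K where
  carrier := {z | ∃ p q : MvPolynomial (Fin 2) ℂ, constantCoeff q ≠ 0 ∧ aeval ![u, v] q ≠ 0 ∧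
    z = aeval ![u, v] p / aeval ![u, v] q}
  mul_mem' := by
    rintro _ _ ⟨p, q, h, h', rfl⟩ ⟨p', q', h1, h1', rfl⟩
    exact ⟨p * p', q * q', by rw [map_mul]; exact mul_ne_zero h h1,
      by rw [map_mul]; exact mul_ne_zero h' h1', by rw [map_mul, map_mul, div_mul_div_comm]⟩
  add_mem' := by
    rintro _ _ ⟨p, q, h, h', rfl⟩ ⟨p', q', h1, h1', rfl⟩
    exact ⟨p * q' + q * p', q * q', by rw [map_mul]; exact mul_ne_zero h h1,
      by rw [map_mul]; exact mul_ne_zero h' h1',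
      by rw [map_add, map_mul, map_mul, map_mul, div_add_div _ _ h' h1']⟩
  algebraMap_mem' r := ⟨C r, 1, by simp, by simp, by simp⟩

variable {u v : K}

lemma aeval_mem_Pt (p : MvPolynomial (Fin 2) ℂ) : aeval ![u, v] p ∈ Pt u v :=
  ⟨p, 1, by simp, by simp, by simp⟩

lemma fst_mem_Pt : u ∈ Pt u v := by simpa using aeval_mem_Pt (u := u) (v := v) (X 0)

lemma snd_mem_Pt : v ∈ Pt u v := by simpa using aeval_mem_Pt (u := u) (v := v) (X 1)

lemma aeval_mem {A : Subalgebra ℂ K} (hu : u ∈ A) (hv : v ∈ A) (p : MvPolynomial (Fin 2) ℂ) :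
    aeval ![u, v] p ∈ A := by
  have : aeval ![u, v] p = A.val (aeval ![⟨u, hu⟩, ⟨v, hv⟩] p) := by
    rw [← AlgHom.comp_apply, MvPolynomial.comp_aeval]
    congr 2
    ext i; fin_cases i <;> rfl
  rw [this]
  exact Subtype.mem _

lemma hasValueAt_aeval {S : Subalgebra ℂ K} {a b : ℂ} (hu : HasValueAt u a S)
    (hv : HasValueAt v b S) (p : MvPolynomial (Fin 2) ℂ) :
    HasValueAt (aeval ![u, v] p) (aeval ![a, b] p) S := by
  induction p using MvPolynomial.induction_on with
  | C r => simpa using hasValueAt_const r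
  | add p q hp hq => rw [map_add, map_add]; exact hp.add hq
  | mul_X p i hp =>
    rw [map_mul, map_mul, aeval_X, aeval_X]
    refine hp.mul ?_
    fin_cases i
    · exact hu
    · exact hv

lemma aeval_zero_eq_constantCoeff (p : MvPolynomial (Fin 2) ℂ) :
    aeval ![(0 : ℂ), 0] p = constantCoeff p := by
  have : (![(0 : ℂ), 0]) = 0 := by ext i; fin_cases i <;> rfl
  rw [this, MvPolynomial.aeval_zero]; rfl

/-- If the coordinates vanish at a local ring, that local ring dominates the local ring of the
origin. -/
lemma Pt_le {S : Subalgebra ℂ K} [IsLocalRing S] (hu : VanishesAt u S) (hv : VanishesAt v S) :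
    Pt u v ≤ S := by
  rintro _ ⟨p, q, h, -, rfl⟩
  have h1 := hasValueAt_aeval hu.hasValueAt hv.hasValueAt q
  rw [aeval_zero_eq_constantCoeff] at h1
  rw [div_eq_mul_inv]
  exact S.mul_mem (aeval_mem hu.mem hv.mem p) (h1.inv_mem h)

variable (u v) in
/-- The functions `u`, `v` are coordinates: they generate the function field. -/
def IsCoord : Prop := adjoin ℂ {u, v} = ⊤

lemma IsCoord.of_mem {u' v' : K} (h : IsCoord u v)
    (hu : u ∈ adjoin ℂ {u', v'})
    (hv : v ∈ adjoin ℂ {u', v'}) : IsCoord u' v' := by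
  unfold IsCoord at *
  rw [eq_top_iff, ← h, IntermediateField.adjoin_le_iff]
  rintro z (rfl | rfl)
  exacts [hu, hv]

lemma IsCoord.map (h : IsCoord u v) (Φ : K ≃ₐ[ℂ] K) : IsCoord (Φ u) (Φ v) := by
  have h1 := IntermediateField.adjoin_map ℂ {u, v} (Φ : K →ₐ[ℂ] K)
  unfold IsCoord at *
  rw [h, Set.image_pair] at h1
  rw [eq_top_iff]
  intro z _
  have : z ∈ (⊤ : IntermediateField ℂ K).map (Φ : K →ₐ[ℂ] K) := ⟨Φ.symm z, trivial, by simp⟩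
  rw [h1] at this
  exact this

lemma transport_Pt (Φ : K ≃ₐ[ℂ] K) (u v : K) : transport Φ (Pt u v) = Pt (Φ u) (Φ v) := by
  have key : ∀ p : MvPolynomial (Fin 2) ℂ, Φ (aeval ![u, v] p) = aeval ![Φ u, Φ v] p := by
    intro p
    have := MvPolynomial.comp_aeval (R := ℂ) ![u, v] (Φ : K →ₐ[ℂ] K)
    have h2 := congrArg (fun f => f p) this
    simp only [AlgHom.comp_apply] at h2
    refine Eq.trans h2 ?_
    congr 2
    ext i; fin_cases i <;> rfl
  ext z
  constructor
  · rintro ⟨_, ⟨p, q, h, h', rfl⟩, rfl⟩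
    refine ⟨p, q, h, ?_, ?_⟩
    · rw [← key]; simpa using h'
    · change Φ _ = _
      rw [map_div₀, key, key]
  · rintro ⟨p, q, h, h', rfl⟩
    rw [← key] at h'
    refine ⟨aeval ![u, v] p / aeval ![u, v] q, ⟨p, q, h, ?_, rfl⟩, ?_⟩
    · rintro h2; rw [h2, map_zero] at h'; exact h' rfl
    · change Φ _ = _
      rw [map_div₀, key, key]

end Points

section PlanePoints

/-- The ideal of the origin. -/
abbrev originIdeal : Ideal (MvPolynomial (Fin 2) ℂ) :=
  RingHom.ker (constantCoeff : MvPolynomial (Fin 2) ℂ →+* ℂ)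

instance : originIdeal.IsPrime := RingHom.ker_isPrime _

lemma trdeg_planeField : Algebra.trdeg ℂ PlaneField = 2 := by
  have h : IsTranscendenceBasis ℂ (algebraMap (MvPolynomial (Fin 2) ℂ) PlaneField ∘ X) := by
    have h1 := IsTranscendenceBasis.mvPolynomial (Fin 2) ℂ
    have : Algebra.IsAlgebraic (MvPolynomial (Fin 2) ℂ) PlaneField :=
      IsLocalization.isAlgebraic _ (nonZeroDivisors (MvPolynomial (Fin 2) ℂ))
    exact h1.algebraMap_comp
  have := h.cardinalMk_eq_trdeg
  simpa using this.symm

lemma isCoord_xc_yc : IsCoord xc yc := by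
  unfold IsCoord
  rw [eq_top_iff]
  rintro z -
  obtain ⟨p, q, _, rfl⟩ := IsFractionRing.div_surjective (A := MvPolynomial (Fin 2) ℂ) z
  have key : ∀ p : MvPolynomial (Fin 2) ℂ,
      algebraMap _ PlaneField p ∈ adjoin ℂ {xc, yc} := by
    intro p
    have : algebraMap _ PlaneField p = aeval ![xc, yc] p := by
      have h := MvPolynomial.aeval_unique
        (IsScalarTower.toAlgHom ℂ (MvPolynomial (Fin 2) ℂ) PlaneField)
      have h2 := congrArg (fun f => f p) h
      simp only [IsScalarTower.coe_toAlgHom'] at h2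
      rw [h2]
      congr 2
      ext i; fin_cases i <;> rfl
    rw [this]
    exact aeval_mem (A := (adjoin ℂ {xc, yc}).toSubalgebra)
      (IntermediateField.subset_adjoin ℂ _ (by simp))
      (IntermediateField.subset_adjoin ℂ _ (by simp)) p
  exact div_mem (key p) (key q)

variable {u v : PlaneField}

lemma IsCoord.algebraicIndependent (h : IsCoord u v) : AlgebraicIndependent ℂ ![u, v] := by
  have hr : Set.range ![u, v] = {u, v} := by simp [Matrix.range_cons, Set.pair_comm]
  have : Algebra.IsAlgebraic (Algebra.adjoin ℂ (Set.range ![u, v])) PlaneField := by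
    rw [hr]
    constructor
    intro z
    have hz : z ∈ adjoin ℂ {u, v} := by rw [h]; trivial
    rw [IntermediateField.mem_adjoin_iff_div] at hz
    obtain ⟨r, hr, s, hs, rfl⟩ := hz
    have h1 := isAlgebraic_algebraMap (R := Algebra.adjoin ℂ {u, v}) (A := PlaneField) ⟨r, hr⟩
    have h2 := isAlgebraic_algebraMap (R := Algebra.adjoin ℂ {u, v}) (A := PlaneField) ⟨s, hs⟩
    rw [div_eq_mul_inv]
    exact h1.mul h2.inv
  refine (Algebra.IsAlgebraic.isTranscendenceBasis_of_le_trdeg_of_finite (R := ℂ) ![u, v] ?_).1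
  rw [trdeg_planeField]; simp

lemma IsCoord.aeval_injective (h : IsCoord u v) :
    Function.Injective (aeval (R := ℂ) ![u, v]) := h.algebraicIndependent

lemma IsCoord.aeval_ne_zero (h : IsCoord u v) {p : MvPolynomial (Fin 2) ℂ} (hp : p ≠ 0) :
    aeval ![u, v] p ≠ 0 := fun h0 => hp (h.aeval_injective (by rw [h0, map_zero]))

lemma ne_zero_of_constantCoeff_ne_zero {p : MvPolynomial (Fin 2) ℂ} (hp : constantCoeff p ≠ 0) :
    p ≠ 0 := by rintro rfl; exact hp (map_zero _)

/-- The polynomials in `u`, `v` as elements of the local ring of the origin. -/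
def polyToPt (u v : PlaneField) : MvPolynomial (Fin 2) ℂ →ₐ[ℂ] Pt u v :=
  (aeval ![u, v]).codRestrict (Pt u v) aeval_mem_Pt

@[simp] theorem coe_polyToPt (p : MvPolynomial (Fin 2) ℂ) :
    (polyToPt u v p : PlaneField) = aeval ![u, v] p := rfl

lemma isUnit_polyToPt (h : IsCoord u v) {q : MvPolynomial (Fin 2) ℂ}
    (hq : constantCoeff q ≠ 0) : IsUnit (polyToPt u v q) := by
  have h0 := h.aeval_ne_zero (ne_zero_of_constantCoeff_ne_zero hq)
  exact (isUnit_mk_iff (aeval_mem_Pt q)).mpr ⟨h0, 1, q, hq, h0, by simp⟩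

lemma IsCoord.isLocalization (h : IsCoord u v) :
    @IsLocalization.AtPrime _ _ (Pt u v) _ (polyToPt u v).toRingHom.toAlgebra originIdeal _ := by
  let := (polyToPt u v).toRingHom.toAlgebra
  have hmap : ∀ p, algebraMap (MvPolynomial (Fin 2) ℂ) (Pt u v) p = polyToPt u v p := fun _ => rfl
  refine (isLocalization_iff _ _).mpr ⟨fun y => ?_, ?_, ?_⟩
  · exact isUnit_polyToPt h y.2
  · rintro ⟨z, p, q, hq, h0, rfl⟩
    refine ⟨⟨p, q, hq⟩, Subtype.ext ?_⟩
    simp only [hmap]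
    push_cast
    rw [coe_polyToPt, coe_polyToPt, div_mul_cancel₀ _ h0]
  · intro p q hpq
    rw [hmap, hmap] at hpq
    exact ⟨1, by rw [h.aeval_injective (congrArg Subtype.val hpq)]⟩

lemma IsCoord.isLocalRing (h : IsCoord u v) : IsLocalRing (Pt u v) := by
  let := (polyToPt u v).toRingHom.toAlgebra
  have := h.isLocalization
  exact IsLocalization.AtPrime.isLocalRing (Pt u v) originIdeal

lemma IsCoord.isNoetherianRing (h : IsCoord u v) : IsNoetherianRing (Pt u v) := by
  let := (polyToPt u v).toRingHom.toAlgebra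
  have := h.isLocalization
  exact IsLocalization.isNoetherianRing originIdeal.primeCompl _ inferInstance

/-- Evaluation of the elements of the local ring of the origin in a `ℂ`-algebra. -/
lemma IsCoord.exists_lift (h : IsCoord u v) {B : Type*} [CommRing B] [Algebra ℂ B] (α β : B)
    (hu : ∀ q : MvPolynomial (Fin 2) ℂ, constantCoeff q ≠ 0 → IsUnit (aeval ![α, β] q)) :
    ∃ ψ : Pt u v →ₐ[ℂ] B, ψ ⟨u, fst_mem_Pt⟩ = α ∧ ψ ⟨v, snd_mem_Pt⟩ = β := by
  let := (polyToPt u v).toRingHom.toAlgebra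
  have := h.isLocalization
  have hmap : ∀ p, algebraMap (MvPolynomial (Fin 2) ℂ) (Pt u v) p = polyToPt u v p := fun _ => rfl
  have hu' : ∀ y : originIdeal.primeCompl, IsUnit (((aeval ![α, β]).toRingHom : MvPolynomial (Fin 2) ℂ →+* B) y) :=
    fun y => hu y y.2
  have hl : ∀ p, IsLocalization.lift (S := Pt u v) hu' (polyToPt u v p) = aeval ![α, β] p := by
    intro p
    rw [← hmap, IsLocalization.lift_eq]; rfl
  refine ⟨⟨IsLocalization.lift (S := Pt u v) hu', fun r => ?_⟩, ?_, ?_⟩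
  · have := hl (C r)
    rw [MvPolynomial.aeval_C, show polyToPt u v (C r) = algebraMap ℂ (Pt u v) r from
      (polyToPt u v).commutes r] at this
    exact this
  · have := hl (X 0)
    rw [show polyToPt u v (X 0) = ⟨u, fst_mem_Pt⟩ from Subtype.ext (by simp)] at this
    simpa using this
  · have := hl (X 1)
    rw [show polyToPt u v (X 1) = ⟨v, snd_mem_Pt⟩ from Subtype.ext (by simp)] at this
    simpa using this

lemma IsCoord.exists_eval (h : IsCoord u v) :
    ∃ ψ : Pt u v →ₐ[ℂ] ℂ, ψ ⟨u, fst_mem_Pt⟩ = 0 ∧ ψ ⟨v, snd_mem_Pt⟩ = 0 := by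
  refine h.exists_lift 0 0 fun q hq => ?_
  rw [aeval_zero_eq_constantCoeff]
  exact hq.isUnit

/-- Restriction of the elements of the local ring of the origin to a formal arc. -/
lemma IsCoord.exists_arc (h : IsCoord u v) (α β : PowerSeries ℂ)
    (hα : PowerSeries.constantCoeff α = 0) (hβ : PowerSeries.constantCoeff β = 0) :
    ∃ ψ : Pt u v →ₐ[ℂ] PowerSeries ℂ, ψ ⟨u, fst_mem_Pt⟩ = α ∧ ψ ⟨v, snd_mem_Pt⟩ = β := by
  refine h.exists_lift α β fun q hq => ?_
  rw [PowerSeries.isUnit_iff_constantCoeff]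
  have h1 : PowerSeries.constantCoeff (aeval ![α, β] q) = aeval ![(0 : ℂ), 0] q := by
    have h2 := MvPolynomial.map_aeval ![α, β] (PowerSeries.constantCoeff (R := ℂ)) q
    rw [h2, MvPolynomial.aeval_def, ← MvPolynomial.coe_eval₂Hom]
    congr 2
    · ext i; fin_cases i <;> simp [hα, hβ]
  rw [h1, aeval_zero_eq_constantCoeff]
  exact hq.isUnit

/-- The elements of the local ring of the origin are the polynomials up to the maximal ideal. -/
lemma IsCoord.vanishesAt_iff (h : IsCoord u v) (z : PlaneField) :
    VanishesAt z (Pt u v) ↔ ∃ p q : MvPolynomial (Fin 2) ℂ, constantCoeff p = 0 ∧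
      constantCoeff q ≠ 0 ∧ z = aeval ![u, v] p / aeval ![u, v] q := by
  have := h.isLocalRing
  rw [HalphenSurface.vanishesAt_iff]
  constructor
  · rintro ⟨⟨p, q, hq, h0, rfl⟩, h1⟩
    refine ⟨p, q, ?_, hq, rfl⟩
    by_contra hp
    have hp0 := h.aeval_ne_zero (ne_zero_of_constantCoeff_ne_zero hp)
    exact h1 (div_ne_zero hp0 h0) ⟨q, p, hp, hp0, by rw [inv_div]⟩
  · rintro ⟨p, q, hp, hq, rfl⟩
    have hq0 := h.aeval_ne_zero (ne_zero_of_constantCoeff_ne_zero hq)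
    refine ⟨⟨p, q, hq, hq0, rfl⟩, ?_⟩
    rintro h0 ⟨a, b, hb, hb0, h1⟩
    have hp0 : aeval ![u, v] p ≠ 0 := (div_ne_zero_iff.mp h0).1
    rw [inv_div, div_eq_div_iff hp0 hb0, ← map_mul, ← map_mul] at h1
    have h2 := congrArg constantCoeff (h.aeval_injective h1)
    rw [map_mul, map_mul, hp, mul_zero] at h2
    exact mul_ne_zero hq hb h2

lemma IsCoord.vanishesAt_fst (h : IsCoord u v) : VanishesAt u (Pt u v) :=
  (h.vanishesAt_iff u).mpr ⟨X 0, 1, by simp, by simp, by simp⟩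

lemma IsCoord.vanishesAt_snd (h : IsCoord u v) : VanishesAt v (Pt u v) :=
  (h.vanishesAt_iff v).mpr ⟨X 1, 1, by simp, by simp, by simp⟩

lemma IsCoord.exists_hasValueAt (h : IsCoord u v) {z : PlaneField} (hz : z ∈ Pt u v) :
    ∃ c : ℂ, HasValueAt z c (Pt u v) := by
  have := h.isLocalRing
  obtain ⟨p, q, hq, h0, rfl⟩ := hz
  have h1 := hasValueAt_aeval h.vanishesAt_fst.hasValueAt h.vanishesAt_snd.hasValueAt
  have hq1 := h1 q
  rw [aeval_zero_eq_constantCoeff] at hq1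
  exact ⟨_, (h1 p).div hq1 hq⟩

lemma IsCoord.dominates (h : IsCoord u v) {S : Subalgebra ℂ PlaneField} [IsLocalRing S]
    (hu : VanishesAt u S) (hv : VanishesAt v S) : Dominates S (Pt u v) := by
  refine ⟨Pt_le hu hv, fun z hz => ?_⟩
  obtain ⟨p, q, hp, hq, rfl⟩ := (h.vanishesAt_iff z).mp hz
  have h1 := hasValueAt_aeval hu.hasValueAt hv.hasValueAt
  have hq1 := h1 q
  rw [aeval_zero_eq_constantCoeff] at hq1
  refine ((h1 p).div hq1 hq).vanishesAt_of_eq rfl ?_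
  rw [aeval_zero_eq_constantCoeff, hp, zero_div]

lemma IsCoord.Pt_eq {u' v' : PlaneField} (h : IsCoord u v) (h' : IsCoord u' v')
    (hu : VanishesAt u (Pt u' v')) (hv : VanishesAt v (Pt u' v'))
    (hu' : VanishesAt u' (Pt u v)) (hv' : VanishesAt v' (Pt u v)) : Pt u v = Pt u' v' := by
  have := h.isLocalRing
  have := h'.isLocalRing
  exact le_antisymm (Pt_le hu hv) (Pt_le hu' hv')

lemma exists_eq_constantCoeff_add (p : MvPolynomial (Fin 2) ℂ) :
    ∃ a b, p = C (constantCoeff p) + X 0 * a + X 1 * b := by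
  induction p using MvPolynomial.induction_on with
  | C r => exact ⟨0, 0, by simp⟩
  | add p q hp hq =>
    obtain ⟨a, b, h⟩ := hp
    obtain ⟨a', b', h'⟩ := hq
    refine ⟨a + a', b + b', ?_⟩
    rw [map_add, C_add]
    linear_combination h + h'
  | mul_X p i hp =>
    have h0 : constantCoeff (p * X i) = 0 := by simp
    rw [h0]
    fin_cases i
    · exact ⟨p, 0, by simp [mul_comm]⟩
    · exact ⟨0, p, by simp [mul_comm]⟩

/-- The maximal ideal of the local ring of the origin is generated by the coordinates. -/
lemma IsCoord.exists_of_vanishesAt (h : IsCoord u v) {z : PlaneField}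
    (hz : VanishesAt z (Pt u v)) : ∃ a ∈ Pt u v, ∃ b ∈ Pt u v, z = u * a + v * b := by
  obtain ⟨p, q, hp, hq, rfl⟩ := (h.vanishesAt_iff z).mp hz
  have h0 := h.aeval_ne_zero (ne_zero_of_constantCoeff_ne_zero hq)
  obtain ⟨a, b, hab⟩ := exists_eq_constantCoeff_add p
  rw [hp, C_0, zero_add] at hab
  refine ⟨aeval ![u, v] a / aeval ![u, v] q, ⟨a, q, hq, h0, rfl⟩,
    aeval ![u, v] b / aeval ![u, v] q, ⟨b, q, hq, h0, rfl⟩, ?_⟩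
  rw [hab]
  simp only [map_add, map_mul, aeval_X]
  simp only [Matrix.cons_val_zero, Matrix.cons_val_one]
  ring

lemma IsCoord.span_eq_maxIdeal (h : IsCoord u v) :
    Ideal.span {⟨u, fst_mem_Pt⟩, ⟨v, snd_mem_Pt⟩} = maxIdeal (Pt u v) := by
  have := h.isLocalRing
  apply le_antisymm
  · rw [Ideal.span_le]
    rintro z (rfl | rfl)
    exacts [h.vanishesAt_fst.2, h.vanishesAt_snd.2]
  · rintro ⟨z, hz⟩ hm
    obtain ⟨a, ha, b, hb, hab⟩ := h.exists_of_vanishesAt ⟨hz, hm⟩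
    rw [Ideal.mem_span_pair]
    exact ⟨⟨a, ha⟩, ⟨b, hb⟩, Subtype.ext (by simp [hab, mul_comm])⟩

lemma IsCoord.symm (h : IsCoord u v) : IsCoord v u := by
  unfold IsCoord at *; rwa [Set.pair_comm]

lemma IsCoord.fst_mem_adjoin : u ∈ adjoin ℂ {u, v} :=
  IntermediateField.subset_adjoin ℂ _ (by simp)

lemma IsCoord.snd_mem_adjoin : v ∈ adjoin ℂ {u, v} :=
  IntermediateField.subset_adjoin ℂ _ (by simp)

lemma IsCoord.fst_ne_zero (h : IsCoord u v) : u ≠ 0 := by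
  have := h.aeval_ne_zero (p := X 0) (X_ne_zero 0)
  simpa using this

lemma IsCoord.snd_ne_zero (h : IsCoord u v) : v ≠ 0 := h.symm.fst_ne_zero

lemma IsCoord.sub_const (h : IsCoord u v) (a b : ℂ) : IsCoord (u - cst a) (v - cst b) := by
  refine h.of_mem ?_ ?_
  · have := add_mem (IsCoord.fst_mem_adjoin (u := u - cst a) (v := v - cst b))
      ((adjoin ℂ {u - cst a, v - cst b}).algebraMap_mem a)
    simpa using this
  · have := add_mem (IsCoord.snd_mem_adjoin (u := u - cst a) (v := v - cst b))
      ((adjoin ℂ {u - cst a, v - cst b}).algebraMap_mem b)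
    simpa using this

lemma IsCoord.sub_const_fst (h : IsCoord u v) (a : ℂ) : IsCoord (u - cst a) v := by
  simpa using h.sub_const a 0

lemma IsCoord.sub_const_snd (h : IsCoord u v) (b : ℂ) : IsCoord u (v - cst b) := by
  simpa using h.sub_const 0 b

lemma IsCoord.inv_fst (h : IsCoord u v) : IsCoord u⁻¹ v := by
  refine h.of_mem ?_ IsCoord.snd_mem_adjoin
  simpa using inv_mem (IsCoord.fst_mem_adjoin (u := u⁻¹) (v := v))

lemma IsCoord.inv_snd (h : IsCoord u v) : IsCoord u v⁻¹ := h.symm.inv_fst.symm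

lemma IsCoord.div_snd (h : IsCoord u v) : IsCoord u (v / u) := by
  refine h.of_mem IsCoord.fst_mem_adjoin ?_
  have := mul_mem (IsCoord.snd_mem_adjoin (u := u) (v := v / u))
    (IsCoord.fst_mem_adjoin (u := u) (v := v / u))
  rwa [div_mul_cancel₀ _ h.fst_ne_zero] at this

lemma IsCoord.div_fst (h : IsCoord u v) : IsCoord (u / v) v := h.symm.div_snd.symm

lemma Pt_comm (u v : PlaneField) : Pt u v = Pt v u := by
  have key : ∀ u v : PlaneField, Pt u v ≤ Pt v u := by
    rintro u v _ ⟨p, q, h, h0, rfl⟩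
    have hr : ∀ p : MvPolynomial (Fin 2) ℂ,
        aeval ![v, u] (rename (Equiv.swap (0 : Fin 2) 1) p) = aeval ![u, v] p := by
      intro p
      rw [aeval_rename]
      congr 2
      ext i; fin_cases i <;> rfl
    exact ⟨rename (Equiv.swap 0 1) p, rename (Equiv.swap 0 1) q, by rwa [constantCoeff_rename],
      by rwa [hr], by rw [hr, hr]⟩
  exact le_antisymm (key u v) (key v u)

end PlanePoints

end

section

lemma surjective_algebraMap_of_finiteType (F : Type*) [Field F] [Algebra ℂ F]
    [Algebra.FiniteType ℂ F] : Function.Surjective (algebraMap ℂ F) := by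
  have := finite_of_finite_type_of_isJacobsonRing ℂ F
  exact (IsAlgClosed.algebraMap_bijective_of_isIntegral (k := ℂ) (K := F)).2

lemma exists_sub_const_mem_of_finiteType {A : Type*} [CommRing A] [Algebra ℂ A] (m : Ideal A)
    [hm : m.IsMaximal] [Algebra.FiniteType ℂ (A ⧸ m)] (a : A) :
    ∃ c : ℂ, a - algebraMap ℂ A c ∈ m := by
  let _ := Ideal.Quotient.field m
  obtain ⟨c, hc⟩ := surjective_algebraMap_of_finiteType (A ⧸ m) (Ideal.Quotient.mk m a)
  refine ⟨c, ?_⟩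
  rw [← Ideal.Quotient.eq_zero_iff_mem, map_sub, ← hc]
  exact sub_self _

variable {u v : PlaneField}

/-- The local ring of a point is the localization of any algebra contained in it and containing
the coordinates. -/
lemma IsCoord.mem_closedPoints (h : IsCoord u v) {B : Subalgebra ℂ PlaneField} (hB : B ≤ Pt u v)
    (hu : u ∈ B) (hv : v ∈ B) : Pt u v ∈ closedPoints B := by
  have hl := h.isLocalRing
  obtain ⟨ψ, hψu, hψv⟩ := h.exists_eval
  let φ : B →ₐ[ℂ] ℂ := ψ.comp (Subalgebra.inclusion hB)
  have hφ : Function.Surjective φ := fun c => ⟨algebraMap ℂ B c, by simp⟩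
  have hmax : (RingHom.ker φ).IsMaximal := RingHom.ker_isMaximal_of_surjective φ hφ
  refine ⟨RingHom.ker φ, hmax, ?_⟩
  have hp := hmax.isPrime
  refine eq_localizationAt_of_dominates hB (h.dominates ?_ ?_)
  · exact vanishesAt_localizationAt_coe (a := ⟨u, hu⟩).mpr hψu
  · exact vanishesAt_localizationAt_coe (a := ⟨v, hv⟩).mpr hψv

lemma IsCoord.closedPoints_adjoin (h : IsCoord u v) :
    closedPoints (Algebra.adjoin ℂ {u, v}) = {R | ∃ a b : ℂ, R = Pt (u - cst a) (v - cst b)} := by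
  have hu : u ∈ Algebra.adjoin ℂ {u, v} := Algebra.subset_adjoin (by simp)
  have hv : v ∈ Algebra.adjoin ℂ {u, v} := Algebra.subset_adjoin (by simp)
  have hle : ∀ a b : ℂ, Algebra.adjoin ℂ {u, v} ≤ Pt (u - cst a) (v - cst b) := by
    intro a b
    rw [Algebra.adjoin_le_iff]
    rintro z (rfl | rfl)
    · simpa using (Pt (z - cst a) (v - cst b)).add_mem fst_mem_Pt (Subalgebra.algebraMap_mem _ a)
    · simpa using (Pt (u - cst a) (z - cst b)).add_mem snd_mem_Pt (Subalgebra.algebraMap_mem _ b)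
  ext R
  constructor
  · rintro ⟨m, hm, rfl⟩
    have : Algebra.FiniteType ℂ (Algebra.adjoin ℂ {u, v}) :=
      (Subalgebra.fg_iff_finiteType _).mp ⟨{u, v}, by simp⟩
    obtain ⟨a, ha⟩ := exists_sub_const_mem_of_finiteType m ⟨u, hu⟩
    obtain ⟨b, hb⟩ := exists_sub_const_mem_of_finiteType m ⟨v, hv⟩
    refine ⟨a, b, ?_⟩
    have hc := h.sub_const a b
    have := hc.isLocalRing
    exact (eq_localizationAt_of_dominates (hle a b) (hc.dominates
      (vanishesAt_localizationAt_coe.mpr ha) (vanishesAt_localizationAt_coe.mpr hb))).symm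
  · rintro ⟨a, b, rfl⟩
    exact (h.sub_const a b).mem_closedPoints (hle a b)
      (Subalgebra.sub_mem _ hu (Subalgebra.algebraMap_mem _ a))
      (Subalgebra.sub_mem _ hv (Subalgebra.algebraMap_mem _ b))

lemma mem_projLineSq {R : Subalgebra ℂ PlaneField} : R ∈ projLineSq xc yc ↔
    ∃ u v : PlaneField, (u = xc ∨ u = xc⁻¹) ∧ (v = yc ∨ v = yc⁻¹) ∧
      ∃ a b : ℂ, R = Pt (u - cst a) (v - cst b) := by
  have key : ∀ u v : PlaneField, (u = xc ∨ u = xc⁻¹) → (v = yc ∨ v = yc⁻¹) → IsCoord u v := by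
    rintro u v (rfl | rfl) (rfl | rfl)
    exacts [isCoord_xc_yc, isCoord_xc_yc.inv_snd, isCoord_xc_yc.inv_fst,
      isCoord_xc_yc.inv_fst.inv_snd]
  constructor
  · rintro ⟨u, v, hu, hv, h⟩
    rw [(key u v hu hv).closedPoints_adjoin] at h
    exact ⟨u, v, hu, hv, h⟩
  · rintro ⟨u, v, hu, hv, h⟩
    refine ⟨u, v, hu, hv, ?_⟩
    rw [(key u v hu hv).closedPoints_adjoin]
    exact h

lemma mem_blowUpChart {R : Subalgebra ℂ PlaneField} {t z : PlaneField}
    (h : VanishesAt (t * z) R) : z ∈ blowUpChart R t := Algebra.subset_adjoin h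

lemma IsCoord.hasValueAt_div (h : IsCoord u v) (s : ℂ) :
    HasValueAt (v / u) s (Pt u (v / u - cst s)) := (h.div_snd.sub_const_snd s).vanishesAt_snd

lemma IsCoord.dominates_div (h : IsCoord u v) (s : ℂ) :
    Dominates (Pt u (v / u - cst s)) (Pt u v) := by
  have hc := h.div_snd.sub_const_snd s
  have := hc.isLocalRing
  refine h.dominates hc.vanishesAt_fst ?_
  have := hc.vanishesAt_fst.mul_left (h.hasValueAt_div s).mem
  rwa [div_mul_cancel₀ _ h.fst_ne_zero] at this

lemma IsCoord.Pt_div_mem_exceptionalPoints (h : IsCoord u v) (s : ℂ) :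
    Pt u (v / u - cst s) ∈ exceptionalPoints (Pt u v) := by
  have hc := h.div_snd.sub_const_snd s
  have hl := hc.isLocalRing
  have hu0 := h.fst_ne_zero
  have hd := h.dominates_div s
  have hl' := h.isLocalRing
  refine ⟨u, hu0, h.vanishesAt_fst, hc.mem_closedPoints ?_ ?_ ?_, hc.vanishesAt_fst⟩
  · unfold blowUpChart
    rw [Algebra.adjoin_le_iff]
    intro z hz
    obtain ⟨a, ha, b, hb, hab⟩ := h.exists_of_vanishesAt hz
    have : z = a + v / u * b := by
      field_simp
      linear_combination hab
    rw [this]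
    exact Subalgebra.add_mem _ (hd.1 ha) (Subalgebra.mul_mem _ (h.hasValueAt_div s).mem (hd.1 hb))
  · exact mem_blowUpChart (h.vanishesAt_fst.mul_left fst_mem_Pt)
  · refine Subalgebra.sub_mem _ (mem_blowUpChart ?_) (Subalgebra.algebraMap_mem _ s)
    rw [mul_div_cancel₀ _ hu0]
    exact h.vanishesAt_snd

lemma IsCoord.eq_Pt_div_of_ne_zero (h : IsCoord u v) {t : PlaneField} {S : Subalgebra ℂ PlaneField}
    [IsLocalRing S] {M : Ideal (blowUpChart (Pt u v) t)} [M.IsPrime]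
    (hS : S = localizationAt (blowUpChart (Pt u v) t) M)
    (ht0 : t ≠ 0) (htR : VanishesAt t (Pt u v)) (htS : VanishesAt t S) {α β : ℂ}
    (hα : HasValueAt (u / t) α S) (hβ : HasValueAt (v / t) β S) (hα0 : α ≠ 0) :
    S = Pt u (v / u - cst (β / α)) := by
  have hu0 := h.fst_ne_zero
  have hc := h.div_snd.sub_const_snd (β / α)
  have hl := hc.isLocalRing
  have hd := h.dominates_div (β / α)
  have hl' := h.isLocalRing
  have hus : VanishesAt u S := by
    have := htS.mul_left hα.mem
    rwa [div_mul_cancel₀ _ ht0] at this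
  have hvs : VanishesAt (v / u - cst (β / α)) S := by
    refine ((hβ.div hα hα0).congr ?_ rfl).vanishesAt_sub_const
    field_simp
  have hdom := hc.dominates hus hvs
  subst hS
  refine (eq_localizationAt_of_dominates ?_ hdom).symm
  have htu : t / u ∈ Pt u (v / u - cst (β / α)) := by
    obtain ⟨a, ha, b, hb, hab⟩ := h.exists_of_vanishesAt htR
    have : t / u = a + v / u * b := by
      field_simp
      linear_combination hab
    rw [this]
    exact Subalgebra.add_mem _ (hd.1 ha)
      (Subalgebra.mul_mem _ (h.hasValueAt_div _).mem (hd.1 hb))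
  have hut : u / t ∈ Pt u (v / u - cst (β / α)) := by
    rw [← inv_div t u]
    refine inv_mem_of_not_vanishesAt htu fun hv => ?_
    refine (hdom.2 _ hv).inv_notMem (div_ne_zero ht0 hu0) ?_
    rw [inv_div]
    exact hα.mem
  unfold blowUpChart
  rw [Algebra.adjoin_le_iff]
  intro z hz
  obtain ⟨a, ha, b, hb, hab⟩ := h.exists_of_vanishesAt hz
  have : z = (a + v / u * b) * (u / t) := by
    field_simp
    linear_combination hab
  rw [this]
  exact Subalgebra.mul_mem _ (Subalgebra.add_mem _ (hd.1 ha)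
      (Subalgebra.mul_mem _ (h.hasValueAt_div _).mem (hd.1 hb))) hut

lemma IsCoord.exceptionalPoints_eq (h : IsCoord u v) : exceptionalPoints (Pt u v) =
    {R | (∃ s : ℂ, R = Pt u (v / u - cst s)) ∨ R = Pt (u / v) v} := by
  have hl := h.isLocalRing
  ext S
  constructor
  · rintro ⟨t, ht0, htR, hcl, htS⟩
    set B := blowUpChart (Pt u v) t with hB
    obtain ⟨M, hM, hS⟩ := hcl
    have hp := hM.isPrime
    classical
    have hle : ∀ z ∈ Pt u v, z ∈ B := fun z hz => mem_blowUpChart (htR.mul_right hz)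
    have hlS : IsLocalRing S := hS ▸ isLocalRing_localizationAt B M
    have hut : u / t ∈ B := mem_blowUpChart (by
      rw [mul_div_cancel₀ _ ht0]; exact h.vanishesAt_fst)
    have hvt : v / t ∈ B := mem_blowUpChart (by
      rw [mul_div_cancel₀ _ ht0]; exact h.vanishesAt_snd)
    have htM : (⟨t, hle t htR.mem⟩ : B) ∈ M := by
      rw [← vanishesAt_localizationAt_coe, ← hS]; exact htS
    have hmM : ∀ z (hz : VanishesAt z (Pt u v)), (⟨z, hle z hz.mem⟩ : B) ∈ M := by
      intro z hz
      have hzt : z / t ∈ B := mem_blowUpChart (by rwa [mul_div_cancel₀ _ ht0])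
      have : (⟨z, hle z hz.mem⟩ : B) = ⟨z / t, hzt⟩ * ⟨t, hle t htR.mem⟩ :=
        Subtype.ext (div_mul_cancel₀ _ ht0).symm
      rw [this]
      exact M.mul_mem_left _ htM
    have hmk : ∀ z (hz : z ∈ Pt u v), ∃ c : ℂ,
        Ideal.Quotient.mkₐ ℂ M ⟨z, hle z hz⟩ = algebraMap ℂ (B ⧸ M) c := by
      intro z hz
      obtain ⟨c, hc⟩ := h.exists_hasValueAt hz
      refine ⟨c, ?_⟩
      rw [← (Ideal.Quotient.mkₐ ℂ M).commutes c, ← sub_eq_zero, ← map_sub,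
        Ideal.Quotient.mkₐ_eq_mk, Ideal.Quotient.eq_zero_iff_mem]
      exact hmM _ hc
    have hft : Algebra.FiniteType ℂ (B ⧸ M) := by
      refine ⟨⟨{Ideal.Quotient.mkₐ ℂ M ⟨u / t, hut⟩, Ideal.Quotient.mkₐ ℂ M ⟨v / t, hvt⟩}, ?_⟩⟩
      rw [eq_top_iff]
      rintro x -
      obtain ⟨⟨z, hz⟩, rfl⟩ := Ideal.Quotient.mkₐ_surjective ℂ M x
      set A := Algebra.adjoin ℂ (↑({Ideal.Quotient.mkₐ ℂ M ⟨u / t, hut⟩,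
        Ideal.Quotient.mkₐ ℂ M ⟨v / t, hvt⟩} : Finset (B ⧸ M)) : Set (B ⧸ M)) with hA
      have hAu : Ideal.Quotient.mkₐ ℂ M ⟨u / t, hut⟩ ∈ A := Algebra.subset_adjoin (by simp)
      have hAv : Ideal.Quotient.mkₐ ℂ M ⟨v / t, hvt⟩ ∈ A := Algebra.subset_adjoin (by simp)
      have hle2 : B ≤ (A.comap (Ideal.Quotient.mkₐ ℂ M)).map B.val := by
        refine hB.le.trans (Algebra.adjoin_le ?_)
        intro z hz
        have hz' : z ∈ B := mem_blowUpChart hz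
        obtain ⟨a, ha, b, hb, hab⟩ := h.exists_of_vanishesAt hz
        refine ⟨⟨z, hz'⟩, ?_, rfl⟩
        have h1 : (⟨z, hz'⟩ : B) = ⟨u / t, hut⟩ * ⟨a, hle a ha⟩ + ⟨v / t, hvt⟩ * ⟨b, hle b hb⟩ := by
          apply Subtype.ext
          push_cast
          field_simp
          linear_combination hab
        obtain ⟨c, hc⟩ := hmk a ha
        obtain ⟨d, hd⟩ := hmk b hb
        change Ideal.Quotient.mkₐ ℂ M ⟨z, hz'⟩ ∈ A
        rw [h1, map_add, map_mul, map_mul, hc, hd]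
        exact A.add_mem (A.mul_mem hAu (A.algebraMap_mem c)) (A.mul_mem hAv (A.algebraMap_mem d))
      obtain ⟨w, hw, hwz⟩ := hle2 hz
      have : w = ⟨z, hz⟩ := Subtype.ext hwz
      exact this ▸ hw
    obtain ⟨α, hα⟩ := exists_sub_const_mem_of_finiteType M ⟨u / t, hut⟩
    obtain ⟨β, hβ⟩ := exists_sub_const_mem_of_finiteType M ⟨v / t, hvt⟩
    have hα' : HasValueAt (u / t) α S := by
      rw [hS]; exact vanishesAt_localizationAt_coe.mpr hα
    have hβ' : HasValueAt (v / t) β S := by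
      rw [hS]; exact vanishesAt_localizationAt_coe.mpr hβ
    by_cases hα0 : α = 0
    · right
      have hβ0 : β ≠ 0 := by
        rintro rfl
        subst hα0
        obtain ⟨a, ha, b, hb, hab⟩ := h.exists_of_vanishesAt htR
        have hRS : Pt u v ≤ S := fun z hz => hS ▸ le_localizationAt B M (hle z hz)
        have h1 : (1 : PlaneField) = u / t * a + v / t * b := by
          field_simp
          linear_combination hab
        refine not_vanishesAt_one (R := S) (K := PlaneField) ?_
        rw [h1]
        exact (hα'.vanishesAt.mul_right (hRS ha)).add (hβ'.vanishesAt.mul_right (hRS hb))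
      have key : ∀ R (hR : R = Pt v u) (M : Ideal (blowUpChart R t)) [M.IsPrime],
          S = localizationAt (blowUpChart R t) M → S = Pt v (u / v - cst (α / β)) := by
        rintro _ rfl M _ hS
        exact h.symm.eq_Pt_div_of_ne_zero hS ht0 (Pt_comm u v ▸ htR) htS hβ' hα' hβ0
      have := key _ (Pt_comm u v) M hS
      rw [this, hα0, Pt_comm]
      simp
    · left
      exact ⟨β / α, h.eq_Pt_div_of_ne_zero hS ht0 htR htS hα' hβ' hα0⟩
  · rintro (⟨s, rfl⟩ | rfl)
    · exact h.Pt_div_mem_exceptionalPoints s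
    · have := h.symm.Pt_div_mem_exceptionalPoints 0
      rw [Pt_comm v u, Pt_comm v] at this
      simpa using this

end

section

/-- A set of local rings of points is a separated nonsingular surface. -/
structure IsSeparatedModel (X : Set (Subalgebra ℂ PlaneField)) : Prop where
  isPt : ∀ R ∈ X, ∃ u v, IsCoord u v ∧ R = Pt u v
  eq_of_dominates : ∀ R ∈ X, ∀ R' ∈ X, ∀ S : Subalgebra ℂ PlaneField, IsLocalRing S → Dominates S R → Dominates S R' → R = R'

/-- The blow-up of `X` at its point with local ring `P`. -/
def blowUpAt (X : Set (Subalgebra ℂ PlaneField)) (P : Subalgebra ℂ PlaneField) :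
    Set (Subalgebra ℂ PlaneField) := (X \ {P}) ∪ exceptionalPoints P

variable {u v : PlaneField} {X : Set (Subalgebra ℂ PlaneField)}

lemma IsSeparatedModel.isLocalRing (hX : IsSeparatedModel X) {R} (hR : R ∈ X) :
    IsLocalRing R := by
  obtain ⟨u, v, h, rfl⟩ := hX.isPt R hR
  exact h.isLocalRing

lemma IsCoord.exists_of_mem_exceptionalPoints (h : IsCoord u v) {R : Subalgebra ℂ PlaneField}
    (hR : R ∈ exceptionalPoints (Pt u v)) :
    (∃ u' v', IsCoord u' v' ∧ R = Pt u' v') ∧ Dominates R (Pt u v) := by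
  rw [h.exceptionalPoints_eq] at hR
  rcases hR with ⟨s, rfl⟩ | rfl
  · exact ⟨⟨_, _, h.div_snd.sub_const_snd s, rfl⟩, h.dominates_div s⟩
  · refine ⟨⟨_, _, h.div_fst, rfl⟩, ?_⟩
    have := h.symm.dominates_div 0
    rw [Pt_comm v u, Pt_comm v] at this
    simpa using this

lemma IsSeparatedModel.blowUp_eq (hX : IsSeparatedModel X) (h : IsCoord u v)
    (hP : Pt u v ∈ X) : blowUp X u v = blowUpAt X (Pt u v) := by
  have key : ∀ R ∈ X, (VanishesAt u R ∧ VanishesAt v R) ↔ R = Pt u v := by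
    intro R hR
    have hl := hX.isLocalRing hR
    constructor
    · rintro ⟨h1, h2⟩
      exact hX.eq_of_dominates R hR _ hP R hl (Dominates.refl R) (h.dominates h1 h2)
    · rintro rfl
      exact ⟨h.vanishesAt_fst, h.vanishesAt_snd⟩
  ext R
  constructor
  · rintro (⟨hR, h1⟩ | ⟨R', hR', h1, h2⟩)
    · exact .inl ⟨hR, fun h2 => h1 ((key R hR).mpr h2)⟩
    · exact .inr ((key R' hR').mp h1 ▸ h2)
  · rintro (⟨hR, h1⟩ | h1)
    · exact .inl ⟨hR, fun h2 => h1 ((key R hR).mp h2)⟩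
    · exact .inr ⟨_, hP, (key _ hP).mpr rfl, h1⟩

lemma IsSeparatedModel.blowUpAt_mem (hX : IsSeparatedModel X) (h : IsCoord u v)
    (hP : Pt u v ∈ X) : IsSeparatedModel (blowUpAt X (Pt u v)) := by
  constructor
  · rintro R (hR | hR)
    · exact hX.isPt R hR.1
    · exact (h.exists_of_mem_exceptionalPoints hR).1
  · rintro R (hR | hR) R' (hR' | hR') S hS hd hd'
    · exact hX.eq_of_dominates R hR.1 R' hR'.1 S hS hd hd'
    · exact absurd (hX.eq_of_dominates R hR.1 _ hP S hS hd
        (hd'.trans (h.exists_of_mem_exceptionalPoints hR').2)) hR.2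
    · exact absurd (hX.eq_of_dominates R' hR'.1 _ hP S hS hd'
        (hd.trans (h.exists_of_mem_exceptionalPoints hR).2)) hR'.2
    · rw [h.exceptionalPoints_eq] at hR hR'
      have aux : ∀ s : ℂ, Dominates S (Pt u (v / u - cst s)) → Dominates S (Pt (u / v) v) →
          False := by
        intro s h1 h2
        have h3 := h1.hasValueAt (h.hasValueAt_div s)
        have h4 := (h2.2 _ h.div_fst.vanishesAt_fst).mul_right h3.mem
        rw [div_mul_div_cancel₀ h.snd_ne_zero, div_self h.fst_ne_zero] at h4
        exact not_vanishesAt_one h4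
      rcases hR with ⟨s, rfl⟩ | rfl <;> rcases hR' with ⟨s', rfl⟩ | rfl
      · rw [(hd.hasValueAt (h.hasValueAt_div s)).eq (hd'.hasValueAt (h.hasValueAt_div s'))]
      · exact (aux s hd hd').elim
      · exact (aux s' hd' hd).elim
      · rfl

/-- The local parameter of `ℙ¹` with coordinate `z` at a point, `none` being the point at
infinity. -/
def localParam (z : PlaneField) : Option ℂ → PlaneField
  | some a => z - cst a
  | none => z⁻¹

lemma localParam_unique {z : PlaneField} (hz : z ≠ 0) {S : Subalgebra ℂ PlaneField}
    [IsLocalRing S] {o o' : Option ℂ} (h : VanishesAt (localParam z o) S)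
    (h' : VanishesAt (localParam z o') S) : o = o' := by
  have aux : ∀ a : ℂ, VanishesAt (z - cst a) S → VanishesAt z⁻¹ S → False := by
    intro a h1 h2
    have h3 := h2.mul_right (HasValueAt.mem h1)
    rw [inv_mul_cancel₀ hz] at h3
    exact not_vanishesAt_one h3
  cases o <;> cases o'
  · rfl
  · exact (aux _ h' h).elim
  · exact (aux _ h h').elim
  · rw [HasValueAt.eq h h']

/-- The local ring of a point of `ℙ¹ × ℙ¹`. -/
def productPt (o o' : Option ℂ) : Subalgebra ℂ PlaneField :=
  Pt (localParam xc o) (localParam yc o')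

lemma isCoord_localParam (h : IsCoord u v) (o o' : Option ℂ) :
    IsCoord (localParam u o) (localParam v o') := by
  cases o <;> cases o'
  · exact h.inv_fst.inv_snd
  · exact h.inv_fst.sub_const_snd _
  · exact h.inv_snd.sub_const_fst _
  · exact h.sub_const _ _

lemma isCoord_productPt (o o' : Option ℂ) : IsCoord (localParam xc o) (localParam yc o') :=
  isCoord_localParam isCoord_xc_yc o o'

lemma productPt_unique {S : Subalgebra ℂ PlaneField} [IsLocalRing S] {o o' p p' : Option ℂ}
    (h : Dominates S (productPt o o')) (h' : Dominates S (productPt p p')) : o = p ∧ o' = p' :=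
  ⟨localParam_unique isCoord_xc_yc.fst_ne_zero (h.2 _ (isCoord_productPt o o').vanishesAt_fst)
      (h'.2 _ (isCoord_productPt p p').vanishesAt_fst),
    localParam_unique isCoord_xc_yc.snd_ne_zero (h.2 _ (isCoord_productPt o o').vanishesAt_snd)
      (h'.2 _ (isCoord_productPt p p').vanishesAt_snd)⟩

lemma productPt_injective {o o' p p' : Option ℂ} (h : productPt o o' = productPt p p') :
    o = p ∧ o' = p' := by
  have : IsLocalRing (productPt o o') := (isCoord_productPt o o').isLocalRing
  exact productPt_unique (S := productPt o o') (Dominates.refl _) (h ▸ Dominates.refl _)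

lemma IsCoord.Pt_inv (h : IsCoord u v) {a : ℂ} (ha : a ≠ 0) :
    Pt (u⁻¹ - cst a⁻¹) v = Pt (u - cst a) v := by
  have h1 := h.sub_const_fst a
  have h2 := h.inv_fst.sub_const_fst a⁻¹
  have := h1.isLocalRing
  have := h2.isLocalRing
  have e1 : HasValueAt u a (Pt (u - cst a) v) := h1.vanishesAt_fst
  have e2 : HasValueAt u⁻¹ a⁻¹ (Pt (u⁻¹ - cst a⁻¹) v) := h2.vanishesAt_fst
  refine h2.Pt_eq h1 (e1.inv ha) h1.vanishesAt_snd ?_ h2.vanishesAt_snd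
  exact (e2.inv (inv_ne_zero ha)).congr (inv_inv u) (inv_inv a)

lemma IsCoord.Pt_div (h : IsCoord u v) {a : ℂ} (ha : a ≠ 0) :
    Pt (u - cst a) (v / u) = Pt (u - cst a) v := by
  have h1 := h.sub_const_fst a
  have h2 := h.div_snd.sub_const_fst a
  have := h1.isLocalRing
  have := h2.isLocalRing
  have e1 : HasValueAt u a (Pt (u - cst a) v) := h1.vanishesAt_fst
  have e2 : HasValueAt u a (Pt (u - cst a) (v / u)) := h2.vanishesAt_fst
  refine h2.Pt_eq h1 h1.vanishesAt_fst ?_ h2.vanishesAt_fst ?_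
  · exact (h1.vanishesAt_snd.hasValueAt.div e1 ha).vanishesAt_of_eq rfl (zero_div a)
  · exact (h2.vanishesAt_snd.hasValueAt.mul e2).vanishesAt_of_eq
      (div_mul_cancel₀ _ h.fst_ne_zero) (zero_mul a)

lemma IsCoord.Pt_flip (h : IsCoord u v) {a : ℂ} (ha : a ≠ 0) :
    Pt (u / v - cst a) v = Pt u (v / u - cst a⁻¹) := by
  have h1 := h.div_fst.sub_const_fst a
  have h2 := h.div_snd.sub_const_snd a⁻¹
  have := h1.isLocalRing
  have := h2.isLocalRing
  have e1 : HasValueAt (u / v) a (Pt (u / v - cst a) v) := h1.vanishesAt_fst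
  have e2 : HasValueAt (v / u) a⁻¹ (Pt u (v / u - cst a⁻¹)) := h2.vanishesAt_snd
  refine h1.Pt_eq h2 ?_ ?_ ?_ ?_
  · exact (e2.inv (inv_ne_zero ha)).congr (inv_div _ _) (inv_inv a)
  · exact (e2.mul h2.vanishesAt_fst.hasValueAt).vanishesAt_of_eq
      (div_mul_cancel₀ _ h.fst_ne_zero) (mul_zero _)
  · exact (e1.mul h1.vanishesAt_snd.hasValueAt).vanishesAt_of_eq
      (div_mul_cancel₀ _ h.snd_ne_zero) (mul_zero _)
  · exact (e1.inv ha).congr (inv_div _ _) rfl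

lemma projLineSq_eq : projLineSq xc yc = {R | ∃ o o', R = productPt o o'} := by
  have key : ∀ z u v : PlaneField, IsCoord z v → (u = z ∨ u = z⁻¹) → ∀ a : ℂ, ∃ o,
      Pt (u - cst a) v = Pt (localParam z o) v := by
    rintro z u v hz (rfl | rfl) a
    · exact ⟨some a, rfl⟩
    · by_cases ha : a = 0
      · exact ⟨none, by simp [ha, localParam]⟩
      · refine ⟨some a⁻¹, ?_⟩
        have := hz.Pt_inv (inv_ne_zero ha)
        rw [inv_inv] at this
        exact this
  ext R
  rw [mem_projLineSq]
  constructor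
  · rintro ⟨u, v, hu, hv, a, b, rfl⟩
    have hv' : IsCoord xc (v - cst b) := by
      rcases hv with rfl | rfl
      · exact isCoord_xc_yc.sub_const_snd b
      · exact isCoord_xc_yc.inv_snd.sub_const_snd b
    obtain ⟨o, ho⟩ := key xc u _ hv' hu a
    have hu' : IsCoord yc (localParam xc o) := (isCoord_localParam isCoord_xc_yc o (some 0)).symm |>
      fun h => by simpa [localParam] using h
    obtain ⟨o', ho'⟩ := key yc v _ hu' hv b
    refine ⟨o, o', ?_⟩
    rw [ho, Pt_comm, ho', Pt_comm]; rfl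
  · rintro ⟨o, o', rfl⟩
    have aux : ∀ (z : PlaneField) (o : Option ℂ), ∃ u, (u = z ∨ u = z⁻¹) ∧
        ∃ a : ℂ, localParam z o = u - cst a := by
      intro z o
      cases o with
      | none => exact ⟨z⁻¹, Or.inr rfl, 0, by simp [localParam]⟩
      | some a => exact ⟨z, Or.inl rfl, a, rfl⟩
    obtain ⟨u, hu, a, ha⟩ := aux xc o
    obtain ⟨v, hv, b, hb⟩ := aux yc o'
    exact ⟨u, v, hu, hv, a, b, by rw [← ha, ← hb]; rfl⟩

lemma isSeparatedModel_projLineSq : IsSeparatedModel (projLineSq xc yc) := by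
  rw [projLineSq_eq]
  constructor
  · rintro R ⟨o, o', rfl⟩
    exact ⟨_, _, isCoord_productPt o o', rfl⟩
  · rintro R ⟨o, o', rfl⟩ R' ⟨p, p', rfl⟩ S hS h h'
    obtain ⟨rfl, rfl⟩ := productPt_unique h h'
    rfl

/-- The first coordinates at the corners of the hexagon of boundary curves. -/
def cornerU : Fin 6 → PlaneField := ![xc / yc, xc, yc, yc / xc, xc⁻¹, yc⁻¹]

/-- The second coordinates at the corners of the hexagon of boundary curves. -/
def cornerV : Fin 6 → PlaneField := ![yc, yc / xc, xc⁻¹, yc⁻¹, xc / yc, xc]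

lemma isCoord_corner (j : Fin 6) : IsCoord (cornerU j) (cornerV j) := by
  have h := isCoord_xc_yc
  have h' := h.inv_fst.inv_snd
  have e1 : (xc⁻¹ : PlaneField) / yc⁻¹ = yc / xc := by rw [inv_div_inv]
  have e2 : (yc⁻¹ : PlaneField) / xc⁻¹ = xc / yc := by rw [inv_div_inv]
  fin_cases j
  · exact h.div_fst
  · exact h.div_snd
  · exact h.inv_fst.symm
  · have := h'.div_fst
    rwa [e1] at this
  · have := h'.div_snd
    rwa [e2] at this
  · exact h.inv_snd.symm

/-- The toric surface with hexagonal boundary, blown up at the points `cornerU j = κ j` of the six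
boundary curves `cornerV j = 0`. -/
def hexagonSurface (κ : Fin 6 → ℂ) : Set (Subalgebra ℂ PlaneField) :=
  {R | (∃ a b : ℂ, a ≠ 0 ∧ b ≠ 0 ∧ R = Pt (xc - cst a) (yc - cst b)) ∨
    (∃ (j : Fin 6) (a : ℂ), a ≠ 0 ∧ a ≠ κ j ∧ R = Pt (cornerU j - cst a) (cornerV j)) ∨
    (∃ j : Fin 6, R = Pt (cornerU j) (cornerV j)) ∨
    ∃ j : Fin 6, R ∈ exceptionalPoints (Pt (cornerU j - cst (κ j)) (cornerV j))}

end

/-- The coordinates `κ` of the blown up points for the surface `familySurface b₀ b₁ b₂ c`. -/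
def familyCoords (b₀ b₁ b₂ c : ℂ) : Fin 6 → ℂ := ![1 / c, b₁, 1, c * b₀, 1, b₂]

section Chain

variable {X : Set (Subalgebra ℂ PlaneField)} {R : Subalgebra ℂ PlaneField}

lemma mem_blowUpAt {P : Subalgebra ℂ PlaneField} :
    R ∈ blowUpAt X P ↔ (R ∈ X ∧ R ≠ P) ∨ R ∈ exceptionalPoints P := Iff.rfl

lemma exceptionalPoints_ne {o o' p p' : Option ℂ}
    (hR : R ∈ exceptionalPoints (productPt o o')) (hne : ¬ (o = p ∧ o' = p'))
    {P : Subalgebra ℂ PlaneField} (hP : Dominates P (productPt p p')) : R ≠ P := by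
  rintro rfl
  obtain ⟨⟨u, v, h, rfl⟩, hd⟩ := (isCoord_productPt o o').exists_of_mem_exceptionalPoints hR
  have := h.isLocalRing
  exact hne (productPt_unique hd hP)

lemma familySurface_spec (b₀ b₁ b₂ c : ℂ) (hb₁ : b₁ ≠ 0) (hb₂ : b₂ ≠ 0) :
    IsSeparatedModel (familySurface b₀ b₁ b₂ c) ∧ ∀ R, R ∈ familySurface b₀ b₁ b₂ c ↔
      (R ∈ projLineSq xc yc ∧ R ≠ productPt (some b₁) (some 0) ∧
        R ≠ productPt (some 0) (some (1 / b₂)) ∧ R ≠ productPt (some 1) none ∧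
        R ≠ productPt none (some 1) ∧ R ≠ productPt (some 0) (some 0) ∧ R ≠ productPt none none) ∨
      R ∈ exceptionalPoints (productPt (some b₁) (some 0)) ∨
      R ∈ exceptionalPoints (productPt (some 0) (some (1 / b₂))) ∨
      R ∈ exceptionalPoints (productPt (some 1) none) ∨
      R ∈ exceptionalPoints (productPt none (some 1)) ∨
      (R ∈ exceptionalPoints (productPt (some 0) (some 0)) ∧ R ≠ Pt xc (yc / xc - cst c)) ∨
      R ∈ exceptionalPoints (Pt xc (yc / xc - cst c)) ∨
      (R ∈ exceptionalPoints (productPt none none) ∧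
        R ≠ Pt xc⁻¹ (xc / yc - cst (1 / (c * b₀)))) ∨
      R ∈ exceptionalPoints (Pt xc⁻¹ (xc / yc - cst (1 / (c * b₀)))) := by
  have hx := isCoord_xc_yc
  have hx' := hx.inv_fst.inv_snd
  set p₁ := productPt (some b₁) (some 0) with hp₁
  set p₂ := productPt (some 0) (some (1 / b₂)) with hp₂
  set p₃ := productPt (some 1) none with hp₃
  set p₄ := productPt none (some 1) with hp₄
  set p₅ := productPt (some 0) (some 0) with hp₅
  set p₆ := Pt xc (yc / xc - cst c) with hp₆
  set p₇ := productPt none none with hp₇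
  set p₈ := Pt xc⁻¹ (xc / yc - cst (1 / (c * b₀))) with hp₈
  have c6 : IsCoord xc (yc / xc - cst c) := hx.div_snd.sub_const_snd c
  have c8 : IsCoord xc⁻¹ (xc / yc - cst (1 / (c * b₀))) := by
    have := hx'.div_snd.sub_const_snd (1 / (c * b₀))
    rwa [inv_div_inv] at this
  have e5 : p₅ = Pt xc yc := by simp [p₅, productPt, localParam]
  have e1 : p₁ = Pt (xc - cst b₁) yc := by simp [p₁, productPt, localParam]
  have e2 : p₂ = Pt xc (yc - cst (1 / b₂)) := by simp [p₂, productPt, localParam]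
  have e3 : p₃ = Pt (xc - 1) yc⁻¹ := by simp [p₃, productPt, localParam]
  have e4 : p₄ = Pt xc⁻¹ (yc - 1) := by simp [p₄, productPt, localParam]
  have e7 : p₇ = Pt xc⁻¹ yc⁻¹ := rfl
  have d6 : Dominates p₆ p₅ := by rw [e5]; exact hx.dominates_div c
  have d8 : Dominates p₈ p₇ := by
    have := hx'.dominates_div (1 / (c * b₀))
    rwa [inv_div_inv] at this
  have m6 : p₆ ∈ exceptionalPoints p₅ := by
    rw [e5]; exact hx.Pt_div_mem_exceptionalPoints c
  have m8 : p₈ ∈ exceptionalPoints p₇ := by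
    have := hx'.Pt_div_mem_exceptionalPoints (1 / (c * b₀))
    rwa [inv_div_inv] at this
  have l6 : IsLocalRing p₆ := c6.isLocalRing
  have l8 : IsLocalRing p₈ := c8.isLocalRing
  have hP : ∀ o o', productPt o o' ∈ projLineSq xc yc := fun o o' => by
    rw [projLineSq_eq]; exact ⟨o, o', rfl⟩
  have nd : ∀ o o' p p' : Option ℂ, (o ≠ p ∨ o' ≠ p') → productPt o o' ≠ productPt p p' :=
    fun o o' p p' h h1 => h.elim (fun h => h (productPt_injective h1).1)
      (fun h => h (productPt_injective h1).2)
  have n6 : ∀ o o', (o ≠ some 0 ∨ o' ≠ some 0) → productPt o o' ≠ p₆ := fun o o' h h1 => by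
    have := productPt_unique (S := p₆) (by rw [h1]; exact Dominates.refl _) d6
    tauto
  have nex : ∀ {o o'} (p p' : Option ℂ), (o ≠ p ∨ o' ≠ p') → ∀ {P}, Dominates P (productPt p p') →
      ∀ {R}, R ∈ exceptionalPoints (productPt o o') → R ≠ P := fun p p' h P hP R hR =>
    exceptionalPoints_ne hR (fun h1 => h.elim (fun h => h h1.1) (fun h => h h1.2)) hP
  have hb₂' : 1 / b₂ ≠ 0 := one_div_ne_zero hb₂
  obtain ⟨X₁, hX₁⟩ : ∃ X, X = blowUp (projLineSq xc yc) (xc - cst b₁) yc := ⟨_, rfl⟩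
  obtain ⟨X₂, hX₂⟩ : ∃ X, X = blowUp X₁ xc (yc - cst (1 / b₂)) := ⟨_, rfl⟩
  obtain ⟨X₃, hX₃⟩ : ∃ X, X = blowUp X₂ (xc - 1) yc⁻¹ := ⟨_, rfl⟩
  obtain ⟨X₄, hX₄⟩ : ∃ X, X = blowUp X₃ xc⁻¹ (yc - 1) := ⟨_, rfl⟩
  obtain ⟨X₅, hX₅⟩ : ∃ X, X = blowUp X₄ xc yc := ⟨_, rfl⟩
  obtain ⟨X₆, hX₆⟩ : ∃ X, X = blowUp X₅ xc (yc / xc - cst c) := ⟨_, rfl⟩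
  obtain ⟨X₇, hX₇⟩ : ∃ X, X = blowUp X₆ xc⁻¹ yc⁻¹ := ⟨_, rfl⟩
  have hF : familySurface b₀ b₁ b₂ c = blowUp X₇ xc⁻¹ (xc / yc - cst (1 / (c * b₀))) := by
    rw [hX₇, hX₆, hX₅, hX₄, hX₃, hX₂, hX₁]; rfl
  have M₀ := isSeparatedModel_projLineSq
  have q1 : X₁ = blowUpAt (projLineSq xc yc) p₁ := by
    rw [hX₁, e1]; exact M₀.blowUp_eq (hx.sub_const_fst b₁) (e1 ▸ hP _ _)
  have M₁ : IsSeparatedModel X₁ := by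
    rw [q1, e1]; exact M₀.blowUpAt_mem (hx.sub_const_fst b₁) (e1 ▸ hP _ _)
  have in2 : p₂ ∈ X₁ := by
    rw [q1]
    exact .inl ⟨hP _ _, nd _ _ _ _ (.inl (by simpa using hb₁.symm))⟩
  have q2 : X₂ = blowUpAt X₁ p₂ := by
    rw [hX₂, e2]; exact M₁.blowUp_eq (hx.sub_const_snd _) (e2 ▸ in2)
  have M₂ : IsSeparatedModel X₂ := by
    rw [q2, e2]; exact M₁.blowUpAt_mem (hx.sub_const_snd _) (e2 ▸ in2)
  have in3 : p₃ ∈ X₂ := by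
    rw [q2, q1]
    exact .inl ⟨.inl ⟨hP _ _, nd _ _ _ _ (.inr (by simp))⟩, nd _ _ _ _ (.inr (by simp))⟩
  have c3 : IsCoord (xc - 1) yc⁻¹ := by simpa using hx.inv_snd.sub_const_fst 1
  have q3 : X₃ = blowUpAt X₂ p₃ := by
    rw [hX₃, e3]; exact M₂.blowUp_eq c3 (e3 ▸ in3)
  have M₃ : IsSeparatedModel X₃ := by
    rw [q3, e3]; exact M₂.blowUpAt_mem c3 (e3 ▸ in3)
  have in4 : p₄ ∈ X₃ := by
    rw [q3, q2, q1]
    exact .inl ⟨.inl ⟨.inl ⟨hP _ _, nd _ _ _ _ (.inl (by simp))⟩,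
      nd _ _ _ _ (.inl (by simp))⟩, nd _ _ _ _ (.inl (by simp))⟩
  have c4 : IsCoord xc⁻¹ (yc - 1) := by simpa using hx.inv_fst.sub_const_snd 1
  have q4 : X₄ = blowUpAt X₃ p₄ := by
    rw [hX₄, e4]; exact M₃.blowUp_eq c4 (e4 ▸ in4)
  have M₄ : IsSeparatedModel X₄ := by
    rw [q4, e4]; exact M₃.blowUpAt_mem c4 (e4 ▸ in4)
  have in5 : p₅ ∈ X₄ := by
    rw [q4, q3, q2, q1]
    exact .inl ⟨.inl ⟨.inl ⟨.inl ⟨hP _ _, nd _ _ _ _ (.inl (by simpa using hb₁.symm))⟩,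
      nd _ _ _ _ (.inr (by simpa using hb₂.symm))⟩, nd _ _ _ _ (.inr (by simp))⟩,
      nd _ _ _ _ (.inl (by simp))⟩
  have q5 : X₅ = blowUpAt X₄ p₅ := by
    rw [hX₅, e5]; exact M₄.blowUp_eq hx (e5 ▸ in5)
  have M₅ : IsSeparatedModel X₅ := by
    rw [q5, e5]; exact M₄.blowUpAt_mem hx (e5 ▸ in5)
  have in6 : p₆ ∈ X₅ := by rw [q5]; exact .inr m6
  have q6 : X₆ = blowUpAt X₅ p₆ := hX₆ ▸ M₅.blowUp_eq c6 in6
  have M₆ : IsSeparatedModel X₆ := by rw [q6]; exact M₅.blowUpAt_mem c6 in6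
  have in7 : p₇ ∈ X₆ := by
    rw [q6, q5, q4, q3, q2, q1]
    exact .inl ⟨.inl ⟨.inl ⟨.inl ⟨.inl ⟨.inl ⟨hP _ _, nd _ _ _ _ (.inl (by simp))⟩,
      nd _ _ _ _ (.inl (by simp))⟩, nd _ _ _ _ (.inl (by simp))⟩,
      nd _ _ _ _ (.inr (by simp))⟩, nd _ _ _ _ (.inl (by simp))⟩, n6 _ _ (.inl (by simp))⟩
  have q7 : X₇ = blowUpAt X₆ p₇ := by
    rw [hX₇, e7]; exact M₆.blowUp_eq hx' (e7 ▸ in7)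
  have M₇ : IsSeparatedModel X₇ := by
    rw [q7, e7]; exact M₆.blowUpAt_mem hx' (e7 ▸ in7)
  have in8 : p₈ ∈ X₇ := by rw [q7]; exact .inr m8
  have q8 : blowUp X₇ xc⁻¹ (xc / yc - cst (1 / (c * b₀))) = blowUpAt X₇ p₈ := M₇.blowUp_eq c8 in8
  refine ⟨by rw [hF, q8]; exact M₇.blowUpAt_mem c8 in8, fun R => ?_⟩
  rw [hF, q8, q7, q6, q5, q4, q3, q2, q1]
  have f6 : R ∈ exceptionalPoints p₆ → ¬ Dominates R p₇ := fun hR hd => by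
    obtain ⟨⟨u, v, h, rfl⟩, hd'⟩ := c6.exists_of_mem_exceptionalPoints hR
    have := h.isLocalRing
    simpa using (productPt_unique hd (hd'.trans d6)).1
  have f67 : R ∈ exceptionalPoints p₆ → R ≠ p₇ := fun h h' => f6 h (h' ▸ Dominates.refl R)
  have f68 : R ∈ exceptionalPoints p₆ → R ≠ p₈ := fun h h' => f6 h (h' ▸ d8)
  have g6 : R ∈ projLineSq xc yc → R = p₆ → R = p₅ := fun h h' =>
    M₀.eq_of_dominates R h p₅ (hP _ _) p₆ l6 (h' ▸ Dominates.refl R) d6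
  have g8 : R ∈ projLineSq xc yc → R = p₈ → R = p₇ := fun h h' =>
    M₀.eq_of_dominates R h p₇ (hP _ _) p₈ l8 (h' ▸ Dominates.refl R) d8
  simp only [mem_blowUpAt]
  have D := @Dominates.refl PlaneField _ _
  constructor
  · rintro (⟨⟨⟨⟨⟨⟨⟨⟨h, h1⟩ | h, h2⟩ | h, h3⟩ | h, h4⟩ | h, h5⟩ | h, h6⟩ | h, h7⟩ | h, h8⟩ | h)
    · exact .inl ⟨h, h1, h2, h3, h4, h5, h7⟩
    · exact .inr (.inl h)
    · exact .inr (.inr (.inl h))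
    · exact .inr (.inr (.inr (.inl h)))
    · exact .inr (.inr (.inr (.inr (.inl h))))
    · exact .inr (.inr (.inr (.inr (.inr (.inl ⟨h, h6⟩)))))
    · exact .inr (.inr (.inr (.inr (.inr (.inr (.inl h))))))
    · exact .inr (.inr (.inr (.inr (.inr (.inr (.inr (.inl ⟨h, h8⟩)))))))
    · exact .inr (.inr (.inr (.inr (.inr (.inr (.inr (.inr h)))))))
  · rintro (⟨h, h1, h2, h3, h4, h5, h7⟩ | h | h | h | h | ⟨h, h6⟩ | h | ⟨h, h8⟩ | h)
    · exact .inl ⟨.inl ⟨.inl ⟨.inl ⟨.inl ⟨.inl ⟨.inl ⟨.inl ⟨h, h1⟩, h2⟩, h3⟩, h4⟩,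
      h5⟩, fun h' => h5 (g6 h h')⟩, h7⟩, fun h' => h7 (g8 h h')⟩
    · exact .inl ⟨.inl ⟨.inl ⟨.inl ⟨.inl ⟨.inl ⟨.inl ⟨.inr h, nex _ _ (.inl (by
      simpa using hb₁)) (D _) h⟩, nex _ _ (.inr (by simp)) (D _) h⟩, nex _ _ (.inl (by simp))
      (D _) h⟩, nex _ _ (.inl (by simpa using hb₁)) (D _) h⟩, nex _ _ (.inl (by simpa using
      hb₁)) d6 h⟩, nex _ _ (.inl (by simp)) (D _) h⟩, nex _ _ (.inl (by simp)) d8 h⟩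
    · exact .inl ⟨.inl ⟨.inl ⟨.inl ⟨.inl ⟨.inl ⟨.inr h, nex _ _ (.inr (by simp)) (D
      _) h⟩, nex _ _ (.inl (by simp)) (D _) h⟩, nex _ _ (.inr (by simpa using hb₂)) (D _) h⟩,
      nex _ _ (.inr (by simpa using hb₂)) d6 h⟩, nex _ _ (.inl (by simp)) (D _) h⟩, nex _ _
      (.inl (by simp)) d8 h⟩
    · exact .inl ⟨.inl ⟨.inl ⟨.inl ⟨.inl ⟨.inr h, nex _ _ (.inl (by simp)) (D _) h⟩,
      nex _ _ (.inl (by simp)) (D _) h⟩, nex _ _ (.inl (by simp)) d6 h⟩, nex _ _ (.inl (by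
      simp)) (D _) h⟩, nex _ _ (.inl (by simp)) d8 h⟩
    · exact .inl ⟨.inl ⟨.inl ⟨.inl ⟨.inr h, nex _ _ (.inl (by simp)) (D _) h⟩, nex _ _
      (.inl (by simp)) d6 h⟩, nex _ _ (.inr (by simp)) (D _) h⟩, nex _ _ (.inr (by simp)) d8
      h⟩
    · exact .inl ⟨.inl ⟨.inl ⟨.inr h, h6⟩, nex _ _ (.inl (by simp)) (D _) h⟩, nex _ _
      (.inl (by simp)) d8 h⟩
    · exact .inl ⟨.inl ⟨.inr h, f67 h⟩, f68 h⟩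
    · exact .inl ⟨.inr h, h8⟩
    · exact .inr h

end Chain

lemma cst_zero : cst 0 = 0 := map_zero (algebraMap ℂ PlaneField)

lemma cst_one : cst 1 = 1 := map_one (algebraMap ℂ PlaneField)

lemma cst_neg (a : ℂ) : cst (-a) = -cst a := map_neg (algebraMap ℂ PlaneField) a

lemma cst_add (a b : ℂ) : cst (a + b) = cst a + cst b := map_add (algebraMap ℂ PlaneField) a b

lemma cst_sub (a b : ℂ) : cst (a - b) = cst a - cst b := map_sub (algebraMap ℂ PlaneField) a b

lemma cst_mul (a b : ℂ) : cst (a * b) = cst a * cst b := map_mul (algebraMap ℂ PlaneField) a b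

lemma cst_div (a b : ℂ) : cst (a / b) = cst a / cst b := map_div₀ (algebraMap ℂ PlaneField) a b

lemma cst_inv (a : ℂ) : cst a⁻¹ = (cst a)⁻¹ := map_inv₀ (algebraMap ℂ PlaneField) a

lemma cst_pow (a : ℂ) (n : ℕ) : cst (a ^ n) = cst a ^ n := map_pow (algebraMap ℂ PlaneField) a n

lemma cst_eq_zero {a : ℂ} : cst a = 0 ↔ a = 0 := map_eq_zero (algebraMap ℂ PlaneField)

lemma cst_ne_zero {a : ℂ} (ha : a ≠ 0) : cst a ≠ 0 := fun h => ha (cst_eq_zero.mp h)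

lemma sub_cst_zero (z : PlaneField) : z - cst 0 = z := by rw [cst_zero, sub_zero]

section Edges

variable {u v : PlaneField}

lemma IsCoord.Pt_snd_injective (h : IsCoord u v) {s s' : ℂ}
    (he : Pt u (v - cst s) = Pt u (v - cst s')) : s = s' := by
  have h1 := h.sub_const_snd s
  have h2 := h.sub_const_snd s'
  have := h1.isLocalRing
  have e1 : HasValueAt v s (Pt u (v - cst s)) := h1.vanishesAt_snd
  have e2 : HasValueAt v s' (Pt u (v - cst s)) := he ▸ h2.vanishesAt_snd
  exact e1.eq e2

lemma Pt_corner_zero {a : ℂ} (ha : a ≠ 0) :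
    Pt (cornerU 0 - cst a) (cornerV 0) = Pt xc (yc / xc - cst a⁻¹) :=
  isCoord_xc_yc.Pt_flip ha

lemma Pt_corner_one {a : ℂ} (ha : a ≠ 0) :
    Pt (cornerU 1 - cst a) (cornerV 1) = productPt (some a) (some 0) := by
  rw [productPt, localParam, localParam, sub_cst_zero]
  exact isCoord_xc_yc.Pt_div ha

lemma Pt_corner_two {a : ℂ} :
    Pt (cornerU 2 - cst a) (cornerV 2) = productPt none (some a) :=
  Pt_comm _ _

lemma Pt_corner_three {a : ℂ} (ha : a ≠ 0) :
    Pt (cornerU 3 - cst a) (cornerV 3) = Pt xc⁻¹ (xc / yc - cst a⁻¹) := by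
  have := isCoord_xc_yc.inv_fst.inv_snd.Pt_flip ha
  rwa [inv_div_inv, inv_div_inv] at this

lemma Pt_corner_four {a : ℂ} (ha : a ≠ 0) :
    Pt (cornerU 4 - cst a) (cornerV 4) = productPt (some a⁻¹) none := by
  have h1 := isCoord_xc_yc.inv_fst.inv_snd.Pt_div ha
  have h2 := isCoord_xc_yc.inv_snd.Pt_inv (inv_ne_zero ha)
  rw [inv_div_inv] at h1
  rw [inv_inv] at h2
  exact h1.trans h2

lemma Pt_corner_five {a : ℂ} (ha : a ≠ 0) :
    Pt (cornerU 5 - cst a) (cornerV 5) = productPt (some 0) (some a⁻¹) := by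
  have h2 := isCoord_xc_yc.symm.Pt_inv (inv_ne_zero ha)
  rw [inv_inv] at h2
  rw [productPt, localParam, localParam, sub_cst_zero, Pt_comm xc]
  exact h2

end Edges

lemma familySurface_eq {b₀ b₁ b₂ c : ℂ} (hb₀ : b₀ ≠ 0) (hb₁ : b₁ ≠ 0) (hb₂ : b₂ ≠ 0)
    (hc : c ≠ 0) : familySurface b₀ b₁ b₂ c = hexagonSurface (familyCoords b₀ b₁ b₂ c) := by
  have hx := isCoord_xc_yc
  have hx' := hx.inv_fst.inv_snd
  have nd : ∀ o o' p p' : Option ℂ, (o ≠ p ∨ o' ≠ p') → productPt o o' ≠ productPt p p' :=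
    fun o o' p p' h h1 => h.elim (fun h => h (productPt_injective h1).1)
      (fun h => h (productPt_injective h1).2)
  have hP : ∀ o o', productPt o o' ∈ projLineSq xc yc := fun o o' => by
    rw [projLineSq_eq]; exact ⟨o, o', rfl⟩
  have e5 : productPt (some 0) (some 0) = Pt xc yc := by simp [productPt, localParam]
  have x5 := hx.exceptionalPoints_eq
  have x7 := hx'.exceptionalPoints_eq
  rw [inv_div_inv, inv_div_inv] at x7
  have k0 : Pt (cornerU 0 - cst (familyCoords b₀ b₁ b₂ c 0)) (cornerV 0) =
      Pt xc (yc / xc - cst c) := by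
    have := Pt_corner_zero (one_div_ne_zero hc)
    rwa [one_div, inv_inv, ← one_div] at this
  have k1 : Pt (cornerU 1 - cst (familyCoords b₀ b₁ b₂ c 1)) (cornerV 1) = _ := Pt_corner_one hb₁
  have k2 : Pt (cornerU 2 - cst (familyCoords b₀ b₁ b₂ c 2)) (cornerV 2) =
    productPt none (some 1) := Pt_corner_two
  have k3 : Pt (cornerU 3 - cst (familyCoords b₀ b₁ b₂ c 3)) (cornerV 3) =
      Pt xc⁻¹ (xc / yc - cst (1 / (c * b₀))) := by
    have := Pt_corner_three (mul_ne_zero hc hb₀)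
    rw [← one_div (c * b₀)] at this
    exact this
  have k4 : Pt (cornerU 4 - cst (familyCoords b₀ b₁ b₂ c 4)) (cornerV 4) =
      productPt (some 1) none := by
    have := Pt_corner_four (one_ne_zero (α := ℂ))
    rwa [inv_one] at this
  have k5 : Pt (cornerU 5 - cst (familyCoords b₀ b₁ b₂ c 5)) (cornerV 5) =
      productPt (some 0) (some (1 / b₂)) := by
    have := Pt_corner_five hb₂
    rwa [← one_div] at this
  ext R
  rw [(familySurface_spec b₀ b₁ b₂ c hb₁ hb₂).2 R]
  constructor
  · rintro (⟨h, h1, h2, h3, h4, h5, h7⟩ | h | h | h | h | ⟨h, h6⟩ | h | ⟨h, h8⟩ | h)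
    · rw [projLineSq_eq] at h
      obtain ⟨o | a, o' | a', rfl⟩ := h
      · exact absurd rfl h7
      · by_cases h : a' = 0
        · subst h
          refine .inr (.inr (.inl ⟨2, ?_⟩))
          have := Pt_corner_two (a := 0)
          rwa [sub_cst_zero, eq_comm] at this
        · refine .inr (.inl ⟨2, a', h, ?_, Pt_corner_two.symm⟩)
          rintro rfl
          exact h4 rfl
      · by_cases h : a = 0
        · subst h
          refine .inr (.inr (.inl ⟨5, ?_⟩))
          simp [productPt, localParam, cornerU, cornerV, Pt_comm]
        · refine .inr (.inl ⟨4, a⁻¹, inv_ne_zero h, ?_, ?_⟩)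
          · intro h'
            have : a = 1 := inv_eq_one.mp h'
            exact h3 (by rw [this])
          · rw [Pt_corner_four (inv_ne_zero h), inv_inv]
      · by_cases h : a = 0
        · subst h
          by_cases h' : a' = 0
          · subst h'; exact absurd rfl h5
          · refine .inr (.inl ⟨5, a'⁻¹, inv_ne_zero h', ?_, ?_⟩)
            · intro h'
              have : a'⁻¹ = b₂ := h'
              exact h2 (by rw [← this, one_div, inv_inv])
            · rw [Pt_corner_five (inv_ne_zero h'), inv_inv]
        · by_cases h' : a' = 0
          · subst h'
            refine .inr (.inl ⟨1, a, h, ?_, (Pt_corner_one h).symm⟩)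
            rintro rfl
            exact h1 rfl
          · exact .inl ⟨a, a', h, h', rfl⟩
    · exact .inr (.inr (.inr ⟨1, k1 ▸ h⟩))
    · exact .inr (.inr (.inr ⟨5, k5 ▸ h⟩))
    · exact .inr (.inr (.inr ⟨4, k4 ▸ h⟩))
    · exact .inr (.inr (.inr ⟨2, k2 ▸ h⟩))
    · rw [e5, x5] at h
      obtain ⟨s, rfl⟩ | rfl := h
      · by_cases hs : s = 0
        · subst hs
          refine .inr (.inr (.inl ⟨1, ?_⟩))
          rw [sub_cst_zero]; rfl
        · refine .inr (.inl ⟨0, s⁻¹, inv_ne_zero hs, ?_, ?_⟩)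
          · intro h'
            have : s⁻¹ = 1 / c := h'
            rw [one_div, inv_inj] at this
            exact h6 (by rw [this])
          · rw [Pt_corner_zero (inv_ne_zero hs), inv_inv]
      · exact .inr (.inr (.inl ⟨0, rfl⟩))
    · exact .inr (.inr (.inr ⟨0, k0 ▸ h⟩))
    · rw [show productPt none none = Pt xc⁻¹ yc⁻¹ from rfl, x7] at h
      obtain ⟨s, rfl⟩ | rfl := h
      · by_cases hs : s = 0
        · subst hs
          refine .inr (.inr (.inl ⟨4, ?_⟩))
          rw [sub_cst_zero]; rfl
        · refine .inr (.inl ⟨3, s⁻¹, inv_ne_zero hs, ?_, ?_⟩)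
          · intro h'
            have : s⁻¹ = c * b₀ := h'
            exact h8 (by rw [← this, one_div, inv_inv])
          · rw [Pt_corner_three (inv_ne_zero hs), inv_inv]
      · exact .inr (.inr (.inl ⟨3, rfl⟩))
    · exact .inr (.inr (.inr ⟨3, k3 ▸ h⟩))
  · have out := fun (o o' : Option ℂ) (h : (o ≠ some b₁ ∨ o' ≠ some 0) ∧
        (o ≠ some 0 ∨ o' ≠ some (1 / b₂)) ∧ (o ≠ some 1 ∨ o' ≠ none) ∧
        (o ≠ none ∨ o' ≠ some 1) ∧ (o ≠ some 0 ∨ o' ≠ some 0) ∧ (o ≠ none ∨ o' ≠ none)) =>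
      And.intro (hP o o') <| And.intro (nd _ _ _ _ h.1) <| And.intro (nd _ _ _ _ h.2.1) <|
        And.intro (nd _ _ _ _ h.2.2.1) <| And.intro (nd _ _ _ _ h.2.2.2.1) <|
        And.intro (nd _ _ _ _ h.2.2.2.2.1) (nd _ _ _ _ h.2.2.2.2.2)
    rintro (⟨a, a', ha, ha', rfl⟩ | ⟨j, a, ha, hj, rfl⟩ | ⟨j, rfl⟩ | ⟨j, h⟩)
    · exact .inl (out (some a) (some a') (by simp [ha, ha']))
    · fin_cases j
      · refine .inr (.inr (.inr (.inr (.inr (.inl ⟨?_, ?_⟩)))))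
        · rw [e5, x5]
          exact .inl ⟨_, Pt_corner_zero ha⟩
        · intro h
          have h' := hx.div_snd.Pt_snd_injective ((Pt_corner_zero ha).symm.trans h)
          exact hj (by rw [← h']; simp [familyCoords])
      · have h : a ≠ b₁ := hj
        have e : Pt (cornerU 1 - cst a) (cornerV 1) = _ := Pt_corner_one ha
        refine .inl ?_
        simp only [Fin.mk_one, Fin.isValue, e]
        exact out _ _ (by simp [ha, h])
      · have h : a ≠ 1 := hj
        have e : Pt (cornerU 2 - cst a) (cornerV 2) = _ := Pt_corner_two
        refine .inl ?_
        simp only [Fin.reduceFinMk, Fin.isValue, e]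
        exact out _ _ (by simp [h])
      · refine .inr (.inr (.inr (.inr (.inr (.inr (.inr (.inl ⟨?_, ?_⟩)))))))
        · rw [show productPt none none = Pt xc⁻¹ yc⁻¹ from rfl, x7]
          exact .inl ⟨_, Pt_corner_three ha⟩
        · intro h
          have hd := hx'.div_snd
          rw [inv_div_inv] at hd
          have h' := hd.Pt_snd_injective ((Pt_corner_three ha).symm.trans h)
          rw [one_div, inv_inj] at h'
          exact hj h'
      · have h : a ≠ 1 := hj
        have e : Pt (cornerU 4 - cst a) (cornerV 4) = _ := Pt_corner_four ha
        refine .inl ?_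
        simp only [Fin.reduceFinMk, Fin.isValue, e]
        exact out _ _ (by simp [ha, h])
      · have h : a ≠ b₂ := hj
        have e : Pt (cornerU 5 - cst a) (cornerV 5) = _ := Pt_corner_five ha
        refine .inl ?_
        simp only [Fin.reduceFinMk, Fin.isValue, e]
        exact out _ _ (by simp [ha, h, hb₁.symm, one_div])
    · fin_cases j
      · refine .inr (.inr (.inr (.inr (.inr (.inl ⟨?_, ?_⟩)))))
        · rw [e5, x5]; exact .inr rfl
        · intro h
          have h : Pt (xc / yc) yc = Pt xc (yc / xc - cst c) := h
          have h1 := hx.div_fst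
          have h2 := hx.div_snd.sub_const_snd c
          have := h1.isLocalRing
          have e1 : VanishesAt (xc / yc) (Pt (xc / yc) yc) := h1.vanishesAt_fst
          have e2 : HasValueAt (yc / xc) c (Pt (xc / yc) yc) := h ▸ h2.vanishesAt_snd
          have e3 := e1.mul_right e2.mem
          rw [div_mul_div_cancel₀ hx.snd_ne_zero, div_self hx.fst_ne_zero] at e3
          exact not_vanishesAt_one e3
      · refine .inr (.inr (.inr (.inr (.inr (.inl ⟨?_, ?_⟩)))))
        · rw [e5, x5]
          exact .inl ⟨0, by rw [sub_cst_zero]; rfl⟩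
        · intro h
          have h : Pt xc (yc / xc) = Pt xc (yc / xc - cst c) := h
          refine hc (hx.div_snd.Pt_snd_injective (h.symm.trans ?_))
          rw [sub_cst_zero]
      · have e : Pt (cornerU 2) (cornerV 2) = productPt none (some 0) := by
          have := Pt_corner_two (a := 0)
          rwa [sub_cst_zero] at this
        refine .inl ?_
        simp only [Fin.reduceFinMk, Fin.isValue, e]
        exact out _ _ (by simp)
      · refine .inr (.inr (.inr (.inr (.inr (.inr (.inr (.inl ⟨?_, ?_⟩)))))))
        · rw [show productPt none none = Pt xc⁻¹ yc⁻¹ from rfl, x7]; exact .inr rfl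
        · intro h
          have h : Pt (yc / xc) yc⁻¹ = Pt xc⁻¹ (xc / yc - cst (1 / (c * b₀))) := h
          have h1 := hx'.div_fst
          have h2 := hx'.div_snd.sub_const_snd (1 / (c * b₀))
          rw [inv_div_inv] at h1 h2
          have := h1.isLocalRing
          have e1 : VanishesAt (yc / xc) (Pt (yc / xc) yc⁻¹) := h1.vanishesAt_fst
          have e2 : HasValueAt (xc / yc) _ (Pt (yc / xc) yc⁻¹) := h ▸ h2.vanishesAt_snd
          have e3 := e1.mul_right e2.mem
          rw [div_mul_div_cancel₀ hx.fst_ne_zero, div_self hx.snd_ne_zero] at e3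
          exact not_vanishesAt_one e3
      · refine .inr (.inr (.inr (.inr (.inr (.inr (.inr (.inl ⟨?_, ?_⟩)))))))
        · rw [show productPt none none = Pt xc⁻¹ yc⁻¹ from rfl, x7]
          exact .inl ⟨0, by rw [sub_cst_zero]; rfl⟩
        · intro h
          have h : Pt xc⁻¹ (xc / yc) = Pt xc⁻¹ (xc / yc - cst (1 / (c * b₀))) := h
          have hd := hx'.div_snd
          rw [inv_div_inv] at hd
          refine one_div_ne_zero (mul_ne_zero hc hb₀) (hd.Pt_snd_injective (h.symm.trans ?_))
          rw [sub_cst_zero]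
      · have e : Pt (cornerU 5) (cornerV 5) = productPt (some 0) none := by
          simp [productPt, localParam, cornerU, cornerV, Pt_comm]
        refine .inl ?_
        simp only [Fin.reduceFinMk, Fin.isValue, e]
        exact out _ _ (by simp [hb₁.symm])
    · fin_cases j
      · exact .inr (.inr (.inr (.inr (.inr (.inr (.inl (k0 ▸ h)))))))
      · exact .inr (.inl (k1 ▸ h))
      · exact .inr (.inr (.inr (.inr (.inl (k2 ▸ h)))))
      · exact .inr (.inr (.inr (.inr (.inr (.inr (.inr (.inr (k3 ▸ h))))))))
      · exact .inr (.inr (.inr (.inl (k4 ▸ h))))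
      · exact .inr (.inr (.inl (k5 ▸ h)))

lemma exampleSurface_eq_familySurface {b : ℂ} (hb : b ≠ 0) :
    exampleSurface b = familySurface (1 / b) (-1) b I := by
  have e1 : xc - cst (-1) = xc + 1 := by rw [cst_neg, cst_one, sub_neg_eq_add]
  have e2 : (1 : ℂ) / (I * (1 / b)) = -(I * b) := by
    have := I_ne_zero
    field_simp
    rw [I_sq]
    ring
  have e3 : xc / yc - cst (1 / (I * (1 / b))) = xc / yc + cst (I * b) := by
    rw [e2, cst_neg, sub_neg_eq_add]
  simp only [exampleSurface, familySurface]
  rw [e1, e3]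

/-- The coordinates of the blown up points of `exampleSurface b`. -/
def exampleCoords (b : ℂ) : Fin 6 → ℂ := ![-I, -1, 1, I / b, 1, b]

lemma exampleSurface_eq {b : ℂ} (hb : b ≠ 0) :
    exampleSurface b = hexagonSurface (exampleCoords b) := by
  rw [exampleSurface_eq_familySurface hb, familySurface_eq (one_div_ne_zero hb)
    (neg_ne_zero.mpr one_ne_zero) hb I_ne_zero]
  congr 1
  ext j
  fin_cases j <;> simp [familyCoords, exampleCoords, div_eq_mul_inv]

section Automorphisms

variable {u v : PlaneField} {X Y Z : Set (Subalgebra ℂ PlaneField)}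
  {Φ Ψ : PlaneField ≃ₐ[ℂ] PlaneField}

lemma algHom_ext_planeField {B : Type*} [Field B] [Algebra ℂ B] {f g : PlaneField →ₐ[ℂ] B}
    (hx : f xc = g xc) (hy : f yc = g yc) : f = g := by
  ext i
  fin_cases i
  exacts [hx, hy]

lemma algEquiv_ext_planeField (hx : Φ xc = Ψ xc) (hy : Φ yc = Ψ yc) : Φ = Ψ := by
  have := algHom_ext_planeField (f := (Φ : PlaneField →ₐ[ℂ] PlaneField))
    (g := (Ψ : PlaneField →ₐ[ℂ] PlaneField)) hx hy
  ext z
  exact congrArg (fun F => F z) this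

lemma IsCoord.exists_algEquiv (h : IsCoord u v) :
    ∃ Φ : PlaneField ≃ₐ[ℂ] PlaneField, Φ xc = u ∧ Φ yc = v := by
  let g : PlaneField →ₐ[ℂ] PlaneField := IsFractionRing.liftAlgHom h.aeval_injective
  have hx : g xc = u := by
    have := IsFractionRing.lift_algebraMap (K := PlaneField)
      (g := (MvPolynomial.aeval (R := ℂ) ![u, v]).toRingHom) h.aeval_injective (MvPolynomial.X 0)
    refine Eq.trans this ?_
    exact MvPolynomial.aeval_X _ _
  have hy : g yc = v := by
    have := IsFractionRing.lift_algebraMap (K := PlaneField)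
      (g := (MvPolynomial.aeval (R := ℂ) ![u, v]).toRingHom) h.aeval_injective (MvPolynomial.X 1)
    refine Eq.trans this ?_
    exact MvPolynomial.aeval_X _ _
  have hs : Function.Surjective g := by
    rw [← AlgHom.fieldRange_eq_top, eq_top_iff, ← (show _ = ⊤ from h),
      IntermediateField.adjoin_le_iff]
    rintro z (rfl | rfl)
    · exact ⟨xc, hx⟩
    · exact ⟨yc, hy⟩
  exact ⟨AlgEquiv.ofBijective g ⟨g.injective, hs⟩, hx, hy⟩

lemma LiftsToIso.trans (h : LiftsToIso Φ X Y) (h' : LiftsToIso Ψ Y Z) :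
    LiftsToIso (Ψ.trans Φ) X Z := by
  unfold LiftsToIso at *
  rw [← h, ← h', Set.image_image]
  refine Set.image_congr fun R _ => ?_
  rw [Subalgebra.map_map]
  rfl

lemma LiftsToIso.symm (h : LiftsToIso Φ X Y) : LiftsToIso Φ.symm Y X := by
  unfold LiftsToIso at *
  rw [← h, Set.image_image]
  refine (Set.image_congr fun R _ => ?_).trans (Set.image_id Y)
  rw [Subalgebra.map_map]
  have : ((Φ.symm : PlaneField →ₐ[ℂ] PlaneField)).comp (Φ : PlaneField →ₐ[ℂ] PlaneField) =
      AlgHom.id ℂ PlaneField := by ext z; simp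
  rw [this, Subalgebra.map_id]; rfl

lemma liftsToIso_of_subset (h : ∀ R ∈ Y, transport Φ R ∈ X)
    (h' : ∀ R ∈ X, transport Φ.symm R ∈ Y) : LiftsToIso Φ X Y := by
  refine Set.Subset.antisymm ?_ fun R hR => ?_
  · rintro _ ⟨R, hR, rfl⟩
    exact h R hR
  · refine ⟨_, h' R hR, ?_⟩
    change Subalgebra.map _ (Subalgebra.map _ R) = R
    rw [Subalgebra.map_map]
    have : ((Φ : PlaneField →ₐ[ℂ] PlaneField)).comp (Φ.symm : PlaneField →ₐ[ℂ] PlaneField) =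
        AlgHom.id ℂ PlaneField := by ext z; simp
    rw [this, Subalgebra.map_id]

lemma IsCoord.transport_mem_exceptionalPoints (h : IsCoord u v) {R : Subalgebra ℂ PlaneField}
    (hR : R ∈ exceptionalPoints (Pt u v)) :
    transport Φ R ∈ exceptionalPoints (Pt (Φ u) (Φ v)) := by
  rw [(h.map Φ).exceptionalPoints_eq]
  rw [h.exceptionalPoints_eq] at hR
  rcases hR with ⟨s, rfl⟩ | rfl
  · refine .inl ⟨s, ?_⟩
    rw [transport_Pt, map_sub, map_div₀, Φ.commutes]
  · refine .inr ?_
    rw [transport_Pt, map_div₀]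

end Automorphisms

section Monomial

variable {u v : PlaneField}

lemma IsCoord.mul_const (h : IsCoord u v) {a b : ℂ} (ha : a ≠ 0) (hb : b ≠ 0) :
    IsCoord (cst a * u) (cst b * v) := by
  refine h.of_mem ?_ ?_
  · have := (adjoin ℂ {cst a * u, cst b * v}).mul_mem
      ((adjoin ℂ {cst a * u, cst b * v}).algebraMap_mem a⁻¹)
      (IsCoord.fst_mem_adjoin (u := cst a * u) (v := cst b * v))
    rwa [← mul_assoc, ← cst_mul, inv_mul_cancel₀ ha, cst_one, one_mul] at this
  · have := (adjoin ℂ {cst a * u, cst b * v}).mul_mem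
      ((adjoin ℂ {cst a * u, cst b * v}).algebraMap_mem b⁻¹)
      (IsCoord.snd_mem_adjoin (u := cst a * u) (v := cst b * v))
    rwa [← mul_assoc, ← cst_mul, inv_mul_cancel₀ hb, cst_one, one_mul] at this

lemma IsCoord.Pt_mul_const (h : IsCoord u v) {a b : ℂ} (ha : a ≠ 0) (hb : b ≠ 0) :
    Pt (cst a * u) (cst b * v) = Pt u v := by
  have h' := h.mul_const ha hb
  have := h.isLocalRing
  have := h'.isLocalRing
  refine h'.Pt_eq h (h.vanishesAt_fst.mul_left (Subalgebra.algebraMap_mem _ _))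
    (h.vanishesAt_snd.mul_left (Subalgebra.algebraMap_mem _ _)) ?_ ?_
  · have := h'.vanishesAt_fst.mul_left (Subalgebra.algebraMap_mem _ a⁻¹)
    rwa [← mul_assoc, ← map_mul, inv_mul_cancel₀ ha, map_one, one_mul] at this
  · have := h'.vanishesAt_snd.mul_left (Subalgebra.algebraMap_mem _ b⁻¹)
    rwa [← mul_assoc, ← map_mul, inv_mul_cancel₀ hb, map_one, one_mul] at this

lemma IsCoord.Pt_mul_const_sub (h : IsCoord u v) {a b : ℂ} (ha : a ≠ 0) (hb : b ≠ 0) (s : ℂ) :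
    Pt (cst a * u - cst s) (cst b * v) = Pt (u - cst (s / a)) v := by
  rw [← (h.sub_const_fst (s / a)).Pt_mul_const ha hb, mul_sub, ← cst_mul, mul_div_cancel₀ _ ha]

lemma cornerU_add_two (j : Fin 6) : cornerU (j + 2) = cornerU (j + 1) / cornerU j := by
  have h1 := isCoord_xc_yc.fst_ne_zero
  have h2 := isCoord_xc_yc.snd_ne_zero
  fin_cases j <;> simp [cornerU] <;> field_simp

lemma cornerV_add_one (j : Fin 6) : cornerV (j + 1) = (cornerU j)⁻¹ := by
  fin_cases j <;> simp [cornerU, cornerV]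

lemma isCoord_cornerU (j : Fin 6) : IsCoord (cornerU j) (cornerU (j + 1)) := by
  have h := (isCoord_corner (j + 1)).inv_snd.symm
  rwa [cornerV_add_one, inv_inv] at h

lemma IsCoord.Pt_torus (h : IsCoord u v) {a b : ℂ} (ha : a ≠ 0) (hb : b ≠ 0) :
    Pt (u - cst a) (v - cst b) = Pt (v - cst b) (v / u - cst (b / a)) := by
  have h1 := h.sub_const a b
  have h3 : IsCoord v (v / u) := by
    have := h.symm.div_snd.inv_snd
    rwa [inv_div] at this
  have h2 := h3.sub_const b (b / a)
  have := h1.isLocalRing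
  have := h2.isLocalRing
  have e1 : HasValueAt u a (Pt (u - cst a) (v - cst b)) := h1.vanishesAt_fst
  have e2 : HasValueAt v b (Pt (u - cst a) (v - cst b)) := h1.vanishesAt_snd
  have e3 : HasValueAt v b (Pt (v - cst b) (v / u - cst (b / a))) := h2.vanishesAt_fst
  have e4 : HasValueAt (v / u) (b / a) (Pt (v - cst b) (v / u - cst (b / a))) := h2.vanishesAt_snd
  refine h1.Pt_eq h2 ?_ e3 e2 (e2.div e1 ha)
  refine (e3.div e4 (div_ne_zero hb ha)).congr ?_ (div_div_cancel₀ hb)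
  exact div_div_cancel₀ h.snd_ne_zero

lemma exists_torus_point_add_one {j : Fin 6} {R : Subalgebra ℂ PlaneField} :
    (∃ a b : ℂ, a ≠ 0 ∧ b ≠ 0 ∧ R = Pt (cornerU j - cst a) (cornerU (j + 1) - cst b)) ↔
    ∃ a b : ℂ, a ≠ 0 ∧ b ≠ 0 ∧ R = Pt (cornerU (j + 1) - cst a) (cornerU (j + 2) - cst b) := by
  constructor
  · rintro ⟨a, b, ha, hb, rfl⟩
    refine ⟨b, b / a, hb, div_ne_zero hb ha, ?_⟩
    rw [(isCoord_cornerU j).Pt_torus ha hb, cornerU_add_two]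
  · rintro ⟨a, b, ha, hb, rfl⟩
    refine ⟨a / b, a, div_ne_zero ha hb, ha, ?_⟩
    rw [(isCoord_cornerU j).Pt_torus (div_ne_zero ha hb) ha, cornerU_add_two, div_div_cancel₀ ha]

lemma exists_torus_point_iff (j : Fin 6) {R : Subalgebra ℂ PlaneField} :
    (∃ a b : ℂ, a ≠ 0 ∧ b ≠ 0 ∧ R = Pt (cornerU j - cst a) (cornerU (j + 1) - cst b)) ↔
    ∃ a b : ℂ, a ≠ 0 ∧ b ≠ 0 ∧ R = Pt (xc - cst a) (yc - cst b) := by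
  have h := fun j => exists_torus_point_add_one (j := j) (R := R)
  have h1 := h 1
  have h2 := h 2
  have h3 := h 3
  have h4 := h 4
  have h0 := h 0
  have e : (∃ a b : ℂ, a ≠ 0 ∧ b ≠ 0 ∧ R = Pt (xc - cst a) (yc - cst b)) ↔
    ∃ a b : ℂ, a ≠ 0 ∧ b ≠ 0 ∧ R = Pt (cornerU 1 - cst a) (cornerU (1 + 1) - cst b) := Iff.rfl
  fin_cases j
  · exact h0
  · exact e.symm
  · exact (e.trans h1).symm
  · exact (e.trans (h1.trans h2)).symm
  · exact (e.trans (h1.trans (h2.trans h3))).symm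
  · exact (e.trans (h1.trans (h2.trans (h3.trans h4)))).symm

lemma transport_mem_hexagonSurface {Φ : PlaneField ≃ₐ[ℂ] PlaneField} {k : Fin 6} {w : Fin 6 → ℂ}
    (hw : ∀ j, w j ≠ 0) (hΦ : ∀ j, Φ (cornerU j) = cst (w j) * cornerU (j + k)) {κ κ' : Fin 6 → ℂ}
    (hκ : ∀ j, κ' j = w j * κ (j + k)) {R : Subalgebra ℂ PlaneField} (hR : R ∈ hexagonSurface κ') :
    transport Φ R ∈ hexagonSurface κ := by
  have hV : ∀ j, ∃ r : ℂ, r ≠ 0 ∧ Φ (cornerV j) = cst r * cornerV (j + k) := by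
    intro j
    obtain ⟨i, rfl⟩ : ∃ i, j = i + 1 := ⟨j - 1, (sub_add_cancel j 1).symm⟩
    refine ⟨(w i)⁻¹, inv_ne_zero (hw i), ?_⟩
    rw [cornerV_add_one, map_inv₀, hΦ, add_right_comm i 1 k, cornerV_add_one,
      mul_inv, cst_inv]
  have key : ∀ j (a : ℂ), Pt (Φ (cornerU j - cst a)) (Φ (cornerV j)) =
      Pt (cornerU (j + k) - cst (a / w j)) (cornerV (j + k)) := by
    intro j a
    obtain ⟨r, hr, h⟩ := hV j
    rw [map_sub, hΦ, h, Φ.commutes]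
    exact (isCoord_corner _).Pt_mul_const_sub (hw j) hr a
  rcases hR with ⟨a, b, ha, hb, rfl⟩ | ⟨j, a, ha, haj, rfl⟩ | ⟨j, rfl⟩ | ⟨j, h⟩
  · refine .inl ((exists_torus_point_iff (1 + k)).mp
      ⟨a / w 1, b / w 2, div_ne_zero ha (hw _), div_ne_zero hb (hw _), ?_⟩)
    have e1 : Φ xc = cst (w 1) * cornerU (1 + k) := hΦ 1
    have e2 : Φ yc = cst (w 2) * cornerU (1 + k + 1) := by
      rw [add_right_comm]; exact hΦ 2
    rw [transport_Pt, map_sub, map_sub, Φ.commutes, Φ.commutes, e1, e2]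
    rw [← ((isCoord_cornerU (1 + k)).sub_const (a / w 1) (b / w 2)).Pt_mul_const (hw 1) (hw 2),
      mul_sub, mul_sub, ← cst_mul, ← cst_mul, mul_div_cancel₀ _ (hw _), mul_div_cancel₀ _ (hw _)]
  · refine .inr (.inl ⟨j + k, a / w j, div_ne_zero ha (hw j), fun h => haj ?_, ?_⟩)
    · rw [hκ, ← h, mul_div_cancel₀ _ (hw j)]
    · rw [transport_Pt, key]
  · refine .inr (.inr (.inl ⟨j + k, ?_⟩))
    have := key j 0
    rwa [sub_cst_zero, zero_div, sub_cst_zero, ← transport_Pt] at this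
  · refine .inr (.inr (.inr ⟨j + k, ?_⟩))
    have := ((isCoord_corner j).sub_const_fst (κ' j)).transport_mem_exceptionalPoints (Φ := Φ) h
    rwa [key, hκ, mul_div_cancel_left₀ _ (hw j)] at this

lemma liftsToIso_monomial {Φ : PlaneField ≃ₐ[ℂ] PlaneField} {k : Fin 6} {w : Fin 6 → ℂ}
    (hw : ∀ j, w j ≠ 0) (hΦ : ∀ j, Φ (cornerU j) = cst (w j) * cornerU (j + k)) {κ κ' : Fin 6 → ℂ}
    (hκ : ∀ j, κ' j = w j * κ (j + k)) : LiftsToIso Φ (hexagonSurface κ) (hexagonSurface κ') := by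
  refine liftsToIso_of_subset (fun R hR => transport_mem_hexagonSurface hw hΦ hκ hR) fun R hR =>
    transport_mem_hexagonSurface (k := -k) (w := fun j => (w (j - k))⁻¹)
      (fun j => inv_ne_zero (hw _)) (fun j => ?_) (fun j => ?_) hR
  · rw [AlgEquiv.symm_apply_eq, map_mul, Φ.commutes, hΦ, ← mul_assoc, ← sub_eq_add_neg,
      sub_add_cancel]
    change _ = cst _ * cst _ * _
    rw [← cst_mul, inv_mul_cancel₀ (hw _), cst_one, one_mul]
  · rw [← sub_eq_add_neg, hκ, sub_add_cancel, inv_mul_cancel_left₀ (hw _)]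

end Monomial

section Elementary

variable {x z u v ω₁ ω₂ : PlaneField} {α β a b w : ℂ} {R : Subalgebra ℂ PlaneField}

/-- The elementary transformation of the second coordinate `z` with centres on the lines `x = α`
and `x = β`. -/
def elementary (α β : ℂ) (x z : PlaneField) : PlaneField := z * ((x - cst α) / (x - cst β))

lemma IsCoord.fst_sub_ne_zero (h : IsCoord x z) (a : ℂ) : x - cst a ≠ 0 :=
  (h.sub_const_fst a).fst_ne_zero

lemma elementary_inv :
    (elementary α β x z)⁻¹ = elementary β α x z⁻¹ := by
  rw [elementary, elementary, mul_inv, inv_div]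

lemma IsCoord.elementary_elementary (h : IsCoord x z) :
    elementary β α x (elementary α β x z) = z := by
  have h1 := h.fst_sub_ne_zero α
  have h2 := h.fst_sub_ne_zero β
  unfold elementary
  field_simp

lemma IsCoord.isCoord_elementary (h : IsCoord x z) : IsCoord x (elementary α β x z) := by
  refine h.of_mem IsCoord.fst_mem_adjoin ?_
  set L := adjoin ℂ {x, elementary α β x z}
  have hx : x ∈ L := IsCoord.fst_mem_adjoin
  have hz : elementary α β x z ∈ L := IsCoord.snd_mem_adjoin
  have hc : ∀ a : ℂ, x - cst a ∈ L := fun a => L.sub_mem hx (L.algebraMap_mem a)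
  have := L.mul_mem hz (L.div_mem (hc β) (hc α))
  rwa [show elementary α β x z * ((x - cst β) / (x - cst α)) = z from
    h.elementary_elementary] at this

lemma HasValueAt.ratio [IsLocalRing R] (h : HasValueAt x a R) (hβ : a ≠ β) :
    HasValueAt ((x - cst α) / (x - cst β)) ((a - α) / (a - β)) R :=
  (h.sub (hasValueAt_const α)).div (h.sub (hasValueAt_const β)) (sub_ne_zero.mpr hβ)

lemma VanishesAt.ratio_of_inv [IsLocalRing R] (hx : x ≠ 0) (h : VanishesAt x⁻¹ R) :
    HasValueAt ((x - cst α) / (x - cst β)) 1 R := by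
  have e : ∀ c : ℂ, HasValueAt (1 - cst c * x⁻¹) 1 R := fun c =>
    (hasValueAt_one.sub ((hasValueAt_const c).mul h.hasValueAt)).congr rfl (by ring)
  refine ((e α).div (e β) one_ne_zero).congr ?_ (div_one 1)
  rw [← mul_div_mul_left _ (1 - cst β * x⁻¹) hx]
  congr 1 <;> field_simp

/-- Multiplying coordinates by functions with nonzero values. -/
lemma IsCoord.Pt_mul_unit (h : IsCoord u v) (h' : IsCoord (u * ω₁) (v * ω₂)) {w₁ w₂ : ℂ}
    (hw₁ : w₁ ≠ 0) (hw₂ : w₂ ≠ 0)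
    (H : ∀ S : Subalgebra ℂ PlaneField, IsLocalRing S →
      (HasValueAt u (a / w₁) S ∧ VanishesAt v S ∨
        HasValueAt (u * ω₁) a S ∧ VanishesAt (v * ω₂) S) →
      HasValueAt ω₁ w₁ S ∧ HasValueAt ω₂ w₂ S) :
    Pt (u * ω₁ - cst a) (v * ω₂) = Pt (u - cst (a / w₁)) v := by
  have h1 := h'.sub_const_fst a
  have h2 := h.sub_const_fst (a / w₁)
  have l1 := h1.isLocalRing
  have l2 := h2.isLocalRing
  have e1 : HasValueAt (u * ω₁) a (Pt (u * ω₁ - cst a) (v * ω₂)) := h1.vanishesAt_fst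
  have e2 : HasValueAt u (a / w₁) (Pt (u - cst (a / w₁)) v) := h2.vanishesAt_fst
  have H1 := H _ l1 (.inr ⟨e1, h1.vanishesAt_snd⟩)
  have H2 := H _ l2 (.inl ⟨e2, h2.vanishesAt_snd⟩)
  refine h1.Pt_eq h2 ?_ ?_ ?_ ?_
  · exact (e2.mul H2.1).congr rfl (div_mul_cancel₀ _ hw₁)
  · exact (h2.vanishesAt_snd.mul_right H2.2.mem)
  · refine (e1.div H1.1 hw₁).congr ?_ rfl
    exact mul_div_cancel_right₀ _ (H1.1.ne_zero hw₁)
  · have := (h1.vanishesAt_snd.mul_right (H1.2.inv_mem hw₂))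
    rwa [mul_inv_cancel_right₀ (H1.2.ne_zero hw₂)] at this

lemma IsCoord.Pt_elementary_of_ne (h : IsCoord x z) (hα : a ≠ α) (hβ : a ≠ β) :
    Pt (x - cst a) (elementary α β x z - cst b) =
      Pt (x - cst a) (z - cst (b * ((a - β) / (a - α)))) := by
  have h1 := (h.isCoord_elementary (α := α) (β := β)).sub_const a b
  have h2 := h.sub_const a (b * ((a - β) / (a - α)))
  have l1 := h1.isLocalRing
  have l2 := h2.isLocalRing
  have x1 : HasValueAt x a _ := h1.vanishesAt_fst
  have x2 : HasValueAt x a _ := h2.vanishesAt_fst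
  have e1 : HasValueAt (elementary α β x z) b _ := h1.vanishesAt_snd
  have e2 : HasValueAt z (b * ((a - β) / (a - α))) _ := h2.vanishesAt_snd
  have hα' := sub_ne_zero.mpr hα
  have hβ' := sub_ne_zero.mpr hβ
  refine h1.Pt_eq h2 x2 ?_ x1 ?_
  · refine (e2.mul (x2.ratio (α := α) hβ)).congr rfl ?_
    field_simp
  · exact (e1.mul (x1.ratio hα)).congr h.elementary_elementary rfl

lemma IsCoord.Pt_elementary_right (h : IsCoord x z) (hαβ : α ≠ β) :
    Pt (x - cst β) (elementary α β x z - cst b) =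
      Pt (x - cst β) (z / (x - cst β) - cst (b / (β - α))) := by
  have h1 := (h.isCoord_elementary (α := α) (β := β)).sub_const β b
  have h2 := (h.sub_const_fst β).div_snd.sub_const_snd (b / (β - α))
  have l1 := h1.isLocalRing
  have l2 := h2.isLocalRing
  have x1 : HasValueAt x β _ := h1.vanishesAt_fst
  have x2 : HasValueAt x β _ := h2.vanishesAt_fst
  have e1 : HasValueAt (elementary α β x z) b _ := h1.vanishesAt_snd
  have e2 : HasValueAt (z / (x - cst β)) (b / (β - α)) _ := h2.vanishesAt_snd
  have hne := sub_ne_zero.mpr hαβ.symm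
  have y1 := x1.sub (hasValueAt_const α)
  have y2 := x2.sub (hasValueAt_const α)
  refine h1.Pt_eq h2 h2.vanishesAt_fst ?_ h1.vanishesAt_fst ?_
  · refine (e2.mul y2).congr ?_ (div_mul_cancel₀ _ hne)
    rw [elementary, mul_div_assoc', div_mul_eq_mul_div]
  · refine (e1.div y1 hne).congr ?_ rfl
    have := h.fst_sub_ne_zero α
    rw [elementary]
    exact by field_simp

lemma IsCoord.Pt_elementary_left (h : IsCoord x z) (hαβ : α ≠ β) (hb : b ≠ 0) :
    Pt (x - cst α) (elementary α β x z - cst b) =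
      Pt (x - cst α) (z⁻¹ / (x - cst α) - cst (b⁻¹ / (α - β))) := by
  have h' := (h.isCoord_elementary (α := α) (β := β)).sub_const_fst α
  have e := h'.symm.Pt_inv hb
  rw [Pt_comm, ← e, Pt_comm, elementary_inv, h.inv_snd.Pt_elementary_right hαβ.symm]

/-- The exceptional points over the point `x = α`, `elementary α β x z = 0`. -/
lemma IsCoord.exceptionalPoints_elementary (h : IsCoord x z) (hαβ : α ≠ β)
    (hR : R ∈ exceptionalPoints (Pt (x - cst α) (elementary α β x z))) :
    (∃ s : ℂ, R = Pt (x - cst α) (z - cst s)) ∨ R ∈ exceptionalPoints (Pt (x - cst α) z⁻¹) := by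
  have h0 := (h.isCoord_elementary (α := α) (β := β)).sub_const_fst α
  have hα := h.fst_sub_ne_zero α
  have hβ := h.fst_sub_ne_zero β
  have hz := h.snd_ne_zero
  have hne := sub_ne_zero.mpr hαβ
  rw [h0.exceptionalPoints_eq] at hR
  rcases hR with ⟨s, rfl⟩ | rfl
  · refine .inl ⟨s * (α - β), ?_⟩
    have e := h.sub_const_fst β
    have h1 := h0.div_snd.sub_const_snd s
    have h2 := h.sub_const α (s * (α - β))
    have l1 := h1.isLocalRing
    have l2 := h2.isLocalRing
    have x1 : HasValueAt x α _ := h1.vanishesAt_fst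
    have x2 : HasValueAt x α _ := h2.vanishesAt_fst
    have e1 : HasValueAt (elementary α β x z / (x - cst α)) s _ := h1.vanishesAt_snd
    have e2 : HasValueAt z (s * (α - β)) _ := h2.vanishesAt_snd
    have y1 := x1.sub (hasValueAt_const β)
    have y2 := x2.sub (hasValueAt_const β)
    refine h1.Pt_eq h2 x2 ?_ x1 ?_
    · refine (e2.div y2 hne).congr ?_ (mul_div_cancel_right₀ _ hne)
      rw [elementary]
      exact by field_simp
    · refine (e1.mul y1).congr ?_ rfl
      rw [elementary]
      exact by field_simp
  · right
    have h3 := h.inv_snd.sub_const_fst α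
    rw [h3.exceptionalPoints_eq]
    right
    have h1 := h0.div_fst
    have h2 := h3.div_fst
    have l1 := h1.isLocalRing
    have l2 := h2.isLocalRing
    have p1 := h1.vanishesAt_fst
    have q1 := h1.vanishesAt_snd
    have p2 := h2.vanishesAt_fst
    have q2 := h2.vanishesAt_snd
    have x1 : HasValueAt x α (Pt ((x - cst α) / elementary α β x z) (elementary α β x z)) := by
      have := p1.mul_right q1.mem
      rwa [div_mul_cancel₀ _ h0.snd_ne_zero] at this
    have x2 : HasValueAt x α (Pt ((x - cst α) / z⁻¹) z⁻¹) := by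
      have := p2.mul_right q2.mem
      rwa [div_mul_cancel₀ _ h3.snd_ne_zero] at this
    have y1 := x1.sub (hasValueAt_const β)
    have y2 := x2.sub (hasValueAt_const β)
    refine h1.Pt_eq h2 ?_ ?_ ?_ ?_
    · refine (q2.hasValueAt.mul y2).vanishesAt_of_eq ?_ (zero_mul _)
      rw [elementary]
      exact by field_simp
    · refine (p2.hasValueAt.div y2 hne).vanishesAt_of_eq ?_ (zero_div _)
      rw [elementary]
      exact by field_simp
    · refine (q1.hasValueAt.mul y1).vanishesAt_of_eq ?_ (zero_mul _)
      rw [elementary]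
      exact by field_simp
    · refine (p1.hasValueAt.div y1 hne).vanishesAt_of_eq ?_ (zero_div _)
      rw [elementary]
      exact by field_simp

end Elementary

section ElementaryIso

variable {κ κ' : Fin 6 → ℂ} {α β : ℂ}

lemma Pt_mem_hexagonSurface {a b : ℂ} (ha : a ≠ 0) (hb : b ≠ 0) :
    Pt (xc - cst a) (yc - cst b) ∈ hexagonSurface κ := .inl ⟨a, b, ha, hb, rfl⟩

lemma Pt_snd_mem_hexagonSurface {a : ℂ} (ha : a ≠ 0) (h : a ≠ κ 1) :
    Pt (xc - cst a) yc ∈ hexagonSurface κ :=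
  .inr (.inl ⟨1, a, ha, h, (isCoord_xc_yc.Pt_div ha).symm⟩)

lemma Pt_snd_inv_mem_hexagonSurface {a : ℂ} (ha : a ≠ 0) (h : a⁻¹ ≠ κ 4) :
    Pt (xc - cst a) yc⁻¹ ∈ hexagonSurface κ := by
  refine .inr (.inl ⟨4, a⁻¹, inv_ne_zero ha, h, ?_⟩)
  rw [Pt_corner_four (inv_ne_zero ha), inv_inv]
  rfl

lemma exceptionalPoints_snd_subset (hκ : κ 1 ≠ 0) :
    exceptionalPoints (Pt (xc - cst (κ 1)) yc) ⊆ hexagonSurface κ := fun R hR =>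
  .inr (.inr (.inr ⟨1, by rwa [show Pt (cornerU 1 - cst (κ 1)) (cornerV 1) = _ from
    isCoord_xc_yc.Pt_div hκ]⟩))

lemma exceptionalPoints_snd_inv_subset {α : ℂ} (hα : α ≠ 0) (hκ : κ 4 = α⁻¹) :
    exceptionalPoints (Pt (xc - cst α) yc⁻¹) ⊆ hexagonSurface κ := fun R hR => by
  refine .inr (.inr (.inr ⟨4, ?_⟩))
  rw [hκ, Pt_corner_four (inv_ne_zero hα), inv_inv]
  exact hR

lemma Pt_snd_sub_mem_hexagonSurface {a b : ℂ} (ha : a ≠ 0) (h : a ≠ κ 1) :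
    Pt (xc - cst a) (yc - cst b) ∈ hexagonSurface κ := by
  by_cases hb : b = 0
  · rw [hb, sub_cst_zero]; exact Pt_snd_mem_hexagonSurface ha h
  · exact Pt_mem_hexagonSurface ha hb

lemma Pt_snd_inv_sub_mem_hexagonSurface {a b : ℂ} (ha : a ≠ 0) (h : a⁻¹ ≠ κ 4) :
    Pt (xc - cst a) (yc⁻¹ - cst b) ∈ hexagonSurface κ := by
  by_cases hb : b = 0
  · rw [hb, sub_cst_zero]; exact Pt_snd_inv_mem_hexagonSurface ha h
  · have := (isCoord_xc_yc.sub_const_fst a).symm.Pt_inv (inv_ne_zero hb)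
    rw [inv_inv] at this
    rw [Pt_comm, this, Pt_comm]
    exact Pt_mem_hexagonSurface ha (inv_ne_zero hb)

lemma transport_elementary_mem (hα : α ≠ 0) (hβ : β ≠ 0) (hαβ : α ≠ β)
    {Φ : PlaneField ≃ₐ[ℂ] PlaneField} (hx : Φ xc = xc) (hy : Φ yc = elementary α β xc yc)
    (h1 : κ 1 = β) (h4 : κ 4 = α⁻¹) (h1' : κ' 1 = α) (h4' : κ' 4 = β⁻¹)
    (h0 : κ' 0 = β / α * κ 0) (h2 : κ' 2 = κ 2) (h3 : κ' 3 = κ 3) (h5 : κ' 5 = β / α * κ 5)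
    {R : Subalgebra ℂ PlaneField} (hR : R ∈ hexagonSurface κ') :
    transport Φ R ∈ hexagonSurface κ := by
  have hc := isCoord_xc_yc
  have hy' : Φ yc⁻¹ = elementary β α xc yc⁻¹ := by rw [map_inv₀, hy, elementary_inv]
  have hne : β / α ≠ 0 := div_ne_zero hβ hα
  have hne' : α / β ≠ 0 := div_ne_zero hα hβ
  -- points over a finite nonzero value of the first coordinate
  have T1 : ∀ a b : ℂ, a ≠ 0 → (a ≠ α ∨ b ≠ 0) →
      Pt (xc - cst a) (elementary α β xc yc - cst b) ∈ hexagonSurface κ := by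
    intro a b ha hab
    by_cases haβ : a = β
    · subst haβ
      rw [hc.Pt_elementary_right hαβ]
      refine exceptionalPoints_snd_subset (h1 ▸ ha) ?_
      rw [h1, (hc.sub_const_fst a).exceptionalPoints_eq]
      exact .inl ⟨_, rfl⟩
    by_cases haα : a = α
    · subst haα
      rw [hc.Pt_elementary_left hαβ (hab.resolve_left (not_not.mpr rfl))]
      refine exceptionalPoints_snd_inv_subset ha h4 ?_
      rw [(hc.inv_snd.sub_const_fst a).exceptionalPoints_eq]
      exact .inl ⟨_, rfl⟩
    · rw [hc.Pt_elementary_of_ne haα haβ]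
      exact Pt_snd_sub_mem_hexagonSurface ha (h1 ▸ haβ)
  have T2 : ∀ a b : ℂ, a ≠ 0 → (a ≠ β ∨ b ≠ 0) →
      Pt (xc - cst a) (elementary β α xc yc⁻¹ - cst b) ∈ hexagonSurface κ := by
    intro a b ha hab
    by_cases haα : a = α
    · subst haα
      rw [hc.inv_snd.Pt_elementary_right hαβ.symm]
      refine exceptionalPoints_snd_inv_subset ha h4 ?_
      rw [(hc.inv_snd.sub_const_fst a).exceptionalPoints_eq]
      exact .inl ⟨_, rfl⟩
    by_cases haβ : a = β
    · subst haβ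
      rw [hc.inv_snd.Pt_elementary_left hαβ.symm (hab.resolve_left (not_not.mpr rfl)), inv_inv]
      refine exceptionalPoints_snd_subset (h1 ▸ ha) ?_
      rw [h1, (hc.sub_const_fst a).exceptionalPoints_eq]
      exact .inl ⟨_, rfl⟩
    · rw [hc.inv_snd.Pt_elementary_of_ne haβ haα]
      exact Pt_snd_inv_sub_mem_hexagonSurface ha fun h => haα (inv_injective (h.trans h4))
  -- points near the lines `x = 0` and `x = ∞`
  obtain ⟨r, hr⟩ : ∃ r, r = (xc - cst α) / (xc - cst β) := ⟨_, rfl⟩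
  have hyr : Φ yc = yc * r := by rw [hy, hr, elementary]
  have r0 : ∀ S : Subalgebra ℂ PlaneField, IsLocalRing S → VanishesAt xc S →
      HasValueAt r (α / β) S ∧ HasValueAt r⁻¹ (β / α) S := by
    intro S hS h
    have := (h.hasValueAt.ratio (α := α) hβ.symm).congr rfl (d := α / β) (by
      rw [zero_sub, zero_sub, neg_div_neg_eq])
    rw [← hr] at this
    exact ⟨this, (this.inv hne').congr rfl (inv_div _ _)⟩
  have r1 : ∀ S : Subalgebra ℂ PlaneField, IsLocalRing S → VanishesAt xc⁻¹ S →
      HasValueAt r 1 S ∧ HasValueAt r⁻¹ 1 S := by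
    intro S hS h
    have := h.ratio_of_inv (α := α) (β := β) hc.fst_ne_zero
    rw [← hr] at this
    exact ⟨this, (this.inv one_ne_zero).congr rfl inv_one⟩
  have hx' : Φ xc⁻¹ = xc⁻¹ := by rw [map_inv₀, hx]
  have hyr' : Φ yc⁻¹ = yc⁻¹ * r⁻¹ := by rw [map_inv₀, hyr, mul_inv]
  have hd : Φ (yc / xc) = yc / xc * r := by rw [map_div₀, hyr, hx, div_mul_eq_mul_div]
  have hd' : Φ (xc / yc) = xc / yc * r⁻¹ := by rw [map_div₀, hyr, hx, div_mul_eq_div_div,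
    div_eq_mul_inv _ r]
  have hm : ∀ j, IsCoord (Φ (cornerU j)) (Φ (cornerV j)) := fun j => (isCoord_corner j).map Φ
  have hm0 := hm 0
  have hm1 := hm 1
  have hm2 := hm 2
  have hm3 := hm 3
  have hm4 := hm 4
  have hm5 := hm 5
  change IsCoord (Φ (xc / yc)) (Φ yc) at hm0
  change IsCoord (Φ xc) (Φ (yc / xc)) at hm1
  change IsCoord (Φ yc) (Φ xc⁻¹) at hm2
  change IsCoord (Φ (yc / xc)) (Φ yc⁻¹) at hm3
  change IsCoord (Φ xc⁻¹) (Φ (xc / yc)) at hm4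
  change IsCoord (Φ yc⁻¹) (Φ xc) at hm5
  rw [hd', hyr] at hm0
  rw [hx, hd] at hm1
  rw [hyr, hx'] at hm2
  rw [hd, hyr'] at hm3
  rw [hx', hd'] at hm4
  rw [hyr', hx] at hm5
  have xne := hc.fst_ne_zero
  have yne := hc.snd_ne_zero
  have rne : r ≠ 0 := fun h => hm2.fst_ne_zero (by rw [h, mul_zero])
  have E0 : ∀ a : ℂ, Pt (Φ (cornerU 0) - cst a) (Φ (cornerV 0)) =
      Pt (cornerU 0 - cst (a / (β / α))) (cornerV 0) := by
    intro a
    change Pt (Φ (xc / yc) - cst a) (Φ yc) = Pt (xc / yc - cst (a / (β / α))) yc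
    rw [hd', hyr]
    refine (isCoord_corner 0).Pt_mul_unit hm0 hne hne' fun S hS h => ?_
    refine (r0 S hS ?_).symm
    rcases h with ⟨h, h'⟩ | ⟨h, h'⟩
    · exact (h.mul h'.hasValueAt).vanishesAt_of_eq (div_mul_cancel₀ _ yne) (mul_zero _)
    · refine (h.mul h'.hasValueAt).vanishesAt_of_eq ?_ (mul_zero _)
      change xc / yc * r⁻¹ * (yc * r) = xc
      field_simp
  have E3 : ∀ a : ℂ, Pt (Φ (cornerU 3) - cst a) (Φ (cornerV 3)) =
      Pt (cornerU 3 - cst (a / 1)) (cornerV 3) := by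
    intro a
    change Pt (Φ (yc / xc) - cst a) (Φ yc⁻¹) = Pt (yc / xc - cst (a / 1)) yc⁻¹
    rw [hd, hyr']
    refine (isCoord_corner 3).Pt_mul_unit hm3 one_ne_zero one_ne_zero fun S hS h => ?_
    refine r1 S hS ?_
    rcases h with ⟨h, h'⟩ | ⟨h, h'⟩
    · refine (h.mul h'.hasValueAt).vanishesAt_of_eq ?_ (mul_zero _)
      change yc / xc * yc⁻¹ = xc⁻¹
      field_simp
    · refine (h.mul h'.hasValueAt).vanishesAt_of_eq ?_ (mul_zero _)
      change yc / xc * r * (yc⁻¹ * r⁻¹) = xc⁻¹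
      field_simp
  have E2 : ∀ a : ℂ, Pt (Φ (cornerU 2) - cst a) (Φ (cornerV 2)) =
      Pt (cornerU 2 - cst (a / 1)) (cornerV 2) := by
    intro a
    change Pt (Φ yc - cst a) (Φ xc⁻¹) = Pt (yc - cst (a / 1)) xc⁻¹
    rw [hyr, hx']
    have := (isCoord_corner 2).Pt_mul_unit (a := a) (ω₁ := r) (ω₂ := 1) (w₁ := 1) (w₂ := 1)
      (by rw [mul_one]; exact hm2) one_ne_zero one_ne_zero fun S hS h =>
        ⟨(r1 S hS (h.elim And.right fun h => h.2.hasValueAt.vanishesAt_of_eq (mul_one _) rfl)).1, hasValueAt_one⟩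
    rwa [mul_one] at this
  have E5 : ∀ a : ℂ, Pt (Φ (cornerU 5) - cst a) (Φ (cornerV 5)) =
      Pt (cornerU 5 - cst (a / (β / α))) (cornerV 5) := by
    intro a
    change Pt (Φ yc⁻¹ - cst a) (Φ xc) = Pt (yc⁻¹ - cst (a / (β / α))) xc
    rw [hyr', hx]
    have := (isCoord_corner 5).Pt_mul_unit (a := a) (ω₁ := r⁻¹) (ω₂ := 1) (w₁ := β / α) (w₂ := 1)
      (by rw [mul_one]; exact hm5) hne one_ne_zero fun S hS h =>
        ⟨(r0 S hS (h.elim And.right fun h => h.2.hasValueAt.vanishesAt_of_eq (mul_one _) rfl)).2, hasValueAt_one⟩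
    rwa [mul_one] at this
  have E1 : Pt (Φ (cornerU 1)) (Φ (cornerV 1)) = Pt (cornerU 1) (cornerV 1) := by
    change Pt (Φ xc) (Φ (yc / xc)) = Pt xc (yc / xc)
    rw [hx, hd]
    have := (isCoord_corner 1).Pt_mul_unit (a := 0) (ω₁ := 1) (ω₂ := r) (w₁ := 1) (w₂ := α / β)
      (by rw [mul_one]; exact hm1) one_ne_zero hne' fun S hS h =>
        ⟨hasValueAt_one, (r0 S hS (h.elim
          (fun h => h.1.vanishesAt_of_eq rfl (zero_div 1))
          fun h => h.1.vanishesAt_of_eq (mul_one _) rfl)).1⟩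
    rwa [mul_one, zero_div, sub_cst_zero] at this
  have E4 : Pt (Φ (cornerU 4)) (Φ (cornerV 4)) = Pt (cornerU 4) (cornerV 4) := by
    change Pt (Φ xc⁻¹) (Φ (xc / yc)) = Pt xc⁻¹ (xc / yc)
    rw [hx', hd']
    have := (isCoord_corner 4).Pt_mul_unit (a := 0) (ω₁ := 1) (ω₂ := r⁻¹) (w₁ := 1) (w₂ := 1)
      (by rw [mul_one]; exact hm4) one_ne_zero one_ne_zero fun S hS h =>
        ⟨hasValueAt_one, (r1 S hS (h.elim
          (fun h => h.1.vanishesAt_of_eq rfl (zero_div 1))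
          fun h => h.1.vanishesAt_of_eq (mul_one _) rfl)).2⟩
    rwa [mul_one, zero_div, sub_cst_zero] at this
  have edge : ∀ j (w : ℂ), w ≠ 0 → κ' j = w * κ j → (∀ a : ℂ, Pt (Φ (cornerU j) - cst a)
      (Φ (cornerV j)) = Pt (cornerU j - cst (a / w)) (cornerV j)) → ∀ a : ℂ, a ≠ 0 → a ≠ κ' j →
      transport Φ (Pt (cornerU j - cst a) (cornerV j)) ∈ hexagonSurface κ := by
    intro j w hw hκ hE a ha haκ
    rw [transport_Pt, map_sub, Φ.commutes, hE]
    refine .inr (.inl ⟨j, _, div_ne_zero ha hw, fun h => haκ ?_, rfl⟩)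
    rw [hκ, ← h, mul_div_cancel₀ _ hw]
  have corner : ∀ j (w : ℂ), w ≠ 0 → (∀ a : ℂ, Pt (Φ (cornerU j) - cst a)
      (Φ (cornerV j)) = Pt (cornerU j - cst (a / w)) (cornerV j)) →
      transport Φ (Pt (cornerU j) (cornerV j)) ∈ hexagonSurface κ := by
    intro j w hw hE
    have := hE 0
    rw [zero_div, sub_cst_zero, sub_cst_zero] at this
    rw [transport_Pt, this]
    exact .inr (.inr (.inl ⟨j, rfl⟩))
  have exc : ∀ j (w : ℂ), w ≠ 0 → κ' j = w * κ j → (∀ a : ℂ, Pt (Φ (cornerU j) - cst a)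
      (Φ (cornerV j)) = Pt (cornerU j - cst (a / w)) (cornerV j)) →
      ∀ R ∈ exceptionalPoints (Pt (cornerU j - cst (κ' j)) (cornerV j)),
      transport Φ R ∈ hexagonSurface κ := by
    intro j w hw hκ hE R hR
    have := ((isCoord_corner j).sub_const_fst (κ' j)).transport_mem_exceptionalPoints (Φ := Φ) hR
    rw [map_sub, Φ.commutes, hE, hκ, mul_div_cancel_left₀ _ hw] at this
    exact .inr (.inr (.inr ⟨j, this⟩))
  have h2' : κ' 2 = 1 * κ 2 := by rw [h2, one_mul]
  have h3' : κ' 3 = 1 * κ 3 := by rw [h3, one_mul]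
  rcases hR with ⟨a, b, ha, hb, rfl⟩ | ⟨j, a, ha, haj, rfl⟩ | ⟨j, rfl⟩ | ⟨j, h⟩
  · rw [transport_Pt, map_sub, map_sub, Φ.commutes, Φ.commutes, hx, hy]
    exact T1 a b ha (.inr hb)
  · fin_cases j
    · exact edge 0 _ hne h0 E0 a ha haj
    · have haj : a ≠ α := h1' ▸ haj
      have e : Pt (cornerU 1 - cst a) (cornerV 1) = Pt (xc - cst a) yc := hc.Pt_div ha
      have := T1 a 0 ha (.inl haj)
      rw [sub_cst_zero] at this
      change transport Φ (Pt (cornerU 1 - cst a) (cornerV 1)) ∈ _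
      rwa [e, transport_Pt, map_sub, Φ.commutes, hx, hy]
    · exact edge 2 1 one_ne_zero h2' E2 a ha haj
    · exact edge 3 1 one_ne_zero h3' E3 a ha haj
    · have haj : a ≠ β⁻¹ := h4' ▸ haj
      have e : Pt (cornerU 4 - cst a) (cornerV 4) = Pt (xc - cst a⁻¹) yc⁻¹ := Pt_corner_four ha
      have := T2 a⁻¹ 0 (inv_ne_zero ha) (.inl fun h => haj (by rw [← h, inv_inv]))
      rw [sub_cst_zero] at this
      change transport Φ (Pt (cornerU 4 - cst a) (cornerV 4)) ∈ _
      rwa [e, transport_Pt, map_sub, Φ.commutes, hx, hy']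
    · exact edge 5 _ hne h5 E5 a ha haj
  · fin_cases j
    · exact corner 0 _ hne E0
    · rw [transport_Pt]
      exact .inr (.inr (.inl ⟨1, E1⟩))
    · exact corner 2 1 one_ne_zero E2
    · exact corner 3 1 one_ne_zero E3
    · rw [transport_Pt]
      exact .inr (.inr (.inl ⟨4, E4⟩))
    · exact corner 5 _ hne E5
  · fin_cases j
    · exact exc 0 _ hne h0 E0 R h
    · have e : Pt (cornerU 1 - cst α) (cornerV 1) = Pt (xc - cst α) yc := hc.Pt_div hα
      change R ∈ exceptionalPoints (Pt (cornerU 1 - cst (κ' 1)) (cornerV 1)) at h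
      rw [h1', e] at h
      have := (hc.sub_const_fst α).transport_mem_exceptionalPoints (Φ := Φ) h
      rw [map_sub, Φ.commutes, hx, hy] at this
      rcases hc.exceptionalPoints_elementary hαβ this with ⟨s, h'⟩ | h'
      · rw [h']
        exact Pt_snd_sub_mem_hexagonSurface hα (h1 ▸ hαβ)
      · exact exceptionalPoints_snd_inv_subset hα h4 h'
    · exact exc 2 1 one_ne_zero h2' E2 R h
    · exact exc 3 1 one_ne_zero h3' E3 R h
    · have e : Pt (cornerU 4 - cst β⁻¹) (cornerV 4) = Pt (xc - cst β) yc⁻¹ := by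
        rw [Pt_corner_four (inv_ne_zero hβ), inv_inv]; rfl
      change R ∈ exceptionalPoints (Pt (cornerU 4 - cst (κ' 4)) (cornerV 4)) at h
      rw [h4', e] at h
      have := (hc.inv_snd.sub_const_fst β).transport_mem_exceptionalPoints (Φ := Φ) h
      rw [map_sub, Φ.commutes, hx, hy'] at this
      rcases hc.inv_snd.exceptionalPoints_elementary hαβ.symm this with ⟨s, h'⟩ | h'
      · rw [h']
        exact Pt_snd_inv_sub_mem_hexagonSurface hβ fun h => hαβ (inv_injective (h.trans h4)).symm
      · rw [inv_inv] at h'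
        exact exceptionalPoints_snd_subset (h1 ▸ hβ) (by rwa [h1])
    · exact exc 5 _ hne h5 E5 R h

lemma liftsToIso_elementary (hα : α ≠ 0) (hβ : β ≠ 0)
    {Φ : PlaneField ≃ₐ[ℂ] PlaneField} (hx : Φ xc = xc) (hy : Φ yc = elementary α β xc yc)
    (h1 : κ 1 = β) (h4 : κ 4 = α⁻¹) (h1' : κ' 1 = α) (h4' : κ' 4 = β⁻¹)
    (h0 : κ' 0 = β / α * κ 0) (h2 : κ' 2 = κ 2) (h3 : κ' 3 = κ 3) (h5 : κ' 5 = β / α * κ 5) :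
    LiftsToIso Φ (hexagonSurface κ) (hexagonSurface κ') := by
  have hc := isCoord_xc_yc
  by_cases hαβ : α = β
  · subst hαβ
    have : κ' = κ := by
      funext j
      fin_cases j
      · exact h0.trans (by rw [div_self hα, one_mul]; rfl)
      · exact h1'.trans h1.symm
      · exact h2
      · exact h3
      · exact h4'.trans h4.symm
      · exact h5.trans (by rw [div_self hα, one_mul]; rfl)
    rw [this]
    refine liftsToIso_monomial (k := 0) (w := 1) (fun j => one_ne_zero) (fun j => ?_) fun j => ?_
    · have : Φ = AlgEquiv.refl := by
        refine algEquiv_ext_planeField hx (hy.trans ?_)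
        rw [elementary, div_self (hc.fst_sub_ne_zero α), mul_one]; rfl
      rw [this, Pi.one_apply, cst_one, one_mul, add_zero]; rfl
    · rw [Pi.one_apply, one_mul, add_zero]
  · refine liftsToIso_of_subset
      (fun R hR => transport_elementary_mem hα hβ hαβ hx hy h1 h4 h1' h4' h0 h2 h3 h5 hR)
      fun R hR => transport_elementary_mem hβ hα (Ne.symm hαβ) ?_ ?_ h1' h4' h1 h4 ?_ h2.symm
        h3.symm ?_ hR
    · rw [AlgEquiv.symm_apply_eq, hx]
    · rw [AlgEquiv.symm_apply_eq]
      have : Φ (elementary β α xc yc) = elementary β α (Φ xc) (Φ yc) := by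
        simp only [elementary, map_mul, map_div₀, map_sub, AlgEquiv.commutes]
      rw [this, hx, hy, hc.elementary_elementary]
    · rw [h0, ← mul_assoc, div_mul_div_cancel₀ hβ, div_self hα, one_mul]
    · rw [h5, ← mul_assoc, div_mul_div_cancel₀ hβ, div_self hα, one_mul]

end ElementaryIso

section Family

/-- The automorphism `s` of the plane field lifts to an isomorphism from `X` onto the surface of
the family with parameters `s`, and these are nonzero. -/
def FamilyPoint.IsIsoFrom (X : Set (Subalgebra ℂ PlaneField)) (s : FamilyPoint) : Prop :=
  (s.b₀ ≠ 0 ∧ s.b₁ ≠ 0 ∧ s.b₂ ≠ 0 ∧ s.c ≠ 0) ∧ ∃ Ψ : PlaneField ≃ₐ[ℂ] PlaneField,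
    Ψ xc = s.x ∧ Ψ yc = s.y ∧ LiftsToIso Ψ X (familySurface s.b₀ s.b₁ s.b₂ s.c)

variable {X : Set (Subalgebra ℂ PlaneField)} {s t : FamilyPoint}

lemma FamilyPoint.IsIsoFrom.comp (h : s.IsIsoFrom X)
    (ht : t.b₀ ≠ 0 ∧ t.b₁ ≠ 0 ∧ t.b₂ ≠ 0 ∧ t.c ≠ 0)
    (Θ : PlaneField ≃ₐ[ℂ] PlaneField)
    (hΘ : LiftsToIso Θ (hexagonSurface (familyCoords s.b₀ s.b₁ s.b₂ s.c))
      (hexagonSurface (familyCoords t.b₀ t.b₁ t.b₂ t.c)))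
    (hxy : ∀ Ψ : PlaneField ≃ₐ[ℂ] PlaneField, Ψ xc = s.x → Ψ yc = s.y →
      Ψ (Θ xc) = t.x ∧ Ψ (Θ yc) = t.y) : t.IsIsoFrom X := by
  obtain ⟨⟨h0, h1, h2, h3⟩, Ψ, hx, hy, hΨ⟩ := h
  refine ⟨ht, Θ.trans Ψ, (hxy Ψ hx hy).1, (hxy Ψ hx hy).2, hΨ.trans ?_⟩
  rw [familySurface_eq h0 h1 h2 h3, familySurface_eq ht.1 ht.2.1 ht.2.2.1 ht.2.2.2]
  exact hΘ

lemma isCoord_scale {a b : ℂ} (ha : a ≠ 0) (hb : b ≠ 0) : IsCoord (cst a * xc) (cst b * yc) :=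
  isCoord_xc_yc.mul_const ha hb

lemma exists_rotation : ∃ r : PlaneField ≃ₐ[ℂ] PlaneField, r xc = yc ∧ r yc = yc / xc := by
  refine IsCoord.exists_algEquiv ?_
  have := isCoord_xc_yc.symm.div_snd.inv_snd
  rwa [inv_div] at this

/-- Scaling the coordinates. -/
lemma exists_scale (κ : Fin 6 → ℂ) {a b : ℂ} (ha : a ≠ 0) (hb : b ≠ 0) :
    ∃ Φ : PlaneField ≃ₐ[ℂ] PlaneField, Φ xc = cst a * xc ∧ Φ yc = cst b * yc ∧
      LiftsToIso Φ (hexagonSurface κ) (hexagonSurface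
        ![a / b * κ 0, a * κ 1, b * κ 2, b / a * κ 3, a⁻¹ * κ 4, b⁻¹ * κ 5]) := by
  obtain ⟨Φ, hx, hy⟩ := (isCoord_scale ha hb).exists_algEquiv
  have ha' := cst_ne_zero ha
  have hb' := cst_ne_zero hb
  refine ⟨Φ, hx, hy, liftsToIso_monomial (k := 0) (w := ![a / b, a, b, b / a, a⁻¹, b⁻¹])
    (fun j => ?_) (fun j => ?_) fun j => ?_⟩
  · fin_cases j
    exacts [div_ne_zero ha hb, ha, hb, div_ne_zero hb ha, inv_ne_zero ha, inv_ne_zero hb]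
  · rw [add_zero]
    fin_cases j
    · change Φ (xc / yc) = cst (a / b) * (xc / yc)
      rw [map_div₀, hx, hy, cst_div, mul_div_mul_comm]
    · exact hx
    · exact hy
    · change Φ (yc / xc) = cst (b / a) * (yc / xc)
      rw [map_div₀, hx, hy, cst_div, mul_div_mul_comm]
    · change Φ xc⁻¹ = cst a⁻¹ * xc⁻¹
      rw [map_inv₀, hx, cst_inv, mul_inv]
    · change Φ yc⁻¹ = cst b⁻¹ * yc⁻¹
      rw [map_inv₀, hy, cst_inv, mul_inv]
  · rw [add_zero]
    fin_cases j <;> rfl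

lemma liftsToIso_rotation {r : PlaneField ≃ₐ[ℂ] PlaneField} (hx : r xc = yc)
    (hy : r yc = yc / xc) (κ : Fin 6 → ℂ) :
    LiftsToIso r (hexagonSurface κ) (hexagonSurface ![κ 1, κ 2, κ 3, κ 4, κ 5, κ 0]) := by
  have h1 := isCoord_xc_yc.fst_ne_zero
  have h2 := isCoord_xc_yc.snd_ne_zero
  refine liftsToIso_monomial (k := 1) (w := 1) (fun j => one_ne_zero) (fun j => ?_) fun j => ?_
  · rw [Pi.one_apply, cst_one, one_mul]
    fin_cases j
    · change r (xc / yc) = xc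
      rw [map_div₀, hx, hy, div_div_cancel₀ h2]
    · exact hx
    · exact hy
    · change r (yc / xc) = xc⁻¹
      rw [map_div₀, hx, hy]
      field_simp
    · change r xc⁻¹ = yc⁻¹
      rw [map_inv₀, hx]
    · change r yc⁻¹ = xc / yc
      rw [map_inv₀, hy, inv_div]
  · rw [Pi.one_apply, one_mul]
    fin_cases j <;> rfl

lemma exists_elementary {κ : Fin 6 → ℂ} {α β : ℂ} (hα : α ≠ 0) (hβ : β ≠ 0)
    (h1 : κ 1 = β) (h4 : κ 4 = α⁻¹) :
    ∃ Φ : PlaneField ≃ₐ[ℂ] PlaneField, Φ xc = xc ∧ Φ yc = elementary α β xc yc ∧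
      LiftsToIso Φ (hexagonSurface κ) (hexagonSurface
        ![β / α * κ 0, α, κ 2, κ 3, β⁻¹, β / α * κ 5]) := by
  obtain ⟨Φ, hx, hy⟩ := (isCoord_xc_yc.isCoord_elementary (α := α) (β := β)).exists_algEquiv
  exact ⟨Φ, hx, hy, liftsToIso_elementary hα hβ hx hy h1 h4 rfl rfl rfl rfl rfl rfl⟩

lemma FamilyPoint.IsIsoFrom.wAlpha₁ (h : s.IsIsoFrom X) : (wAlpha₁ s).IsIsoFrom X := by
  obtain ⟨h0, h1, h2, h3⟩ := h.1
  obtain ⟨Φ, hx, hy, hΦ⟩ := exists_elementary (κ := familyCoords s.b₀ s.b₁ s.b₂ s.c) one_ne_zero h1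
    rfl inv_one.symm
  obtain ⟨Φ', hx', hy', hΦ'⟩ := exists_scale
    ![s.b₁ / 1 * familyCoords s.b₀ s.b₁ s.b₂ s.c 0, 1, familyCoords s.b₀ s.b₁ s.b₂ s.c 2,
      familyCoords s.b₀ s.b₁ s.b₂ s.c 3, s.b₁⁻¹, s.b₁ / 1 * familyCoords s.b₀ s.b₁ s.b₂ s.c 5]
    (inv_ne_zero h1) one_ne_zero
  refine h.comp (t := HalphenSurface.wAlpha₁ s) ⟨mul_ne_zero h0 h1, one_div_ne_zero h1,
    mul_ne_zero h1 h2, h3⟩ (Φ'.trans Φ) ?_ ?_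
  · convert hΦ.trans hΦ' using 2
    ext j
    fin_cases j <;> simp [familyCoords, HalphenSurface.wAlpha₁] <;> field_simp
  · intro Ψ hsx hsy
    constructor
    · change Ψ (Φ (Φ' xc)) = s.x / cst s.b₁
      rw [hx', map_mul, map_mul, hx, Φ.commutes, Ψ.commutes, hsx, map_inv₀, div_eq_inv_mul]
    · change Ψ (Φ (Φ' yc)) = s.y * (s.x - 1) / (s.x - cst s.b₁)
      rw [hy', cst_one, one_mul, hy, elementary, map_mul, map_div₀, map_sub, map_sub, hsx, hsy,
        Ψ.commutes, Ψ.commutes, map_one, mul_div_assoc]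

lemma FamilyPoint.IsIsoFrom.wAlpha₂ (h : s.IsIsoFrom X) : (wAlpha₂ s).IsIsoFrom X := by
  obtain ⟨h0, h1, h2, h3⟩ := h.1
  obtain ⟨r, rx, ry⟩ := exists_rotation
  set κ := familyCoords s.b₀ s.b₁ s.b₂ s.c with hκ
  have i1 := liftsToIso_rotation rx ry κ
  obtain ⟨Φ, hx, hy, hΦ⟩ := exists_elementary (κ := ![κ 1, κ 2, κ 3, κ 4, κ 5, κ 0])
    (inv_ne_zero h2) one_ne_zero (by rfl) (inv_inv _).symm
  have i3 := (liftsToIso_rotation rx ry ![1 / (s.b₂)⁻¹ * κ 0, 1 / (s.b₂)⁻¹ * κ 1, s.b₂⁻¹, κ 3, κ 4, 1]).symm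
  obtain ⟨Φ', hx', hy', hΦ'⟩ := exists_scale
    ![1 / (s.b₂)⁻¹ * κ 0, 1 / (s.b₂)⁻¹ * κ 1, s.b₂⁻¹, κ 3, κ 4, 1] one_ne_zero h2
  have sx : r.symm xc = xc / yc := by
    rw [AlgEquiv.symm_apply_eq, map_div₀, rx, ry, div_div_cancel₀ isCoord_xc_yc.snd_ne_zero]
  have sy : r.symm yc = xc := by rw [AlgEquiv.symm_apply_eq, rx]
  refine h.comp (t := HalphenSurface.wAlpha₂ s) ⟨mul_ne_zero h0 h2, mul_ne_zero h1 h2,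
    one_div_ne_zero h2, h3⟩ (((Φ'.trans r.symm).trans Φ).trans r) ?_ ?_
  · have hΦ2 : LiftsToIso Φ (hexagonSurface ![κ 1, κ 2, κ 3, κ 4, κ 5, κ 0]) (hexagonSurface
        ![1 / (s.b₂)⁻¹ * κ 1, s.b₂⁻¹, κ 3, κ 4, 1, 1 / (s.b₂)⁻¹ * κ 0]) := by
      convert hΦ using 2
      ext j
      fin_cases j <;> simp
    convert i1.trans (hΦ2.trans (i3.trans hΦ')) using 2
    ext j
    fin_cases j <;> simp [familyCoords, HalphenSurface.wAlpha₂, hκ] <;> field_simp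
  · have e1 : r (Φ (r.symm (Φ' xc))) = xc * ((yc - 1) / (yc - cst s.b₂⁻¹)) := by
      have : Φ (xc / yc) = xc / yc * ((xc - 1) / (xc - cst s.b₂⁻¹)) := by
        rw [map_div₀, hx, hy, elementary, ← div_div, div_eq_mul_inv (xc / yc), inv_div, cst_one]
      rw [hx', cst_one, one_mul, sx, this, map_mul, map_div₀, map_div₀, map_sub, map_sub, rx, ry,
        r.commutes, map_one, div_div_cancel₀ isCoord_xc_yc.snd_ne_zero]
    have e2 : r (Φ (r.symm (Φ' yc))) = cst s.b₂ * yc := by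
      rw [hy', map_mul, map_mul, map_mul, sy, hx, rx, r.symm.commutes, Φ.commutes, r.commutes]
    intro Ψ hsx hsy
    constructor
    · change Ψ (r (Φ (r.symm (Φ' xc)))) = cst s.b₂ * s.x * (s.y - 1) / (cst s.b₂ * s.y - 1)
      rw [e1, map_mul, map_div₀, map_sub, map_sub, hsx, hsy, Ψ.commutes, map_one, map_inv₀]
      have hb := cst_ne_zero h2
      rw [← mul_div_mul_left (s.y - 1) _ hb, mul_sub, mul_sub, mul_inv_cancel₀ hb]
      ring
    · change Ψ (r (Φ (r.symm (Φ' yc)))) = cst s.b₂ * s.y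
      rw [e2, map_mul, hsy, Ψ.commutes]

lemma FamilyPoint.IsIsoFrom.rho (h : s.IsIsoFrom X) : (rho s).IsIsoFrom X := by
  obtain ⟨h0, h1, h2, h3⟩ := h.1
  have c1 := isCoord_xc_yc.fst_ne_zero
  have c2 := isCoord_xc_yc.snd_ne_zero
  have c3 := cst_ne_zero h3
  obtain ⟨Θ, hx, hy⟩ :=
    (isCoord_xc_yc.div_fst.inv_snd.symm.mul_const one_ne_zero h3).exists_algEquiv
  rw [cst_one, one_mul] at hx
  refine h.comp (t := HalphenSurface.rho s) ⟨h1, h2, h0, h3⟩ Θ ?_ ?_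
  · refine liftsToIso_monomial (k := 4) (w := ![s.c⁻¹, 1, s.c, s.c, 1, s.c⁻¹])
      (fun j => ?_) (fun j => ?_) fun j => ?_
    · fin_cases j
      exacts [inv_ne_zero h3, one_ne_zero, h3, h3, one_ne_zero, inv_ne_zero h3]
    · fin_cases j
      · change Θ (xc / yc) = cst s.c⁻¹ * xc⁻¹
        rw [map_div₀, hx, hy, cst_inv]; field_simp
      · change Θ xc = cst 1 * yc⁻¹
        rw [hx, cst_one, one_mul]
      · exact hy
      · change Θ (yc / xc) = cst s.c * xc
        rw [map_div₀, hx, hy]; field_simp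
      · change Θ xc⁻¹ = cst 1 * yc
        rw [map_inv₀, hx, inv_inv, cst_one, one_mul]
      · change Θ yc⁻¹ = cst s.c⁻¹ * (yc / xc)
        rw [map_inv₀, hy, cst_inv, mul_inv, inv_div]
    · fin_cases j <;> simp [familyCoords, HalphenSurface.rho] <;> field_simp
  · intro Ψ hsx hsy
    constructor
    · rw [hx, map_inv₀, hsy]; exact (one_div _).symm
    · rw [hy, map_mul, map_div₀, hsx, hsy, Ψ.commutes]
      exact (mul_div_assoc _ _ _).symm

lemma FamilyPoint.IsIsoFrom.sigma (h : s.IsIsoFrom X) : (sigma s).IsIsoFrom X := by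
  obtain ⟨h0, h1, h2, h3⟩ := h.1
  have c1 := isCoord_xc_yc.fst_ne_zero
  have c2 := isCoord_xc_yc.snd_ne_zero
  have d1 := cst_ne_zero h1
  have d2 := cst_ne_zero h2
  obtain ⟨Θ, hx, hy⟩ :=
    (isCoord_xc_yc.inv_fst.inv_snd.mul_const h1 (inv_ne_zero h2)).exists_algEquiv
  refine h.comp (t := HalphenSurface.sigma s)
    ⟨h0, h1, h2, one_div_ne_zero (mul_ne_zero (mul_ne_zero (mul_ne_zero h0 h1) h2) h3)⟩ Θ ?_ ?_
  · refine liftsToIso_monomial (k := 3)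
      (w := ![s.b₁ * s.b₂, s.b₁, s.b₂⁻¹, (s.b₁ * s.b₂)⁻¹, s.b₁⁻¹, s.b₂])
      (fun j => ?_) (fun j => ?_) fun j => ?_
    · fin_cases j
      exacts [mul_ne_zero h1 h2, h1, inv_ne_zero h2, inv_ne_zero (mul_ne_zero h1 h2),
        inv_ne_zero h1, h2]
    · fin_cases j
      · change Θ (xc / yc) = cst (s.b₁ * s.b₂) * (yc / xc)
        rw [map_div₀, hx, hy, cst_inv, cst_mul]; field_simp
      · exact hx
      · exact hy
      · change Θ (yc / xc) = cst (s.b₁ * s.b₂)⁻¹ * (xc / yc)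
        rw [map_div₀, hx, hy, cst_inv, cst_inv, cst_mul]; field_simp
      · change Θ xc⁻¹ = cst s.b₁⁻¹ * xc
        rw [map_inv₀, hx, mul_inv, inv_inv, cst_inv]
      · change Θ yc⁻¹ = cst s.b₂ * yc
        rw [map_inv₀, hy, mul_inv, cst_inv, inv_inv, inv_inv]
    · fin_cases j <;> simp [familyCoords, HalphenSurface.sigma] <;> field_simp
  · intro Ψ hsx hsy
    constructor
    · rw [hx, map_mul, map_inv₀, hsx, Ψ.commutes]; exact (div_eq_mul_inv _ _).symm
    · rw [hy, map_mul, map_inv₀, hsy, Ψ.commutes, map_inv₀, ← mul_inv]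
      exact (one_div _).symm

lemma FamilyPoint.IsIsoFrom.familyMap (h : s.IsIsoFrom X) : (familyMap s).IsIsoFrom X :=
  h.rho.wAlpha₂.wAlpha₁.rho.wAlpha₂.wAlpha₁.sigma

lemma isIsoFrom_familySurface {b₀ b₁ b₂ c : ℂ} (hb₀ : b₀ ≠ 0) (hb₁ : b₁ ≠ 0) (hb₂ : b₂ ≠ 0)
    (hc : c ≠ 0) : (⟨xc, yc, b₀, b₁, b₂, c⟩ : FamilyPoint).IsIsoFrom (familySurface b₀ b₁ b₂ c) := by
  refine ⟨⟨hb₀, hb₁, hb₂, hc⟩, AlgEquiv.refl, rfl, rfl, ?_⟩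
  refine (Set.image_congr fun R _ => ?_).trans (Set.image_id _)
  exact Subalgebra.map_id R

lemma familyMap_parameters {b₀ b₁ b₂ : ℂ} (h : (b₀ * b₁ * b₂)⁻¹ = -1) (x y : PlaneField) :
    (familyMap ⟨x, y, b₀, b₁, b₂, I⟩).b₀ = b₀ ∧
      (familyMap ⟨x, y, b₀, b₁, b₂, I⟩).b₁ = b₁ ∧
      (familyMap ⟨x, y, b₀, b₁, b₂, I⟩).b₂ = b₂ ∧
      (familyMap ⟨x, y, b₀, b₁, b₂, I⟩).c = I := by
  have h' : b₀ * b₁ * b₂ = -1 := by rw [← inv_inv (b₀ * b₁ * b₂), h]; norm_num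
  have hne : b₀ * b₁ * b₂ ≠ 0 := by rw [h']; norm_num
  obtain ⟨h01, h2⟩ := mul_ne_zero_iff.mp hne
  obtain ⟨h0, h1⟩ := mul_ne_zero_iff.mp h01
  have hI := I_ne_zero
  have hI2 : I ^ 2 = -1 := I_sq
  simp only [familyMap, Function.comp_apply, Function.iterate_succ, Function.iterate_zero, id,
    rho, wAlpha₁, wAlpha₂, sigma]
  refine ⟨?_, ?_, ?_, ?_⟩
  · field_simp
    linear_combination (b₀ * b₁ * b₂ - 1) * h'
  · field_simp
    linear_combination (1 - b₀ * b₁ * b₂) * h'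
  · field_simp
  · field_simp
    linear_combination h' - b₀ * b₁ * b₂ * hI2

lemma exists_hasValueAt_xc_yc (a b : ℂ) : ∃ S : Subalgebra ℂ PlaneField, IsLocalRing S ∧
    HasValueAt xc a S ∧ HasValueAt yc b S :=
  ⟨_, (isCoord_xc_yc.sub_const a b).isLocalRing, (isCoord_xc_yc.sub_const a b).vanishesAt_fst,
    (isCoord_xc_yc.sub_const a b).vanishesAt_snd⟩

lemma cst_I_sq : cst I ^ 2 = -1 := by
  rw [← cst_pow, I_sq, cst_neg, cst_one]

lemma phi_denominators {b : ℂ} (hb : b ≠ 0) :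
    cst I * xc - cst b * yc ≠ 0 ∧ cst I * xc - yc ≠ 0 ∧
      -cst I * xc * (xc + 1) + yc * (cst b * xc + 1) ≠ 0 ∧
      xc * (xc - cst b) + cst I * cst b * yc * (xc - 1) ≠ 0 ∧
      xc * (xc + 1) - cst I * yc * (xc - 1) ≠ 0 ∧
      xc * (xc + 1) + cst I * cst b * yc * (xc - 1) ≠ 0 := by
  obtain ⟨S, _, hx, hy⟩ := exists_hasValueAt_xc_yc 1 0
  have hI := hasValueAt_const (R := S) I
  have hb' := hasValueAt_const (R := S) b
  have h1 := hasValueAt_one (R := S)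
  obtain ⟨T, _, hx', hy'⟩ := exists_hasValueAt_xc_yc 0 1
  have hI' := hasValueAt_const (R := T) I
  have hbT := hasValueAt_const (R := T) b
  have h1' := hasValueAt_one (R := T)
  refine ⟨((hI.mul hx).sub (hb'.mul hy)).ne_zero ?_, ((hI.mul hx).sub hy).ne_zero ?_,
    (((hI.neg.mul hx).mul (hx.add h1)).add (hy.mul ((hb'.mul hx).add h1))).ne_zero ?_,
    ((hx'.mul (hx'.sub hbT)).add (((hI'.mul hbT).mul hy').mul (hx'.sub h1'))).ne_zero ?_,
    ((hx.mul (hx.add h1)).sub ((hI.mul hy).mul (hx.sub h1))).ne_zero ?_,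
    ((hx.mul (hx.add h1)).add (((hI.mul hb').mul hy).mul (hx.sub h1))).ne_zero ?_⟩
  all_goals norm_num [I_ne_zero, hb]

lemma familyMap_example {b : ℂ} (hb : b ≠ 0) :
    familyMap ⟨xc, yc, 1 / b, -1, b, I⟩ = ⟨phiX b, phiY b, 1 / b, -1, b, I⟩ := by
  have hpar := familyMap_parameters (b₀ := 1 / b) (b₁ := -1) (b₂ := b)
    (by field_simp) xc yc
  have hx := isCoord_xc_yc.fst_ne_zero
  have hy := isCoord_xc_yc.snd_ne_zero
  obtain ⟨n1, n2, n3, n4, n5, n6⟩ := phi_denominators hb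
  have hb' := cst_ne_zero hb
  have hI := cst_ne_zero I_ne_zero
  have hI2 := cst_I_sq
  have q1 : wAlpha₂ (rho ⟨xc, yc, 1 / b, -1, b, I⟩) =
      ⟨(cst I * xc - yc) / (yc * (cst I * xc - cst b * yc)),
        cst I * xc / (cst b * yc), -1 / b, 1, b, I⟩ := by
    ext
    · simp only [wAlpha₂, rho, cst_div, cst_one]
      rw [show (1 / cst b * (cst I * xc / yc) - 1) =
        (cst I * xc - cst b * yc) / (cst b * yc) by field_simp]
      field_simp
    · simp only [wAlpha₂, rho, cst_div, cst_one]; field_simp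
    · simp only [wAlpha₂, rho]; ring
    · simp only [wAlpha₂, rho]; field_simp
    · simp only [wAlpha₂, rho]; field_simp
    · rfl
  have hx1 : (cst I * xc - yc) / (yc * (cst I * xc - cst b * yc)) - 1 ≠ 0 := by
    obtain ⟨S, _, hx', hy'⟩ := exists_hasValueAt_xc_yc 1 0
    have hI' := hasValueAt_const (R := S) I
    have h := (((hI'.mul hx').sub hy').sub (hy'.mul ((hI'.mul hx').sub
      ((hasValueAt_const b).mul hy')))).ne_zero (by norm_num [I_ne_zero])
    rw [div_sub_one (mul_ne_zero hy n1)]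
    exact div_ne_zero h (mul_ne_zero hy n1)
  have q2 : wAlpha₁ ⟨(cst I * xc - yc) / (yc * (cst I * xc - cst b * yc)),
        cst I * xc / (cst b * yc), -1 / b, 1, b, I⟩ =
      ⟨(cst I * xc - yc) / (yc * (cst I * xc - cst b * yc)),
        cst I * xc / (cst b * yc), -1 / b, 1, b, I⟩ := by
    ext
    · simp only [wAlpha₁, cst_one, div_one]
    · simp only [wAlpha₁, cst_one]
      exact mul_div_cancel_right₀ _ hx1
    all_goals simp [wAlpha₁]
  obtain ⟨D, hD⟩ : ∃ D, D = -cst I * xc * (xc + 1) + yc * (cst b * xc + 1) := ⟨_, rfl⟩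
  obtain ⟨N, hN⟩ : ∃ N, N = yc * (xc * (xc - cst b) + cst I * cst b * yc * (xc - 1)) :=
    ⟨_, rfl⟩
  rw [← hD] at n3
  have q3 : wAlpha₂ (rho ⟨(cst I * xc - yc) / (yc * (cst I * xc - cst b * yc)),
        cst I * xc / (cst b * yc), -1 / b, 1, b, I⟩) =
      ⟨N / (xc * D), -(cst I * xc - yc) / (xc * (cst I * xc - cst b * yc)),
        -1 / b, -1, -b, I⟩ := by
    ext
    · simp only [wAlpha₂, rho, cst_div, cst_neg, cst_one]
      rw [show -1 / cst b * (cst I * ((cst I * xc - yc) /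
          (yc * (cst I * xc - cst b * yc))) / (cst I * xc / (cst b * yc))) - 1 =
          D / (xc * (cst I * xc - cst b * yc)) by
        rw [hD]; field_simp; ring]
      rw [hN]
      field_simp
      linear_combination -(cst b * yc * (xc - 1)) * hI2
    · simp only [wAlpha₂, rho, cst_div, cst_neg, cst_one]; field_simp
    · simp only [wAlpha₂, rho]; ring
    · simp only [wAlpha₂, rho]; field_simp
    · simp only [wAlpha₂, rho]; field_simp
    · rfl
  have e : familyMap ⟨xc, yc, 1 / b, -1, b, I⟩ = sigma (wAlpha₁ (wAlpha₂ (rho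
      (wAlpha₁ (wAlpha₂ (rho ⟨xc, yc, 1 / b, -1, b, I⟩)))))) := rfl
  have k1 : N + xc * D = -(cst I * xc - yc) *
      (xc * (xc + 1) + cst I * cst b * yc * (xc - 1)) := by
    rw [hN, hD]; linear_combination (xc - 1) * xc * yc * cst b * hI2
  have k2 : N - xc * D = (cst I * xc - cst b * yc) *
      (xc * (xc + 1) - cst I * yc * (xc - 1)) := by
    rw [hN, hD]; linear_combination (xc - 1) * xc * yc * hI2
  have k3 : (N / (xc * D) - 1) / (N / (xc * D) - -1) = (N - xc * D) / (N + xc * D) := by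
    rw [sub_neg_eq_add, div_sub_one (mul_ne_zero hx n3), div_add_one (mul_ne_zero hx n3),
      div_div_div_cancel_right₀ (mul_ne_zero hx n3)]
  ext
  · rw [e, q1, q2, q3]
    simp only [sigma, wAlpha₁, cst_neg, cst_one, phiX, ← hD, ← hN]
    rw [(by
      rw [one_div_neg_one_eq_neg_one, cst_neg, cst_one] : cst (1 / -1) = -1)]
    field_simp
  · rw [e, q1, q2, q3]
    simp only [sigma, wAlpha₁, cst_neg, cst_one, phiY]
    rw [mul_div_assoc, k3, k1, k2, neg_one_mul, neg_neg]
    field_simp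
  · exact hpar.1
  · exact hpar.2.1
  · exact hpar.2.2.1
  · exact hpar.2.2.2

end Family

section

open MvPolynomial

section Derivation

variable {K : Type*} [Field K] [Algebra ℂ K] {u v z : K}

local notation "𝐝" => KaehlerDifferential.D ℂ K

lemma D_aeval (p : MvPolynomial (Fin 2) ℂ) : 𝐝 (aeval ![u, v] p) =
    aeval ![u, v] (pderiv 0 p) • 𝐝 u + aeval ![u, v] (pderiv 1 p) • 𝐝 v := by
  induction p using MvPolynomial.induction_on with
  | C a =>
    rw [pderiv_C, pderiv_C, map_zero, zero_smul, zero_smul, add_zero, aeval_C]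
    exact Derivation.map_algebraMap _ a
  | add p q hp hq =>
    simp only [map_add, hp, hq, add_smul]
    abel
  | mul_X p i hp =>
    rw [map_mul, Derivation.leibniz, hp, pderiv_mul, pderiv_mul]
    fin_cases i
    · simp only [aeval_X, map_add, map_mul, Fin.zero_eta, pderiv_X_self,
        pderiv_X_of_ne (show (0 : Fin 2) ≠ 1 by decide), mul_one, mul_zero,
        add_zero, Matrix.cons_val_zero]
      module
    · simp only [aeval_X, map_add, map_mul, Fin.mk_one, pderiv_X_self,
        pderiv_X_of_ne (show (1 : Fin 2) ≠ 0 by decide), mul_one, mul_zero,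
        add_zero, Matrix.cons_val_one, Matrix.cons_val_fin_one]
      module

lemma D_div_aeval {p q : MvPolynomial (Fin 2) ℂ} {P Q : K} (hP : P = aeval ![u, v] p)
    (hQ : Q = aeval ![u, v] q) : 𝐝 (P / Q) =
    ((aeval ![u, v] (pderiv 0 p) * Q - P * aeval ![u, v] (pderiv 0 q)) / Q ^ 2) • 𝐝 u +
      ((aeval ![u, v] (pderiv 1 p) * Q - P * aeval ![u, v] (pderiv 1 q)) / Q ^ 2) • 𝐝 v := by
  rw [Derivation.leibniz_div]
  conv_lhs => rw [hP, hQ, D_aeval, D_aeval, ← hP, ← hQ]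
  module

lemma exists_D_eq_of_mem_Pt (hz : z ∈ Pt u v) :
    ∃ a ∈ Pt u v, ∃ b ∈ Pt u v, 𝐝 z = a • 𝐝 u + b • 𝐝 v := by
  obtain ⟨p, q, hq, h0, rfl⟩ := hz
  have key : ∀ i, (aeval ![u, v] (pderiv i p) * aeval ![u, v] q -
      aeval ![u, v] p * aeval ![u, v] (pderiv i q)) / aeval ![u, v] q ^ 2 ∈ Pt u v := fun i =>
    ⟨pderiv i p * q - p * pderiv i q, q ^ 2, by rw [map_pow]; exact pow_ne_zero 2 hq,
      by rw [map_pow]; exact pow_ne_zero 2 h0, by simp only [map_sub, map_mul, map_pow]⟩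
  exact ⟨_, key 0, _, key 1, D_div_aeval rfl rfl⟩

/-- Nakayama: generators of the maximal ideal have differentials generating those of coordinates. -/
lemma exists_D_eq_of_span (R : Subalgebra ℂ K) [IsLocalRing R]
    (hD : ∀ z ∈ R, ∃ a ∈ R, ∃ b ∈ R, 𝐝 z = a • 𝐝 u + b • 𝐝 v) (hu : VanishesAt u R)
    (hv : VanishesAt v R) (σ τ : R) (hm : Ideal.span {σ, τ} = maxIdeal R) :
    (∃ a b : R, 𝐝 u = (a : K) • 𝐝 (σ : K) + (b : K) • 𝐝 (τ : K)) ∧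
      ∃ a b : R, 𝐝 v = (a : K) • 𝐝 (σ : K) + (b : K) • 𝐝 (τ : K) := by
  let M : Submodule R Ω[K⁄ℂ] := Submodule.span R {𝐝 u, 𝐝 v}
  let N : Submodule R Ω[K⁄ℂ] := Submodule.span R {𝐝 (σ : K), 𝐝 (τ : K)}
  have smul_eq : ∀ (a : R) (ω : Ω[K⁄ℂ]), a • ω = (a : K) • ω := fun _ _ => rfl
  have hDM : ∀ z : R, 𝐝 (z : K) ∈ M := by
    intro z
    obtain ⟨a, ha, b, hb, hz⟩ := hD z z.2
    rw [hz]
    exact Submodule.mem_span_pair.mpr ⟨⟨a, ha⟩, ⟨b, hb⟩, rfl⟩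
  have hσ : σ ∈ maxIdeal R := hm ▸ Ideal.subset_span (.inl rfl)
  have hτ : τ ∈ maxIdeal R := hm ▸ Ideal.subset_span (.inr rfl)
  have hmN : ∀ z : R, z ∈ maxIdeal R → 𝐝 (z : K) ∈ N ⊔ maxIdeal R • M := by
    intro z hz
    rw [← hm] at hz
    obtain ⟨a, b, hab⟩ := Ideal.mem_span_pair.mp hz
    have e : (z : K) = a * σ + b * τ := by rw [← hab]; rfl
    rw [e, map_add, Derivation.leibniz, Derivation.leibniz,
      show (a : K) • 𝐝 (σ : K) + (σ : K) • 𝐝 (a : K) + ((b : K) • 𝐝 (τ : K) + (τ : K) • 𝐝 (b : K)) =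
        (a • 𝐝 (σ : K) + b • 𝐝 (τ : K)) + (σ • 𝐝 (a : K) + τ • 𝐝 (b : K)) by
        simp only [smul_eq]; abel]
    refine Submodule.add_mem_sup (Submodule.mem_span_pair.mpr ⟨a, b, rfl⟩) ?_
    exact add_mem (Submodule.smul_mem_smul hσ (hDM a)) (Submodule.smul_mem_smul hτ (hDM b))
  have hMN : M ≤ N := by
    refine Submodule.le_of_le_smul_of_le_jacobson_bot (I := maxIdeal R) ?_ le_rfl ?_
    · exact Submodule.fg_span (Set.toFinite _)
    · rw [Submodule.span_le]
      rintro ω (rfl | rfl)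
      · exact hmN ⟨u, _⟩ hu.2
      · exact hmN ⟨v, _⟩ hv.2
  obtain ⟨a, b, h1⟩ := Submodule.mem_span_pair.mp (hMN (Submodule.subset_span (.inl rfl)))
  obtain ⟨c, d, h2⟩ := Submodule.mem_span_pair.mp (hMN (Submodule.subset_span (.inr rfl)))
  exact ⟨⟨a, b, h1.symm⟩, c, d, h2.symm⟩

end Derivation

section Jacobian

variable {u v s t z w : PlaneField}

local notation "𝐝" => KaehlerDifferential.D ℂ PlaneField

lemma jacobian_eq (u v : PlaneField) : jacobian u v =
    differentialBasis.repr (𝐝 u) 0 * differentialBasis.repr (𝐝 v) 1 -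
      differentialBasis.repr (𝐝 v) 0 * differentialBasis.repr (𝐝 u) 1 := by
  rw [jacobian, Module.Basis.det_apply, Matrix.det_fin_two]
  rfl

lemma jacobian_of_eq {a b c d : PlaneField} (hs : 𝐝 s = a • 𝐝 u + b • 𝐝 v)
    (ht : 𝐝 t = c • 𝐝 u + d • 𝐝 v) : jacobian s t = (a * d - b * c) * jacobian u v := by
  simp only [jacobian_eq, hs, ht, map_add, map_smul, Finsupp.add_apply, Finsupp.smul_apply,
    smul_eq_mul]
  ring

lemma jacobian_xc_yc : jacobian xc yc = 1 := by
  rw [jacobian_eq, show 𝐝 xc = _ from (differentialBasis_apply 0).symm,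
    show 𝐝 yc = _ from (differentialBasis_apply 1).symm]
  simp

lemma jacobian_swap (u v : PlaneField) : jacobian v u = -jacobian u v := by
  rw [jacobian_eq, jacobian_eq]; ring

lemma jacobian_self (u : PlaneField) : jacobian u u = 0 := by rw [jacobian_eq]; ring

lemma jacobian_add_left : jacobian (z + w) v = jacobian z v + jacobian w v := by
  simp only [jacobian_eq, map_add, Finsupp.add_apply]; ring

lemma jacobian_sub_left : jacobian (z - w) v = jacobian z v - jacobian w v := by
  simp only [jacobian_eq, map_sub, Finsupp.sub_apply]; ring

lemma jacobian_mul_left : jacobian (z * w) v = z * jacobian w v + w * jacobian z v := by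
  simp only [jacobian_eq, Derivation.leibniz, map_add, map_smul, Finsupp.add_apply,
    Finsupp.smul_apply, smul_eq_mul]
  ring

lemma jacobian_cst_left (c : ℂ) : jacobian (cst c) v = 0 := by
  have h : 𝐝 (cst c) = 0 := Derivation.map_algebraMap _ c
  simp only [jacobian_eq, h, map_zero, Finsupp.zero_apply]; ring

lemma jacobian_one_left : jacobian 1 v = 0 := by
  rw [← cst_one, jacobian_cst_left]

lemma jacobian_sub_cst_left (c : ℂ) : jacobian (z - cst c) v = jacobian z v := by
  rw [jacobian_sub_left, jacobian_cst_left, sub_zero]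

lemma jacobian_sub_cst_right (c : ℂ) : jacobian u (z - cst c) = jacobian u z := by
  rw [jacobian_swap, jacobian_sub_cst_left, ← jacobian_swap]

lemma jacobian_inv_left (hz : z ≠ 0) : jacobian z⁻¹ v = -(z ^ 2)⁻¹ * jacobian z v := by
  have h := jacobian_mul_left (z := z) (w := z⁻¹) (v := v)
  rw [mul_inv_cancel₀ hz, jacobian_one_left] at h
  field_simp at h ⊢
  linear_combination -h

lemma jacobian_div_left (hw : w ≠ 0) :
    jacobian (z / w) v = (jacobian z v * w - z * jacobian w v) / w ^ 2 := by
  rw [div_eq_mul_inv, jacobian_mul_left, jacobian_inv_left hw]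
  field_simp
  ring

lemma jacobian_div_self_left (hv : v ≠ 0) : jacobian (z / v) v = jacobian z v / v := by
  rw [jacobian_div_left hv, jacobian_self]
  field_simp
  ring

lemma jacobian_div_self_right (hu : u ≠ 0) : jacobian u (z / u) = jacobian u z / u := by
  rw [jacobian_swap, jacobian_div_self_left hu, jacobian_swap z u]
  ring

lemma IsCoord.exists_eq_div (h : IsCoord u v) (z : PlaneField) :
    ∃ p q : MvPolynomial (Fin 2) ℂ, q ≠ 0 ∧ z = aeval ![u, v] p / aeval ![u, v] q := by
  obtain ⟨Φ, rfl, rfl⟩ := h.exists_algEquiv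
  obtain ⟨p, q, hq, hz⟩ := IsFractionRing.div_surjective (MvPolynomial (Fin 2) ℂ) (Φ.symm z)
  refine ⟨p, q, nonZeroDivisors.ne_zero hq, ?_⟩
  have key : ∀ p : MvPolynomial (Fin 2) ℂ, Φ (algebraMap _ _ p) = aeval ![Φ xc, Φ yc] p := by
    intro p
    have : (Φ : PlaneField →ₐ[ℂ] PlaneField).comp
        (IsScalarTower.toAlgHom ℂ (MvPolynomial (Fin 2) ℂ) PlaneField) =
        aeval ![Φ xc, Φ yc] := by
      refine MvPolynomial.algHom_ext fun i => ?_
      fin_cases i <;> simp [xc, yc]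
    exact congrArg (fun F => F p) this
  rw [← key, ← key, ← map_div₀, hz, AlgEquiv.apply_symm_apply]

lemma IsCoord.exists_D_eq (h : IsCoord u v) (z : PlaneField) :
    ∃ a b : PlaneField, 𝐝 z = a • 𝐝 u + b • 𝐝 v := by
  obtain ⟨p, q, -, rfl⟩ := h.exists_eq_div z
  exact ⟨_, _, D_div_aeval rfl rfl⟩

lemma IsCoord.jacobian_ne_zero (h : IsCoord u v) : jacobian u v ≠ 0 := by
  intro h0
  obtain ⟨a, b, h1⟩ := h.exists_D_eq xc
  obtain ⟨c, d, h2⟩ := h.exists_D_eq yc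
  have := jacobian_of_eq h1 h2
  rw [h0, mul_zero, jacobian_xc_yc] at this
  exact one_ne_zero this

/-- The Jacobian with respect to generators of the maximal ideal differs by a unit from that of
coordinates. -/
lemma IsCoord.exists_jacobian_eq (h : IsCoord u v) (σ τ : Pt u v)
    (hm : Ideal.span {σ, τ} = maxIdeal (Pt u v)) :
    ∃ δ ∈ Pt u v, δ ≠ 0 ∧ δ⁻¹ ∈ Pt u v ∧ jacobian σ τ = δ * jacobian u v := by
  have := h.isLocalRing
  obtain ⟨⟨a, b, hu⟩, c, d, hv⟩ := exists_D_eq_of_span (Pt u v) (fun z hz => exists_D_eq_of_mem_Pt hz)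
    h.vanishesAt_fst h.vanishesAt_snd σ τ hm
  obtain ⟨a', ha', b', hb', hs⟩ := exists_D_eq_of_mem_Pt σ.2
  obtain ⟨c', hc', d', hd', ht⟩ := exists_D_eq_of_mem_Pt τ.2
  have j1 := jacobian_of_eq hs ht
  have j2 : jacobian u v = (a * d - b * c) * jacobian σ τ :=
    jacobian_of_eq hu hv
  have h0 := h.jacobian_ne_zero
  have hmul : ((a : PlaneField) * d - b * c) * (a' * d' - b' * c') = 1 := by
    have : (((a : PlaneField) * d - b * c) * (a' * d' - b' * c') - 1) * jacobian u v = 0 := by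
      rw [j1] at j2
      linear_combination -j2
    exact sub_eq_zero.mp ((mul_eq_zero.mp this).resolve_right h0)
  have hδ : a' * d' - b' * c' ∈ Pt u v :=
    (Pt u v).sub_mem ((Pt u v).mul_mem ha' hd') ((Pt u v).mul_mem hb' hc')
  refine ⟨_, hδ, right_ne_zero_of_mul_eq_one hmul, ?_, j1⟩
  rw [← eq_inv_of_mul_eq_one_left hmul]
  exact (a * d - b * c : Pt u v).2

variable {X : Set (Subalgebra ℂ PlaneField)} {n : ℕ} {f : PlaneField}

lemma mem_antiPluricanonical_iff : f ∈ antiPluricanonical X n ↔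
    ∀ R ∈ X, ∀ u v : R, Ideal.span {u, v} = maxIdeal R → f * jacobian u v ^ n ∈ R := Iff.rfl

lemma IsCoord.mem_of_mem_antiPluricanonical (h : IsCoord u v) (hP : Pt u v ∈ X)
    (hf : f ∈ antiPluricanonical X n) : f * jacobian u v ^ n ∈ Pt u v :=
  mem_antiPluricanonical_iff.mp hf (Pt u v) hP ⟨u, fst_mem_Pt⟩ ⟨v, snd_mem_Pt⟩ h.span_eq_maxIdeal

lemma mem_antiPluricanonical_of_coord (H : ∀ R ∈ X, ∃ u v, IsCoord u v ∧ R = Pt u v ∧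
    f * jacobian u v ^ n ∈ R) : f ∈ antiPluricanonical X n := by
  intro R hR σ τ hm
  obtain ⟨u, v, h, rfl, hf⟩ := H R hR
  obtain ⟨δ, hδ, -, -, hj⟩ := h.exists_jacobian_eq σ τ hm
  rw [hj, mul_pow, mul_left_comm]
  exact (Pt u v).mul_mem ((Pt u v).pow_mem hδ n) hf

end Jacobian

end

section PencilIdentities

variable {F : Type*} [Field F] {x y i β : F}

local notation "𝐤" =>
  ((i * x * (x + 1) ^ 2 - i * (x + i) * (x ^ 2 - 1) * y + β * (x - 1) ^ 2 * y ^ 2) *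
    (-i * x * (y - 1) + y * (β * y - 1)) / (x ^ 2 * y ^ 2))

lemma pencil_identity_zero (hx : x ≠ 0) (hy : y ≠ 0) (hi : i ^ 2 = -1) {U V : F}
    (hU : U = x / y) (hV : V = y) :
    𝐤 * (U * V) ^ 2 = -1 * (U - (-i)) ^ 2 +
      (U - (-i)) * V * (-2 * U ^ 2 + 2 * i * β) +
      V ^ 2 * (-U ^ 4 + 2 * U ^ 3 + 2 * U * β + β ^ 2 +
        V * (2 * U ^ 4 + 2 * i * U ^ 3 * β + 2 * i * U ^ 2 * β - 2 * U * β ^ 2) +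
        V ^ 2 * (-U ^ 4 - 2 * i * U ^ 3 * β + U ^ 2 * β ^ 2)) := by
  subst hU hV
  field_simp
  grind

lemma pencil_identity_one (hx : x ≠ 0) (hy : y ≠ 0) (hi : i ^ 2 = -1) {U V : F}
    (hU : U = x) (hV : V = y / x) :
    𝐤 * (U * V) ^ 2 = -1 * (U - (-1)) ^ 2 +
      (U - (-1)) * V * (2 * U ^ 2 - 2 * i) +
      V ^ 2 * (-U ^ 4 + 2 * i * U ^ 3 * β + 2 * i * U * β + 1 +
        V * (-2 * i * U ^ 4 * β + 2 * i * U ^ 3 * β + 2 * U ^ 2 * β - 2 * U * β) +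
        V ^ 2 * (U ^ 4 * β ^ 2 - 2 * U ^ 3 * β ^ 2 + U ^ 2 * β ^ 2)) := by
  subst hU hV
  field_simp
  grind

lemma pencil_identity_two (hx : x ≠ 0) (hy : y ≠ 0) (hi : i ^ 2 = -1) {U V : F}
    (hU : U = y) (hV : V = x⁻¹) :
    𝐤 * (U * V) ^ 2 = -1 * (U - 1) ^ 2 +
      (U - 1) * V * (-2 * i * β * U ^ 2 + 2) +
      V ^ 2 * (U ^ 4 * β ^ 2 + 2 * i * U ^ 3 * β - 2 * i * U - 1 +
        V * (-2 * U ^ 4 * β ^ 2 + 2 * U ^ 3 * β + 2 * i * U ^ 2 * β - 2 * i * U) +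
        V ^ 2 * (U ^ 4 * β ^ 2 - 2 * U ^ 3 * β + U ^ 2)) := by
  subst hU hV
  field_simp
  grind

lemma pencil_identity_three (hx : x ≠ 0) (hy : y ≠ 0) (hβ : β ≠ 0) (hi : i ^ 2 = -1) {U V : F}
    (hU : U = y / x) (hV : V = y⁻¹) :
    𝐤 * (U * V) ^ 2 = β ^ 2 * (U - (i / β)) ^ 2 +
      (U - (i / β)) * V * (-2 * β ^ 2 * U ^ 2 + 2 * i * β) +
      V ^ 2 * (U ^ 4 * β ^ 2 + 2 * U ^ 3 * β + 2 * U - 1 +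
        V * (-2 * U ^ 4 * β + 2 * i * U ^ 3 * β - 2 * i * U ^ 2 - 2 * U) +
        V ^ 2 * (U ^ 4 - 2 * i * U ^ 3 - U ^ 2)) := by
  subst hU hV
  field_simp
  grind

lemma pencil_identity_four (hx : x ≠ 0) (hy : y ≠ 0) (hi : i ^ 2 = -1) {U V : F}
    (hU : U = x⁻¹) (hV : V = x / y) :
    𝐤 * (U * V) ^ 2 = β ^ 2 * (U - 1) ^ 2 +
      (U - 1) * V * (-2 * β * U ^ 2 + 2 * i * β) +
      V ^ 2 * (U ^ 4 + 2 * i * U ^ 3 * β + 2 * i * U * β - 1 +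
        V * (-2 * i * U ^ 4 - 2 * i * U ^ 3 + 2 * U ^ 2 + 2 * U) +
        V ^ 2 * (-U ^ 4 - 2 * U ^ 3 - U ^ 2)) := by
  subst hU hV
  field_simp
  grind

lemma pencil_identity_five (hx : x ≠ 0) (hy : y ≠ 0) (hi : i ^ 2 = -1) {U V : F}
    (hU : U = y⁻¹) (hV : V = x) :
    𝐤 * (U * V) ^ 2 = 1 * (U - β) ^ 2 +
      (U - β) * V * (-2 * i * U ^ 2 + 2 * β) +
      V ^ 2 * (-U ^ 4 - 2 * i * U ^ 3 + 2 * i * U * β + β ^ 2 +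
        V * (-2 * U ^ 4 + 2 * U ^ 3 + 2 * i * U ^ 2 * β - 2 * i * U * β) +
        V ^ 2 * (-U ^ 4 + 2 * U ^ 3 - U ^ 2)) := by
  subst hU hV
  field_simp
  grind

end PencilIdentities

lemma IsCoord.exceptionalPoints_eq_swap {u v : PlaneField} (h : IsCoord u v) :
    exceptionalPoints (Pt u v) = {R | (∃ s, R = Pt (u / v - cst s) v) ∨ R = Pt u (v / u)} := by
  rw [Pt_comm, h.symm.exceptionalPoints_eq]
  simp only [Pt_comm v, Pt_comm (v / u)]

section Pencil

variable {b : ℂ} {u v : PlaneField} {R : Subalgebra ℂ PlaneField}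

/-- The parameter `f₁ / f₀` of the pencil. -/
abbrev pencil (b : ℂ) : PlaneField := f₁ b / f₀

/-- The leading coefficients of the pencil at the boundary curves. -/
def edgeCoeff (b : ℂ) : Fin 6 → ℂ := ![-1, -1, -1, b ^ 2, b ^ 2, 1]

lemma edgeCoeff_ne_zero (hb : b ≠ 0) (j : Fin 6) : edgeCoeff b j ≠ 0 := by
  fin_cases j <;> simp [edgeCoeff, hb]

lemma exampleCoords_ne_zero (hb : b ≠ 0) (j : Fin 6) : exampleCoords b j ≠ 0 := by
  fin_cases j <;> simp [exampleCoords, hb]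

lemma f₀_ne_zero : f₀ ≠ 0 :=
  mul_ne_zero (pow_ne_zero 2 isCoord_xc_yc.fst_ne_zero) (pow_ne_zero 2 isCoord_xc_yc.snd_ne_zero)

lemma pencil_mul_f₀ : pencil b * f₀ = f₁ b := div_mul_cancel₀ _ f₀_ne_zero

open MvPolynomial in
/-- The pencil near the boundary curves. -/
lemma exists_pencil_corner (hb : b ≠ 0) (j : Fin 6) :
    ∃ B ∈ Algebra.adjoin ℂ {cornerU j, cornerV j}, ∃ C ∈ Algebra.adjoin ℂ {cornerU j, cornerV j},
      pencil b * (cornerU j * cornerV j) ^ 2 =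
        cst (edgeCoeff b j) * (cornerU j - cst (exampleCoords b j)) ^ 2 +
        (cornerU j - cst (exampleCoords b j)) * cornerV j * B + cornerV j ^ 2 * C := by
  have hx := isCoord_xc_yc.fst_ne_zero
  have hy := isCoord_xc_yc.snd_ne_zero
  have hb' := cst_ne_zero hb
  have hI2 := cst_I_sq
  have mem : ∀ (u v : PlaneField) (p : MvPolynomial (Fin 4) ℂ),
      aeval ![u, v, cst I, cst b] p ∈ Algebra.adjoin ℂ {u, v} := by
    intro u v p
    have h : (aeval (R := ℂ) ![u, v, cst I, cst b]).range ≤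
        Algebra.adjoin ℂ {u, v} := by
      rw [← Algebra.adjoin_range_eq_range_aeval, Algebra.adjoin_le_iff]
      rintro _ ⟨n, rfl⟩
      fin_cases n
      · exact Algebra.subset_adjoin (.inl rfl)
      · exact Algebra.subset_adjoin (.inr rfl)
      · exact Subalgebra.algebraMap_mem _ _
      · exact Subalgebra.algebraMap_mem _ _
    exact h ⟨p, rfl⟩
  have key : ∀ (κ e : ℂ) (u v : PlaneField) (p q : MvPolynomial (Fin 4) ℂ),
      pencil b * (u * v) ^ 2 = cst e * (u - cst κ) ^ 2 +
        (u - cst κ) * v * aeval ![u, v, cst I, cst b] p +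
        v ^ 2 * aeval ![u, v, cst I, cst b] q →
      ∃ B ∈ Algebra.adjoin ℂ {u, v}, ∃ C ∈ Algebra.adjoin ℂ {u, v},
        pencil b * (u * v) ^ 2 = cst e * (u - cst κ) ^ 2 + (u - cst κ) * v * B + v ^ 2 * C :=
    fun κ e u v p q h => ⟨_, mem u v p, _, mem u v q, h⟩
  let U : MvPolynomial (Fin 4) ℂ := X 0
  let W : MvPolynomial (Fin 4) ℂ := X 1
  let i : MvPolynomial (Fin 4) ℂ := X 2
  let β : MvPolynomial (Fin 4) ℂ := X 3
  have eU (u v : PlaneField) : aeval ![u, v, cst I, cst b] U = u := aeval_X _ _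
  have eW (u v : PlaneField) : aeval ![u, v, cst I, cst b] W = v := aeval_X _ _
  have ei (u v : PlaneField) : aeval ![u, v, cst I, cst b] i = cst I := aeval_X _ _
  have eβ (u v : PlaneField) : aeval ![u, v, cst I, cst b] β = cst b := aeval_X _ _
  clear_value U W i β
  fin_cases j
  on_goal 1 =>
    refine key (-I) (-1) (xc / yc) yc (-2 * U ^ 2 + 2 * i * β)
      (-U ^ 4 + 2 * U ^ 3 + 2 * U * β + β ^ 2 +
        W * (2 * U ^ 4 + 2 * i * U ^ 3 * β + 2 * i * U ^ 2 * β - 2 * U * β ^ 2) +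
        W ^ 2 * (-U ^ 4 - 2 * i * U ^ 3 * β + U ^ 2 * β ^ 2)) ?_
  on_goal 2 =>
    refine key (-1) (-1) xc (yc / xc) (2 * U ^ 2 - 2 * i)
      (-U ^ 4 + 2 * i * U ^ 3 * β + 2 * i * U * β + 1 +
        W * (-2 * i * U ^ 4 * β + 2 * i * U ^ 3 * β + 2 * U ^ 2 * β - 2 * U * β) +
        W ^ 2 * (U ^ 4 * β ^ 2 - 2 * U ^ 3 * β ^ 2 + U ^ 2 * β ^ 2)) ?_
  on_goal 3 =>
    refine key (1) (-1) yc xc⁻¹ (-2 * i * β * U ^ 2 + 2)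
      (U ^ 4 * β ^ 2 + 2 * i * U ^ 3 * β - 2 * i * U - 1 +
        W * (-2 * U ^ 4 * β ^ 2 + 2 * U ^ 3 * β + 2 * i * U ^ 2 * β - 2 * i * U) +
        W ^ 2 * (U ^ 4 * β ^ 2 - 2 * U ^ 3 * β + U ^ 2)) ?_
  on_goal 4 =>
    refine key (I / b) (b ^ 2) (yc / xc) yc⁻¹ (-2 * β ^ 2 * U ^ 2 + 2 * i * β)
      (U ^ 4 * β ^ 2 + 2 * U ^ 3 * β + 2 * U - 1 +
        W * (-2 * U ^ 4 * β + 2 * i * U ^ 3 * β - 2 * i * U ^ 2 - 2 * U) +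
        W ^ 2 * (U ^ 4 - 2 * i * U ^ 3 - U ^ 2)) ?_
  on_goal 5 =>
    refine key (1) (b ^ 2) xc⁻¹ (xc / yc) (-2 * β * U ^ 2 + 2 * i * β)
      (U ^ 4 + 2 * i * U ^ 3 * β + 2 * i * U * β - 1 +
        W * (-2 * i * U ^ 4 - 2 * i * U ^ 3 + 2 * U ^ 2 + 2 * U) +
        W ^ 2 * (-U ^ 4 - 2 * U ^ 3 - U ^ 2)) ?_
  on_goal 6 =>
    refine key (b) (1) yc⁻¹ xc (-2 * i * U ^ 2 + 2 * β)
      (-U ^ 4 - 2 * i * U ^ 3 + 2 * i * U * β + β ^ 2 +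
        W * (-2 * U ^ 4 + 2 * U ^ 3 + 2 * i * U ^ 2 * β - 2 * i * U * β) +
        W ^ 2 * (-U ^ 4 + 2 * U ^ 3 - U ^ 2)) ?_
  all_goals simp only [map_add, map_sub, map_mul, map_neg, map_pow, map_ofNat, map_one, map_div₀,
    eU, eW, ei, eβ]
  · exact pencil_identity_zero hx hy hI2 rfl rfl
  · exact pencil_identity_one hx hy hI2 rfl rfl
  · exact pencil_identity_two hx hy hI2 rfl rfl
  · exact pencil_identity_three hx hy hb' hI2 rfl rfl
  · exact pencil_identity_four hx hy hI2 rfl rfl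
  · exact pencil_identity_five hx hy hI2 rfl rfl

lemma jacobian_corner (j : Fin 6) :
    jacobian (cornerU j) (cornerV j) = cornerU j * cornerV j / (xc * yc) := by
  have hx := isCoord_xc_yc.fst_ne_zero
  have hy := isCoord_xc_yc.snd_ne_zero
  have hJ := jacobian_xc_yc
  have hJ' : jacobian yc xc = -1 := by rw [jacobian_swap, hJ]
  have h2 : jacobian yc xc⁻¹ = (xc ^ 2)⁻¹ := by
    rw [jacobian_swap, jacobian_inv_left hx, hJ]; ring
  have h5 : jacobian yc⁻¹ xc = (yc ^ 2)⁻¹ := by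
    rw [jacobian_inv_left hy, hJ']; ring
  have h34 : jacobian xc⁻¹ yc⁻¹ = (xc ^ 2 * yc ^ 2)⁻¹ := by
    rw [jacobian_inv_left hx, jacobian_swap, jacobian_inv_left hy, hJ', mul_inv]; ring
  have e : ∀ z w : PlaneField, z / w = w⁻¹ / z⁻¹ := fun z w => by rw [inv_div_inv]
  fin_cases j
  · change jacobian (xc / yc) yc = xc / yc * yc / (xc * yc)
    rw [jacobian_div_self_left hy, hJ]; field_simp
  · change jacobian xc (yc / xc) = xc * (yc / xc) / (xc * yc)
    rw [jacobian_div_self_right hx, hJ]; field_simp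
  · change jacobian yc xc⁻¹ = yc * xc⁻¹ / (xc * yc)
    rw [h2]; field_simp
  · change jacobian (yc / xc) yc⁻¹ = yc / xc * yc⁻¹ / (xc * yc)
    rw [e yc xc, jacobian_div_self_left (inv_ne_zero hy), h34]; field_simp
  · change jacobian xc⁻¹ (xc / yc) = xc⁻¹ * (xc / yc) / (xc * yc)
    rw [e xc yc, jacobian_div_self_right (inv_ne_zero hx), h34]; field_simp
  · change jacobian yc⁻¹ xc = yc⁻¹ * xc / (xc * yc)
    rw [h5]; field_simp

lemma f₀_mul_jacobian_corner (j : Fin 6) :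
    f₀ * jacobian (cornerU j) (cornerV j) ^ 2 = (cornerU j * cornerV j) ^ 2 := by
  have hx := isCoord_xc_yc.fst_ne_zero
  have hy := isCoord_xc_yc.snd_ne_zero
  rw [jacobian_corner, f₀]
  field_simp

lemma f₁_mul_eq (z : PlaneField) : f₁ b * z = pencil b * (f₀ * z) := by
  rw [← mul_assoc, pencil_mul_f₀]

/-- `z` is a unit of the local ring `R`. -/
def IsUnitAt (z : PlaneField) (R : Subalgebra ℂ PlaneField) : Prop := z ≠ 0 ∧ z ∈ R ∧ z⁻¹ ∈ R

lemma HasValueAt.isUnitAt [IsLocalRing R] {z : PlaneField} {c : ℂ} (h : HasValueAt z c R)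
    (hc : c ≠ 0) : IsUnitAt z R := ⟨h.ne_zero hc, h.mem, h.inv_mem hc⟩

/-- The pencil is regular at the point with local coordinates `u`, `v`, where `f₀` generates the
square of the anticanonical sheaf. -/
def IsRegularForm (b : ℂ) (u v : PlaneField) : Prop :=
  pencil b ∈ Pt u v ∧ IsUnitAt (f₀ * jacobian u v ^ 2) (Pt u v)

/-- The pencil has a pole at the point with local coordinates `u`, `v`, where `f₁` generates the
square of the anticanonical sheaf. -/
def IsPolarForm (b : ℂ) (u v : PlaneField) : Prop :=
  pencil b ≠ 0 ∧ VanishesAt (pencil b)⁻¹ (Pt u v) ∧ IsUnitAt (f₁ b * jacobian u v ^ 2) (Pt u v)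

lemma isRegularForm_torus {a c : ℂ} (ha : a ≠ 0) (hc : c ≠ 0) :
    IsRegularForm b (xc - cst a) (yc - cst c) := by
  have h := isCoord_xc_yc.sub_const a c
  have := h.isLocalRing
  have hx : HasValueAt xc a _ := h.vanishesAt_fst
  have hy : HasValueAt yc c _ := h.vanishesAt_snd
  have h0 := ((hx.pow 2).mul (hy.pow 2)).isUnitAt (mul_ne_zero (pow_ne_zero 2 ha) (pow_ne_zero 2 hc))
  refine ⟨?_, ?_⟩
  · rw [pencil, div_eq_mul_inv]
    refine mul_mem ?_ h0.2.2
    have hc := fun z => Subalgebra.algebraMap_mem (Pt (xc - cst a) (yc - cst c)) z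
    have h1 := (Pt (xc - cst a) (yc - cst c)).one_mem
    exact mul_mem (add_mem (sub_mem (mul_mem (mul_mem (hc _) hx.mem) (pow_mem (add_mem hx.mem h1) 2))
      (mul_mem (mul_mem (mul_mem (hc _) (add_mem hx.mem (hc _))) (sub_mem (pow_mem hx.mem 2) h1))
      hy.mem)) (mul_mem (mul_mem (hc _) (pow_mem (sub_mem hx.mem h1) 2)) (pow_mem hy.mem 2)))
      (add_mem (mul_mem (mul_mem (neg_mem (hc _)) hx.mem) (sub_mem hy.mem h1))
      (mul_mem hy.mem (sub_mem (mul_mem (hc _) hy.mem) h1)))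
  · rw [jacobian_sub_cst_left, jacobian_sub_cst_right, jacobian_xc_yc, one_pow, mul_one]
    exact h0

lemma isPolarForm_edge (hb : b ≠ 0) {j : Fin 6} {a : ℂ} (ha : a ≠ exampleCoords b j) :
    IsPolarForm b (cornerU j - cst a) (cornerV j) := by
  have h := (isCoord_corner j).sub_const_fst a
  have := h.isLocalRing
  have hu : HasValueAt (cornerU j) a _ := h.vanishesAt_fst
  have hv := h.vanishesAt_snd
  obtain ⟨B, hB, C, hC, hk⟩ := exists_pencil_corner hb j
  have hle : Algebra.adjoin ℂ {cornerU j, cornerV j} ≤ Pt (cornerU j - cst a) (cornerV j) := by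
    rw [Algebra.adjoin_le_iff]
    rintro z (rfl | rfl)
    exacts [hu.mem, hv.mem]
  have hval : HasValueAt (pencil b * (cornerU j * cornerV j) ^ 2)
      (edgeCoeff b j * (a - exampleCoords b j) ^ 2) (Pt (cornerU j - cst a) (cornerV j)) := by
    have h1 := (hasValueAt_const (edgeCoeff b j)).mul
      ((hu.sub (hasValueAt_const (exampleCoords b j))).pow 2)
    have h2 := ((hv.mul_left (hu.sub (hasValueAt_const (exampleCoords b j))).mem).mul_right
      (hle hB)).hasValueAt
    have h3 := ((hv.mul_left hv.mem).mul_right (hle hC)).hasValueAt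
    refine ((h1.add h2).add h3).congr ?_ (by ring)
    rw [hk]; ring
  have hne : edgeCoeff b j * (a - exampleCoords b j) ^ 2 ≠ 0 :=
    mul_ne_zero (edgeCoeff_ne_zero hb j) (pow_ne_zero 2 (sub_ne_zero.mpr ha))
  have hk0 : pencil b ≠ 0 := left_ne_zero_of_mul (hval.ne_zero hne)
  refine ⟨hk0, ?_, ?_⟩
  · have h1 := ((hv.mul_left hv.mem).mul_left (pow_mem hu.mem 2)).mul_right (hval.inv_mem hne)
    have huv : (cornerU j * cornerV j) ^ 2 ≠ 0 := right_ne_zero_of_mul (hval.ne_zero hne)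
    rwa [mul_inv, show cornerU j ^ 2 * (cornerV j * cornerV j) = (cornerU j * cornerV j) ^ 2 by ring,
      mul_left_comm, mul_inv_cancel₀ huv, mul_one] at h1
  · rw [jacobian_sub_cst_left, f₁_mul_eq, f₀_mul_jacobian_corner]
    exact hval.isUnitAt hne

lemma isRegularForm_exceptional (hb : b ≠ 0) (j : Fin 6) (s : ℂ) :
    IsRegularForm b ((cornerU j - cst (exampleCoords b j)) / cornerV j - cst s) (cornerV j) := by
  have h0 := (isCoord_corner j).sub_const_fst (exampleCoords b j)
  have h := h0.div_fst.sub_const_fst s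
  have hv0 := h.snd_ne_zero
  have := h.isLocalRing
  have hv := h.vanishesAt_snd
  set R := Pt ((cornerU j - cst (exampleCoords b j)) / cornerV j - cst s) (cornerV j) with hR
  have hp : HasValueAt ((cornerU j - cst (exampleCoords b j)) / cornerV j) s R := h.vanishesAt_fst
  have hu : HasValueAt (cornerU j) (exampleCoords b j) R := by
    have := hv.mul_left hp.mem
    rwa [div_mul_cancel₀ _ hv0] at this
  obtain ⟨B, hB, C, hC, hk⟩ := exists_pencil_corner hb j
  have hle : Algebra.adjoin ℂ {cornerU j, cornerV j} ≤ R := by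
    rw [Algebra.adjoin_le_iff]
    rintro z (rfl | rfl)
    exacts [hu.mem, hv.mem]
  have hu2 := (hu.pow 2).isUnitAt (pow_ne_zero 2 (exampleCoords_ne_zero hb j))
  refine ⟨?_, ?_⟩
  · have h1 : pencil b = (cst (edgeCoeff b j) *
        ((cornerU j - cst (exampleCoords b j)) / cornerV j) ^ 2 +
        (cornerU j - cst (exampleCoords b j)) / cornerV j * B + C) * (cornerU j ^ 2)⁻¹ := by
      rw [eq_mul_inv_iff_mul_eq₀ hu2.1]
      field_simp
      linear_combination hk
    rw [h1]
    exact mul_mem (add_mem (add_mem (mul_mem (Subalgebra.algebraMap_mem _ _) (pow_mem hp.mem 2))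
      (mul_mem hp.mem (hle hB))) (hle hC)) hu2.2.2
  · rw [jacobian_sub_cst_left, jacobian_div_self_left hv0, jacobian_sub_cst_left, div_pow,
      mul_div_assoc', f₀_mul_jacobian_corner, mul_pow, mul_div_cancel_right₀ _ (pow_ne_zero 2 hv0)]
    exact hu2

lemma isPolarForm_exceptional (hb : b ≠ 0) (j : Fin 6) :
    IsPolarForm b (cornerU j - cst (exampleCoords b j))
      (cornerV j / (cornerU j - cst (exampleCoords b j))) := by
  have h0 := (isCoord_corner j).sub_const_fst (exampleCoords b j)
  have h := h0.div_snd
  have hr0 := h.fst_ne_zero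
  have := h.isLocalRing
  have hw := h.vanishesAt_snd
  have hr := h.vanishesAt_fst
  set R := Pt (cornerU j - cst (exampleCoords b j))
      (cornerV j / (cornerU j - cst (exampleCoords b j))) with hR
  have hu : HasValueAt (cornerU j) (exampleCoords b j) R := hr
  have hv : VanishesAt (cornerV j) R := by
    have := hw.mul_right hr.mem
    rwa [div_mul_cancel₀ _ hr0] at this
  obtain ⟨B, hB, C, hC, hk⟩ := exists_pencil_corner hb j
  have hle : Algebra.adjoin ℂ {cornerU j, cornerV j} ≤ R := by
    rw [Algebra.adjoin_le_iff]
    rintro z (rfl | rfl)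
    exacts [hu.mem, hv.mem]
  obtain ⟨w, hwd⟩ : ∃ w, w = cornerV j / (cornerU j - cst (exampleCoords b j)) := ⟨_, rfl⟩
  rw [← hwd] at hw
  have hval : HasValueAt (pencil b * (cornerU j * w) ^ 2) (edgeCoeff b j) R := by
    have h1 := (hw.mul_right (hle hB)).hasValueAt
    have h2 := ((hw.mul_left hw.mem).mul_right (hle hC)).hasValueAt
    refine (((hasValueAt_const _).add h1).add h2).congr ?_ (by ring)
    rw [hwd]
    field_simp
    linear_combination -hk
  have hne := edgeCoeff_ne_zero hb j
  have hk0 : pencil b ≠ 0 := left_ne_zero_of_mul (hval.ne_zero hne)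
  refine ⟨hk0, ?_, ?_⟩
  · have h1 := ((hw.mul_left hw.mem).mul_left (pow_mem hu.mem 2)).mul_right (hval.inv_mem hne)
    have huv : (cornerU j * w) ^ 2 ≠ 0 := right_ne_zero_of_mul (hval.ne_zero hne)
    rwa [mul_inv, show cornerU j ^ 2 * (w * w) = (cornerU j * w) ^ 2 by ring,
      mul_left_comm, mul_inv_cancel₀ huv, mul_one] at h1
  · have e : f₁ b * jacobian (cornerU j - cst (exampleCoords b j))
        (cornerV j / (cornerU j - cst (exampleCoords b j))) ^ 2 = pencil b * (cornerU j * w) ^ 2 := by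
      rw [jacobian_div_self_right hr0, jacobian_sub_cst_left, div_pow, mul_div_assoc', f₁_mul_eq,
        f₀_mul_jacobian_corner, hwd]
      field_simp
    rw [e]
    exact hval.isUnitAt hne

lemma exists_isLocalForm (hb : b ≠ 0) (hR : R ∈ exampleSurface b) :
    ∃ u v, IsCoord u v ∧ R = Pt u v ∧ (IsRegularForm b u v ∨ IsPolarForm b u v) := by
  rw [exampleSurface_eq hb] at hR
  rcases hR with ⟨a, c, ha, hc, rfl⟩ | ⟨j, a, ha, haj, rfl⟩ | ⟨j, rfl⟩ | ⟨j, h⟩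
  · exact ⟨_, _, isCoord_xc_yc.sub_const a c, rfl, Or.inl (isRegularForm_torus ha hc)⟩
  · exact ⟨_, _, (isCoord_corner j).sub_const_fst a, rfl, Or.inr (isPolarForm_edge hb haj)⟩
  · have := isPolarForm_edge hb (exampleCoords_ne_zero hb j).symm
    rw [sub_cst_zero] at this
    exact ⟨_, _, isCoord_corner j, rfl, Or.inr this⟩
  · have h0 := (isCoord_corner j).sub_const_fst (exampleCoords b j)
    rw [h0.exceptionalPoints_eq_swap] at h
    rcases h with ⟨s, rfl⟩ | rfl
    · exact ⟨_, _, h0.div_fst.sub_const_fst s, rfl, Or.inl (isRegularForm_exceptional hb j s)⟩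
    · exact ⟨_, _, h0.div_snd, rfl, Or.inr (isPolarForm_exceptional hb j)⟩

lemma localForm_mem (h : IsRegularForm b u v ∨ IsPolarForm b u v) :
    f₀ * jacobian u v ^ 2 ∈ Pt u v ∧ f₁ b * jacobian u v ^ 2 ∈ Pt u v := by
  rcases h with ⟨hk, -, h, -⟩ | ⟨hk0, hk, -, h, -⟩
  · refine ⟨h, ?_⟩
    rw [f₁_mul_eq]
    exact mul_mem hk h
  · refine ⟨?_, h⟩
    have := mul_mem hk.mem h
    rwa [f₁_mul_eq, inv_mul_cancel_left₀ hk0] at this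

lemma pencil_mem_or_inv_mem (hb : b ≠ 0) (hR : R ∈ exampleSurface b) :
    pencil b ∈ R ∨ (pencil b)⁻¹ ∈ R := by
  obtain ⟨u, v, -, rfl, ⟨hk, -⟩ | ⟨-, hk, -⟩⟩ := exists_isLocalForm hb hR
  exacts [Or.inl hk, Or.inr hk.mem]

lemma f₀_mem_antiPluricanonical (hb : b ≠ 0) : f₀ ∈ antiPluricanonical (exampleSurface b) 2 :=
  mem_antiPluricanonical_of_coord fun R hR => by
    obtain ⟨u, v, h, rfl, hf⟩ := exists_isLocalForm hb hR
    exact ⟨u, v, h, rfl, (localForm_mem hf).1⟩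

lemma f₁_mem_antiPluricanonical (hb : b ≠ 0) : f₁ b ∈ antiPluricanonical (exampleSurface b) 2 :=
  mem_antiPluricanonical_of_coord fun R hR => by
    obtain ⟨u, v, h, rfl, hf⟩ := exists_isLocalForm hb hR
    exact ⟨u, v, h, rfl, (localForm_mem hf).2⟩

end Pencil

section Laurent

open MvPolynomial

variable {u v z : PlaneField} {R : Subalgebra ℂ PlaneField}

lemma hasValueAt_sum {ι : Type*} {s : Finset ι} {f : ι → PlaneField} {c : ι → ℂ}
    (h : ∀ i ∈ s, HasValueAt (f i) (c i) R) : HasValueAt (∑ i ∈ s, f i) (∑ i ∈ s, c i) R := by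
  classical
  induction s using Finset.induction_on with
  | empty => simpa using (vanishesAt_zero : VanishesAt (0 : PlaneField) R).hasValueAt
  | insert a s ha ih =>
    rw [Finset.sum_insert ha, Finset.sum_insert ha]
    exact (h a (Finset.mem_insert_self a s)).add (ih fun i hi => h i (Finset.mem_insert_of_mem hi))

lemma HasValueAt.zpow [IsLocalRing R] {c : ℂ} (h : HasValueAt z c R) (hc : c ≠ 0) (n : ℤ) :
    HasValueAt (z ^ n) (c ^ n) R := by
  cases n with
  | ofNat n => simpa using h.pow n
  | negSucc n => simpa using (h.pow (n + 1)).inv (pow_ne_zero _ hc)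

lemma zpow_mem_of_nonneg (hz : z ∈ R) {n : ℤ} (hn : 0 ≤ n) : z ^ n ∈ R := by
  lift n to ℕ using hn
  simpa using pow_mem hz n

lemma VanishesAt.zpow_pos (hz : VanishesAt z R) {n : ℤ} (hn : 0 < n) : VanishesAt (z ^ n) R := by
  lift n to ℕ using hn.le
  obtain ⟨n, rfl⟩ := Nat.exists_eq_succ_of_ne_zero (by exact_mod_cast hn.ne' : n ≠ 0)
  rw [zpow_natCast, pow_succ]
  exact hz.mul_left (pow_mem hz.mem n)

/-- The Laurent polynomial with coefficients `A`, evaluated at `u`, `v`. -/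
def laurent (u v : PlaneField) (A : ℤ × ℤ →₀ ℂ) : PlaneField :=
  A.sum fun p c => cst c * (u ^ p.1 * v ^ p.2)

lemma laurent_mapDomain (e : ℤ × ℤ ≃ ℤ × ℤ) (A : ℤ × ℤ →₀ ℂ) {u' v' : PlaneField}
    (h : ∀ p : ℤ × ℤ, u' ^ (e p).1 * v' ^ (e p).2 = u ^ p.1 * v ^ p.2) :
    laurent u' v' (A.equivMapDomain e) = laurent u v A := by
  rw [laurent, Finsupp.equivMapDomain_eq_mapDomain,
    Finsupp.sum_mapDomain_index (fun _ => by rw [cst_zero, zero_mul])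
      (fun _ _ _ => by rw [cst_add, add_mul])]
  exact Finset.sum_congr rfl fun p _ => by simp only [h]

/-- A rational function without poles on the torus is a Laurent polynomial. -/
lemma exists_laurent {f : PlaneField}
    (hf : ∀ a c : ℂ, a ≠ 0 → c ≠ 0 → f ∈ Pt (xc - cst a) (yc - cst c)) :
    ∃ A, f = laurent xc yc A := by
  have hx := isCoord_xc_yc.fst_ne_zero
  have hy := isCoord_xc_yc.snd_ne_zero
  let I : Ideal (MvPolynomial (Fin 2) ℂ) :=
    { carrier := {q | ∃ P : MvPolynomial (Fin 2) ℂ, f * aeval ![xc, yc] q = aeval ![xc, yc] P}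
      add_mem' := by
        rintro q r ⟨P, hP⟩ ⟨Q, hQ⟩
        exact ⟨P + Q, by rw [map_add, map_add, mul_add, hP, hQ]⟩
      zero_mem' := ⟨0, by rw [map_zero, mul_zero]⟩
      smul_mem' := by
        rintro r q ⟨P, hP⟩
        exact ⟨r * P, by rw [smul_eq_mul, map_mul, map_mul, mul_left_comm, hP]⟩ }
  have hI : X 0 * X 1 ∈ vanishingIdeal ℂ (zeroLocus ℂ I) := by
    rw [mem_vanishingIdeal_iff]
    intro w hw
    by_contra hne
    simp only [map_mul, aeval_X, mul_eq_zero, not_or] at hne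
    obtain ⟨p, q, hq, hpq⟩ := hf (w 0) (w 1) hne.1 hne.2
    have e : ∀ r : MvPolynomial (Fin 2) ℂ, aeval ![xc - cst (w 0), yc - cst (w 1)] r =
        aeval ![xc, yc] (aeval ![X 0 - C (w 0), X 1 - C (w 1)] r) := by
      have : aeval ![xc - cst (w 0), yc - cst (w 1)] = (aeval ![xc, yc]).comp
          (aeval ![(X 0 - C (w 0) : MvPolynomial (Fin 2) ℂ), X 1 - C (w 1)]) := by
        ext i
        fin_cases i
        · simp
        · simp
      intro r
      rw [this, AlgHom.comp_apply]
    have hq0 := ((isCoord_xc_yc.sub_const (w 0) (w 1)).aeval_ne_zero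
      (ne_zero_of_constantCoeff_ne_zero hq))
    have hmem : aeval ![X 0 - C (w 0), X 1 - C (w 1)] q ∈ I :=
      ⟨aeval ![X 0 - C (w 0), X 1 - C (w 1)] p, by
        rw [← e, ← e, hpq.2, div_mul_cancel₀ _ hq0]⟩
    have h0 := (mem_zeroLocus_iff.mp hw) _ hmem
    apply hq
    have : aeval ![(0 : ℂ), 0] = (aeval w).comp
        (aeval ![(X 0 - C (w 0) : MvPolynomial (Fin 2) ℂ), X 1 - C (w 1)]) := by
      ext i
      fin_cases i
      · simp
      · simp
    rw [← aeval_zero_eq_constantCoeff, this, AlgHom.comp_apply, h0]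
  rw [vanishingIdeal_zeroLocus_eq_radical] at hI
  obtain ⟨N, P, hP⟩ := hI
  let e : (Fin 2 →₀ ℕ) ↪ ℤ × ℤ := ⟨fun d => ((d 0 : ℤ) - N, (d 1 : ℤ) - N), fun d d' h => by
    have h' := Prod.ext_iff.mp h
    ext i
    fin_cases i
    · have := h'.1; simp only at this ⊢; simpa using this
    · have := h'.2; simp only at this ⊢; simpa using this⟩
  refine ⟨Finsupp.embDomain e (AddMonoidAlgebra.coeff P), ?_⟩
  rw [laurent, Finsupp.sum_embDomain]
  simp only [map_pow, map_mul, aeval_X] at hP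
  rw [aeval_def, eval₂_eq'] at hP
  rw [eq_div_of_mul_eq (pow_ne_zero N (mul_ne_zero hx hy)) hP, Finset.sum_div]
  refine Finset.sum_congr rfl fun d _ => ?_
  rw [Fin.prod_univ_two, mul_div_assoc, mul_pow, mul_div_mul_comm]
  change _ = cst _ * (xc ^ ((d 0 : ℤ) - N) * yc ^ ((d 1 : ℤ) - N))
  rw [zpow_sub₀ hx, zpow_sub₀ hy]
  simp only [zpow_natCast]
  rfl

lemma exists_slice_eq_zero (A : ℤ × ℤ →₀ ℂ) (n : ℤ) {S : Set ℂ} (hS : S.Finite)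
    (h : ∀ a ∉ S, ∑ p ∈ A.support with p.2 = n, A p * a ^ p.1 = 0) (m : ℤ) : A (m, n) = 0 := by
  by_contra hm
  obtain ⟨M, hM⟩ : ∃ M : ℕ, ∀ p ∈ A.support, 0 ≤ p.1 + M := by
    refine ⟨A.support.sup fun p => p.1.natAbs, fun p hp => ?_⟩
    have := Finset.le_sup (f := fun p : ℤ × ℤ => p.1.natAbs) hp
    omega
  let P : Polynomial ℂ := ∑ p ∈ A.support with p.2 = n, Polynomial.monomial (p.1 + M).toNat (A p)
  have hP : P = 0 := by
    refine Polynomial.eq_zero_of_infinite_isRoot P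
      (Set.Infinite.mono (s := (insert 0 S)ᶜ) (fun a ha => ?_) (hS.insert 0).infinite_compl)
    have ha' := not_or.mp ha
    change P.eval a = 0
    rw [Polynomial.eval_finsetSum, ← mul_zero (a ^ M), ← h a ha'.2, Finset.mul_sum]
    refine Finset.sum_congr rfl fun p hp => ?_
    rw [Polynomial.eval_monomial, mul_left_comm, ← zpow_natCast, ← zpow_natCast,
      Int.toNat_of_nonneg (hM p (Finset.mem_filter.mp hp).1), ← zpow_add₀ ha'.1, add_comm (M : ℤ)]
  have hmem : (m, n) ∈ A.support := Finsupp.mem_support_iff.mpr hm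
  have h1 : P.coeff (m + M).toNat = A (m, n) := by
    rw [Polynomial.finsetSum_coeff, Finset.sum_eq_single (m, n)]
    · rw [Polynomial.coeff_monomial, if_pos rfl]
    · intro p hp hne
      rw [Polynomial.coeff_monomial, if_neg]
      intro he
      have hp' := Finset.mem_filter.mp hp
      have h1 := hM p hp'.1
      have h2 := hM _ hmem
      simp only at h2
      exact hne (Prod.ext (by simp only; omega) hp'.2)
    · exact fun h => (h (Finset.mem_filter.mpr ⟨hmem, rfl⟩)).elim
  rw [hP, Polynomial.coeff_zero] at h1
  exact hm h1.symm

lemma IsCoord.hasValueAt_laurent (h : IsCoord u v) {a : ℂ} (ha : a ≠ 0) (A : ℤ × ℤ →₀ ℂ) (N : ℤ)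
    (hA : ∀ p ∈ A.support, N ≤ p.2) : HasValueAt (laurent u v A * v ^ (-N))
      (∑ p ∈ A.support with p.2 = N, A p * a ^ p.1) (Pt (u - cst a) v) := by
  have hc := h.sub_const_fst a
  have := hc.isLocalRing
  have hu : HasValueAt u a (Pt (u - cst a) v) := hc.vanishesAt_fst
  have hv : VanishesAt v (Pt (u - cst a) v) := hc.vanishesAt_snd
  rw [laurent, Finsupp.sum, Finset.sum_mul, Finset.sum_filter]
  refine hasValueAt_sum fun p hp => ?_
  have e : cst (A p) * (u ^ p.1 * v ^ p.2) * v ^ (-N) = cst (A p) * u ^ p.1 * v ^ (p.2 - N) := by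
    rw [sub_eq_add_neg, zpow_add₀ h.snd_ne_zero]; ring
  have h1 := (hasValueAt_const (R := Pt (u - cst a) v) (A p)).mul (hu.zpow ha p.1)
  rw [e]
  split_ifs with hN
  · rw [hN, sub_self, zpow_zero, mul_one]
    exact h1
  · have h2 := hv.zpow_pos (n := p.2 - N) (by have := hA p hp; omega)
    exact (h2.mul_left h1.mem).hasValueAt

/-- A Laurent polynomial regular at almost all points of the axis `v = 0` has no negative powers
of `v`. -/
lemma IsCoord.nonneg_of_laurent_mem (h : IsCoord u v) (A : ℤ × ℤ →₀ ℂ) {S : Set ℂ} (hS : S.Finite)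
    {N : ℤ} (hA : ∀ a ∉ S, laurent u v A * v ^ N ∈ Pt (u - cst a) v) {p : ℤ × ℤ} (hp : A p ≠ 0) :
    -N ≤ p.2 := by
  obtain ⟨q, hq, hmin⟩ := A.support.exists_min_image Prod.snd
    ⟨p, Finsupp.mem_support_iff.mpr hp⟩
  refine le_trans ?_ (hmin p (Finsupp.mem_support_iff.mpr hp))
  by_contra! hlt
  refine (Finsupp.mem_support_iff.mp hq) (exists_slice_eq_zero A q.2 (hS.insert 0) (fun a ha => ?_) q.1)
  have ha' := not_or.mp ha
  have hc := h.sub_const_fst a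
  have := hc.isLocalRing
  refine (h.hasValueAt_laurent ha'.1 A q.2 hmin).eq (VanishesAt.hasValueAt ?_)
  have h1 := (hc.vanishesAt_snd.zpow_pos (n := -q.2 - N) (by omega)).mul_left (hA a ha'.2)
  rwa [mul_assoc, ← zpow_add₀ h.snd_ne_zero, add_sub_cancel] at h1

end Laurent

section AntiBicanonical

variable {u v f : PlaneField} {b : ℂ} {A : ℤ × ℤ →₀ ℂ}

/-- Exponents of a monomial in `xc`, `yc`, rewritten in the `j`-th corner coordinates. -/
def cornerExp : Fin 6 → ℤ × ℤ ≃ ℤ × ℤ :=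
  ![⟨fun p => (p.1, p.1 + p.2), fun p => (p.1, p.2 - p.1), fun p => by simp, fun p => by simp⟩,
    ⟨fun p => (p.1 + p.2, p.2), fun p => (p.1 - p.2, p.2), fun p => by simp, fun p => by simp⟩,
    ⟨fun p => (p.2, -p.1), fun p => (-p.2, p.1), fun p => by simp, fun p => by simp⟩,
    ⟨fun p => (-p.1, -p.1 - p.2), fun p => (-p.1, p.1 - p.2), fun p => by simp, fun p => by simp⟩,
    ⟨fun p => (-p.1 - p.2, -p.2), fun p => (p.2 - p.1, -p.2), fun p => by ext <;> simp; ring, fun p => by simp⟩,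
    ⟨fun p => (-p.2, p.1), fun p => (p.2, -p.1), fun p => by simp, fun p => by simp⟩]

lemma corner_monomial (j : Fin 6) (p : ℤ × ℤ) :
    cornerU j ^ (cornerExp j p).1 * cornerV j ^ (cornerExp j p).2 = xc ^ p.1 * yc ^ p.2 := by
  have hx := isCoord_xc_yc.fst_ne_zero
  have hy := isCoord_xc_yc.snd_ne_zero
  fin_cases j
  · change (xc / yc) ^ p.1 * yc ^ (p.1 + p.2) = _
    rw [div_zpow, zpow_add₀ hy]; field_simp
  · change xc ^ (p.1 + p.2) * (yc / xc) ^ p.2 = _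
    rw [div_zpow, zpow_add₀ hx]; field_simp
  · change yc ^ p.2 * xc⁻¹ ^ (-p.1) = _
    rw [inv_zpow', neg_neg, mul_comm]
  · change (yc / xc) ^ (-p.1) * yc⁻¹ ^ (-p.1 - p.2) = _
    rw [inv_zpow', div_zpow, neg_sub, sub_neg_eq_add, zpow_add₀ hy, zpow_neg, zpow_neg]; field_simp
  · change xc⁻¹ ^ (-p.1 - p.2) * (xc / yc) ^ (-p.2) = _
    rw [inv_zpow', div_zpow, neg_sub, sub_neg_eq_add, zpow_add₀ hx, zpow_neg, zpow_neg]; field_simp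
  · change yc⁻¹ ^ (-p.2) * xc ^ p.1 = _
    rw [inv_zpow', neg_neg, mul_comm]

lemma laurent_corner (j : Fin 6) (A : ℤ × ℤ →₀ ℂ) :
    laurent (cornerU j) (cornerV j) (A.equivMapDomain (cornerExp j)) = laurent xc yc A :=
  laurent_mapDomain _ _ (corner_monomial j)

/-- The exponents in the hexagon. -/
def IsHexagonal (p : ℤ × ℤ) : Prop :=
  (-2 ≤ p.1 ∧ p.1 ≤ 2) ∧ (-2 ≤ p.2 ∧ p.2 ≤ 2) ∧ -2 ≤ p.1 - p.2 ∧ p.1 - p.2 ≤ 2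

lemma laurent_eq_sum (hA : ∀ p, A p ≠ 0 → IsHexagonal p) : laurent u v A =
    ∑ n ∈ Finset.Icc (-2 : ℤ) 2, ∑ m ∈ Finset.Icc (-2 : ℤ) 2, cst (A (m, n)) * (u ^ m * v ^ n) := by
  rw [← Finset.sum_product_right', laurent]
  refine Finset.sum_subset (fun p hp => ?_) (fun p _ hp => ?_)
  · obtain ⟨h1, h2, -⟩ := hA p (Finsupp.mem_support_iff.mp hp)
    exact Finset.mem_product.mpr ⟨Finset.mem_Icc.mpr h1, Finset.mem_Icc.mpr h2⟩
  · simp only [Finsupp.notMem_support_iff.mp hp]; rw [cst_zero, zero_mul]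

lemma laurent_hexagonal (hu : u ≠ 0) (hv : v ≠ 0) (hA : ∀ p, A p ≠ 0 → IsHexagonal p) :
    ∃ C ∈ Algebra.adjoin ℂ {u, v}, laurent u v A * u ^ 2 * v ^ 2 =
      cst (A (-2, -2)) + cst (A (-1, -2)) * u + cst (A (0, -2)) * u ^ 2 +
      v * (cst (A (-2, -1)) + cst (A (-1, -1)) * u + cst (A (0, -1)) * u ^ 2 +
        cst (A (1, -1)) * u ^ 3) + v ^ 2 * C := by
  have h0 : ∀ m n : ℤ, ¬ IsHexagonal (m, n) → cst (A (m, n)) = 0 := fun m n h => by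
    by_cases hA' : A (m, n) = 0
    · rw [hA', cst_zero]
    · exact absurd (hA _ hA') h
  have hu' : u ∈ Algebra.adjoin ℂ {u, v} := Algebra.subset_adjoin (by simp)
  have hv' : v ∈ Algebra.adjoin ℂ {u, v} := Algebra.subset_adjoin (by simp)
  refine ⟨∑ n ∈ Finset.Icc (0 : ℤ) 2, ∑ m ∈ Finset.Icc (-2 : ℤ) 2,
    cst (A (m, n)) * (u ^ (m + 2) * v ^ n), ?_, ?_⟩
  · refine sum_mem fun n hn => sum_mem fun m hm => mul_mem (Subalgebra.algebraMap_mem _ _)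
      (mul_mem (zpow_mem_of_nonneg hu' ?_) (zpow_mem_of_nonneg hv' (Finset.mem_Icc.mp hn).1))
    have := (Finset.mem_Icc.mp hm).1
    omega
  · have e : Finset.Icc (-2 : ℤ) 2 = insert (-2) (insert (-1) (Finset.Icc 0 2)) := by decide
    have e' : Finset.Icc (-2 : ℤ) 2 = {-2, -1, 0, 1, 2} := by decide
    have e2 : ∀ n : ℤ, ∑ m ∈ Finset.Icc (-2 : ℤ) 2, cst (A (m, n)) * (u ^ m * v ^ n) =
        cst (A (-2, n)) * (u ^ (-2 : ℤ) * v ^ n) + (cst (A (-1, n)) * (u ^ (-1 : ℤ) * v ^ n) +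
        (cst (A (0, n)) * (u ^ (0 : ℤ) * v ^ n) + (cst (A (1, n)) * (u ^ (1 : ℤ) * v ^ n) +
          cst (A (2, n)) * (u ^ (2 : ℤ) * v ^ n)))) := by
      intro n
      rw [e', Finset.sum_insert (by decide), Finset.sum_insert (by decide),
        Finset.sum_insert (by decide), Finset.sum_insert (by decide), Finset.sum_singleton]
    rw [laurent_eq_sum hA]
    nth_rewrite 1 [e]
    rw [Finset.sum_insert (by decide), Finset.sum_insert (by decide), e2, e2,
      h0 1 (-2) (by simp [IsHexagonal]), h0 2 (-2) (by simp [IsHexagonal]),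
      h0 2 (-1) (by simp [IsHexagonal])]
    have e3 : v ^ 2 * ∑ n ∈ Finset.Icc (0 : ℤ) 2, ∑ m ∈ Finset.Icc (-2 : ℤ) 2,
        cst (A (m, n)) * (u ^ (m + 2) * v ^ n) = (∑ n ∈ Finset.Icc (0 : ℤ) 2,
        ∑ m ∈ Finset.Icc (-2 : ℤ) 2, cst (A (m, n)) * (u ^ m * v ^ n)) * u ^ 2 * v ^ 2 := by
      rw [mul_comm (v ^ 2), Finset.sum_mul, Finset.sum_mul, Finset.sum_mul]
      refine Finset.sum_congr rfl fun n _ => ?_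
      rw [Finset.sum_mul, Finset.sum_mul, Finset.sum_mul]
      refine Finset.sum_congr rfl fun m _ => ?_
      rw [zpow_add₀ hu, zpow_ofNat]; ring
    rw [e3, zpow_neg, zpow_neg, zpow_neg, zpow_neg, zpow_ofNat, zpow_ofNat, zpow_one, zpow_one,
      zpow_zero]
    generalize ∑ n ∈ Finset.Icc (0 : ℤ) 2,
        ∑ m ∈ Finset.Icc (-2 : ℤ) 2, cst (A (m, n)) * (u ^ m * v ^ n) = Z
    field_simp
    ring

/-- The conditions imposed by a blown up point `u = κ` of the axis `v = 0`. -/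
lemma IsCoord.laurent_conditions (h : IsCoord u v) {κ : ℂ} (hA : ∀ p, A p ≠ 0 → IsHexagonal p)
    (H : ∀ s, laurent u v A * u ^ 2 ∈ Pt ((u - cst κ) / v - cst s) v) :
    A (-2, -2) + A (-1, -2) * κ + A (0, -2) * κ ^ 2 = 0 ∧ A (-1, -2) + 2 * A (0, -2) * κ = 0 ∧
    A (-2, -1) + A (-1, -1) * κ + A (0, -1) * κ ^ 2 + A (1, -1) * κ ^ 3 = 0 := by
  obtain ⟨C, hC, e⟩ := laurent_hexagonal h.fst_ne_zero h.snd_ne_zero hA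
  have key : ∀ s : ℂ, A (-2, -2) + A (-1, -2) * κ + A (0, -2) * κ ^ 2 = 0 ∧
      s * (A (-1, -2) + A (0, -2) * (κ + κ)) +
        (A (-2, -1) + A (-1, -1) * κ + A (0, -1) * κ ^ 2 + A (1, -1) * κ ^ 3) = 0 := by
    intro s
    have hc := (h.sub_const_fst κ).div_fst.sub_const_fst s
    have := hc.isLocalRing
    have hH := H s
    have hw : HasValueAt ((u - cst κ) / v) s (Pt ((u - cst κ) / v - cst s) v) := hc.vanishesAt_fst
    have hv : HasValueAt v 0 (Pt ((u - cst κ) / v - cst s) v) := hc.vanishesAt_snd.hasValueAt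
    have eu : cst κ + v * ((u - cst κ) / v) = u := by
      rw [mul_div_cancel₀ _ h.snd_ne_zero]; ring
    have hu : HasValueAt u κ (Pt ((u - cst κ) / v - cst s) v) :=
      ((hasValueAt_const κ).add (hv.mul hw)).congr eu (by ring)
    have hCm : C ∈ Pt ((u - cst κ) / v - cst s) v := by
      have : Algebra.adjoin ℂ {u, v} ≤ Pt ((u - cst κ) / v - cst s) v :=
        Algebra.adjoin_le (by rintro _ (rfl | rfl); exacts [hu.mem, hv.mem])
      exact this hC
    have hconst : ∀ c : ℂ, HasValueAt (cst c) c (Pt ((u - cst κ) / v - cst s) v) :=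
      hasValueAt_const
    have h0 : ∀ z ∈ Pt ((u - cst κ) / v - cst s) v,
        HasValueAt (v * z) 0 (Pt ((u - cst κ) / v - cst s) v) := fun z hz =>
      (hv.vanishesAt.mul_right hz).hasValueAt
    set c0 := A (-2, -2)
    set c1 := A (-1, -2)
    set c2 := A (0, -2)
    set d0 := A (-2, -1)
    set d1 := A (-1, -1)
    set d2 := A (0, -1)
    set d3 := A (1, -1)
    have hd := (((hconst d0).add ((hconst d1).mul hu)).add ((hconst d2).mul (hu.pow 2))).add
      ((hconst d3).mul (hu.pow 3))
    have hq := ((hconst c0).add ((hconst c1).mul hu)).add ((hconst c2).mul (hu.pow 2))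
    have e1 : c0 + c1 * κ + c2 * κ ^ 2 = 0 := by
      refine hq.eq ((h0 _ (sub_mem (sub_mem (mul_mem hH hv.mem) hd.mem)
        (mul_mem hv.mem hCm))).congr ?_ rfl)
      linear_combination e
    refine ⟨e1, ?_⟩
    have e1' := congrArg cst e1
    rw [cst_add, cst_add, cst_mul, cst_mul, cst_pow, cst_zero] at e1'
    have hq' := (hw.mul ((hconst c1).add ((hconst c2).mul (hu.add (hconst κ))))).add hd
    refine hq'.eq ((h0 _ (sub_mem hH hCm)).congr ?_ rfl)
    refine mul_left_cancel₀ h.snd_ne_zero ?_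
    have ew : v * ((u - cst κ) / v) = u - cst κ := mul_div_cancel₀ _ h.snd_ne_zero
    linear_combination e - (cst c1 + cst c2 * (u + cst κ)) * ew + e1'
  obtain ⟨h1, h2⟩ := key 0
  obtain ⟨-, h3⟩ := key 1
  exact ⟨h1, by linear_combination h3 - h2, by linear_combination h2⟩

/-- The Laurent expansion of `f / f₀`, for a section `f` of the square of the anticanonical
sheaf. -/
lemma exists_laurent_of_mem_antiPluricanonical (hb : b ≠ 0)
    (hf : f ∈ antiPluricanonical (exampleSurface b) 2) :
    ∃ A, f = f₀ * laurent xc yc A ∧ (∀ p, A p ≠ 0 → (-2 ≤ p.1 ∧ p.1 ≤ 2) ∧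
      (-2 ≤ p.2 ∧ p.2 ≤ 2) ∧ -2 ≤ p.1 + p.2 ∧ p.1 + p.2 ≤ 2) := by
  rw [exampleSurface_eq hb] at hf
  obtain ⟨A, hA⟩ := exists_laurent (f := f / f₀) fun a c ha hc => by
    have h := isCoord_xc_yc.sub_const a c
    have := h.isLocalRing
    have hx : HasValueAt xc a _ := h.vanishesAt_fst
    have hy : HasValueAt yc c _ := h.vanishesAt_snd
    have h0 : HasValueAt f₀ _ _ := (hx.pow 2).mul (hy.pow 2)
    have h1 := h.mem_of_mem_antiPluricanonical (.inl ⟨a, c, ha, hc, rfl⟩) hf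
    rw [jacobian_sub_cst_left, jacobian_sub_cst_right, jacobian_xc_yc, one_pow, mul_one] at h1
    exact mul_mem h1 (h0.inv_mem (mul_ne_zero (pow_ne_zero 2 ha) (pow_ne_zero 2 hc)))
  have hA' := (div_eq_iff f₀_ne_zero).mp hA
  rw [mul_comm] at hA'
  have key : ∀ (j : Fin 6) p, A p ≠ 0 → -2 ≤ (cornerExp j p).2 := by
    intro j p hp
    have hc := isCoord_corner j
    refine hc.nonneg_of_laurent_mem (A.equivMapDomain (cornerExp j)) (S := {0, exampleCoords b j})
      (Set.toFinite _) (N := 2) (fun a ha => ?_) (by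
        rwa [Finsupp.equivMapDomain_apply, Equiv.symm_apply_apply])
    have ha' := not_or.mp ha
    have h := hc.sub_const_fst a
    have := h.isLocalRing
    have hu : HasValueAt (cornerU j) a _ := h.vanishesAt_fst
    have h1 := h.mem_of_mem_antiPluricanonical (.inr (.inl ⟨j, a, ha'.1, ha'.2, rfl⟩)) hf
    rw [jacobian_sub_cst_left, hA', mul_right_comm, f₀_mul_jacobian_corner] at h1
    have h2 := mul_mem h1 ((hu.pow 2).inv_mem (pow_ne_zero 2 ha'.1))
    rw [laurent_corner, zpow_ofNat]
    convert h2 using 1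
    have := hc.fst_ne_zero
    field_simp
  refine ⟨A, hA', fun p hp => ?_⟩
  have h0 : -2 ≤ p.1 + p.2 := key 0 p hp
  have h1 : -2 ≤ p.2 := key 1 p hp
  have h2 : -2 ≤ -p.1 := key 2 p hp
  have h3 : -2 ≤ -p.1 - p.2 := key 3 p hp
  have h4 : -2 ≤ -p.2 := key 4 p hp
  have h5 : -2 ≤ p.1 := key 5 p hp
  omega

lemma corner_conditions (hb : b ≠ 0) (hf : f₀ * laurent xc yc A ∈
      antiPluricanonical (exampleSurface b) 2) (hA : ∀ p, A p ≠ 0 → (-2 ≤ p.1 ∧ p.1 ≤ 2) ∧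
      (-2 ≤ p.2 ∧ p.2 ≤ 2) ∧ -2 ≤ p.1 + p.2 ∧ p.1 + p.2 ≤ 2) (j : Fin 6) :
    let B := fun m n => A ((cornerExp j).symm (m, n))
    let κ := exampleCoords b j
    B (-2) (-2) + B (-1) (-2) * κ + B 0 (-2) * κ ^ 2 = 0 ∧ B (-1) (-2) + 2 * B 0 (-2) * κ = 0 ∧
    B (-2) (-1) + B (-1) (-1) * κ + B 0 (-1) * κ ^ 2 + B 1 (-1) * κ ^ 3 = 0 := by
  rw [exampleSurface_eq hb] at hf
  have hc := isCoord_corner j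
  refine hc.laurent_conditions (A := A.equivMapDomain (cornerExp j)) (fun p hp => ?_) fun s => ?_
  · have h := hA _ hp
    fin_cases j
    · have h' : (-2 ≤ p.1 ∧ p.1 ≤ 2) ∧ (-2 ≤ p.2 - p.1 ∧ p.2 - p.1 ≤ 2) ∧
        -2 ≤ p.1 + (p.2 - p.1) ∧ p.1 + (p.2 - p.1) ≤ 2 := h
      unfold IsHexagonal; omega
    · have h' : (-2 ≤ p.1 - p.2 ∧ p.1 - p.2 ≤ 2) ∧ (-2 ≤ p.2 ∧ p.2 ≤ 2) ∧
        -2 ≤ p.1 - p.2 + p.2 ∧ p.1 - p.2 + p.2 ≤ 2 := h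
      unfold IsHexagonal; omega
    · have h' : (-2 ≤ -p.2 ∧ -p.2 ≤ 2) ∧ (-2 ≤ p.1 ∧ p.1 ≤ 2) ∧
        -2 ≤ -p.2 + p.1 ∧ -p.2 + p.1 ≤ 2 := h
      unfold IsHexagonal; omega
    · have h' : (-2 ≤ -p.1 ∧ -p.1 ≤ 2) ∧ (-2 ≤ p.1 - p.2 ∧ p.1 - p.2 ≤ 2) ∧
        -2 ≤ -p.1 + (p.1 - p.2) ∧ -p.1 + (p.1 - p.2) ≤ 2 := h
      unfold IsHexagonal; omega
    · have h' : (-2 ≤ p.2 - p.1 ∧ p.2 - p.1 ≤ 2) ∧ (-2 ≤ -p.2 ∧ -p.2 ≤ 2) ∧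
        -2 ≤ p.2 - p.1 + -p.2 ∧ p.2 - p.1 + -p.2 ≤ 2 := h
      unfold IsHexagonal; omega
    · have h' : (-2 ≤ p.2 ∧ p.2 ≤ 2) ∧ (-2 ≤ -p.1 ∧ -p.1 ≤ 2) ∧
        -2 ≤ p.2 + -p.1 ∧ p.2 + -p.1 ≤ 2 := h
      unfold IsHexagonal; omega
  · have h0 := hc.sub_const_fst (exampleCoords b j)
    have h1 := (h0.div_fst.sub_const_fst s).mem_of_mem_antiPluricanonical
      (.inr (.inr (.inr ⟨j, by
        rw [h0.exceptionalPoints_eq_swap]; exact .inl ⟨s, rfl⟩⟩))) hf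
    rw [jacobian_sub_cst_left, jacobian_div_self_left hc.snd_ne_zero, jacobian_sub_cst_left,
      div_pow, mul_div_assoc', mul_right_comm, f₀_mul_jacobian_corner] at h1
    rw [laurent_corner]
    convert h1 using 1
    have := hc.snd_ne_zero
    field_simp

/-- A section of the square of the anticanonical sheaf, one coefficient of which vanishes, is a
multiple of `f₀`. -/
lemma eq_const_of_coeff_eq_zero (hb : b ≠ 0) (hf : f₀ * laurent xc yc A ∈
      antiPluricanonical (exampleSurface b) 2) (hA : ∀ p, A p ≠ 0 → (-2 ≤ p.1 ∧ p.1 ≤ 2) ∧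
      (-2 ≤ p.2 ∧ p.2 ≤ 2) ∧ -2 ≤ p.1 + p.2 ∧ p.1 + p.2 ≤ 2) (h0 : A (2, -2) = 0) :
    f₀ * laurent xc yc A = cst (A (0, 0)) * f₀ := by
  have hI := I_ne_zero
  have C0 : (A (-2, 0) + A (-1, -1) * (-I) + A (0, -2) * (-I) ^ 2 = 0 ∧
    A (-1, -1) + 2 * A (0, -2) * (-I) = 0 ∧ A (-2, 1) + A (-1, 0) * (-I) +
      A (0, -1) * (-I) ^ 2 + A (1, -2) * (-I) ^ 3 = 0) := corner_conditions hb hf hA 0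
  have C1 : (A (0, -2) + A (1, -2) * (-1) + A (2, -2) * (-1) ^ 2 = 0 ∧
    A (1, -2) + 2 * A (2, -2) * (-1) = 0 ∧ A (-1, -1) + A (0, -1) * (-1) +
      A (1, -1) * (-1) ^ 2 + A (2, -1) * (-1) ^ 3 = 0) := corner_conditions hb hf hA 1
  have C2 : (A (2, -2) + A (2, -1) * 1 + A (2, 0) * 1 ^ 2 = 0 ∧
    A (2, -1) + 2 * A (2, 0) * 1 = 0 ∧ A (1, -2) + A (1, -1) * 1 +
      A (1, 0) * 1 ^ 2 + A (1, 1) * 1 ^ 3 = 0) := corner_conditions hb hf hA 2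
  have C3 : (A (2, 0) + A (1, 1) * (I / b) + A (0, 2) * (I / b) ^ 2 = 0 ∧
    A (1, 1) + 2 * A (0, 2) * (I / b) = 0 ∧ A (2, -1) + A (1, 0) * (I / b) +
      A (0, 1) * (I / b) ^ 2 + A (-1, 2) * (I / b) ^ 3 = 0) :=
    corner_conditions hb hf hA 3
  have C4 : (A (0, 2) + A (-1, 2) * 1 + A (-2, 2) * 1 ^ 2 = 0 ∧
    A (-1, 2) + 2 * A (-2, 2) * 1 = 0 ∧ A (1, 1) + A (0, 1) * 1 +
      A (-1, 1) * 1 ^ 2 + A (-2, 1) * 1 ^ 3 = 0) := corner_conditions hb hf hA 4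
  have C5 : (A (-2, 2) + A (-2, 1) * b + A (-2, 0) * b ^ 2 = 0 ∧
    A (-2, 1) + 2 * A (-2, 0) * b = 0 ∧ A (-1, 2) + A (-1, 1) * b +
      A (-1, 0) * b ^ 2 + A (-1, -1) * b ^ 3 = 0) := corner_conditions hb hf hA 5
  have e1 : A (2, 0) = 0 := by linear_combination C2.2.1 - C2.1 + h0
  have e2 : A (2, -1) = 0 := by linear_combination C2.2.1 - 2 * e1
  have hIb : I / b ≠ 0 := div_ne_zero hI hb
  have e3 : A (0, 2) = 0 := by
    refine (mul_eq_zero.mp ?_).resolve_right (pow_ne_zero 2 hIb)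
    linear_combination (I / b) * C3.2.1 - C3.1 + e1
  have e4 : A (1, 1) = 0 := by linear_combination C3.2.1 - 2 * (I / b) * e3
  have e5 : A (-2, 2) = 0 := by linear_combination C4.2.1 - C4.1 + e3
  have e6 : A (-1, 2) = 0 := by linear_combination C4.2.1 - 2 * e5
  have e7 : A (-2, 0) = 0 := by
    refine (mul_eq_zero.mp ?_).resolve_right (pow_ne_zero 2 hb)
    linear_combination b * C5.2.1 - C5.1 + e5
  have e8 : A (-2, 1) = 0 := by linear_combination C5.2.1 - 2 * b * e7
  have e9 : A (1, -2) = 0 := by linear_combination C1.2.1 + 2 * h0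
  have e10 : A (0, -2) = 0 := by linear_combination C1.1 + e9 - h0
  have e11 : A (-1, -1) = 0 := by linear_combination C0.2.1 + 2 * I * e10
  have g1 : A (0, -1) = A (1, -1) := by linear_combination -C1.2.2 + e11 - e2
  have g2 : A (1, -1) = -A (1, 0) := by linear_combination C2.2.2 - e9 - e4
  have g3 : A (1, 0) = -A (0, 1) * (I / b) := by
    refine mul_right_cancel₀ hIb ?_
    linear_combination C3.2.2 - e2 - (I / b) ^ 3 * e6
  have g4 : A (0, 1) = -A (-1, 1) := by linear_combination C4.2.2 - e4 - e8
  have g5 : A (-1, 1) = -A (-1, 0) * b := by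
    refine mul_right_cancel₀ hb ?_
    linear_combination C5.2.2 - e6 - b ^ 3 * e11
  have g0 : A (-1, 0) = A (0, -1) * I := by
    refine mul_right_cancel₀ (neg_ne_zero.mpr hI) ?_
    linear_combination C0.2.2 - e8 - (-I) ^ 3 * e9
  have g6 : A (-1, 0) = 0 := by
    have h1 : A (0, 1) = A (-1, 0) * b := by linear_combination g4 - g5
    have h2 : A (1, 0) = -A (-1, 0) * I := by
      rw [g3, h1]; field_simp
    have h3 : A (-1, 0) = -A (-1, 0) := by
      linear_combination g0 + I * g1 + I * g2 - I * h2 +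
        A (-1, 0) * I_sq
    linear_combination h3 / 2
  have h1 : A (-1, 1) = 0 := by rw [g5, g6]; ring
  have h2 : A (0, 1) = 0 := by rw [g4, h1]; ring
  have h3 : A (1, 0) = 0 := by rw [g3, h2]; ring
  have h4 : A (1, -1) = 0 := by rw [g2, h3]; ring
  have h5 : A (0, -1) = 0 := by rw [g1, h4]
  have hz : ∀ p, p ≠ 0 → A p = 0 := by
    rintro ⟨m, n⟩ hp
    by_contra hne
    obtain ⟨⟨_, _⟩, ⟨_, _⟩, _, _⟩ := hA _ hne
    simp only at *
    apply hne
    interval_cases m <;> interval_cases n <;>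
      first | omega | assumption | exact absurd rfl hp
  have hs : A = Finsupp.single 0 (A 0) := by
    ext p
    by_cases hp : p = 0
    · rw [hp, Finsupp.single_eq_same]
    · rw [hz p hp, Finsupp.single_eq_of_ne hp]
  rw [hs, laurent, Finsupp.sum_single_index (by rw [cst_zero, zero_mul])]
  change _ = cst (Finsupp.single 0 (A 0) 0) * f₀
  rw [Finsupp.single_eq_same, Prod.fst_zero, Prod.snd_zero, zpow_zero, zpow_zero]
  ring

end AntiBicanonical

section AntiDimensions

variable {f : PlaneField} {b : ℂ} {R : Subalgebra ℂ PlaneField}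

lemma IsPolarForm.pencil_notMem {u v : PlaneField} (h : IsCoord u v) (hk : IsPolarForm b u v) :
    pencil b ∉ Pt u v := by
  have := h.isLocalRing
  have := hk.2.1.inv_notMem (inv_ne_zero hk.1)
  rwa [inv_inv] at this

lemma isPolarForm_corner (hb : b ≠ 0) (j : Fin 6) : IsPolarForm b (cornerU j) (cornerV j) := by
  have := isPolarForm_edge hb (exampleCoords_ne_zero hb j).symm
  rwa [sub_cst_zero] at this

lemma pencil_notMem_corner (hb : b ≠ 0) (j : Fin 6) : pencil b ∉ Pt (cornerU j) (cornerV j) :=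
  (isPolarForm_corner hb j).pencil_notMem (isCoord_corner j)

lemma inv_pencil_vanishesAt_corner (hb : b ≠ 0) (j : Fin 6) :
    VanishesAt (pencil b)⁻¹ (Pt (cornerU j) (cornerV j)) := (isPolarForm_corner hb j).2.1

lemma pencil_ne_zero (hb : b ≠ 0) : pencil b ≠ 0 := (isPolarForm_corner hb 0).1

lemma pencil_ne_cst (hb : b ≠ 0) (c : ℂ) : pencil b ≠ cst c := fun h =>
  pencil_notMem_corner hb 0 (h ▸ Subalgebra.algebraMap_mem _ c)

lemma laurent_sub_smul (u v : PlaneField) (A B : ℤ × ℤ →₀ ℂ) (μ : ℂ) :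
    laurent u v (A - μ • B) = laurent u v A - cst μ * laurent u v B := by
  rw [laurent, laurent, laurent, sub_eq_add_neg, ← neg_smul, Finsupp.sum_add_index'
    (fun _ => by rw [cst_zero, zero_mul]) (fun _ _ _ => by rw [cst_add, add_mul]),
    Finsupp.sum_smul_index (fun _ => by rw [cst_zero, zero_mul]), sub_eq_add_neg, Finsupp.sum,
    Finsupp.sum, Finsupp.sum, Finset.mul_sum, ← Finset.sum_neg_distrib]
  congr 1
  refine Finset.sum_congr rfl fun p _ => ?_
  rw [cst_mul, cst_neg]
  ring

lemma antiPluricanonical_two (hb : b ≠ 0) :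
    antiPluricanonical (exampleSurface b) 2 = Submodule.span ℂ {f₀, f₁ b} := by
  refine le_antisymm (fun f hf => ?_) (Submodule.span_le.mpr ?_)
  · obtain ⟨A, rfl, hA⟩ := exists_laurent_of_mem_antiPluricanonical hb hf
    obtain ⟨B, hB, hB'⟩ :=
      exists_laurent_of_mem_antiPluricanonical hb (f₁_mem_antiPluricanonical hb)
    have hne : B (2, -2) ≠ 0 := by
      intro h
      have h1 := eq_const_of_coeff_eq_zero hb (hB ▸ f₁_mem_antiPluricanonical hb) hB' h
      rw [← hB] at h1
      exact pencil_ne_cst hb _ (by rw [pencil, h1, mul_div_cancel_right₀ _ f₀_ne_zero])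
    have e : f₀ * laurent xc yc (A - (A (2, -2) / B (2, -2)) • B) =
        f₀ * laurent xc yc A - (A (2, -2) / B (2, -2)) • f₁ b := by
      rw [laurent_sub_smul, mul_sub, Algebra.smul_def, hB]
      ring
    have h2 := eq_const_of_coeff_eq_zero (A := A - (A (2, -2) / B (2, -2)) • B) hb
      (by rw [e]; exact Submodule.sub_mem _ hf (Submodule.smul_mem _ _ (f₁_mem_antiPluricanonical hb)))
      (fun p hp => by
        by_cases h : A p = 0
        · refine hB' p fun h' => hp ?_
          rw [Finsupp.sub_apply, Finsupp.smul_apply, h, h', smul_zero, sub_zero]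
        · exact hA p h)
      (by rw [Finsupp.sub_apply, Finsupp.smul_apply, smul_eq_mul, div_mul_cancel₀ _ hne, sub_self])
    rw [e, sub_eq_iff_eq_add] at h2
    rw [h2, ← Algebra.smul_def]
    exact add_mem (Submodule.smul_mem _ _ (Submodule.subset_span (by simp)))
      (Submodule.smul_mem _ _ (Submodule.subset_span (by simp)))
  · rintro _ (rfl | rfl)
    exacts [f₀_mem_antiPluricanonical hb, f₁_mem_antiPluricanonical hb]

lemma antiPluricanonicalDim_two (hb : b ≠ 0) : antiPluricanonicalDim (exampleSurface b) 2 = 1 := by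
  have h : LinearIndependent ℂ ![f₀, f₁ b] := by
    rw [LinearIndependent.pair_iff' f₀_ne_zero]
    intro c h
    refine pencil_ne_cst hb c ?_
    rw [pencil, ← h, Algebra.smul_def, mul_div_cancel_right₀ _ f₀_ne_zero]
  rw [antiPluricanonicalDim, antiPluricanonical_two hb, ← Matrix.range_cons_cons_empty, finrank_span_eq_card h]
  simp

lemma xc_mul_yc_mem_antiPluricanonical (hb : b ≠ 0) :
    xc * yc ∈ antiPluricanonical (exampleSurface b) 1 := by
  have hxy := mul_ne_zero isCoord_xc_yc.fst_ne_zero isCoord_xc_yc.snd_ne_zero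
  refine mem_antiPluricanonical_of_coord fun R hR => ?_
  rw [exampleSurface_eq hb] at hR
  have hJ : ∀ j, xc * yc * jacobian (cornerU j) (cornerV j) = cornerU j * cornerV j := fun j => by
    rw [jacobian_corner, mul_div_cancel₀ _ hxy]
  rcases hR with ⟨a, c, ha, hc, rfl⟩ | ⟨j, a, ha, haj, rfl⟩ | ⟨j, rfl⟩ | ⟨j, h⟩
  · have h := isCoord_xc_yc.sub_const a c
    refine ⟨_, _, h, rfl, ?_⟩
    have hx : HasValueAt xc a _ := h.vanishesAt_fst
    have hy : HasValueAt yc c _ := h.vanishesAt_snd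
    rw [jacobian_sub_cst_left, jacobian_sub_cst_right, jacobian_xc_yc, one_pow, mul_one]
    exact mul_mem hx.mem hy.mem
  · have h := (isCoord_corner j).sub_const_fst a
    refine ⟨_, _, h, rfl, ?_⟩
    have hu : HasValueAt (cornerU j) a _ := h.vanishesAt_fst
    rw [jacobian_sub_cst_left, pow_one, hJ]
    exact mul_mem hu.mem snd_mem_Pt
  · refine ⟨_, _, isCoord_corner j, rfl, ?_⟩
    rw [pow_one, hJ]
    exact mul_mem fst_mem_Pt snd_mem_Pt
  · have h0 := (isCoord_corner j).sub_const_fst (exampleCoords b j)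
    rw [h0.exceptionalPoints_eq_swap] at h
    have hv0 := h0.snd_ne_zero
    have hu0 := h0.fst_ne_zero
    rcases h with ⟨s, rfl⟩ | rfl
    · have h := h0.div_fst.sub_const_fst s
      refine ⟨_, _, h, rfl, ?_⟩
      have hw : HasValueAt ((cornerU j - cst (exampleCoords b j)) / cornerV j) s _ :=
        h.vanishesAt_fst
      have hu : cornerU j ∈ Pt ((cornerU j - cst (exampleCoords b j)) / cornerV j - cst s)
          (cornerV j) := by
        have := add_mem (mul_mem hw.mem snd_mem_Pt) (Subalgebra.algebraMap_mem _ (exampleCoords b j))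
        rwa [div_mul_cancel₀ _ hv0, sub_add_cancel] at this
      rw [jacobian_sub_cst_left, jacobian_div_self_left hv0, jacobian_sub_cst_left, pow_one,
        mul_div_assoc', hJ, mul_div_cancel_right₀ _ hv0]
      exact hu
    · refine ⟨_, _, h0.div_snd, rfl, ?_⟩
      rw [jacobian_div_self_right hu0, jacobian_sub_cst_left, pow_one, mul_div_assoc', hJ,
        mul_div_assoc]
      refine mul_mem ?_ snd_mem_Pt
      have := add_mem (fst_mem_Pt (u := cornerU j - cst (exampleCoords b j))
        (v := cornerV j / (cornerU j - cst (exampleCoords b j))))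
        (Subalgebra.algebraMap_mem _ (exampleCoords b j))
      rwa [sub_add_cancel] at this

lemma antiPluricanonical_one (hb : b ≠ 0) :
    antiPluricanonical (exampleSurface b) 1 = Submodule.span ℂ {xc * yc} := by
  have hxy := mul_ne_zero isCoord_xc_yc.fst_ne_zero isCoord_xc_yc.snd_ne_zero
  refine le_antisymm (fun f hf => ?_) ?_
  · have hmul : ∀ g ∈ antiPluricanonical (exampleSurface b) 1,
        ∃ l m : ℂ, cst l * f₀ + cst m * f₁ b = f * g := by
      intro g hg
      have : f * g ∈ antiPluricanonical (exampleSurface b) 2 := by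
        rw [mem_antiPluricanonical_iff] at *
        intro R hR u v huv
        have h := mul_mem (hf R hR u v huv) (hg R hR u v huv)
        convert h using 1
        ring
      rw [antiPluricanonical_two hb, Submodule.mem_span_pair] at this
      obtain ⟨l, m, h⟩ := this
      exact ⟨l, m, by rw [← h, Algebra.smul_def, Algebra.smul_def]⟩
    obtain ⟨l, m, h1⟩ := hmul _ (xc_mul_yc_mem_antiPluricanonical hb)
    obtain ⟨l', m', h2⟩ := hmul f hf
    have hk0 := pencil_ne_zero hb
    have e : (cst l * (pencil b)⁻¹ + cst m) ^ 2 =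
        cst l' * (pencil b)⁻¹ ^ 2 + cst m' * (pencil b)⁻¹ := by
      rw [← pencil_mul_f₀] at h1 h2
      have h3 : (xc * yc) * (cst l + cst m * pencil b) = f := by
        refine mul_right_cancel₀ hxy ?_
        rw [← h1, f₀]; ring
      have h4 : (cst l + cst m * pencil b) ^ 2 = cst l' + cst m' * pencil b := by
        refine mul_left_cancel₀ f₀_ne_zero ?_
        have : f₀ = (xc * yc) ^ 2 := by rw [f₀]; ring
        linear_combination -h2 + (f + xc * yc * (cst l + cst m * pencil b)) * h3 +
          (cst l + cst m * pencil b) ^ 2 * this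
      generalize pencil b = k at hk0 h4 ⊢
      field_simp
      linear_combination h4
    have := (isCoord_corner 0).isLocalRing
    have hk := (inv_pencil_vanishesAt_corner hb 0).hasValueAt
    have hc := fun c : ℂ => hasValueAt_const (R := Pt (cornerU 0) (cornerV 0)) c
    have v1 := (((hc l).mul hk).add (hc m)).pow 2
    have v2 := ((hc l').mul (hk.pow 2)).add ((hc m').mul hk)
    rw [show (algebraMap ℂ PlaneField l * (pencil b)⁻¹ + algebraMap ℂ PlaneField m) ^ 2 = _ from e] at v1
    have hm : m = 0 := by
      have := v1.eq v2
      simpa using this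
    rw [Submodule.mem_span_singleton]
    refine ⟨l, mul_right_cancel₀ hxy ?_⟩
    rw [← h1, hm, cst_zero, Algebra.smul_def, f₀]
    ring
  · rw [Submodule.span_singleton_le_iff_mem]
    exact xc_mul_yc_mem_antiPluricanonical hb

lemma antiPluricanonicalDim_one (hb : b ≠ 0) : antiPluricanonicalDim (exampleSurface b) 1 = 0 := by
  rw [antiPluricanonicalDim, antiPluricanonical_one hb, finrank_span_singleton
    (mul_ne_zero isCoord_xc_yc.fst_ne_zero isCoord_xc_yc.snd_ne_zero)]
  simp

end AntiDimensions

section Transcendental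

open scoped IntermediateField.algebraAdjoinAdjoin in
lemma formallyEtale_adjoin {L : Type*} [Field L] [Algebra ℂ L] {s : Set L}
    (hs : IsTranscendenceBasis ℂ ((↑) : s → L)) :
    Algebra.FormallyEtale (Algebra.adjoin ℂ (Set.range ((↑) : s → L))) L := by
  have : Algebra.FormallyEtale (Algebra.adjoin ℂ (Set.range ((↑) : s → L)))
      (adjoin ℂ (Set.range ((↑) : s → L))) :=
    .of_isLocalization (nonZeroDivisors _)
  have : Algebra.IsAlgebraic (adjoin ℂ (Set.range ((↑) : s → L))) L :=
    hs.isAlgebraic_field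
  have : Algebra.FormallyEtale (adjoin ℂ (Set.range ((↑) : s → L))) L :=
    .of_isSeparable _ L
  exact .comp _ (adjoin ℂ (Set.range ((↑) : s → L))) _

open scoped Classical in
lemma D_ne_zero_of_transcendental {L : Type*} [Field L] [Algebra ℂ L] {t : L}
    (ht : Transcendental ℂ t) : KaehlerDifferential.D ℂ L t ≠ 0 := by
  have hi : AlgebraicIndepOn ℂ id {t} :=
    (algebraicIndependent_singleton_iff (⟨t, rfl⟩ : ({t} : Set L))).mpr ht
  obtain ⟨s, hts, hs⟩ := exists_isTranscendenceBasis_superset hi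
  have := formallyEtale_adjoin hs
  let : Algebra (MvPolynomial s ℂ) L := (MvPolynomial.aeval ((↑) : s → L)).toAlgebra
  have : IsScalarTower ℂ (MvPolynomial s ℂ) L :=
    IsScalarTower.of_algebraMap_eq' (MvPolynomial.aeval ((↑) : s → L)).comp_algebraMap.symm
  let e := hs.1.aevalEquiv
  let i : s := ⟨t, hts rfl⟩
  let d := MvPolynomial.mkDerivation ℂ (Pi.single i (1 : L))
  let d' : Derivation ℂ (Algebra.adjoin ℂ (Set.range ((↑) : s → L))) L :=
    Derivation.mk' (d.toLinearMap ∘ₗ e.symm.toLinearMap) (fun x y => by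
      have h : ∀ z : Algebra.adjoin ℂ (Set.range ((↑) : s → L)), ∀ l : L,
          e.symm z • l = z • l := fun z l => by
        obtain ⟨z, rfl⟩ := e.surjective z
        rw [AlgEquiv.symm_apply_apply, Algebra.smul_def, Algebra.smul_def]
        rfl
      change d (e.symm (x * y)) = x • d (e.symm y) + y • d (e.symm x)
      rw [map_mul, d.leibniz, h, h])
  have hi' : e (MvPolynomial.X i) = ⟨t, Algebra.subset_adjoin ⟨i, rfl⟩⟩ :=
    Subtype.ext (by
      change algebraMap _ L (hs.1.aevalEquiv _) = t
      rw [hs.1.algebraMap_aevalEquiv, MvPolynomial.aeval_X])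
  have hd : d' (e (MvPolynomial.X i)) = 1 := by
    change d (e.symm (e _)) = 1
    rw [AlgEquiv.symm_apply_apply, MvPolynomial.mkDerivation_X, Pi.single_eq_same]
  have hB := KaehlerDifferential.isBaseChange_of_formallyEtale ℂ
    (Algebra.adjoin ℂ (Set.range ((↑) : s → L))) L
  intro h0
  have h1 := hB.lift_eq d'.liftKaehlerDifferential (KaehlerDifferential.D ℂ _ (e (MvPolynomial.X i)))
  rw [Derivation.liftKaehlerDifferential_comp_D, hd, hi', KaehlerDifferential.map_D] at h1
  change hB.lift _ (KaehlerDifferential.D ℂ L t) = 1 at h1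
  rw [h0, map_zero] at h1
  exact zero_ne_one h1

end Transcendental

section DoubleCover

open Polynomial

variable {F : Type*} [Field F] [Algebra ℂ F] {t w z g : F} {q : ℂ[X]} {O : Subalgebra ℂ F}

local notation "𝐝" => KaehlerDifferential.D ℂ F

/-- `F` is the function field of the curve `w² = q(t)`, where `q` is squarefree. -/
structure IsDoubleCover (t w : F) (q : ℂ[X]) : Prop where
  transcendental : Transcendental ℂ t
  sq_eq : w ^ 2 = aeval t q
  adjoin_eq_top : adjoin ℂ {t, w} = ⊤
  isCoprime : IsCoprime q (derivative q)

namespace IsDoubleCover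

lemma aeval_ne_zero (h : IsDoubleCover t w q) {p : ℂ[X]} (hp : p ≠ 0) : aeval t p ≠ 0 := fun h0 =>
  h.transcendental ⟨p, hp, h0⟩

lemma poly_ne_zero (h : IsDoubleCover t w q) : q ≠ 0 := by
  rintro rfl
  have := h.isCoprime
  rw [derivative_zero, isCoprime_zero_left] at this
  exact not_isUnit_zero this

lemma ne_zero (h : IsDoubleCover t w q) : w ≠ 0 := by
  rintro rfl
  refine h.aeval_ne_zero h.poly_ne_zero ?_
  rw [← h.sq_eq]
  ring

lemma exists_eq_div (h : IsDoubleCover t w q) (z : F) :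
    ∃ α β δ : ℂ[X], δ ≠ 0 ∧ z = (aeval t α + aeval t β * w) / aeval t δ := by
  have hz : z ∈ adjoin ℂ {t, w} := h.adjoin_eq_top ▸ IntermediateField.mem_top
  induction hz using IntermediateField.adjoin_induction with
  | mem x hx =>
    rcases hx with rfl | rfl
    · exact ⟨X, 0, 1, one_ne_zero, by simp⟩
    · exact ⟨0, 1, 1, one_ne_zero, by simp⟩
  | algebraMap c => exact ⟨C c, 0, 1, one_ne_zero, by simp⟩
  | add x y _ _ hx hy =>
    obtain ⟨α, β, δ, hδ, rfl⟩ := hx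
    obtain ⟨α', β', δ', hδ', rfl⟩ := hy
    refine ⟨α * δ' + δ * α', β * δ' + δ * β', δ * δ', mul_ne_zero hδ hδ', ?_⟩
    rw [div_add_div _ _ (h.aeval_ne_zero hδ) (h.aeval_ne_zero hδ')]
    simp only [map_add, map_mul]
    ring
  | inv x _ hx =>
    obtain ⟨α, β, δ, hδ, rfl⟩ := hx
    have hδ' := h.aeval_ne_zero hδ
    have hsq := h.sq_eq
    by_cases h0 : aeval t α + aeval t β * w = 0
    · exact ⟨0, 0, 1, one_ne_zero, by rw [h0]; simp⟩
    by_cases h1 : aeval t α - aeval t β * w = 0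
    · have e : aeval t α + aeval t β * w = aeval t (C 2 * α) := by
        rw [map_mul, aeval_C, map_ofNat]
        linear_combination -h1
      rw [e] at h0 ⊢
      refine ⟨δ, 0, C 2 * α, fun h => h0 (by rw [h, map_zero]), ?_⟩
      rw [inv_div, map_zero, zero_mul, add_zero]
    · have e : aeval t (α ^ 2 - β ^ 2 * q) =
          (aeval t α + aeval t β * w) * (aeval t α - aeval t β * w) := by
        simp only [map_sub, map_mul, map_pow, ← hsq]
        ring
      have h2 : aeval t (α ^ 2 - β ^ 2 * q) ≠ 0 := e ▸ mul_ne_zero h0 h1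
      refine ⟨δ * α, -(δ * β), α ^ 2 - β ^ 2 * q, fun h => h2 (by rw [h, map_zero]), ?_⟩
      rw [inv_div, div_eq_div_iff h0 h2, e]
      simp only [map_neg, map_mul]
      ring
  | mul x y _ _ hx hy =>
    obtain ⟨α, β, δ, hδ, rfl⟩ := hx
    obtain ⟨α', β', δ', hδ', rfl⟩ := hy
    refine ⟨α * α' + β * β' * q, α * β' + β * α', δ * δ', mul_ne_zero hδ hδ', ?_⟩
    rw [div_mul_div_comm]
    simp only [map_add, map_mul, ← h.sq_eq]
    ring

end IsDoubleCover

lemma inv_mem_Pt_of_not_vanishesAt {u v z : F} {S : Subalgebra ℂ F} [IsLocalRing S]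
    (hu : VanishesAt u S) (hv : VanishesAt v S) (hz : z ∈ Pt u v) (h : ¬ VanishesAt z S) :
    z⁻¹ ∈ Pt u v := by
  obtain ⟨p, q, hq, hq0, rfl⟩ := hz
  have hp := hasValueAt_aeval hu.hasValueAt hv.hasValueAt p
  have hq' := hasValueAt_aeval hu.hasValueAt hv.hasValueAt q
  rw [aeval_zero_eq_constantCoeff] at hp hq'
  have hp0 : MvPolynomial.constantCoeff p ≠ 0 := by
    intro h0
    rw [h0] at hp
    exact h (div_eq_mul_inv (G := F) _ _ ▸ hp.vanishesAt.mul_right (hq'.inv_mem hq))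
  rw [inv_div]
  exact ⟨q, p, hp0, hp.ne_zero hp0, rfl⟩

lemma exists_eq_of_mem_Pt_of_vanishesAt {u v z : F} {S : Subalgebra ℂ F} [IsLocalRing S]
    (hu : VanishesAt u S) (hv : VanishesAt v S) (hz : z ∈ Pt u v) (h : VanishesAt z S) :
    ∃ a ∈ Pt u v, ∃ b ∈ Pt u v, z = u * a + v * b := by
  obtain ⟨p, q, hq, hq0, rfl⟩ := hz
  have hp := hasValueAt_aeval hu.hasValueAt hv.hasValueAt p
  have hq' := hasValueAt_aeval hu.hasValueAt hv.hasValueAt q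
  rw [aeval_zero_eq_constantCoeff] at hp hq'
  have hp0 : MvPolynomial.constantCoeff p = 0 := by
    refine hp.eq (h.mul_right hq'.mem |>.hasValueAt.congr (div_mul_cancel₀ _ hq0) rfl)
  obtain ⟨a, b, e⟩ := exists_eq_constantCoeff_add p
  refine ⟨MvPolynomial.aeval ![u, v] a / MvPolynomial.aeval ![u, v] q, ⟨a, q, hq, hq0, rfl⟩,
    MvPolynomial.aeval ![u, v] b / MvPolynomial.aeval ![u, v] q, ⟨b, q, hq, hq0, rfl⟩, ?_⟩
  rw [e, hp0]
  simp only [map_add, map_mul, map_zero, MvPolynomial.aeval_X, Matrix.cons_val_zero,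
    Matrix.cons_val_one, zero_add]
  ring

lemma aeval_mem_of_mem {A : Subalgebra ℂ F} (ht : t ∈ A) (p : ℂ[X]) : aeval t p ∈ A := by
  rw [aeval_eq_sum_range]
  exact sum_mem fun i _ => A.smul_mem (pow_mem ht i) _

lemma hasValueAt_aeval_poly [IsLocalRing O] {c : ℂ} (ht : HasValueAt t c O) (p : ℂ[X]) :
    HasValueAt (aeval t p) (p.eval c) O := by
  induction p using Polynomial.induction_on' with
  | add p r hp hr => rw [map_add, eval_add]; exact hp.add hr
  | monomial n a =>
    rw [aeval_monomial, eval_monomial]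
    exact (hasValueAt_const a).mul (ht.pow n)

lemma exists_eval_sub (p : ℂ[X]) (c : ℂ) : ∃ r : ℂ[X], p - C (p.eval c) = (X - C c) * r := by
  obtain ⟨r, hr⟩ := Polynomial.dvd_iff_isRoot.mpr (show (p - C (p.eval c)).IsRoot c by simp)
  exact ⟨r, hr⟩

namespace IsDoubleCover

/-- The valuation rings of a double cover of the line are the local rings of its points. -/
lemma mem_Pt_of_mem (h : IsDoubleCover t w q) [IsLocalRing O] {a c : ℂ}
    (ht : VanishesAt (t - algebraMap ℂ F a) O) (hw : VanishesAt (w - algebraMap ℂ F c) O)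
    (hz : z ∈ O) : z ∈ Pt (t - algebraMap ℂ F a) (w - algebraMap ℂ F c) := by
  set P := Pt (t - algebraMap ℂ F a) (w - algebraMap ℂ F c) with hP
  have htP : t ∈ P := by
    have := add_mem (fst_mem_Pt (u := t - algebraMap ℂ F a) (v := w - algebraMap ℂ F c))
      (Subalgebra.algebraMap_mem _ a)
    rwa [sub_add_cancel] at this
  have hwP : w ∈ P := by
    have := add_mem (snd_mem_Pt (u := t - algebraMap ℂ F a) (v := w - algebraMap ℂ F c))
      (Subalgebra.algebraMap_mem _ c)
    rwa [sub_add_cancel] at this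
  have hta : t - algebraMap ℂ F a ≠ 0 := by
    have := h.aeval_ne_zero (Polynomial.X_sub_C_ne_zero a)
    rwa [map_sub, aeval_X, aeval_C] at this
  have htv : HasValueAt t a O := ht
  have hwv : HasValueAt w c O := hw
  have hqc : q.eval a = c ^ 2 :=
    (hasValueAt_aeval_poly htv q).eq ((hwv.pow 2).congr h.sq_eq rfl)
  have hstep : ∀ π : F, π ≠ 0 → VanishesAt π O → (∀ x ∈ P, VanishesAt x O → ∃ y ∈ P, x = π * y) →
      ∀ g ∈ O, π * g ∈ P → g ∈ P := by
    intro π h0 hπ hgen g hg hπg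
    obtain ⟨y, hy, e⟩ := hgen _ hπg (hπ.mul_right hg)
    rwa [mul_left_cancel₀ h0 e]
  have hdiv : ∀ g ∈ O, (t - algebraMap ℂ F a) * g ∈ P → g ∈ P := by
    by_cases hc : c = 0
    · obtain ⟨r, hr⟩ := exists_eval_sub q a
      rw [hqc, hc, zero_pow two_ne_zero, C_0, sub_zero] at hr
      have hr0 : r.eval a ≠ 0 := by
        have := (Polynomial.isCoprime_iff_aeval_ne_zero_of_isAlgClosed ℂ ℂ _ _).mp h.isCoprime a
        rw [hr] at this
        simpa using this
      have hrv := hasValueAt_aeval_poly htv r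
      have e : (t - algebraMap ℂ F a) * aeval t r = w ^ 2 := by
        rw [h.sq_eq, hr, map_mul, map_sub, aeval_X, aeval_C]
      have hri : (aeval t r)⁻¹ ∈ P := inv_mem_Pt_of_not_vanishesAt ht hw
        (aeval_mem_of_mem htP r) (hrv.not_vanishesAt hr0)
      have hw0 : VanishesAt w O := by rw [hc] at hwv; exact hwv.vanishesAt
      have hgen : ∀ x ∈ P, VanishesAt x O → ∃ y ∈ P, x = w * y := by
        intro x hx hxv
        obtain ⟨α, hα, β, hβ, rfl⟩ := exists_eq_of_mem_Pt_of_vanishesAt ht hw hx hxv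
        refine ⟨w * (aeval t r)⁻¹ * α + β, add_mem (mul_mem (mul_mem hwP hri) hα) hβ, ?_⟩
        have hr0' := hrv.ne_zero hr0
        rw [hc, map_zero, sub_zero, ← mul_right_inj' hr0']
        field_simp
        linear_combination α * e
      intro g hg hgP
      have h1 := mul_mem (aeval_mem_of_mem htP r) hgP
      rw [← mul_assoc, mul_comm (aeval t r), e, pow_two, mul_assoc] at h1
      refine hstep w h.ne_zero hw0 hgen g hg (hstep w h.ne_zero hw0 hgen _ (mul_mem hwv.mem hg) h1)
    · refine hstep _ hta ht fun x hx hxv => ?_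
      obtain ⟨α, hα, β, hβ, rfl⟩ := exists_eq_of_mem_Pt_of_vanishesAt ht hw hx hxv
      obtain ⟨r, hr⟩ := exists_eval_sub q a
      have hs : HasValueAt (w + algebraMap ℂ F c) (c + c) O := hwv.add (hasValueAt_const c)
      have hc2 : c + c ≠ 0 := by simpa [← two_mul] using hc
      have hsP : (w + algebraMap ℂ F c)⁻¹ ∈ P := inv_mem_Pt_of_not_vanishesAt ht hw
        (add_mem hwP (Subalgebra.algebraMap_mem _ c)) (hs.not_vanishesAt hc2)
      have hs0 := hs.ne_zero hc2
      have e := congrArg (aeval t) hr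
      rw [map_sub, ← h.sq_eq, hqc, map_mul, map_sub, aeval_X, aeval_C, aeval_C, map_pow] at e
      refine ⟨α + aeval t r * (w + algebraMap ℂ F c)⁻¹ * β, add_mem hα
        (mul_mem (mul_mem (aeval_mem_of_mem htP r) hsP) hβ), ?_⟩
      field_simp
      linear_combination β * e
  obtain ⟨α, β, δ, hδ, rfl⟩ := h.exists_eq_div z
  obtain ⟨n, δ', hδ', hroot⟩ : ∃ n δ', δ = (X - C a) ^ n * δ' ∧ ¬ δ'.IsRoot a := by
    obtain ⟨δ', h1, h2⟩ := Polynomial.exists_eq_pow_rootMultiplicity_mul_and_not_dvd δ hδ a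
    exact ⟨_, δ', h1, fun hr => h2 (Polynomial.dvd_iff_isRoot.mpr hr)⟩
  have hδv := hasValueAt_aeval_poly htv δ'
  have hδ'P : (aeval t δ')⁻¹ ∈ P := inv_mem_Pt_of_not_vanishesAt ht hw
    (aeval_mem_of_mem htP δ') (hδv.not_vanishesAt hroot)
  have hnum : (t - algebraMap ℂ F a) ^ n * ((aeval t α + aeval t β * w) / aeval t δ) ∈ P := by
    have := mul_mem (add_mem (aeval_mem_of_mem htP α) (mul_mem (aeval_mem_of_mem htP β) hwP)) hδ'P
    convert this using 1
    rw [hδ', map_mul, map_pow, map_sub, aeval_X, aeval_C]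
    have := hδv.ne_zero hroot
    field_simp
  clear hδ' hδ
  induction n with
  | zero => rwa [pow_zero, one_mul] at hnum
  | succ n ih =>
    refine ih (hdiv _ (mul_mem (pow_mem ht.mem n) hz) ?_)
    rwa [← mul_assoc, ← pow_succ']

lemma D_snd (h : IsDoubleCover t w q) : 𝐝 w = (aeval t (derivative q) / 2) • (w⁻¹ • 𝐝 t) := by
  have h2 : (2 : F) ≠ 0 := by
    have := Algebra.charZero_of_charZero ℂ F
    exact two_ne_zero
  have e := congrArg (𝐝) h.sq_eq
  rw [Derivation.leibniz_pow, Derivation.map_aeval, ← Nat.cast_smul_eq_nsmul F, smul_smul,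
    Nat.cast_ofNat, pow_one] at e
  rw [smul_smul, div_mul_eq_mul_div, div_eq_inv_mul, mul_comm (aeval t _) w⁻¹, ← mul_assoc,
    ← smul_smul, ← e, smul_smul]
  have := h.ne_zero
  rw [← mul_inv, mul_comm 2 w, mul_comm, mul_inv_cancel₀ (mul_ne_zero this h2), one_smul]

lemma D_fst (h : IsDoubleCover t w q) : 𝐝 t = w • (w⁻¹ • 𝐝 t) := by
  rw [smul_smul, mul_inv_cancel₀ h.ne_zero, one_smul]

lemma snd_mem (h : IsDoubleCover t w q) (hO : ∀ z, z ∈ O ∨ z⁻¹ ∈ O) (ht : t ∈ O) : w ∈ O := by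
  refine (hO w).elim id fun hw => ?_
  have := mul_mem (aeval_mem_of_mem ht q) hw
  rwa [← h.sq_eq, pow_two, mul_inv_cancel_right₀ h.ne_zero] at this

lemma exists_D_eq (h : IsDoubleCover t w q) [IsLocalRing O] (hO : ∀ z, z ∈ O ∨ z⁻¹ ∈ O)
    (ht : t ∈ O) (hz : z ∈ O) : ∃ g ∈ O, 𝐝 z = g • (w⁻¹ • 𝐝 t) := by
  have hw := h.snd_mem hO ht
  have h2 : (2 : F)⁻¹ ∈ O := by
    have := O.algebraMap_mem (2⁻¹ : ℂ)
    rwa [map_inv₀, map_ofNat] at this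
  have hq' : aeval t (derivative q) / 2 ∈ O :=
    div_eq_mul_inv (G := F) _ _ ▸ mul_mem (aeval_mem_of_mem ht _) h2
  by_cases hp : ∃ a : ℂ, VanishesAt (t - algebraMap ℂ F a) O
  · obtain ⟨a, ha⟩ := hp
    obtain ⟨c, hc⟩ := IsAlgClosed.exists_pow_nat_eq (q.eval a) two_pos
    obtain ⟨c', hc'⟩ : ∃ c' : ℂ, VanishesAt (w - algebraMap ℂ F c') O := by
      have hv := (hasValueAt_aeval_poly (show HasValueAt t a O from ha) q)
      rw [← h.sq_eq, ← hc] at hv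
      have e : w ^ 2 - algebraMap ℂ F (c ^ 2) =
          (w - algebraMap ℂ F c) * (w - algebraMap ℂ F (-c)) := by
        rw [map_pow, map_neg]; ring
      have hv' : VanishesAt (w ^ 2 - algebraMap ℂ F (c ^ 2)) O := hv
      rw [e, vanishesAt_mul_iff (sub_mem hw (O.algebraMap_mem _))
        (sub_mem hw (O.algebraMap_mem _))] at hv'
      exact hv'.elim (fun h => ⟨_, h⟩) fun h => ⟨_, h⟩
    obtain ⟨g₁, hg₁, g₂, hg₂, e⟩ := exists_D_eq_of_mem_Pt (h.mem_Pt_of_mem ha hc' hz)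
    have hle := Pt_le ha hc'
    refine ⟨g₁ * w + g₂ * (aeval t (derivative q) / 2),
      add_mem (mul_mem (hle hg₁) hw) (mul_mem (hle hg₂) hq'), ?_⟩
    rw [e, map_sub, map_sub, Derivation.map_algebraMap, Derivation.map_algebraMap, sub_zero,
      sub_zero, h.D_snd, add_smul, mul_smul, mul_smul, ← h.D_fst]
  · push Not at hp
    have hinv : ∀ δ : ℂ[X], δ ≠ 0 → (aeval t δ)⁻¹ ∈ O := by
      intro δ hδ
      rw [(IsAlgClosed.splits δ).eq_prod_roots, map_mul, aeval_C, map_multiset_prod,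
        Multiset.map_map, mul_inv, ← map_inv₀]
      refine mul_mem (O.algebraMap_mem _) ?_
      induction δ.roots using Multiset.induction_on with
      | empty => simp
      | cons a s ih =>
        rw [Multiset.map_cons, Multiset.prod_cons, mul_inv]
        refine mul_mem ?_ ih
        simp only [Function.comp_apply, map_sub, aeval_X, aeval_C]
        exact inv_mem_of_not_vanishesAt (sub_mem ht (O.algebraMap_mem a)) (hp a)
    obtain ⟨α, β, δ, hδ, rfl⟩ := h.exists_eq_div z
    have hd := hinv δ hδ
    have hm : ∀ p : ℂ[X], aeval t p ∈ O := aeval_mem_of_mem ht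
    refine ⟨(aeval t δ)⁻¹ ^ 2 * (aeval t δ * ((aeval t (derivative α) + aeval t (derivative β) * w) * w
      + aeval t β * (aeval t (derivative q) / 2)) - (aeval t α + aeval t β * w) *
      (aeval t (derivative δ) * w)), ?_, ?_⟩
    · exact mul_mem (pow_mem hd 2) (sub_mem (mul_mem (hm _) (add_mem (mul_mem (add_mem (hm _)
        (mul_mem (hm _) hw)) hw) (mul_mem (hm _) hq'))) (mul_mem (add_mem (hm _)
        (mul_mem (hm _) hw)) (mul_mem (hm _) hw)))
    · have hfst := h.D_fst
      have hsnd := h.D_snd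
      generalize w⁻¹ • 𝐝 t = ω at hfst hsnd ⊢
      rw [Derivation.leibniz_div, map_add, Derivation.leibniz, Derivation.map_aeval,
        Derivation.map_aeval, Derivation.map_aeval, hsnd, hfst, inv_pow]
      module

lemma D_mem_span (h : IsDoubleCover t w q) (hO : ∀ z, z ∈ O ∨ z⁻¹ ∈ O) (ht : t ∈ O) :
    w⁻¹ • 𝐝 t ∈ Submodule.span ℂ {η | ∃ a ∈ O, ∃ g ∈ O, η = a • 𝐝 g} := by
  have hw := h.snd_mem hO ht
  obtain ⟨A, B, e⟩ := h.isCoprime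
  have e' := congrArg (aeval t) e
  rw [map_add, map_mul, map_mul, ← h.sq_eq, map_one] at e'
  have : w⁻¹ • 𝐝 t = (aeval t A * w) • 𝐝 t + (2 * aeval t B) • 𝐝 w := by
    have h2 : (2 : F) ≠ 0 := by
      have := Algebra.charZero_of_charZero ℂ F
      exact two_ne_zero
    rw [h.D_snd, smul_smul, mul_assoc, mul_comm (aeval t B), ← mul_assoc, mul_div_cancel₀ _ h2]
    nth_rewrite 2 [h.D_fst]
    rw [smul_smul, ← add_smul, mul_assoc, ← pow_two, mul_comm (aeval t (derivative q)), e', one_smul]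
  rw [this]
  have hB : 2 * aeval t B ∈ O := mul_mem (by
    have := O.algebraMap_mem 2
    rwa [map_ofNat] at this) (aeval_mem_of_mem ht B)
  exact add_mem (Submodule.subset_span ⟨_, mul_mem (aeval_mem_of_mem ht A) hw, _, ht, rfl⟩)
    (Submodule.subset_span ⟨_, hB, _, hw, rfl⟩)

end IsDoubleCover

end DoubleCover

section Genus

open Polynomial

variable {F : Type*} [Field F] [Algebra ℂ F] {t w z g : F}

local notation "𝐝" => KaehlerDifferential.D ℂ F

/-- A valuation ring of `F` over `ℂ`, as a subalgebra. -/
def valuationSubalgebra (O : ValuationSubring F) (hO : ∀ z : ℂ, algebraMap ℂ F z ∈ O) :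
    Subalgebra ℂ F :=
  { O.toSubring with algebraMap_mem' := hO }

instance (O : ValuationSubring F) (hO : ∀ z : ℂ, algebraMap ℂ F z ∈ O) :
    IsLocalRing (valuationSubalgebra O hO) :=
  inferInstanceAs (IsLocalRing O)

/-- A rational function without poles is algebraic over the constants. -/
lemma exists_eq_algebraMap_of_forall_mem
    (h : ∀ O : ValuationSubring F, (∀ z : ℂ, algebraMap ℂ F z ∈ O) → z ∈ O) :
    ∃ c : ℂ, z = algebraMap ℂ F c := by
  have h1 : z ∈ (⨅ V : {V : ValuationSubring F // Set.range (algebraMap ℂ F) ⊆ V.toSubring},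
      V.1.toSubring) := by
    rw [Subring.mem_iInf]
    exact fun V => h V.1 fun c => V.2 ⟨c, rfl⟩
  rw [iInf_valuationSubring_superset] at h1
  have h2 : IsIntegral ℂ z := by
    obtain ⟨p, hp, h0⟩ := (mem_integralClosure_iff _ _).mp h1
    let f : ℂ →+* Subring.closure (Set.range (algebraMap ℂ F)) :=
      (algebraMap ℂ F).codRestrict _ fun c => Subring.subset_closure ⟨c, rfl⟩
    have hf : Function.Surjective f := by
      rintro ⟨y, hy⟩
      rw [← RingHom.coe_range, Subring.closure_eq] at hy
      obtain ⟨c, rfl⟩ := hy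
      exact ⟨c, rfl⟩
    obtain ⟨P, rfl, -, hP⟩ := lifts_and_degree_eq_and_monic
      ((mem_lifts p).mpr (map_surjective f hf p)) hp
    exact ⟨P, hP, by rwa [eval₂_map] at h0⟩
  obtain ⟨c, hc⟩ := minpoly.mem_range_of_degree_eq_one ℂ z
    (IsAlgClosed.degree_eq_one_of_irreducible ℂ (minpoly.irreducible h2))
  exact ⟨c, hc.symm⟩

lemma mem_regularDifferentials {η : Ω[F⁄ℂ]} : η ∈ regularDifferentials F ↔
    ∀ O : ValuationSubring F, (∀ z : ℂ, algebraMap ℂ F z ∈ O) →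
      η ∈ Submodule.span ℂ {η | ∃ a ∈ O, ∃ g ∈ O, η = a • 𝐝 g} := by
  simp [regularDifferentials, Submodule.mem_iInf]

/-- A quartic polynomial. -/
def quartic (a b c d e : ℂ) : ℂ[X] := C a * X ^ 4 + C b * X ^ 3 + C c * X ^ 2 + C d * X + C e

/-- The discriminant of a quartic polynomial, up to the factor `1 / 27`. -/
def quarticDisc (a b c d e : ℂ) : ℂ :=
  4 * (12 * a * e - 3 * b * d + c ^ 2) ^ 3 -
    (72 * a * c * e + 9 * b * c * d - 27 * a * d ^ 2 - 27 * e * b ^ 2 - 2 * c ^ 3) ^ 2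

lemma isCoprime_quartic {a b c d e : ℂ} (h : quarticDisc a b c d e ≠ 0) :
    IsCoprime (quartic a b c d e) (derivative (quartic a b c d e)) := by
  rw [Polynomial.isCoprime_iff_aeval_ne_zero_of_isAlgClosed ℂ ℂ]
  intro s
  by_contra! h0
  obtain ⟨h1, h2⟩ := h0
  apply h
  simp [quartic] at h1 h2
  have e1 : d = -(a * (4 * s ^ 3) + b * (3 * s ^ 2) + c * (2 * s)) := by linear_combination h2
  have e2 : e = -(a * s ^ 4 + b * s ^ 3 + c * s ^ 2 + d * s) := by linear_combination h1
  rw [quarticDisc, e2, e1]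
  ring

lemma quarticDisc_reverse (a b c d e : ℂ) : quarticDisc e d c b a = quarticDisc a b c d e := by
  unfold quarticDisc; ring

lemma aeval_quartic (a b c d e : ℂ) : aeval t (quartic a b c d e) =
    algebraMap ℂ F a * t ^ 4 + algebraMap ℂ F b * t ^ 3 + algebraMap ℂ F c * t ^ 2 +
      algebraMap ℂ F d * t + algebraMap ℂ F e := by
  simp [quartic]

variable {a b c d e : ℂ}

lemma IsDoubleCover.reverse (h : IsDoubleCover t w (quartic a b c d e))
    (hd : quarticDisc a b c d e ≠ 0) : IsDoubleCover t⁻¹ (w / t ^ 2) (quartic e d c b a) := by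
  have ht : t ≠ 0 := by
    have := h.aeval_ne_zero X_ne_zero
    rwa [aeval_X] at this
  refine ⟨fun h0 => h.transcendental (by simpa using h0.inv), ?_, ?_,
    isCoprime_quartic (by rwa [quarticDisc_reverse])⟩
  · rw [div_pow, h.sq_eq, aeval_quartic, aeval_quartic]
    field_simp
    ring
  · rw [eq_top_iff, ← h.adjoin_eq_top, IntermediateField.adjoin_le_iff]
    have h1 : t⁻¹ ∈ adjoin ℂ {t⁻¹, w / t ^ 2} :=
      IntermediateField.subset_adjoin _ _ (by simp)
    have h2 : w / t ^ 2 ∈ adjoin ℂ {t⁻¹, w / t ^ 2} :=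
      IntermediateField.subset_adjoin _ _ (by simp)
    have h3 : t ∈ adjoin ℂ {t⁻¹, w / t ^ 2} := by simpa using inv_mem h1
    rintro _ (rfl | rfl)
    · exact h3
    · have := mul_mem h2 (pow_mem h3 2)
      rwa [div_mul_cancel₀ _ (pow_ne_zero 2 ht)] at this

lemma IsDoubleCover.geometricGenus_eq_one (h : IsDoubleCover t w (quartic a b c d e))
    (hd : quarticDisc a b c d e ≠ 0) : geometricGenus F = 1 := by
  have ht : t ≠ 0 := by
    have := h.aeval_ne_zero X_ne_zero
    rwa [aeval_X] at this
  have h' := h.reverse hd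
  set ω := w⁻¹ • 𝐝 t with hω
  have hω' : (w / t ^ 2)⁻¹ • 𝐝 t⁻¹ = -ω := by
    rw [Derivation.leibniz_inv, smul_smul, hω, ← neg_smul]
    congr 1
    have := h.ne_zero
    field_simp
  have hω0 : ω ≠ 0 := smul_ne_zero (inv_ne_zero h.ne_zero)
    (D_ne_zero_of_transcendental h.transcendental)
  have hval : ∀ (O : ValuationSubring F) (hO : ∀ z : ℂ, algebraMap ℂ F z ∈ O),
      (∀ z ∈ O, ∃ g ∈ O, 𝐝 z = g • ω) ∧
      ω ∈ Submodule.span ℂ {η | ∃ a ∈ O, ∃ g ∈ O, η = a • 𝐝 g} := by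
    intro O hO
    have hO' : ∀ z, z ∈ valuationSubalgebra O hO ∨ z⁻¹ ∈ valuationSubalgebra O hO :=
      O.mem_or_inv_mem
    rcases hO' t with htO | htO
    · exact ⟨fun z hz => h.exists_D_eq (O := valuationSubalgebra O hO) hO' htO hz,
        h.D_mem_span (O := valuationSubalgebra O hO) hO' htO⟩
    · refine ⟨fun z hz => ?_, ?_⟩
      · obtain ⟨g, hg, e⟩ := h'.exists_D_eq (O := valuationSubalgebra O hO) hO' htO hz
        exact ⟨-g, neg_mem hg, by rw [e, hω', smul_neg, neg_smul]⟩
      · have := h'.D_mem_span (O := valuationSubalgebra O hO) hO' htO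
        rw [hω'] at this
        exact neg_mem_iff.mp this
  have htop : ∀ η : Ω[F⁄ℂ], ∃ g : F, η = g • ω := by
    intro η
    have hη : η ∈ Submodule.span F (Set.range (𝐝)) := by
      rw [KaehlerDifferential.span_range_derivation]; exact Submodule.mem_top
    induction hη using Submodule.span_induction with
    | mem x hx =>
      obtain ⟨z, rfl⟩ := hx
      obtain ⟨g, -, e⟩ := (hval ⊤ fun _ => trivial).1 z trivial
      exact ⟨g, e⟩
    | zero => exact ⟨0, (zero_smul _ _).symm⟩
    | add x y _ _ hx hy =>
      obtain ⟨g, rfl⟩ := hx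
      obtain ⟨g', rfl⟩ := hy
      exact ⟨g + g', (add_smul _ _ _).symm⟩
    | smul a x _ hx =>
      obtain ⟨g, rfl⟩ := hx
      exact ⟨a * g, smul_smul _ _ _⟩
  have hreg : regularDifferentials F = Submodule.span ℂ {ω} := by
    refine le_antisymm (fun η hη => ?_) ?_
    · rw [mem_regularDifferentials] at hη
      obtain ⟨z, rfl⟩ := htop η
      obtain ⟨c, rfl⟩ := exists_eq_algebraMap_of_forall_mem (z := z) fun O hO => by
        have hle : Submodule.span ℂ {η | ∃ a ∈ O, ∃ g ∈ O, η = a • 𝐝 g} ≤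
            (Subalgebra.toSubmodule (valuationSubalgebra O hO)).map
              ((LinearMap.toSpanSingleton F _ ω).restrictScalars ℂ) := by
          rw [Submodule.span_le]
          rintro _ ⟨a, ha, g, hg, rfl⟩
          obtain ⟨g', hg', e⟩ := (hval O hO).1 g hg
          exact ⟨a * g', O.mul_mem _ _ ha hg', by
            rw [e, smul_smul]; rfl⟩
        obtain ⟨y, hy, e⟩ := hle (hη O hO)
        have : y = z := smul_left_injective F hω0 e
        exact this ▸ hy
      rw [algebraMap_smul]
      exact Submodule.smul_mem _ _ (Submodule.mem_span_singleton_self ω)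
    · rw [Submodule.span_singleton_le_iff_mem, mem_regularDifferentials]
      exact fun O hO => (hval O hO).2
  rw [geometricGenus, hreg, finrank_span_singleton hω0]

end Genus

section FibreForms

variable {F : Type*} [Field F] {x y i β : F}

/-- The rational function `t` of degree two on the fibres of the pencil. -/
def tForm (x y i β : F) : F := -x - i * β * y + i / x + 1 / y + x / y + i * β * y / x

/-- `η` is a quadratic polynomial in `t` on each fibre of the pencil. -/
def etaForm (x y i : F) : F := ((1 - x) * y - i * x) / x ^ 2

/-- `ω²` is a quartic polynomial in `t` on each fibre of the pencil. -/
def omegaForm (x y i β : F) : F := y + i / y + i * β * y ^ 2 / x - (β + 1) * y / x + i / (x * y) -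
  2 * i * β * y ^ 2 / x ^ 2 + (β + i) * y / x ^ 2 - 2 / x ^ 2 + i * β * y ^ 2 / x ^ 3 - i * y / x ^ 3

lemma omegaForm_sq (hx : x ≠ 0) (hy : y ≠ 0) (hi : i ^ 2 = -1) :
    omegaForm x y i β ^ 2 = (tForm x y i β * etaForm x y i + 1 - i) ^ 2 +
      4 * (β * etaForm x y i + i) * (etaForm x y i ^ 2 + 1) := by
  unfold omegaForm tForm etaForm
  field_simp
  grind

lemma pencil_eq_forms (hx : x ≠ 0) (hy : y ≠ 0) (hi : i ^ 2 = -1) :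
    (i * x * (x + 1) ^ 2 - i * (x + i) * (x ^ 2 - 1) * y + β * (x - 1) ^ 2 * y ^ 2) *
        (-i * x * (y - 1) + y * (β * y - 1)) / (x ^ 2 * y ^ 2) =
     -(tForm x y i β ^ 2 + 4 * β * etaForm x y i + 2 * i) := by
  unfold tForm etaForm
  field_simp
  grind

lemma fst_mul_forms (hx : x ≠ 0) (hy : y ≠ 0) (hi : i ^ 2 = -1) :
    x * (omegaForm x y i β - tForm x y i β * etaForm x y i - 2 * β * etaForm x y i - 1 - i) =
      2 * i * (tForm x y i β + β - etaForm x y i) := by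
  unfold omegaForm tForm etaForm
  field_simp
  grind

lemma snd_mul_forms (hx : x ≠ 0) : (1 - x) * y = x ^ 2 * etaForm x y i + i * x := by
  unfold etaForm
  field_simp
  ring

lemma omegaForm_quartic (hx : x ≠ 0) (hy : y ≠ 0) (hi : i ^ 2 = -1) (c : F)
   (hc : c = -(tForm x y i β ^ 2 + 4 * β * etaForm x y i + 2 * i)) :
    (4 * i * β * omegaForm x y i β) ^ 2 = (c - 2 * i) * tForm x y i β ^ 4 +
      (8 * β * (1 - i)) * tForm x y i β ^ 3 +
      (2 * (c - 2 * i) * (c + 2 * i) + 16 * β ^ 2) * tForm x y i β ^ 2 +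
      (8 * β * (1 - i) * (c + 2 * i)) * tForm x y i β +
      ((c - 2 * i) * (c + 2 * i) ^ 2 + 16 * β ^ 2 * c) := by
  have h1 := omegaForm_sq (β := β) hx hy hi
  rw [mul_pow, h1, hc]
  generalize tForm x y i β = t
  generalize etaForm x y i = η
  grind

lemma fst_cubic (hx : x ≠ 0) (hy : y ≠ 0) (hi : i ^ 2 = -1) :
    etaForm x y i * (1 - i * β * etaForm x y i) * x ^ 3 + ((tForm x y i β + β) * etaForm x y i +
      i * (1 - i * β * etaForm x y i) + 1) * x ^ 2 + i * (tForm x y i β + β - etaForm x y i) * x = 0 := by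
  unfold tForm etaForm
  field_simp
  grind

end FibreForms

section FibreDoubleCover

open Polynomial

/-- The quartic polynomial of the fibre over `c`. -/
def fibreQuartic (b c : ℂ) : ℂ[X] := quartic (c - 2 * I) (8 * b * (1 - I))
  (2 * (c - 2 * I) * (c + 2 * I) + 16 * b ^ 2)
  (8 * b * (1 - I) * (c + 2 * I))
  ((c - 2 * I) * (c + 2 * I) ^ 2 + 16 * b ^ 2 * c)

/-- The discriminant of `fibreQuartic`. -/
def fibreDisc (b c : ℂ) : ℂ := quarticDisc (c - 2 * I) (8 * b * (1 - I))
  (2 * (c - 2 * I) * (c + 2 * I) + 16 * b ^ 2)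
  (8 * b * (1 - I) * (c + 2 * I))
  ((c - 2 * I) * (c + 2 * I) ^ 2 + 16 * b ^ 2 * c)

lemma quarticDisc_identity {R : Type*} [CommRing R] {i : R} (hi : i ^ 2 = -1) (b c : R) :
    4 * (12 * (c - 2 * i) * ((c - 2 * i) * (c + 2 * i) ^ 2 + 16 * b ^ 2 * c) -
      3 * (8 * b * (1 - i)) * (8 * b * (1 - i) * (c + 2 * i)) +
      (2 * (c - 2 * i) * (c + 2 * i) + 16 * b ^ 2) ^ 2) ^ 3 -
    (72 * (c - 2 * i) * (2 * (c - 2 * i) * (c + 2 * i) + 16 * b ^ 2) *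
      ((c - 2 * i) * (c + 2 * i) ^ 2 + 16 * b ^ 2 * c) +
      9 * (8 * b * (1 - i)) * (2 * (c - 2 * i) * (c + 2 * i) + 16 * b ^ 2) *
      (8 * b * (1 - i) * (c + 2 * i)) - 27 * (c - 2 * i) * (8 * b * (1 - i) * (c + 2 * i)) ^ 2 -
      27 * ((c - 2 * i) * (c + 2 * i) ^ 2 + 16 * b ^ 2 * c) * (8 * b * (1 - i)) ^ 2 -
      2 * (2 * (c - 2 * i) * (c + 2 * i) + 16 * b ^ 2) ^ 3) ^ 2 =
    -28311552 * b ^ 4 * c ^ 2 *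
      (c ^ 4 - (b ^ 4 - 20 * b ^ 2 - 8) * c ^ 2 - 16 * (b ^ 2 - 1) ^ 3) := by
  grind

lemma fibreDisc_eq (b c : ℂ) : fibreDisc b c = -28311552 * b ^ 4 * c ^ 2 *
    (c ^ 4 - (b ^ 4 - 20 * b ^ 2 - 8) * c ^ 2 - 16 * (b ^ 2 - 1) ^ 3) :=
  quarticDisc_identity I_sq b c

lemma ne_zero_of_fibreDisc_ne_zero {b c : ℂ} (h : fibreDisc b c ≠ 0) : b ≠ 0 ∧ c ≠ 0 := by
  rw [fibreDisc_eq] at h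
  constructor
  · rintro rfl; simp at h
  · rintro rfl; simp at h

lemma finite_fibreDisc_eq_zero {b : ℂ} (hb : b ≠ 0) : {c : ℂ | fibreDisc b c = 0}.Finite := by
  have hfin : ∀ u v : ℂ, {c : ℂ | c ^ 2 * (c ^ 4 - u * c ^ 2 - v) = 0}.Finite := fun u v => by
    have hp : (X ^ 2 * (X ^ 4 - C u * X ^ 2 - C v) : ℂ[X]) ≠ 0 := by
      refine mul_ne_zero (pow_ne_zero 2 X_ne_zero) fun h => ?_
      have := congrArg (coeff · 4) h
      simp [coeff_X_pow] at this
    refine (Polynomial.finite_setOfPred_isRoot hp).subset fun c hc => ?_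
    rw [Set.mem_ofPred_eq] at hc ⊢
    simpa [IsRoot.def] using hc
  refine (hfin (b ^ 4 - 20 * b ^ 2 - 8) (16 * (b ^ 2 - 1) ^ 3)).subset fun c hc => ?_
  rw [Set.mem_ofPred_eq, fibreDisc_eq, mul_assoc, mul_assoc] at hc
  have h1 := (mul_eq_zero.mp hc).resolve_left (by norm_num)
  exact (mul_eq_zero.mp h1).resolve_left (pow_ne_zero 4 hb)

variable {F : Type*} [Field F] [Algebra ℂ F] {x y : F} {b c : ℂ}

local notation "ι" => algebraMap ℂ F

lemma exists_eq_of_isAlgebraic {z : F} (h : IsAlgebraic ℂ z) : ∃ a, z = ι a := by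
  obtain ⟨c, hc⟩ := minpoly.mem_range_of_degree_eq_one ℂ z
    (IsAlgClosed.degree_eq_one_of_irreducible ℂ (minpoly.irreducible h.isIntegral))
  exact ⟨c, hc.symm⟩

/-- `x`, `y` are the coordinates of a generic point of a component of the fibre over `c`. -/
structure IsFibrePoint (b c : ℂ) (x y : F) : Prop where
  fst_ne_zero : x ≠ 0
  snd_ne_zero : y ≠ 0
  pencil_eq : ι c = -(tForm x y (ι I) (ι b) ^ 2 + 4 * ι b * etaForm x y (ι I) +
    2 * ι I)
  not_const : ¬ ((∃ a, x = ι a) ∧ ∃ a, y = ι a)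
  adjoin_eq_top : adjoin ℂ {x, y} = ⊤

namespace IsFibrePoint

lemma I_sq : (ι I) ^ 2 = -1 := by rw [← map_pow, Complex.I_sq, map_neg, map_one]

lemma etaForm_eq (h : IsFibrePoint b c x y) (hb : b ≠ 0) : etaForm x y (ι I) =
    -(tForm x y (ι I) (ι b) ^ 2 + ι c + 2 * ι I) / (4 * ι b) := by
  have hb' : ι b ≠ 0 := (_root_.map_ne_zero _).mpr hb
  have := Algebra.charZero_of_charZero ℂ F
  have h4 : (4 : F) ≠ 0 := by norm_num
  rw [eq_div_iff (mul_ne_zero h4 hb')]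
  linear_combination h.pencil_eq

lemma transcendental (h : IsFibrePoint b c x y) (hd : fibreDisc b c ≠ 0) :
    Transcendental ℂ (tForm x y (ι I) (ι b)) := by
  obtain ⟨hb, hc⟩ := ne_zero_of_fibreDisc_ne_zero hd
  intro halg
  obtain ⟨t, ht⟩ := exists_eq_of_isAlgebraic halg
  obtain ⟨e, he⟩ : ∃ e, etaForm x y (ι I) = ι e := by
    refine ⟨-(t ^ 2 + c + 2 * I) / (4 * b), ?_⟩
    rw [h.etaForm_eq hb, ht]
    simp only [map_div₀, map_neg, map_add, map_mul, map_pow, map_ofNat]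
  have hy := snd_mul_forms (y := y) (i := ι I) h.fst_ne_zero
  have hcub := fst_cubic (β := ι b) h.fst_ne_zero h.snd_ne_zero I_sq
  have hpen := h.pencil_eq
  have hI := Complex.I_sq
  rw [ht, he] at hcub hpen
  have hpen' : c = -(t ^ 2 + 4 * b * e + 2 * I) := by
    refine (algebraMap ℂ F).injective ?_
    rw [hpen]
    simp only [map_neg, map_add, map_mul, map_pow, map_ofNat]
  have hx : ∃ a, x = ι a := by
    refine exists_eq_of_isAlgebraic ?_
    by_contra htr
    have key : ∀ p : ℂ[X], aeval x p = 0 → p = 0 := fun p hp => by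
      by_contra h0; exact htr ⟨p, h0, hp⟩
    have hcoeff : ∀ u v w : ℂ, ι u * x ^ 3 + ι v * x ^ 2 + ι w * x = 0 →
        u = 0 ∧ v = 0 ∧ w = 0 := fun u v w huvw => by
      have h0 := key (C u * X ^ 3 + C v * X ^ 2 + C w * X) (by simpa using huvw)
      have h3 := congrArg (coeff · 3) h0
      have h2 := congrArg (coeff · 2) h0
      have h1 := congrArg (coeff · 1) h0
      simp [coeff_X_pow, coeff_C] at h1 h2 h3
      exact ⟨h3, h2, h1⟩
    obtain ⟨h3, h2, h1⟩ := hcoeff (e * (1 - I * b * e))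
      ((t + b) * e + I * (1 - I * b * e) + 1) (I * (t + b - e))
      (by rw [← hcub]; simp only [map_add, map_sub, map_mul, map_one])
    have h1' : t + b - e = 0 := (mul_eq_zero.mp h1).resolve_left I_ne_zero
    apply hc
    generalize I = i at *
    grind
  refine h.not_const ⟨hx, ?_⟩
  obtain ⟨a, rfl⟩ := hx
  by_cases ha : ι a = 1
  · rw [ha] at ht
    have hy0 := h.snd_ne_zero
    have h1 : ι (t + 1 - I) * y = 2 := by
      rw [map_sub, map_add, ← ht, tForm, map_one]
      field_simp
      ring
    have h2 : ι (t + 1 - I) ≠ 0 := by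
      intro h0
      have := Algebra.charZero_of_charZero ℂ F
      rw [h0, zero_mul] at h1
      exact two_ne_zero h1.symm
    refine ⟨2 / (t + 1 - I), ?_⟩
    rw [map_div₀, eq_div_iff h2, mul_comm, h1, map_ofNat]
  · refine ⟨(a ^ 2 * e + I * a) / (1 - a), ?_⟩
    have h1 : (1 : F) - ι a ≠ 0 := sub_ne_zero.mpr (Ne.symm ha)
    rw [map_div₀, eq_div_iff (by simpa using h1)]
    rw [he] at hy
    simp only [map_add, map_sub, map_mul, map_pow, map_one]
    linear_combination hy

end IsFibrePoint

end FibreDoubleCover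

section

open Polynomial

section PairOfDoubleCovers

variable {F F' : Type*} [Field F] [Algebra ℂ F] [Field F'] [Algebra ℂ F'] {t w : F} {t' w' : F'}
  {q : ℂ[X]}

lemma eq_zero_of_sq_eq_sq_mul (hq : IsCoprime q (derivative q)) (hdeg : q.natDegree ≠ 0)
    {α β : ℂ[X]} (h : α ^ 2 = β ^ 2 * q) : α = 0 ∧ β = 0 := by
  have hβ : β = 0 := by
    by_contra hβ
    have hq0 : q ≠ 0 := by rintro rfl; simp at hdeg
    obtain ⟨r, hr⟩ := IsAlgClosed.exists_root q (fun h0 => hdeg (natDegree_eq_of_degree_eq_some h0))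
    have h1 : q.rootMultiplicity r = 1 := le_antisymm
      (rootMultiplicity_le_one_of_separable hq r) ((rootMultiplicity_pos hq0).mpr hr)
    have h2 := congrArg (rootMultiplicity r) h
    have hne : β ^ 2 * q ≠ 0 := mul_ne_zero (pow_ne_zero 2 hβ) hq0
    have hα : α ^ 2 ≠ 0 := h ▸ hne
    rw [rootMultiplicity_mul hne, sq, sq, rootMultiplicity_mul (sq α ▸ hα),
      rootMultiplicity_mul (mul_ne_zero hβ hβ), h1] at h2
    omega
  refine ⟨?_, hβ⟩
  rw [hβ] at h
  simpa using h

lemma IsDoubleCover.eq_zero_of_add_eq_zero (h : IsDoubleCover t w q) (hdeg : q.natDegree ≠ 0)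
    {α β : ℂ[X]} (h0 : aeval t α + aeval t β * w = 0) : α = 0 ∧ β = 0 := by
  refine eq_zero_of_sq_eq_sq_mul h.isCoprime hdeg ?_
  by_contra hne
  refine h.aeval_ne_zero (sub_ne_zero.mpr hne) ?_
  have := h.sq_eq
  simp only [map_sub, map_mul, map_pow]
  linear_combination (aeval t α - aeval t β * w) * h0 + aeval t β ^ 2 * this

/-- The elements of `F × F'` given by the same rational function of `t`, `w` and of `t'`, `w'`. -/
def IsDoubleCover.pairs (h : IsDoubleCover t w q) (h' : IsDoubleCover t' w' q) :
    Subalgebra ℂ (F × F') where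
  carrier := {z | ∃ α β δ : ℂ[X], δ ≠ 0 ∧ aeval t δ * z.1 = aeval t α + aeval t β * w ∧
    aeval t' δ * z.2 = aeval t' α + aeval t' β * w'}
  mul_mem' := by
    rintro z₁ z₂ ⟨α, β, δ, hδ, e, e'⟩ ⟨α₂, β₂, δ₂, hδ₂, e₂, e₂'⟩
    refine ⟨α * α₂ + β * β₂ * q, α * β₂ + β * α₂, δ * δ₂, mul_ne_zero hδ hδ₂, ?_, ?_⟩
    · simp only [map_mul, map_add, ← h.sq_eq, Prod.fst_mul]
      linear_combination (aeval t δ₂ * z₂.1) * e + (aeval t α + aeval t β * w) * e₂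
    · simp only [map_mul, map_add, ← h'.sq_eq, Prod.snd_mul]
      linear_combination (aeval t' δ₂ * z₂.2) * e' + (aeval t' α + aeval t' β * w') * e₂'
  add_mem' := by
    rintro z₁ z₂ ⟨α, β, δ, hδ, e, e'⟩ ⟨α₂, β₂, δ₂, hδ₂, e₂, e₂'⟩
    refine ⟨δ₂ * α + δ * α₂, δ₂ * β + δ * β₂, δ * δ₂, mul_ne_zero hδ hδ₂, ?_, ?_⟩
    · simp only [map_mul, map_add, Prod.fst_add]
      linear_combination aeval t δ₂ * e + aeval t δ * e₂
    · simp only [map_mul, map_add, Prod.snd_add]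
      linear_combination aeval t' δ₂ * e' + aeval t' δ * e₂'
  algebraMap_mem' c := ⟨C c, 0, 1, one_ne_zero, by simp, by simp⟩

namespace IsDoubleCover

variable (h : IsDoubleCover t w q) (h' : IsDoubleCover t' w' q)

lemma pair_snd_mem : (w, w') ∈ h.pairs h' := ⟨0, 1, 1, one_ne_zero, by simp, by simp⟩

lemma snd_eq_zero_of_mem_pairs {z : F} {z' : F'} (hdeg : q.natDegree ≠ 0)
    (hz : (z, z') ∈ h.pairs h') (h0 : z = 0) : z' = 0 := by
  obtain ⟨α, β, δ, hδ, e, e'⟩ := hz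
  obtain ⟨rfl, rfl⟩ := h.eq_zero_of_add_eq_zero hdeg (by rw [← e, h0, mul_zero])
  simp only [map_zero, zero_mul, add_zero] at e'
  exact (mul_eq_zero.mp e').resolve_left (h'.aeval_ne_zero hδ)

lemma mem_pairs_of_mul_mem {u z : F} {u' z' : F'} (hdeg : q.natDegree ≠ 0)
    (hu : (u, u') ∈ h.pairs h') (hu0 : u ≠ 0) (hz : (u * z, u' * z') ∈ h.pairs h') :
    (z, z') ∈ h.pairs h' := by
  obtain ⟨α, β, δ, hδ, e, e'⟩ := hu
  obtain ⟨α₂, β₂, δ₂, hδ₂, e₂, e₂'⟩ := hz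
  have hne : α ^ 2 - β ^ 2 * q ≠ 0 := fun h0 => by
    obtain ⟨rfl, rfl⟩ := eq_zero_of_sq_eq_sq_mul h.isCoprime hdeg (sub_eq_zero.mp h0)
    refine mul_ne_zero (h.aeval_ne_zero hδ) hu0 ?_
    rw [e]
    simp
  refine ⟨δ * (α * α₂ - β * β₂ * q), δ * (α * β₂ - β * α₂), (α ^ 2 - β ^ 2 * q) * δ₂,
    mul_ne_zero hne hδ₂, ?_, ?_⟩
  · simp only [map_mul, map_sub, map_pow, ← h.sq_eq] at e e₂ ⊢
    linear_combination -(aeval t α - aeval t β * w) * aeval t δ₂ * z * e +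
      (aeval t α - aeval t β * w) * aeval t δ * e₂
  · simp only [map_mul, map_sub, map_pow, ← h'.sq_eq] at e' e₂' ⊢
    linear_combination -(aeval t' α - aeval t' β * w') * aeval t' δ₂ * z' * e' +
      (aeval t' α - aeval t' β * w') * aeval t' δ * e₂'

end IsDoubleCover

end PairOfDoubleCovers

section FibrePoints

variable {F F' : Type*} [Field F] [Algebra ℂ F] [Field F'] [Algebra ℂ F'] {x y : F} {x' y' : F'}
  {b c : ℂ}

local notation "ι" => algebraMap ℂ F

lemma natDegree_fibreQuartic_ne_zero (hd : fibreDisc b c ≠ 0) :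
    (fibreQuartic b c).natDegree ≠ 0 := by
  have hb := (ne_zero_of_fibreDisc_ne_zero hd).1
  intro h0
  have h3 := coeff_eq_zero_of_natDegree_lt (p := fibreQuartic b c) (n := 3) (by omega)
  have hq : ∀ u v w x y : ℂ, (quartic u v w x y).coeff 3 = v := fun u v w x y => by
    simp [quartic, coeff_X_pow]
  rw [fibreQuartic, hq] at h3
  have h1 : (1 - I) ≠ 0 := fun h => by simpa using congrArg Complex.im h
  exact mul_ne_zero (mul_ne_zero (by norm_num) hb) h1 h3

namespace IsFibrePoint

/-- `η` as a polynomial in `t`. -/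
def etaPoly (b c : ℂ) : ℂ[X] := C (-1 / (4 * b)) * (X ^ 2 + C (c + 2 * I))

lemma aeval_etaPoly (h : IsFibrePoint b c x y) (hb : b ≠ 0) :
    aeval (tForm x y (ι I) (ι b)) (etaPoly b c) = etaForm x y (ι I) := by
  rw [h.etaForm_eq hb, etaPoly]
  simp only [map_mul, map_add, map_pow, aeval_X, aeval_C, map_div₀, map_neg, map_one, map_ofNat]
  ring

lemma add_sub_ne_zero (h : IsFibrePoint b c x y) (hd : fibreDisc b c ≠ 0) :
    tForm x y (ι I) (ι b) + ι b - etaForm x y (ι I) ≠ 0 := by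
  have hb := (ne_zero_of_fibreDisc_ne_zero hd).1
  rw [← h.aeval_etaPoly hb]
  intro h0
  refine h.transcendental hd ⟨X + C b - etaPoly b c, fun h1 => ?_, by simpa using h0⟩
  have := congrArg (coeff · 2) h1
  simp [etaPoly, coeff_X, hb] at this

lemma fst_ne_one (h : IsFibrePoint b c x y) (hd : fibreDisc b c ≠ 0) : x ≠ 1 := by
  have hb := (ne_zero_of_fibreDisc_ne_zero hd).1
  have h0 := snd_mul_forms (y := y) (i := ι I) h.fst_ne_zero
  rw [← h.aeval_etaPoly hb] at h0
  intro hx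
  rw [hx] at h0
  refine h.transcendental hd ⟨etaPoly b c + C I, fun h1 => ?_, ?_⟩
  · have := congrArg (coeff · 2) h1
    simp [etaPoly, hb] at this
  · rw [hx, map_add, aeval_C]
    linear_combination -h0

lemma isDoubleCover (h : IsFibrePoint b c x y) (hd : fibreDisc b c ≠ 0) :
    IsDoubleCover (tForm x y (ι I) (ι b))
      (4 * ι I * ι b * omegaForm x y (ι I) (ι b)) (fibreQuartic b c) where
  transcendental := h.transcendental hd
  isCoprime := isCoprime_quartic hd
  sq_eq := by
    rw [omegaForm_quartic h.fst_ne_zero h.snd_ne_zero I_sq (ι c) h.pencil_eq, fibreQuartic,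
      aeval_quartic]
    simp only [map_mul, map_add, map_sub, map_pow, map_one, map_ofNat]
  adjoin_eq_top := by
    have hb := (ne_zero_of_fibreDisc_ne_zero hd).1
    have hb' : ι b ≠ 0 := (_root_.map_ne_zero _).mpr hb
    have hI' : ι I ≠ 0 := (_root_.map_ne_zero _).mpr I_ne_zero
    have := Algebra.charZero_of_charZero ℂ F
    have hη := h.aeval_etaPoly hb
    have hN := h.add_sub_ne_zero hd
    have hx1 := h.fst_ne_one hd
    have e1 := fst_mul_forms (β := ι b) h.fst_ne_zero h.snd_ne_zero I_sq
    have e2 := snd_mul_forms (y := y) (i := ι I) h.fst_ne_zero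
    generalize tForm x y (ι I) (ι b) = t at *
    generalize omegaForm x y (ι I) (ι b) = o at *
    generalize etaForm x y (ι I) = η at *
    set E := adjoin ℂ {t, 4 * ι I * ι b * o}
    have hc : ∀ z, ι z ∈ E := fun z => E.algebraMap_mem z
    have ht : t ∈ E := IntermediateField.subset_adjoin _ _ (by simp)
    have hw : 4 * ι I * ι b * o ∈ E := IntermediateField.subset_adjoin _ _ (by simp)
    have hη' : η ∈ E := hη ▸ aeval_mem_of_mem (A := E.toSubalgebra) ht _
    have ho : o ∈ E := by
      have : o = ι (1 / (4 * I * b)) * (4 * ι I * ι b * o) := by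
        simp only [map_div₀, map_mul, map_one, map_ofNat]
        field_simp
      rw [this]
      exact E.mul_mem (hc _) hw
    have h2 : (2 : F) ∈ E := by simp
    have hD : o - t * η - 2 * ι b * η - 1 - ι I ≠ 0 := fun h0 => by
      rw [h0, mul_zero] at e1
      exact mul_ne_zero (mul_ne_zero two_ne_zero hI') hN e1.symm
    have hx : x ∈ E := by
      rw [← eq_div_iff hD] at e1
      rw [e1]
      exact E.div_mem (E.mul_mem (E.mul_mem h2 (hc _)) (E.sub_mem (E.add_mem ht (hc _)) hη'))
        (E.sub_mem (E.sub_mem (E.sub_mem (E.sub_mem ho (E.mul_mem ht hη'))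
          (E.mul_mem (E.mul_mem h2 (hc _)) hη')) E.one_mem) (hc _))
    have hy : y ∈ E := by
      rw [mul_comm, ← eq_div_iff (sub_ne_zero.mpr hx1.symm)] at e2
      rw [e2]
      exact E.div_mem (E.add_mem (E.mul_mem (pow_mem hx 2) hη') (E.mul_mem (hc _) hx))
        (E.sub_mem E.one_mem hx)
    rw [eq_top_iff, ← h.adjoin_eq_top, IntermediateField.adjoin_le_iff]
    rintro z (rfl | rfl)
    exacts [hx, hy]

lemma geometricGenus_eq_one (h : IsFibrePoint b c x y) (hd : fibreDisc b c ≠ 0) :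
    geometricGenus F = 1 := (h.isDoubleCover hd).geometricGenus_eq_one hd

lemma mul_fst_eq (h : IsFibrePoint b c x y) :
    (omegaForm x y (ι I) (ι b) - tForm x y (ι I) (ι b) * etaForm x y (ι I) -
      ι (2 * b) * etaForm x y (ι I) - 1 - ι I) * x =
    ι (2 * I) * (tForm x y (ι I) (ι b) + ι b - etaForm x y (ι I)) := by
  simp only [map_mul, map_ofNat]
  linear_combination fst_mul_forms (β := ι b) h.fst_ne_zero h.snd_ne_zero I_sq

lemma aeval_eq_zero (h : IsFibrePoint b c x y) (h' : IsFibrePoint b c x' y')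
    (hd : fibreDisc b c ≠ 0) (P : MvPolynomial (Fin 4) ℂ)
    (hP : MvPolynomial.aeval ![x, y, x⁻¹, y⁻¹] P = 0) :
    MvPolynomial.aeval ![x', y', x'⁻¹, y'⁻¹] P = 0 := by
  have hb := (ne_zero_of_fibreDisc_ne_zero hd).1
  have hdeg := natDegree_fibreQuartic_ne_zero hd
  have := Algebra.charZero_of_charZero ℂ F
  have hb₁ : ι b ≠ 0 := (_root_.map_ne_zero _).mpr hb
  have hI₁ : ι I ≠ 0 := (_root_.map_ne_zero _).mpr I_ne_zero
  have H := h.isDoubleCover hd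
  have H' := h'.isDoubleCover hd
  set S := H.pairs H'
  have hc : ∀ z, (algebraMap ℂ F z, algebraMap ℂ F' z) ∈ S := fun z => S.algebraMap_mem z
  have hpoly : ∀ p : ℂ[X], (aeval (tForm x y (ι I) (ι b)) p,
      aeval (tForm x' y' (algebraMap ℂ F' I) (algebraMap ℂ F' b)) p) ∈ S := fun p =>
    ⟨p, 0, 1, one_ne_zero, by simp, by simp⟩
  have hη := hpoly (etaPoly b c)
  have ht := hpoly X
  have hw := H.pair_snd_mem H'
  have e1 := h.mul_fst_eq
  have e1' := h'.mul_fst_eq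
  have e2 := snd_mul_forms (y := y) (i := ι I) h.fst_ne_zero
  have e2' := snd_mul_forms (y := y') (i := algebraMap ℂ F' I) h'.fst_ne_zero
  have hN := h.add_sub_ne_zero hd
  have hx1 := h.fst_ne_one hd
  rw [h.aeval_etaPoly hb, h'.aeval_etaPoly hb] at hη
  rw [aeval_X, aeval_X] at ht
  have hdiv : ∀ {u z : F} {u' z' : F'}, (u, u') ∈ S → u ≠ 0 → (u * z, u' * z') ∈ S →
    (z, z') ∈ S := fun h1 h2 h3 => H.mem_pairs_of_mul_mem H' hdeg h1 h2 h3
  have ho : (omegaForm x y (ι I) (ι b),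
      omegaForm x' y' (algebraMap ℂ F' I) (algebraMap ℂ F' b)) ∈ S := by
    refine hdiv (hc (4 * I * b)) ((_root_.map_ne_zero _).mpr ?_) ?_
    · exact mul_ne_zero (mul_ne_zero (by norm_num) I_ne_zero) hb
    · simpa only [map_mul, map_ofNat] using hw
  have hx : (x, x') ∈ S := by
    have hD := S.sub_mem (S.sub_mem (S.sub_mem (S.sub_mem ho (S.mul_mem ht hη))
          (S.mul_mem (hc (2 * b)) hη)) S.one_mem) (hc I)
    refine hdiv hD ?_ ?_
    · intro h0
      refine mul_ne_zero ?_ hN (e1.symm.trans (mul_eq_zero_of_left h0 x))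
      rw [map_mul, map_ofNat]
      exact mul_ne_zero two_ne_zero hI₁
    · have hN' := S.mul_mem (hc (2 * I)) (S.sub_mem (S.add_mem ht (hc b)) hη)
      convert hN' using 1
      exact Prod.ext e1 e1'
  have hy : (y, y') ∈ S := by
    refine hdiv (S.sub_mem S.one_mem hx) (sub_ne_zero.mpr hx1.symm) ?_
    have hN' := S.add_mem (S.mul_mem (S.pow_mem hx 2) hη) (S.mul_mem (hc I) hx)
    convert hN' using 1
    exact Prod.ext e2 e2'
  have hx' : (x⁻¹, x'⁻¹) ∈ S := hdiv hx h.fst_ne_zero (by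
    rw [mul_inv_cancel₀ h.fst_ne_zero, mul_inv_cancel₀ h'.fst_ne_zero]; exact S.one_mem)
  have hy' : (y⁻¹, y'⁻¹) ∈ S := hdiv hy h.snd_ne_zero (by
    rw [mul_inv_cancel₀ h.snd_ne_zero, mul_inv_cancel₀ h'.snd_ne_zero]; exact S.one_mem)
  have hmem : (MvPolynomial.aeval ![x, y, x⁻¹, y⁻¹] P,
      MvPolynomial.aeval ![x', y', x'⁻¹, y'⁻¹] P) ∈ S := by
    have key : MvPolynomial.aeval ![(x, x'), (y, y'), (x⁻¹, x'⁻¹), (y⁻¹, y'⁻¹)] P ∈ S := by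
      have : MvPolynomial.aeval ![(x, x'), (y, y'), (x⁻¹, x'⁻¹), (y⁻¹, y'⁻¹)] P =
          S.val (MvPolynomial.aeval ![⟨_, hx⟩, ⟨_, hy⟩, ⟨_, hx'⟩, ⟨_, hy'⟩] P) := by
        rw [MvPolynomial.comp_aeval_apply]
        congr 2
        funext i
        fin_cases i <;> rfl
      rw [this]
      exact Subtype.property _
    convert key using 1
    have h1 := MvPolynomial.comp_aeval_apply (f := ![(x, x'), (y, y'), (x⁻¹, x'⁻¹), (y⁻¹, y'⁻¹)])
      (AlgHom.fst ℂ F F') P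
    have h2 := MvPolynomial.comp_aeval_apply (f := ![(x, x'), (y, y'), (x⁻¹, x'⁻¹), (y⁻¹, y'⁻¹)])
      (AlgHom.snd ℂ F F') P
    refine Prod.ext
      (Eq.trans (congrArg (fun f : Fin 4 → F => MvPolynomial.aeval f P) ?_) h1.symm)
      (Eq.trans (congrArg (fun f : Fin 4 → F' => MvPolynomial.aeval f P) ?_) h2.symm)
    all_goals
      funext i
      fin_cases i <;> rfl
  exact H.snd_eq_zero_of_mem_pairs H' hdeg hmem hP

end IsFibrePoint

end FibrePoints

end

section

variable {b c : ℂ} {R W W' : Subalgebra ℂ PlaneField} {u v : PlaneField}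

lemma IsCoord.not_fst_and_snd_mem (h : IsCoord u v) {p : Ideal (Pt u v)} [p.IsPrime]
    (hp : p.height = 1) : ¬ ((⟨u, fst_mem_Pt⟩ : Pt u v) ∈ p ∧ (⟨v, snd_mem_Pt⟩ : Pt u v) ∈ p) := by
  rintro ⟨hu, hv⟩
  have := h.isLocalRing
  obtain ⟨ψ, hψu, hψv⟩ := h.exists_arc PowerSeries.X 0 (by simp) (by simp)
  have hlt : RingHom.ker ψ < p := by
    refine lt_of_le_of_ne ?_ ?_
    · have hm : maxIdeal (Pt u v) ≤ p := by
        rw [← h.span_eq_maxIdeal, Ideal.span_le]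
        rintro z (rfl | rfl)
        exacts [hu, hv]
      refine le_trans (IsLocalRing.le_maximalIdeal (RingHom.ker_ne_top ψ)) ?_
      rw [← maxIdeal_eq]
      exact hm
    · rintro h0
      rw [← h0, RingHom.mem_ker, hψu] at hu
      exact PowerSeries.X_ne_zero hu
  have := h.isNoetherianRing
  have : (RingHom.ker ψ).IsPrime := RingHom.ker_isPrime _
  have h1 := Ideal.height_strict_mono_of_isPrime hlt
  rw [hp, Order.lt_one_iff, Ideal.height_eq_zero_iff] at h1
  rw [IsDomain.minimalPrimes_eq_singleton_bot, Set.mem_singleton_iff] at h1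
  have h2 : (⟨v, snd_mem_Pt⟩ : Pt u v) ∈ RingHom.ker ψ := hψv
  rw [h1, Ideal.mem_bot] at h2
  exact h.snd_ne_zero (congrArg Subtype.val h2)

/-- The coordinate ring of the torus `x y ≠ 0`. -/
def torusRing : Subalgebra ℂ PlaneField := Algebra.adjoin ℂ {xc, yc, xc⁻¹, yc⁻¹}

lemma xc_mem_torusRing : xc ∈ torusRing := Algebra.subset_adjoin (by simp)
lemma yc_mem_torusRing : yc ∈ torusRing := Algebra.subset_adjoin (by simp)
lemma inv_xc_mem_torusRing : xc⁻¹ ∈ torusRing := Algebra.subset_adjoin (by simp)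
lemma inv_yc_mem_torusRing : yc⁻¹ ∈ torusRing := Algebra.subset_adjoin (by simp)

lemma cst_mem (A : Subalgebra ℂ PlaneField) (z : ℂ) : cst z ∈ A := A.algebraMap_mem z

lemma corner_mem_torusRing (j : Fin 6) : cornerU j ∈ torusRing ∧ cornerV j ∈ torusRing ∧
    (cornerV j)⁻¹ ∈ torusRing := by
  have h1 := xc_mem_torusRing
  have h2 := yc_mem_torusRing
  have h3 := inv_xc_mem_torusRing
  have h4 := inv_yc_mem_torusRing
  have h5 := torusRing.mul_mem h1 h4
  have h6 := torusRing.mul_mem h2 h3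
  rw [← div_eq_mul_inv] at h5 h6
  fin_cases j <;> simp [cornerU, cornerV, *]

lemma exists_aeval_of_mem_torusRing {z : PlaneField} (hz : z ∈ torusRing) :
    ∃ P : MvPolynomial (Fin 4) ℂ, z = MvPolynomial.aeval ![xc, yc, xc⁻¹, yc⁻¹] P := by
  have h : Set.range ![xc, yc, xc⁻¹, yc⁻¹] = {xc, yc, xc⁻¹, yc⁻¹} := by
    simp only [Matrix.range_cons, Matrix.range_empty, Set.union_empty, Set.singleton_union]
  rw [torusRing, ← h, Algebra.adjoin_range_eq_range_aeval] at hz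
  obtain ⟨P, rfl⟩ := hz
  exact ⟨P, rfl⟩

lemma aeval_mem_torusRing (P : MvPolynomial (Fin 4) ℂ) :
    MvPolynomial.aeval ![xc, yc, xc⁻¹, yc⁻¹] P ∈ torusRing := by
  have h1 : Set.range ![xc, yc, xc⁻¹, yc⁻¹] = {xc, yc, xc⁻¹, yc⁻¹} := by
    simp only [Matrix.range_cons, Matrix.range_empty, Set.union_empty, Set.singleton_union]
  rw [torusRing, ← h1, Algebra.adjoin_range_eq_range_aeval]
  exact ⟨P, rfl⟩

lemma not_vanishesAt_pencil_sub_of_inv [IsLocalRing R] [IsLocalRing W] (hRW : R ≤ W)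
    (hk : pencil b ≠ 0) (h : VanishesAt (pencil b)⁻¹ R) : ¬ VanishesAt (pencil b - cst c) W := by
  intro hW
  have h1 : HasValueAt (1 - cst c * (pencil b)⁻¹) 1 R :=
    (hasValueAt_one.sub ((hasValueAt_const c).mul h.hasValueAt)).congr rfl (by simp)
  have h2 : VanishesAt (1 - cst c * (pencil b)⁻¹) W := by
    have := hW.mul_left (hRW h.mem)
    rwa [mul_sub, inv_mul_cancel₀ hk, mul_comm (pencil b)⁻¹] at this
  exact h2.inv_notMem (h1.ne_zero one_ne_zero) (hRW (h1.inv_mem one_ne_zero))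

/-- The generic point of a curve in the fibre of the pencil over `c`. -/
structure IsFibreDivisor (b c : ℂ) (W : Subalgebra ℂ PlaneField) : Prop where
  isLocalRing : IsLocalRing W
  vanishesAt : VanishesAt (pencil b - cst c) W
  torusRing_le : torusRing ≤ W
  not_const : ∀ α γ : ℂ, ¬ (VanishesAt (xc - cst α) W ∧ VanishesAt (yc - cst γ) W)
  exists_eq_div : ∀ z ∈ W, ∃ P ∈ torusRing, ∃ Q ∈ torusRing, ¬ VanishesAt Q W ∧ z = P / Q

lemma exists_eq_div_of_mem_localizationAt {A : Subalgebra ℂ PlaneField} (hu : u ∈ A) (hv : v ∈ A)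
    {p : Ideal (Pt u v)} [p.IsPrime] {z : PlaneField} (hz : z ∈ localizationAt (Pt u v) p) :
    ∃ P ∈ A, ∃ Q ∈ A, ¬ VanishesAt Q (localizationAt (Pt u v) p) ∧ z = P / Q := by
  obtain ⟨a, t, ht, rfl⟩ := hz
  obtain ⟨q₁, q₂, h₁, h₂, ha⟩ := a.2
  obtain ⟨r₁, r₂, h₃, h₄, ht'⟩ := t.2
  refine ⟨_, A.mul_mem (aeval_mem hu hv q₁) (aeval_mem hu hv r₂), _,
    A.mul_mem (aeval_mem hu hv r₁) (aeval_mem hu hv q₂), fun h => ?_, ?_⟩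
  · have hinv : (MvPolynomial.aeval ![u, v] (r₂ * q₂))⁻¹ ∈ Pt u v :=
      ⟨1, r₂ * q₂, by rw [map_mul]; exact mul_ne_zero h₃ h₁,
        by rw [map_mul]; exact mul_ne_zero h₄ h₂, by rw [map_one, one_div]⟩
    have hle := le_localizationAt (Pt u v) p
    have h' : VanishesAt ((t : PlaneField) * MvPolynomial.aeval ![u, v] (r₂ * q₂))
        (localizationAt (Pt u v) p) := by
      convert h using 1
      rw [ht', map_mul]
      field_simp
    rcases (vanishesAt_mul_iff (hle t.2) (hle (aeval_mem_Pt _))).mp h' with h1 | h1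
    · exact ht (vanishesAt_localizationAt_coe.mp h1)
    · exact not_vanishesAt_of_inv_mem (by rw [map_mul]; exact mul_ne_zero h₄ h₂) (hle hinv) h1
  · rw [ha, ht', div_div_div_eq, mul_comm (MvPolynomial.aeval ![u, v] q₂)]

lemma eq_of_vanishesAt_sub [IsLocalRing R] [IsLocalRing W] (hRW : R ≤ W) {z : PlaneField}
    {e α : ℂ} (h : HasValueAt z e R) (h' : VanishesAt (z - cst α) W) : α = e := by
  by_contra hne
  have h3 := h.sub (hasValueAt_const α)
  have h4 : e - α ≠ 0 := sub_ne_zero.mpr (Ne.symm hne)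
  exact h'.inv_notMem (h3.ne_zero h4) (hRW (h3.inv_mem h4))

lemma zpow_mem_of_mem {z : PlaneField} (h : z ∈ W) (h' : z⁻¹ ∈ W) (n : ℤ) : z ^ n ∈ W := by
  rcases le_total 0 n with hn | hn
  · exact zpow_mem_of_nonneg h hn
  · rw [← neg_neg n, zpow_neg, ← inv_zpow]
    exact zpow_mem_of_nonneg h' (neg_nonneg.mpr hn)

lemma mem_of_localizationAt {p : Ideal R} [p.IsPrime] {z : PlaneField} (hz : z ∈ R)
    (h : VanishesAt z (localizationAt R p)) : (⟨z, hz⟩ : R) ∈ p :=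
  vanishesAt_localizationAt_coe.mp h

lemma torusRing_le_iff : torusRing ≤ W ↔ xc ∈ W ∧ yc ∈ W ∧ xc⁻¹ ∈ W ∧ yc⁻¹ ∈ W := by
  rw [torusRing, Algebra.adjoin_le_iff]
  simp [Set.insert_subset_iff]

lemma isFibreDivisor_torus {a d : ℂ} (ha : a ≠ 0) (hd : d ≠ 0)
    {p : Ideal (Pt (xc - cst a) (yc - cst d))} [p.IsPrime] (hp : p.height = 1)
    (h : VanishesAt (pencil b - cst c) (localizationAt _ p)) :
    IsFibreDivisor b c (localizationAt _ p) := by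
  have hc := isCoord_xc_yc.sub_const a d
  have hR := hc.isLocalRing
  have hx : HasValueAt xc a (Pt (xc - cst a) (yc - cst d)) := hc.vanishesAt_fst
  have hy : HasValueAt yc d (Pt (xc - cst a) (yc - cst d)) := hc.vanishesAt_snd
  have hle := le_localizationAt _ p
  refine ⟨inferInstance, h, ?_, ?_, ?_⟩
  · rw [torusRing_le_iff]
    exact ⟨hle hx.mem, hle hy.mem, hle (hx.inv_mem ha), hle (hy.inv_mem hd)⟩
  · rintro α γ ⟨h1, h2⟩
    obtain rfl := eq_of_vanishesAt_sub hle hx h1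
    obtain rfl := eq_of_vanishesAt_sub hle hy h2
    exact hc.not_fst_and_snd_mem hp ⟨mem_of_localizationAt _ h1, mem_of_localizationAt _ h2⟩
  · intro z hz
    exact exists_eq_div_of_mem_localizationAt
      (torusRing.sub_mem xc_mem_torusRing (cst_mem _ a))
      (torusRing.sub_mem yc_mem_torusRing (cst_mem _ d)) hz

lemma hasValueAt_of_mem_adjoin {α β : ℂ} (hu : HasValueAt u α W) (hv : HasValueAt v β W)
    {z : PlaneField} (hz : z ∈ Algebra.adjoin ℂ {u, v}) : ∃ γ, HasValueAt z γ W := by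
  have h : Set.range ![u, v] = {u, v} := by
    simp only [Matrix.range_cons, Matrix.range_empty, Set.union_empty, Set.singleton_union]
  rw [← h, Algebra.adjoin_range_eq_range_aeval] at hz
  obtain ⟨P, rfl⟩ := hz
  exact ⟨_, hasValueAt_aeval hu hv P⟩

lemma exists_quadratic_factors {e : ℂ} (he : e ≠ 0) (β γ : ℂ) :
    ∃ r₁ r₂ : ℂ, ∀ z, e * z ^ 2 + β * z + γ = e * ((z - r₁) * (z - r₂)) := by
  obtain ⟨s, hs⟩ := IsAlgClosed.exists_pow_nat_eq (β ^ 2 - 4 * e * γ) (n := 2) (by norm_num)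
  refine ⟨(-β + s) / (2 * e), (-β - s) / (2 * e), fun z => ?_⟩
  field_simp
  linear_combination hs

lemma isFibreDivisor_exceptional (hb : b ≠ 0) (j : Fin 6) (s : ℂ)
    {p : Ideal (Pt ((cornerU j - cst (exampleCoords b j)) / cornerV j - cst s) (cornerV j))}
    [p.IsPrime] (hp : p.height = 1)
    (h : VanishesAt (pencil b - cst c) (localizationAt _ p)) :
    IsFibreDivisor b c (localizationAt _ p) := by
  have hcoord : IsCoord ((cornerU j - cst (exampleCoords b j)) / cornerV j - cst s) (cornerV j) :=
    (((isCoord_corner j).sub_const_fst (exampleCoords b j)).div_fst).sub_const_fst s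
  have hR := hcoord.isLocalRing
  have hκ := exampleCoords_ne_zero hb j
  obtain ⟨B, hB, C, hC, hk⟩ := exists_pencil_corner hb j
  have he := edgeCoeff_ne_zero hb j
  have hV0 := hcoord.snd_ne_zero
  have hU0 := (isCoord_corner j).fst_ne_zero
  have hVR := hcoord.vanishesAt_snd
  have hs : HasValueAt ((cornerU j - cst (exampleCoords b j)) / cornerV j) s
    (Pt ((cornerU j - cst (exampleCoords b j)) / cornerV j - cst s) (cornerV j)) :=
    hcoord.vanishesAt_fst
  have hle := le_localizationAt _ p
  have hmon := corner_monomial j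
  obtain ⟨hUT, hVT, -⟩ := corner_mem_torusRing j
  have hVT' := (corner_mem_torusRing j).2.2
  generalize exampleCoords b j = κ at *
  generalize edgeCoeff b j = e at *
  generalize cornerU j = U at *
  generalize cornerV j = V at *
  have hck : HasValueAt (pencil b) c (localizationAt _ p) := h
  generalize pencil b = k at hck hk
  have hUs : U = cst κ + V * ((U - cst κ) / V) := by field_simp; ring
  have hUR : HasValueAt U κ (Pt ((U - cst κ) / V - cst s) V) :=
    ((hasValueAt_const κ).add (hVR.hasValueAt.mul hs)).congr hUs.symm (by simp)
  have hVW : ¬ VanishesAt V (localizationAt _ p) := fun hVW => by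
    have hs' := hle hs.mem
    have hU : HasValueAt U κ (localizationAt _ p) := by
      have := hVW.mul_right hs'
      rwa [mul_div_cancel₀ _ hV0] at this
    obtain ⟨β, hβ⟩ := hasValueAt_of_mem_adjoin hU hVW.hasValueAt hB
    obtain ⟨γ, hγ⟩ := hasValueAt_of_mem_adjoin hU hVW.hasValueAt hC
    obtain ⟨r₁, r₂, hr⟩ := exists_quadratic_factors he β (γ - c * κ ^ 2)
    have h1 : VanishesAt (cst e * (((U - cst κ) / V - cst r₁) * ((U - cst κ) / V - cst r₂)))
        (localizationAt _ p) := by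
      have h2 := ((hβ.vanishesAt_sub_const.mul_right hs').neg.sub hγ.vanishesAt_sub_const).add
        ((hck.mul (hU.pow 2)).vanishesAt_sub_const)
      have h3 : k * U ^ 2 = cst e * ((U - cst κ) / V) ^ 2 + ((U - cst κ) / V) * B + C := by
        field_simp
        linear_combination hk
      convert h2 using 1
      have h4 : cst e * (((U - cst κ) / V - cst r₁) * ((U - cst κ) / V - cst r₂)) =
          cst e * ((U - cst κ) / V) ^ 2 + cst β * ((U - cst κ) / V) + cst (γ - c * κ ^ 2) := by
        have e1 : β = -(e * (r₁ + r₂)) := by linear_combination hr 1 - hr 0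
        have e2 : γ - c * κ ^ 2 = e * r₁ * r₂ := by linear_combination hr 0
        rw [e1, e2]
        simp only [cst_mul, cst_add, cst_neg]
        ring
      rw [h4, h3]
      change _ = -((B - cst β) * ((U - cst κ) / V)) - (C - cst γ) + (_ - cst (c * κ ^ 2))
      rw [cst_sub]
      ring
    have hmem : ∀ r, (U - cst κ) / V - cst r ∈ localizationAt _ p := fun r =>
      (localizationAt _ p).sub_mem hs' (cst_mem _ r)
    have hconst : ¬ VanishesAt (cst e) (localizationAt _ p) :=
      (hasValueAt_const e).not_vanishesAt he
    have hfin : ∀ r, ¬ VanishesAt ((U - cst κ) / V - cst r) (localizationAt _ p) := fun r hr => by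
      obtain rfl := eq_of_vanishesAt_sub hle hs hr
      exact hcoord.not_fst_and_snd_mem hp ⟨mem_of_localizationAt _ hr, mem_of_localizationAt _ hVW⟩
    rcases (vanishesAt_mul_iff (cst_mem _ e) (Subalgebra.mul_mem _ (hmem _) (hmem _))).mp h1 with
      h1 | h1
    · exact hconst h1
    · rcases (vanishesAt_mul_iff (hmem _) (hmem _)).mp h1 with h1 | h1
      exacts [hfin _ h1, hfin _ h1]
  have hVinv := inv_mem_of_not_vanishesAt (hle hVR.mem) hVW
  have hz : ∀ m n : ℤ, U ^ m * V ^ n ∈ localizationAt _ p := fun m n =>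
    Subalgebra.mul_mem _ (zpow_mem_of_mem (hle hUR.mem) (hle (hUR.inv_mem hκ)) m)
      (zpow_mem_of_mem (hle hVR.mem) hVinv n)
  refine ⟨inferInstance, h, ?_, ?_, ?_⟩
  · have hxy : ∀ m n : ℤ, xc ^ m * yc ^ n ∈ localizationAt _ p := fun m n => by
      rw [← hmon (m, n)]
      exact hz _ _
    rw [torusRing_le_iff]
    exact ⟨by simpa using hxy 1 0, by simpa using hxy 0 1, by simpa using hxy (-1) 0,
      by simpa using hxy 0 (-1)⟩
  · rintro α γ ⟨h1, h2⟩
    have hx0 := isCoord_xc_yc.fst_ne_zero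
    have hy0 := isCoord_xc_yc.snd_ne_zero
    have h1' : HasValueAt xc α (localizationAt _ p) := h1
    have h2' : HasValueAt yc γ (localizationAt _ p) := h2
    have hxy : ∀ m n : ℤ, (xc ^ m * yc ^ n)⁻¹ ∈ localizationAt _ p := fun m n => by
      rw [← hmon (m, n), mul_inv, ← zpow_neg, ← zpow_neg]
      exact hz _ _
    have hα : α ≠ 0 := by
      rintro rfl
      exact h1'.vanishesAt.inv_notMem hx0 (by simpa using hxy 1 0)
    have hγ : γ ≠ 0 := by
      rintro rfl
      exact h2'.vanishesAt.inv_notMem hy0 (by simpa using hxy 0 1)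
    have h3 := (h1'.zpow hα ((cornerExp j).symm (0, 1)).1).mul
      (h2'.zpow hγ ((cornerExp j).symm (0, 1)).2)
    rw [← hmon, Equiv.apply_symm_apply, zpow_zero, one_mul, zpow_one] at h3
    exact mul_ne_zero (zpow_ne_zero _ hα) (zpow_ne_zero _ hγ)
      (eq_of_vanishesAt_sub hle hVR.hasValueAt h3)
  · intro z hz
    refine exists_eq_div_of_mem_localizationAt ?_ hVT hz
    rw [div_eq_mul_inv]
    exact torusRing.sub_mem (torusRing.mul_mem (torusRing.sub_mem hUT (cst_mem _ κ)) hVT')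
      (cst_mem _ s)

lemma isFibreDivisor (hb : b ≠ 0) (hW : W ∈ primeDivisors (exampleSurface b))
    (h : VanishesAt (pencil b - cst c) W) : IsFibreDivisor b c W := by
  obtain ⟨R, hR, p, _, hp, rfl⟩ := hW
  rw [exampleSurface_eq hb] at hR
  have hle := le_localizationAt R p
  have hpole : ∀ {u v}, IsCoord u v → R = Pt u v → IsPolarForm b u v →
      IsFibreDivisor b c (localizationAt R p) := fun huv hRuv hk => by
    subst hRuv
    have := huv.isLocalRing
    exact absurd h (not_vanishesAt_pencil_sub_of_inv hle hk.1 hk.2.1)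
  rcases hR with ⟨a, d, ha, hd, rfl⟩ | ⟨j, a, ha, ha', rfl⟩ | ⟨j, rfl⟩ | ⟨j, hR⟩
  · exact isFibreDivisor_torus ha hd hp h
  · exact hpole ((isCoord_corner j).sub_const_fst a) rfl (isPolarForm_edge hb ha')
  · exact hpole (isCoord_corner j) rfl (isPolarForm_corner hb j)
  · have h1 := (isCoord_corner j).sub_const_fst (exampleCoords b j)
    rw [h1.exceptionalPoints_eq_swap] at hR
    rcases hR with ⟨s, rfl⟩ | rfl
    · exact isFibreDivisor_exceptional hb j s hp h
    · exact hpole h1.div_snd rfl (isPolarForm_exceptional hb j)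

/-- The residue map as a homomorphism of algebras. -/
def residueHom (W : Subalgebra ℂ PlaneField) [IsLocalRing W] :
    W →ₐ[ℂ] IsLocalRing.ResidueField W where
  __ := IsLocalRing.residue W
  commutes' _ := rfl

lemma residueHom_eq_zero [IsLocalRing W] {z : PlaneField} (hz : z ∈ W) :
    residueHom W ⟨z, hz⟩ = 0 ↔ VanishesAt z W := by
  change IsLocalRing.residue W ⟨z, hz⟩ = 0 ↔ _
  rw [IsLocalRing.residue_eq_zero_iff, ← maxIdeal_eq]
  exact ⟨fun h => ⟨hz, h⟩, fun h => h.2⟩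

namespace IsFibreDivisor

variable [IsLocalRing W]

/-- The residue class of `x`. -/
def resX (h : IsFibreDivisor b c W) : IsLocalRing.ResidueField W :=
  residueHom W ⟨xc, h.torusRing_le xc_mem_torusRing⟩

/-- The residue class of `y`. -/
def resY (h : IsFibreDivisor b c W) : IsLocalRing.ResidueField W :=
  residueHom W ⟨yc, h.torusRing_le yc_mem_torusRing⟩

lemma residueHom_inv_xc (h : IsFibreDivisor b c W) :
    residueHom W ⟨xc⁻¹, h.torusRing_le inv_xc_mem_torusRing⟩ = h.resX⁻¹ := by
  refine eq_inv_of_mul_eq_one_left ?_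
  rw [resX, ← map_mul, ← map_one (residueHom W)]
  congr 1
  exact Subtype.ext (inv_mul_cancel₀ isCoord_xc_yc.fst_ne_zero)

lemma residueHom_inv_yc (h : IsFibreDivisor b c W) :
    residueHom W ⟨yc⁻¹, h.torusRing_le inv_yc_mem_torusRing⟩ = h.resY⁻¹ := by
  refine eq_inv_of_mul_eq_one_left ?_
  rw [resY, ← map_mul, ← map_one (residueHom W)]
  congr 1
  exact Subtype.ext (inv_mul_cancel₀ isCoord_xc_yc.snd_ne_zero)

omit [IsLocalRing W] in
lemma aeval_mem (h : IsFibreDivisor b c W) (P : MvPolynomial (Fin 4) ℂ) :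
    MvPolynomial.aeval ![xc, yc, xc⁻¹, yc⁻¹] P ∈ W :=
  h.torusRing_le (aeval_mem_torusRing P)

lemma residueHom_aeval (h : IsFibreDivisor b c W) (P : MvPolynomial (Fin 4) ℂ) :
    residueHom W ⟨MvPolynomial.aeval ![xc, yc, xc⁻¹, yc⁻¹] P, h.aeval_mem P⟩ =
      MvPolynomial.aeval ![h.resX, h.resY, h.resX⁻¹, h.resY⁻¹] P := by
  have h1 := MvPolynomial.comp_aeval_apply (residueHom W) (f := ![
    ⟨xc, h.torusRing_le xc_mem_torusRing⟩, ⟨yc, h.torusRing_le yc_mem_torusRing⟩,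
    ⟨xc⁻¹, h.torusRing_le inv_xc_mem_torusRing⟩, ⟨yc⁻¹, h.torusRing_le inv_yc_mem_torusRing⟩]) P
  have h2 := MvPolynomial.comp_aeval_apply W.val (f := ![
    ⟨xc, h.torusRing_le xc_mem_torusRing⟩, ⟨yc, h.torusRing_le yc_mem_torusRing⟩,
    ⟨xc⁻¹, h.torusRing_le inv_xc_mem_torusRing⟩, ⟨yc⁻¹, h.torusRing_le inv_yc_mem_torusRing⟩]) P
  refine Eq.trans ?_ (h1.trans ?_)
  · congr 1
    refine Subtype.ext (Eq.trans ?_ h2.symm)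
    refine congrArg (fun f : Fin 4 → PlaneField => MvPolynomial.aeval f P) ?_
    funext i
    fin_cases i <;> rfl
  · refine congrArg (fun f : Fin 4 → _ => MvPolynomial.aeval f P) ?_
    rw [← h.residueHom_inv_xc, ← h.residueHom_inv_yc]
    funext i
    fin_cases i <;> rfl

lemma vanishesAt_aeval_iff (h : IsFibreDivisor b c W) (P : MvPolynomial (Fin 4) ℂ) :
    VanishesAt (MvPolynomial.aeval ![xc, yc, xc⁻¹, yc⁻¹] P) W ↔
      MvPolynomial.aeval ![h.resX, h.resY, h.resX⁻¹, h.resY⁻¹] P = 0 := by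
  rw [← h.residueHom_aeval, residueHom_eq_zero]

lemma exists_pencil_poly (b c : ℂ) : ∃ P : MvPolynomial (Fin 4) ℂ,
    ∀ {F : Type} [Field F] [Algebra ℂ F] (x y : F), MvPolynomial.aeval ![x, y, x⁻¹, y⁻¹] P =
      -(tForm x y (algebraMap ℂ F I) (algebraMap ℂ F b) ^ 2 + 4 * algebraMap ℂ F b *
        etaForm x y (algebraMap ℂ F I) + 2 * algebraMap ℂ F I) -
        algebraMap ℂ F c := by
  let x : MvPolynomial (Fin 4) ℂ := .X 0
  let y : MvPolynomial (Fin 4) ℂ := .X 1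
  let z : MvPolynomial (Fin 4) ℂ := .X 2
  let w : MvPolynomial (Fin 4) ℂ := .X 3
  let i : MvPolynomial (Fin 4) ℂ := .C I
  let β : MvPolynomial (Fin 4) ℂ := .C b
  refine ⟨-((-x - i * β * y + i * z + w + x * w + i * β * y * z) ^ 2 + 4 * β *
    (((1 - x) * y - i * x) * z ^ 2) + 2 * i) - .C c, fun x' y' => ?_⟩
  simp only [x, y, z, w, i, β, map_sub, map_neg, map_add, map_mul, map_pow, map_one, map_ofNat,
    MvPolynomial.aeval_X, MvPolynomial.aeval_C, tForm, etaForm, div_eq_mul_inv, one_mul, ← inv_pow]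
  rfl

lemma isFibrePoint (h : IsFibreDivisor b c W) : IsFibrePoint b c h.resX h.resY := by
  have hx0 := isCoord_xc_yc.fst_ne_zero
  have hy0 := isCoord_xc_yc.snd_ne_zero
  refine ⟨fun h0 => ?_, fun h0 => ?_, ?_, ?_, ?_⟩
  · exact not_vanishesAt_of_inv_mem hx0 (h.torusRing_le inv_xc_mem_torusRing)
      ((residueHom_eq_zero _).mp h0)
  · exact not_vanishesAt_of_inv_mem hy0 (h.torusRing_le inv_yc_mem_torusRing)
      ((residueHom_eq_zero _).mp h0)
  · obtain ⟨P, hP⟩ := exists_pencil_poly b c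
    have h1 : MvPolynomial.aeval ![xc, yc, xc⁻¹, yc⁻¹] P = pencil b - cst c := by
      rw [hP, ← pencil_eq_forms hx0 hy0 cst_I_sq]
      rfl
    have h2 := (h.vanishesAt_aeval_iff P).mp (h1 ▸ h.vanishesAt)
    rw [hP] at h2
    exact (sub_eq_zero.mp h2).symm
  · rintro ⟨⟨α, hα⟩, γ, hγ⟩
    have key : ∀ {z : PlaneField} (hz : z ∈ W) (e : ℂ),
        residueHom W ⟨z, hz⟩ = algebraMap ℂ _ e → VanishesAt (z - cst e) W := fun {z} hz e h0 => by
      refine (residueHom_eq_zero (W.sub_mem hz (cst_mem W e))).mp ?_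
      rw [← (residueHom W).commutes, ← sub_eq_zero, ← map_sub] at h0
      exact h0
    exact h.not_const α γ ⟨key _ α hα, key _ γ hγ⟩
  · rw [eq_top_iff]
    have hx : h.resX ∈ adjoin ℂ {h.resX, h.resY} :=
      IntermediateField.subset_adjoin _ _ (by simp)
    have hy : h.resY ∈ adjoin ℂ {h.resX, h.resY} :=
      IntermediateField.subset_adjoin _ _ (by simp)
    have key : ∀ P ∈ torusRing, ∃ hP : P ∈ W,
        residueHom W ⟨P, hP⟩ ∈ adjoin ℂ {h.resX, h.resY} := fun P hP => by
      obtain ⟨p, rfl⟩ := exists_aeval_of_mem_torusRing hP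
      refine ⟨h.aeval_mem p, ?_⟩
      rw [h.residueHom_aeval]
      have hmem : ∀ i, ![h.resX, h.resY, h.resX⁻¹, h.resY⁻¹] i ∈
          adjoin ℂ {h.resX, h.resY} := by
        intro i
        fin_cases i
        exacts [hx, hy, inv_mem hx, inv_mem hy]
      induction p using MvPolynomial.induction_on with
      | C a => rw [MvPolynomial.aeval_C]; exact IntermediateField.algebraMap_mem _ a
      | add p q hp hq =>
        rw [map_add]
        exact add_mem (hp (aeval_mem_torusRing p)) (hq (aeval_mem_torusRing q))
      | mul_X p i hp =>
        rw [map_mul, MvPolynomial.aeval_X]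
        exact mul_mem (hp (aeval_mem_torusRing p)) (hmem i)
    rintro z -
    obtain ⟨⟨z, hz⟩, rfl⟩ := IsLocalRing.residue_surjective z
    obtain ⟨P, hP, Q, hQ, hQW, rfl⟩ := h.exists_eq_div z hz
    obtain ⟨hP', hP⟩ := key P hP
    obtain ⟨hQ', hQ⟩ := key Q hQ
    have hQ0 : residueHom W ⟨Q, hQ'⟩ ≠ 0 := fun h0 => hQW ((residueHom_eq_zero _).mp h0)
    have hQ1 : Q ≠ 0 := by rintro rfl; exact hQW vanishesAt_zero
    have h1 : residueHom W ⟨P / Q, hz⟩ = residueHom W ⟨P, hP'⟩ / residueHom W ⟨Q, hQ'⟩ := by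
      rw [eq_div_iff hQ0, ← map_mul]
      congr 1
      exact Subtype.ext (div_mul_cancel₀ P hQ1)
    change residueHom W ⟨P / Q, hz⟩ ∈ _
    rw [h1]
    exact div_mem hP hQ

omit [IsLocalRing W] in
lemma le (h : IsFibreDivisor b c W) (h' : IsFibreDivisor b c W') (hd : fibreDisc b c ≠ 0) :
    W ≤ W' := by
  intro z hz
  obtain ⟨P, hP, Q, hQ, hQW, rfl⟩ := h.exists_eq_div z hz
  have := h.isLocalRing
  have := h'.isLocalRing
  refine div_eq_mul_inv P Q ▸ W'.mul_mem (h'.torusRing_le hP)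
    (inv_mem_of_not_vanishesAt (h'.torusRing_le hQ) fun hQW' => hQW ?_)
  obtain ⟨p, rfl⟩ := exists_aeval_of_mem_torusRing hQ
  rw [h.vanishesAt_aeval_iff] 
  rw [h'.vanishesAt_aeval_iff] at hQW'
  exact h'.isFibrePoint.aeval_eq_zero h.isFibrePoint hd p hQW'

omit [IsLocalRing W] in
lemma eq (h : IsFibreDivisor b c W) (h' : IsFibreDivisor b c W') (hd : fibreDisc b c ≠ 0) :
    W = W' := le_antisymm (h.le h' hd) (h'.le h hd)

end IsFibreDivisor

lemma coeff_quartic (a b c d e : ℂ) : (quartic a b c d e).coeff 4 = a := by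
  simp [quartic, Polynomial.coeff_X_pow]

lemma exists_torus_point (hb : b ≠ 0) (c : ℂ) : ∃ d : ℂ, d ≠ 0 ∧
    VanishesAt (pencil b - cst c) (Pt (xc - cst 2) (yc - cst d)) := by
  have hI := I_sq
  obtain ⟨d, hd⟩ : ∃ d : ℂ, (I * 2 * (2 + 1) ^ 2 -
      I * (2 + I) * (2 ^ 2 - 1) * d + b * (2 - 1) ^ 2 * d ^ 2) *
        (-I * 2 * (d - 1) + d * (b * d - 1)) - c * (2 ^ 2 * d ^ 2) = 0 := by
    let P : Polynomial ℂ := quartic (b ^ 2) (b * (2 - 8 * I))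
      (20 * I * b - 15 - 4 * c) (48 - 12 * I) (-36)
    have hP : P.degree ≠ 0 := fun h0 => by
      have h4 : P.coeff 4 = 0 := Polynomial.coeff_eq_zero_of_degree_lt (by rw [h0]; norm_num)
      rw [coeff_quartic] at h4
      exact pow_ne_zero 2 hb h4
    obtain ⟨d, hd⟩ := IsAlgClosed.exists_root P hP
    refine ⟨d, ?_⟩
    simp only [P, quartic, Polynomial.IsRoot.def, Polynomial.eval_add, Polynomial.eval_mul,
      Polynomial.eval_C, Polynomial.eval_pow, Polynomial.eval_X] at hd
    generalize I = i at *
    grind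
  have hd0 : d ≠ 0 := by
    rintro rfl
    generalize I = i at *
    grind
  refine ⟨d, hd0, ?_⟩
  have hc := isCoord_xc_yc.sub_const 2 d
  have := hc.isLocalRing
  have hx : HasValueAt xc 2 (Pt (xc - cst 2) (yc - cst d)) := hc.vanishesAt_fst
  have hy : HasValueAt yc d (Pt (xc - cst 2) (yc - cst d)) := hc.vanishesAt_snd
  have h1 : HasValueAt (1 : PlaneField) 1 (Pt (xc - cst 2) (yc - cst d)) := hasValueAt_one
  have hi := hasValueAt_const (R := Pt (xc - cst 2) (yc - cst d)) I
  have hβ := hasValueAt_const (R := Pt (xc - cst 2) (yc - cst d)) b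
  have h0 : HasValueAt f₀ _ _ := (hx.pow 2).mul (hy.pow 2)
  have hf : HasValueAt (f₁ b) _ _ := ((((hi.mul hx).mul ((hx.add h1).pow 2)).sub
    (((hi.mul (hx.add hi)).mul ((hx.pow 2).sub h1)).mul hy)).add
    ((hβ.mul ((hx.sub h1).pow 2)).mul (hy.pow 2))).mul
    (((hi.neg.mul hx).mul (hy.sub h1)).add (hy.mul ((hβ.mul hy).sub h1)))
  have hne : (2 : ℂ) ^ 2 * d ^ 2 ≠ 0 := mul_ne_zero (by norm_num) (pow_ne_zero 2 hd0)
  exact (hf.div h0 hne).congr rfl (by rw [div_eq_iff hne]; exact sub_eq_zero.mp hd)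

lemma exists_primeDivisor (hb : b ≠ 0) (c : ℂ) :
    ∃ W ∈ primeDivisors (exampleSurface b), VanishesAt (pencil b - cst c) W := by
  obtain ⟨d, hd, hk⟩ := exists_torus_point hb c
  have hc := isCoord_xc_yc.sub_const 2 d
  have := hc.isLocalRing
  have := hc.isNoetherianRing
  obtain ⟨hmem, hk⟩ := hk
  rw [maxIdeal_eq] at hk
  obtain ⟨p, hp, -⟩ := Ideal.exists_minimalPrimes_le
    ((Ideal.span_singleton_le_iff_mem _).mpr hk)
  have hprime : p.IsPrime := hp.1.1
  have hin : _ ∈ p := hp.1.2 (Ideal.mem_span_singleton_self _)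
  refine ⟨localizationAt _ p, ⟨_, ?_, p, hprime, ?_, rfl⟩, vanishesAt_localizationAt_coe.mpr hin⟩
  · rw [exampleSurface_eq hb]
    exact .inl ⟨2, d, two_ne_zero, hd, rfl⟩
  · refine le_antisymm (Ideal.height_le_one_of_isPrincipal_of_mem_minimalPrimes _ p hp) ?_
    rw [Order.one_le_iff_ne_zero]
    intro h0
    rw [Ideal.height_eq_zero_iff, IsDomain.minimalPrimes_eq_singleton_bot,
      Set.mem_singleton_iff] at h0
    rw [h0, Ideal.mem_bot] at hin
    exact pencil_ne_cst hb c (sub_eq_zero.mp (congrArg Subtype.val hin))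

lemma exists_unique_primeDivisor (hb : b ≠ 0) (hd : fibreDisc b c ≠ 0) :
    ∃ V ∈ primeDivisors (exampleSurface b), VanishesAt (pencil b - algebraMap ℂ PlaneField c) V ∧
    (∀ W ∈ primeDivisors (exampleSurface b), VanishesAt (pencil b - algebraMap ℂ PlaneField c) W →
      W = V) ∧
    ∃ _ : IsLocalRing V, geometricGenus (IsLocalRing.ResidueField V) = 1 := by
  obtain ⟨V, hV, hVk⟩ := exists_primeDivisor hb c
  have hf := isFibreDivisor hb hV hVk
  have := hf.isLocalRing
  exact ⟨V, hV, hVk, fun W hW hWk => (isFibreDivisor hb hW hWk).eq hf hd, hf.isLocalRing,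
    hf.isFibrePoint.geometricGenus_eq_one hd⟩

end

section

open MvPolynomial

variable {b c : ℂ} {R : Subalgebra ℂ PlaneField} {u v z w : PlaneField}

local notation "𝐝" => KaehlerDifferential.D ℂ PlaneField

lemma IsCoord.jacobian_div_mem (h : IsCoord u v) (hz : z ∈ Pt u v) (hw : w ∈ Pt u v) :
    jacobian z w / jacobian u v ∈ Pt u v := by
  obtain ⟨a, ha, a', ha', h1⟩ := exists_D_eq_of_mem_Pt hz
  obtain ⟨d, hd, d', hd', h2⟩ := exists_D_eq_of_mem_Pt hw
  rw [jacobian_of_eq h1 h2, mul_div_cancel_right₀ _ h.jacobian_ne_zero]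
  exact Subalgebra.sub_mem _ (Subalgebra.mul_mem _ ha hd') (Subalgebra.mul_mem _ ha' hd)

lemma IsCoord.vanishesAt_jacobian_div (h : IsCoord u v) {z : Pt u v}
    (hz : z ∈ maxIdeal (Pt u v) ^ 2) (hw : w ∈ Pt u v) :
    VanishesAt (jacobian z w / jacobian u v) (Pt u v) := by
  rw [sq] at hz
  induction hz using Submodule.mul_induction_on' with
  | mem_mul_mem m hm n hn =>
    have hm' : VanishesAt (m : PlaneField) (Pt u v) := ⟨m.2, hm⟩
    have hn' : VanishesAt (n : PlaneField) (Pt u v) := ⟨n.2, hn⟩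
    have h1 := (hm'.mul_right (h.jacobian_div_mem n.2 hw)).add
      (hn'.mul_right (h.jacobian_div_mem m.2 hw))
    convert h1 using 1
    change jacobian ((m : PlaneField) * n) w / _ = _
    rw [jacobian_mul_left]
    ring
  | add x _ y _ hx hy =>
    convert hx.add hy using 1
    change jacobian ((x : PlaneField) + y) w / _ = _
    rw [jacobian_add_left, add_div]

lemma jacobian_neg_left : jacobian (-z) w = -jacobian z w := by
  simp only [jacobian_eq, map_neg, Finsupp.neg_apply]
  ring

lemma jacobian_eq_partials (z w : PlaneField) : jacobian z w =
    jacobian z xc * jacobian w yc - jacobian z yc * jacobian w xc := by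
  obtain ⟨a, a', hz⟩ := isCoord_xc_yc.exists_D_eq z
  obtain ⟨d, d', hw⟩ := isCoord_xc_yc.exists_D_eq w
  have hx : 𝐝 xc = (1 : PlaneField) • 𝐝 xc + (0 : PlaneField) • 𝐝 yc := by simp
  have hy : 𝐝 yc = (0 : PlaneField) • 𝐝 xc + (1 : PlaneField) • 𝐝 yc := by simp
  rw [jacobian_of_eq hz hw, jacobian_of_eq hz hx, jacobian_of_eq hz hy, jacobian_of_eq hw hx,
    jacobian_of_eq hw hy, jacobian_xc_yc]
  ring

lemma jacobian_yc_xc : jacobian yc xc = -1 := by rw [jacobian_swap, jacobian_xc_yc]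

/-- The form `t` on the plane. -/
abbrev tc (b : ℂ) : PlaneField := tForm xc yc (cst I) (cst b)

/-- The form `η` on the plane. -/
abbrev etac : PlaneField := etaForm xc yc (cst I)

/-- The form `ω` on the plane. -/
abbrev omegac (b : ℂ) : PlaneField := omegaForm xc yc (cst I) (cst b)

lemma jacobian_tc_xc (b : ℂ) : jacobian (tc b) xc =
    cst I * cst b + 1 / yc ^ 2 + xc / yc ^ 2 - cst I * cst b / xc := by
  have hx := isCoord_xc_yc.fst_ne_zero
  have hy := isCoord_xc_yc.snd_ne_zero
  simp only [tc, tForm, div_eq_mul_inv, jacobian_add_left, jacobian_sub_left, jacobian_mul_left,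
    jacobian_inv_left hx, jacobian_inv_left hy, jacobian_cst_left, jacobian_self, jacobian_yc_xc,
    jacobian_one_left, jacobian_neg_left]
  field_simp
  ring

lemma jacobian_tc_yc (b : ℂ) : jacobian (tc b) yc =
    -1 - cst I / xc ^ 2 + 1 / yc - cst I * cst b * yc / xc ^ 2 := by
  have hx := isCoord_xc_yc.fst_ne_zero
  have hy := isCoord_xc_yc.snd_ne_zero
  simp only [tc, tForm, div_eq_mul_inv, jacobian_add_left, jacobian_sub_left, jacobian_mul_left,
    jacobian_inv_left hx, jacobian_inv_left hy, jacobian_cst_left, jacobian_self, jacobian_xc_yc,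
    jacobian_one_left, jacobian_neg_left]
  field_simp
  ring

lemma jacobian_etac_xc : jacobian etac xc = -(1 - xc) / xc ^ 2 := by
  have hx := isCoord_xc_yc.fst_ne_zero
  simp only [etac, etaForm, div_eq_mul_inv, pow_two, mul_inv, jacobian_sub_left,
    jacobian_mul_left, jacobian_inv_left hx, jacobian_cst_left, jacobian_self, jacobian_yc_xc,
    jacobian_one_left]
  field_simp
  ring

lemma jacobian_etac_yc : jacobian etac yc =
    (-yc - cst I) / xc ^ 2 - 2 * ((1 - xc) * yc - cst I * xc) / xc ^ 3 := by
  have hx := isCoord_xc_yc.fst_ne_zero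
  simp only [etac, etaForm, div_eq_mul_inv, pow_two, mul_inv, jacobian_sub_left,
    jacobian_mul_left, jacobian_inv_left hx, jacobian_cst_left, jacobian_self, jacobian_xc_yc,
    jacobian_one_left]
  field_simp
  ring

lemma jacobian_tc_etac (b : ℂ) : jacobian (tc b) etac = omegac b / (xc * yc) := by
  have hx := isCoord_xc_yc.fst_ne_zero
  have hy := isCoord_xc_yc.snd_ne_zero
  have hi := cst_I_sq
  rw [jacobian_eq_partials, jacobian_tc_xc, jacobian_tc_yc, jacobian_etac_xc, jacobian_etac_yc,
    omegac, omegaForm]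
  generalize cst I = i at *
  generalize cst b = β at *
  generalize xc = x at *
  generalize yc = y at *
  field_simp
  grind

lemma pencil_eq_tc_etac (b : ℂ) : pencil b =
    -(tc b * tc b + cst (4 * b) * etac + cst (2 * I)) := by
  refine (pencil_eq_forms (β := cst b) isCoord_xc_yc.fst_ne_zero isCoord_xc_yc.snd_ne_zero
    cst_I_sq).trans ?_
  simp only [map_mul, map_ofNat, sq]

lemma omegac_mul_omegac (b : ℂ) : omegac b * omegac b =
    (tc b * etac + cst (1 - I)) * (tc b * etac + cst (1 - I)) +
      cst 4 * ((cst b * etac + cst I) * (etac * etac + cst 1)) := by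
  have h := omegaForm_sq (β := cst b) isCoord_xc_yc.fst_ne_zero isCoord_xc_yc.snd_ne_zero cst_I_sq
  simp only [map_sub, map_one, map_ofNat]
  linear_combination h

lemma quartic_not_root {t η i β c q q' : ℂ} (hi : i ^ 2 = -1) (hβ : β ≠ 0)
    (hk : c = -(t * t + 4 * β * η + 2 * i))
    (hq : q = (c - 2 * i) * t ^ 4 + 8 * β * (1 - i) * t ^ 3 +
      (2 * (c - 2 * i) * (c + 2 * i) + 16 * β ^ 2) * t ^ 2 + 8 * β * (1 - i) * (c + 2 * i) * t +
      ((c - 2 * i) * (c + 2 * i) ^ 2 + 16 * β ^ 2 * c))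
    (hq' : q' = 4 * (c - 2 * i) * t ^ 3 + 24 * β * (1 - i) * t ^ 2 +
      2 * (2 * (c - 2 * i) * (c + 2 * i) + 16 * β ^ 2) * t + 8 * β * (1 - i) * (c + 2 * i))
    (hω : (t * η + (1 - i)) * (t * η + (1 - i)) + 4 * ((β * η + i) * (η * η + 1)) = 0)
    {τ ε : ℂ} (h1 : 2 * t * τ + 4 * β * ε = 0)
    (h2 : 2 * ((t * η + (1 - i)) * (t * ε + η * τ)) +
      4 * (β * ε * (η * η + 1) + (β * η + i) * (2 * η * ε)) = 0) : q = 0 ∧ q' * τ = 0 := by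
  have hε : ε = -(t * τ) / (2 * β) := by
    field_simp
    linear_combination h1 / 2
  subst hε hq hq'
  field_simp at h2
  rw [hk]
  constructor
  · grind
  · grind

lemma not_mem_sq_torus (hb : b ≠ 0) (hd : fibreDisc b c ≠ 0) {a d : ℂ} (ha : a ≠ 0)
    (hd0 : d ≠ 0) (h : pencil b - cst c ∈ Pt (xc - cst a) (yc - cst d)) :
    (⟨pencil b - cst c, h⟩ : Pt (xc - cst a) (yc - cst d)) ∉ maxIdeal _ ^ 2 := by
  intro hk
  have hc := isCoord_xc_yc.sub_const a d
  have := hc.isLocalRing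
  have hk' : ∀ w ∈ Pt (xc - cst a) (yc - cst d),
      VanishesAt (jacobian (pencil b) w) (Pt (xc - cst a) (yc - cst d)) := fun w hw => by
    have := hc.vanishesAt_jacobian_div hk hw
    rwa [jacobian_sub_cst_left, jacobian_sub_cst_left, jacobian_sub_cst_right, jacobian_xc_yc,
      div_one] at this
  have hjac : ∀ z ∈ Pt (xc - cst a) (yc - cst d), ∀ w ∈ Pt (xc - cst a) (yc - cst d),
      ∃ e, HasValueAt (jacobian z w) e (Pt (xc - cst a) (yc - cst d)) := fun z hz w hw => by
    refine hc.exists_hasValueAt ?_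
    have := hc.jacobian_div_mem hz hw
    rwa [jacobian_sub_cst_left, jacobian_sub_cst_right, jacobian_xc_yc, div_one] at this
  have hkc : HasValueAt (pencil b) c (Pt (xc - cst a) (yc - cst d)) :=
    ⟨h, Ideal.pow_le_self two_ne_zero hk⟩
  have hx : HasValueAt xc a (Pt (xc - cst a) (yc - cst d)) := hc.vanishesAt_fst
  have hy : HasValueAt yc d (Pt (xc - cst a) (yc - cst d)) := hc.vanishesAt_snd
  have hi := hasValueAt_const (R := Pt (xc - cst a) (yc - cst d)) I
  have hβ := hasValueAt_const (R := Pt (xc - cst a) (yc - cst d)) b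
  have h1 : HasValueAt (1 : PlaneField) 1 (Pt (xc - cst a) (yc - cst d)) := hasValueAt_one
  have h2 : HasValueAt (2 : PlaneField) 2 (Pt (xc - cst a) (yc - cst d)) := by
    have := hasValueAt_const (R := Pt (xc - cst a) (yc - cst d)) 2
    rwa [map_ofNat] at this
  have ht : HasValueAt (tc b) _ _ := (((((hx.neg.sub ((hi.mul hβ).mul hy)).add (hi.div hx ha)).add
    (h1.div hy hd0)).add (hx.div hy hd0))).add (((hi.mul hβ).mul hy).div hx ha)
  have hη : HasValueAt etac _ _ := (((h1.sub hx).mul hy).sub (hi.mul hx)).div (hx.pow 2)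
    (pow_ne_zero 2 ha)
  have htx : HasValueAt (jacobian (tc b) xc) _ _ := ((((hi.mul hβ).add (h1.div (hy.pow 2)
    (pow_ne_zero 2 hd0))).add (hx.div (hy.pow 2) (pow_ne_zero 2 hd0))).sub
      ((hi.mul hβ).div hx ha)).congr (jacobian_tc_xc b).symm rfl
  have hηx : HasValueAt (jacobian etac xc) _ _ := ((h1.sub hx).neg.div (hx.pow 2)
    (pow_ne_zero 2 ha)).congr jacobian_etac_xc.symm rfl
  have hηy : HasValueAt (jacobian etac yc) _ _ := (((hy.neg.sub hi).div (hx.pow 2)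
    (pow_ne_zero 2 ha)).sub ((h2.mul (((h1.sub hx).mul hy).sub (hi.mul hx))).div (hx.pow 3)
    (pow_ne_zero 3 ha))).congr jacobian_etac_yc.symm rfl
  have hω : VanishesAt (omegac b) (Pt (xc - cst a) (yc - cst d)) := by
    have h3 := (hk' _ ht.mem).mul_right
      ((((hasValueAt_const (1 / (4 * b))).mul hx).mul hy).mem)
    convert h3 using 1
    have hx0 := isCoord_xc_yc.fst_ne_zero
    have hy0 := isCoord_xc_yc.snd_ne_zero
    have hb' := cst_ne_zero hb
    rw [pencil_eq_tc_etac, jacobian_neg_left, jacobian_add_left, jacobian_add_left,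
      jacobian_mul_left, jacobian_mul_left, jacobian_self, jacobian_cst_left, jacobian_cst_left,
      jacobian_swap (tc b), jacobian_tc_etac]
    change _ = _ * (cst (1 / (4 * b)) * xc * yc)
    have h4 : cst 4 ≠ 0 := cst_ne_zero (by norm_num)
    rw [cst_div, cst_one, cst_mul]
    field_simp
    ring
  have hω' : omegac b ∈ Pt (xc - cst a) (yc - cst d) := hω.mem
  generalize ht0 : (-a - I * b * d + I / a + 1 / d + a / d + I * b * d / a) = t₀ at ht
  generalize hη0 : ((1 - a) * d - I * a) / a ^ 2 = η₀ at hη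
  have e1 : c = -(t₀ * t₀ + 4 * b * η₀ + 2 * I) :=
    hkc.eq ((((ht.mul ht).add ((hasValueAt_const (4 * b)).mul hη)).add
      (hasValueAt_const (2 * I))).neg.congr (pencil_eq_tc_etac b).symm rfl)
  have hth := (ht.mul hη).add (hasValueAt_const (1 - I))
  have hηh := (hβ.mul hη).add hi
  have hηη := (hη.mul hη).add (hasValueAt_const 1)
  have e2 := ((hth.mul hth).add ((hasValueAt_const 4).mul (hηh.mul hηη))).eq
    ((hω.hasValueAt.mul hω.hasValueAt).congr (omegac_mul_omegac b) rfl)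
  rw [mul_zero] at e2
  have key : ∀ w ∈ Pt (xc - cst a) (yc - cst d), ∀ τ ε,
      HasValueAt (jacobian (tc b) w) τ (Pt (xc - cst a) (yc - cst d)) →
      HasValueAt (jacobian etac w) ε (Pt (xc - cst a) (yc - cst d)) → τ = 0 ∧ ε = 0 := by
    intro w hw τ ε hτ hε
    obtain ⟨o, ho⟩ := hjac _ hω' _ hw
    have e3 := (hk' w hw).hasValueAt.eq ((((ht.mul hτ).add (ht.mul hτ)).add
      ((hasValueAt_const (4 * b)).mul hε)).neg.congr (by
        rw [pencil_eq_tc_etac, jacobian_neg_left, jacobian_add_left, jacobian_add_left,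
          jacobian_mul_left, jacobian_mul_left, jacobian_cst_left, jacobian_cst_left, mul_zero,
          add_zero, add_zero]) rfl)
    have hdh := (ht.mul hε).add (hη.mul hτ)
    have e4 := ((hω.hasValueAt.mul ho).add (hω.hasValueAt.mul ho)).eq
      ((((hth.mul hdh).add (hth.mul hdh)).add ((hasValueAt_const 4).mul ((hηh.mul
        ((hη.mul hε).add (hη.mul hε))).add (hηη.mul (hβ.mul hε))))).congr (by
        have h5 := congrArg (fun z => jacobian z w) (omegac_mul_omegac b)
        simp only [jacobian_add_left, jacobian_mul_left, jacobian_cst_left, mul_zero,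
          add_zero] at h5
        exact h5.symm) rfl)
    obtain ⟨q1, q2⟩ := quartic_not_root I_sq hb e1 rfl rfl e2 (τ := τ) (ε := ε)
      (by linear_combination e3) (by linear_combination -e4)
    have hτ0 : τ = 0 := by
      refine (mul_eq_zero.mp q2).resolve_left fun q3 => ?_
      obtain ⟨A, B, hAB⟩ := isCoprime_quartic hd
      have := congrArg (Polynomial.eval t₀) hAB
      simp only [quartic, Polynomial.eval_add, Polynomial.eval_mul, Polynomial.eval_C,
        Polynomial.eval_pow, Polynomial.eval_X, Polynomial.derivative_add,
        Polynomial.derivative_C_mul, Polynomial.derivative_X_pow, Polynomial.derivative_C,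
        Polynomial.derivative_X, Polynomial.eval_one, Polynomial.eval_zero] at this
      rw [q1] at this
      refine one_ne_zero (this.symm.trans ?_)
      push_cast
      linear_combination Polynomial.eval t₀ B * q3
    refine ⟨hτ0, ?_⟩
    rw [hτ0] at e3
    have h4 : 4 * b * ε = 0 := by linear_combination e3
    exact (mul_eq_zero.mp h4).resolve_left (mul_ne_zero (by norm_num) hb)
  obtain ⟨τ, hτ⟩ := hjac _ ht.mem _ hy.mem
  obtain ⟨k1, k2⟩ := key xc hx.mem _ _ htx hηx
  have k3 := (key yc hy.mem _ _ hτ hηy).2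
  have ha1 : a = 1 := by
    field_simp at k2
    linear_combination k2
  rw [ha1] at k1 k3
  have hd1 : d = I := by linear_combination -k3
  rw [hd1, I_sq] at k1
  have : (-2 : ℂ) = 0 := by linear_combination k1
  norm_num at this

lemma exists_critical_value (hb : b ≠ 0) (j : Fin 6) : ∃ c₀ : ℂ, ∀ c s : ℂ, c ≠ c₀ →
    ∀ h : pencil b - cst c ∈
      Pt ((cornerU j - cst (exampleCoords b j)) / cornerV j - cst s) (cornerV j),
    (⟨pencil b - cst c, h⟩ : Pt _ _) ∉ maxIdeal _ ^ 2 := by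
  obtain ⟨B, hB, C, hC, hk⟩ := exists_pencil_corner hb j
  have he := edgeCoeff_ne_zero hb j
  have hκ := exampleCoords_ne_zero hb j
  have hcoord := isCoord_corner j
  generalize exampleCoords b j = κ at *
  generalize edgeCoeff b j = e at *
  generalize cornerU j = U at *
  generalize cornerV j = V at *
  have hadj : ∀ {z}, z ∈ Algebra.adjoin ℂ {U, V} → ∃ p : MvPolynomial (Fin 2) ℂ,
      z = aeval ![U, V] p := fun {z} hz => by
    have h : Set.range ![U, V] = {U, V} := by
      simp only [Matrix.range_cons, Matrix.range_empty, Set.union_empty, Set.singleton_union]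
    rw [← h, Algebra.adjoin_range_eq_range_aeval] at hz
    obtain ⟨P, rfl⟩ := hz
    exact ⟨P, rfl⟩
  obtain ⟨p, rfl⟩ := hadj hB
  obtain ⟨q, rfl⟩ := hadj hC
  set β := aeval ![κ, 0] p with hβ
  set γ := aeval ![κ, 0] q with hγ
  refine ⟨(e * (-β / (2 * e)) ^ 2 + (-β / (2 * e)) * β + γ) / κ ^ 2, fun c s hne h hk2 => hne ?_⟩
  have hs : IsCoord ((U - cst κ) / V - cst s) V :=
    ((hcoord.sub_const_fst κ).div_fst).sub_const_fst s
  have := hs.isLocalRing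
  have hV0 := hcoord.snd_ne_zero
  have hVR := hs.vanishesAt_snd
  have hsR : HasValueAt ((U - cst κ) / V) s (Pt ((U - cst κ) / V - cst s) V) := hs.vanishesAt_fst
  have hUs : cst κ + V * ((U - cst κ) / V) = U := by field_simp; ring
  have hUR : HasValueAt U κ (Pt ((U - cst κ) / V - cst s) V) :=
    ((hasValueAt_const κ).add (hVR.hasValueAt.mul hsR)).congr hUs (by simp)
  have hpR := hasValueAt_aeval hUR hVR.hasValueAt p
  have hqR := hasValueAt_aeval hUR hVR.hasValueAt q
  have hkR : HasValueAt (pencil b) c (Pt ((U - cst κ) / V - cst s) V) :=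
    ⟨h, Ideal.pow_le_self two_ne_zero hk2⟩
  have hj := hs.vanishesAt_jacobian_div hk2 hVR.mem
  have hJ0 := hs.jacobian_ne_zero
  rw [jacobian_sub_cst_left] at hj hJ0
  rw [jacobian_sub_cst_left] at hj
  have hUV : jacobian U V = V * jacobian ((U - cst κ) / V) V := by
    rw [jacobian_div_self_left hV0, jacobian_sub_cst_left]
    field_simp
  have hjp : ∀ p : MvPolynomial (Fin 2) ℂ, jacobian (aeval ![U, V] p) V =
      aeval ![U, V] (pderiv 0 p) * V * jacobian ((U - cst κ) / V) V := fun p => by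
    have hv : 𝐝 V = (0 : PlaneField) • 𝐝 U + (1 : PlaneField) • 𝐝 V := by simp
    rw [jacobian_of_eq (D_aeval p) hv, hUV]
    ring
  have hk3 : pencil b * (U * U) = cst e * (((U - cst κ) / V) * ((U - cst κ) / V)) +
      ((U - cst κ) / V) * aeval ![U, V] p + aeval ![U, V] q := by
    field_simp
    linear_combination hk
  have e1 : c * (κ * κ) = e * (s * s) + s * β + γ :=
    (hkR.mul (hUR.mul hUR)).eq (((((hasValueAt_const e).mul (hsR.mul hsR)).add
      (hsR.mul hpR)).add hqR).congr hk3.symm rfl)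
  have hk4 := congrArg (fun z => jacobian z V) hk3
  simp only [jacobian_add_left, jacobian_mul_left, jacobian_cst_left, hjp, hUV, mul_zero,
    add_zero] at hk4
  have hp' := hasValueAt_aeval hUR hVR.hasValueAt (pderiv 0 p)
  have hq' := hasValueAt_aeval hUR hVR.hasValueAt (pderiv 0 q)
  have hV := hVR.hasValueAt
  have e2 := (((hkR.mul ((hUR.mul hV).add (hUR.mul hV))).add
      ((hUR.mul hUR).mul hj.hasValueAt))).eq
    (((((hasValueAt_const e).mul (hsR.add hsR)).add ((hsR.mul (hp'.mul hV)).add hpR)).add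
      (hq'.mul hV)).congr (by
        refine mul_right_cancel₀ hJ0 ?_
        have hJ := div_mul_cancel₀ (jacobian (pencil b) V) hJ0
        linear_combination -hk4 - U * U * hJ) rfl)
  have hs0 : s = -β / (2 * e) := by
    field_simp
    simp only [mul_zero, add_zero, zero_add, ← hβ] at e2
    linear_combination -e2
  rw [← hs0]
  field_simp
  linear_combination e1

lemma finite_not_isEllipticFibre (hb : b ≠ 0) :
    {c : ℂ | ¬ IsEllipticFibre (exampleSurface b) (pencil b) c}.Finite := by
  choose c₀ hc₀ using exists_critical_value hb
  refine ((finite_fibreDisc_eq_zero hb).union (Set.finite_range c₀)).subset fun c hc => ?_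
  by_contra hcon
  rw [Set.mem_union, not_or, Set.mem_ofPred_eq] at hcon
  refine hc ⟨fun R hR h => ?_, exists_unique_primeDivisor hb hcon.1⟩
  have hpole : ∀ {u v}, IsCoord u v → R = Pt u v → ¬ IsPolarForm b u v :=
    fun huv hRuv hk => by
      subst hRuv
      refine hk.pencil_notMem huv ?_
      simpa using Subalgebra.add_mem _ h (cst_mem _ c)
  have hR' := hR
  rw [exampleSurface_eq hb] at hR'
  rcases hR' with ⟨a, d, ha, hd, rfl⟩ | ⟨j, a, ha, ha', rfl⟩ | ⟨j, rfl⟩ | ⟨j, hR⟩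
  · exact not_mem_sq_torus hb hcon.1 ha hd h
  · exact absurd (isPolarForm_edge hb ha') (hpole ((isCoord_corner j).sub_const_fst a) rfl)
  · exact absurd (isPolarForm_corner hb j) (hpole (isCoord_corner j) rfl)
  · have h1 := (isCoord_corner j).sub_const_fst (exampleCoords b j)
    rw [h1.exceptionalPoints_eq_swap] at hR
    rcases hR with ⟨s, rfl⟩ | rfl
    · exact hc₀ j c s (fun h0 => hcon.2 ⟨j, h0.symm⟩) h
    · exact absurd (isPolarForm_exceptional hb j) (hpole h1.div_snd rfl)

end

section RationalSurface

open Polynomial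

variable {u v z : PlaneField}

local notation "𝐝" => KaehlerDifferential.D ℂ PlaneField

lemma jacobian_eq_zero_of_mem_adjoin (hz : z ∈ adjoin ℂ {v}) :
    jacobian z v = 0 := by
  induction hz using IntermediateField.adjoin_induction with
  | mem x hx => rw [Set.mem_singleton_iff.mp hx, jacobian_self]
  | algebraMap c => exact jacobian_cst_left c
  | add x y _ _ hx hy => rw [jacobian_add_left, hx, hy, add_zero]
  | inv x _ hx =>
    by_cases h0 : x = 0
    · rw [h0, inv_zero]; exact h0 ▸ hx
    · rw [jacobian_inv_left h0, hx, mul_zero]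
  | mul x y _ _ hx hy => rw [jacobian_mul_left, hx, hy, mul_zero, mul_zero, add_zero]

lemma jacobian_aeval_left (P : (adjoin ℂ {v})[X]) :
    jacobian (aeval u P) v = aeval u (derivative P) * jacobian u v := by
  induction P using Polynomial.induction_on' with
  | add p q hp hq =>
    rw [map_add, jacobian_add_left, hp, hq, derivative_add, map_add, add_mul]
  | monomial n a =>
    have ha : jacobian (algebraMap _ PlaneField a) v = 0 := jacobian_eq_zero_of_mem_adjoin a.2
    have hpow : ∀ n : ℕ, jacobian (u ^ n) v = n * u ^ (n - 1) * jacobian u v := fun n => by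
      induction n with
      | zero => simp [jacobian_one_left]
      | succ n ih =>
        rw [pow_succ, jacobian_mul_left, ih]
        cases n with
        | zero => simp
        | succ n => simp only [Nat.add_sub_cancel]; push_cast; ring
    rw [aeval_monomial, jacobian_mul_left, ha, hpow, derivative_monomial, aeval_monomial, map_mul,
      map_natCast]
    ring

lemma mem_adjoin_adjoin_of_adjoin_eq_top {K : Type*} [Field K] [Algebra ℂ K] {u v : K}
    (h : adjoin ℂ {u, v} = ⊤) (z : K) :
    z ∈ adjoin (adjoin ℂ {v}) {u} := by
  have h1 : z ∈ (adjoin (adjoin ℂ {v}) {u}).restrictScalars ℂ := by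
    rw [IntermediateField.adjoin_adjoin_left, Set.union_comm, Set.singleton_union, h]
    exact IntermediateField.mem_top
  exact h1

lemma IsCoord.exists_coprime_eq_div (h : IsCoord u v) (z : PlaneField) :
    ∃ P Q : (adjoin ℂ {v})[X], IsCoprime P Q ∧ aeval u Q ≠ 0 ∧
      z = aeval u P / aeval u Q := by
  classical
  have hz : z ∈ adjoin (adjoin ℂ {v}) {u} := by
    exact mem_adjoin_adjoin_of_adjoin_eq_top h z
  obtain ⟨r, s, rfl⟩ := IntermediateField.mem_adjoin_simple_iff _ z |>.mp hz
  by_cases hs : aeval u s = 0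
  · exact ⟨0, 1, isCoprime_one_right, by simp, by rw [hs]; simp⟩
  have hs0 : s ≠ 0 := by rintro rfl; simp at hs
  have hcop := isCoprime_div_gcd_div_gcd (p := r) (q := s) hs0
  have hr' := EuclideanDomain.mul_div_cancel' (gcd_ne_zero_of_right hs0) (GCDMonoid.gcd_dvd_left r s)
  have hs' := EuclideanDomain.mul_div_cancel' (gcd_ne_zero_of_right hs0) (GCDMonoid.gcd_dvd_right r s)
  set g := GCDMonoid.gcd r s
  have hgs : aeval u g * aeval u (s / g) = aeval u s := by rw [← map_mul, hs']
  have hgr : aeval u g * aeval u (r / g) = aeval u r := by rw [← map_mul, hr']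
  have hg0 : aeval u g ≠ 0 := fun h0 => hs (by rw [← hgs, h0, zero_mul])
  refine ⟨r / g, s / g, hcop, fun h0 => hs (by rw [← hgs, h0, mul_zero]), ?_⟩
  rw [← hgr, ← hgs, mul_div_mul_left _ _ hg0]

lemma IsCoord.jacobian_div_mem_valuationSubring (h : IsCoord u v) {O : ValuationSubring PlaneField}
    (hO : ∀ l ∈ adjoin ℂ {v}, l ∈ O) (hu : u ∈ O) (hz : z ∈ O) :
    jacobian z v / jacobian u v ∈ O := by
  have hmem : ∀ P : (adjoin ℂ {v})[X], aeval u P ∈ O := fun P => by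
    rw [aeval_eq_sum_range]
    refine sum_mem fun i _ => ?_
    rw [Algebra.smul_def]
    exact O.mul_mem _ _ (hO _ (P.coeff i).2) (pow_mem hu i)
  obtain ⟨P, Q, ⟨A, B, hAB⟩, hQ, rfl⟩ := h.exists_coprime_eq_div z
  have hinv : (aeval u Q)⁻¹ ∈ O := by
    have : (aeval u Q)⁻¹ = aeval u A * (aeval u P / aeval u Q) + aeval u B := by
      have := congrArg (aeval u) hAB
      simp only [map_add, map_mul, map_one] at this
      field_simp
      linear_combination -this
    rw [this]
    exact O.add_mem _ _ (O.mul_mem _ _ (hmem A) hz) (hmem B)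
  rw [jacobian_div_left hQ, jacobian_aeval_left, jacobian_aeval_left]
  have : (aeval u (derivative P) * jacobian u v * aeval u Q -
      aeval u P * (aeval u (derivative Q) * jacobian u v)) / aeval u Q ^ 2 / jacobian u v =
      (aeval u (derivative P * Q - P * derivative Q)) * ((aeval u Q)⁻¹ * (aeval u Q)⁻¹) := by
    have := h.jacobian_ne_zero
    simp only [map_sub, map_mul]
    field_simp
  rw [this]
  exact O.mul_mem _ _ (hmem _) (O.mul_mem _ _ hinv hinv)

/-- The contraction of a differential with the bivector dual to the Jacobian: `ω ↦ ω ∧ dv`. -/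
def wedge (v : PlaneField) : Ω[PlaneField⁄ℂ] →ₗ[PlaneField] PlaneField :=
  (differentialBasis.repr (𝐝 v) 1) • differentialBasis.coord 0 -
    (differentialBasis.repr (𝐝 v) 0) • differentialBasis.coord 1

lemma wedge_D (z v : PlaneField) : wedge v (𝐝 z) = jacobian z v := by
  rw [jacobian_eq, wedge]
  simp
  ring

lemma IsCoord.wedge_div_mem (h : IsCoord u v) {ω : Ω[PlaneField⁄ℂ]}
    (hω : ω ∈ regularDifferentials PlaneField) {O : ValuationSubring PlaneField}
    (hO : ∀ l ∈ adjoin ℂ {v}, l ∈ O) (hu : u ∈ O) :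
    wedge v ω / jacobian u v ∈ O := by
  have h1 := mem_regularDifferentials.mp hω O fun c => hO _ (IntermediateField.algebraMap_mem _ c)
  clear hω
  induction h1 using Submodule.span_induction with
  | mem ω h2 =>
    obtain ⟨a, ha, g, hg, rfl⟩ := h2
    rw [map_smul, wedge_D, smul_eq_mul, mul_div_assoc]
    exact O.mul_mem _ _ ha (h.jacobian_div_mem_valuationSubring hO hu hg)
  | zero => rw [map_zero, zero_div]; exact O.zero_mem
  | add x y _ _ hx hy => rw [map_add, add_div]; exact O.add_mem _ _ hx hy
  | smul a x _ hx =>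
    rw [← algebraMap_smul PlaneField a x, map_smul, smul_eq_mul, mul_div_assoc]
    exact O.mul_mem _ _ (hO _ (IntermediateField.algebraMap_mem _ a)) hx

lemma isIntegral_of_forall_valuationSubring {K : Type*} [Field K] {L : Subfield K} {z : K}
    (h : ∀ O : ValuationSubring K, (∀ l ∈ L, l ∈ O) → z ∈ O) : IsIntegral L z := by
  have h1 : z ∈ (⨅ V : {V : ValuationSubring K // (L : Set K) ⊆ V.toSubring},
      V.1.toSubring) := by
    rw [Subring.mem_iInf]
    exact fun V => h V.1 fun l hl => V.2 hl
  rw [iInf_valuationSubring_superset] at h1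
  obtain ⟨p, hp, h0⟩ := (mem_integralClosure_iff _ _).mp h1
  have hle : Subring.closure (L : Set K) ≤ L.toSubring := by
    rw [Subring.closure_le]
    exact fun l hl => hl
  exact ⟨p.map (Subring.inclusion hle), hp.map _, by rw [eval₂_map]; exact h0⟩

lemma IsCoord.not_isAlgebraic (h : IsCoord u v) :
    ¬ IsAlgebraic (adjoin ℂ {v}) u := fun ha => by
  have h1 := jacobian_aeval_left (u := u) (minpoly (adjoin ℂ {v}) u)
  have h2 := jacobian_cst_left (v := v) 0
  rw [cst_zero] at h2
  rw [minpoly.aeval, h2] at h1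
  refine mul_ne_zero ?_ h.jacobian_ne_zero h1.symm
  exact (minpoly.irreducible ha.isIntegral).separable.aeval_derivative_ne_zero (minpoly.aeval _ _)

lemma IsCoord.wedge_eq_zero (h : IsCoord u v) {ω : Ω[PlaneField⁄ℂ]}
    (hω : ω ∈ regularDifferentials PlaneField) : wedge v ω = 0 := by
  by_contra h0
  have hJ := h.jacobian_ne_zero
  have hu := h.fst_ne_zero
  set F := wedge v ω / jacobian u v with hF
  have hF0 : F ≠ 0 := div_ne_zero h0 hJ
  have key : ∀ O : ValuationSubring PlaneField,
      (∀ l ∈ (adjoin ℂ {v}).toSubfield, l ∈ O) → F ∈ O ∧ u * F ∈ O := by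
    intro O hO
    rcases O.mem_or_inv_mem u with h1 | h1
    · have h2 := h.wedge_div_mem hω hO h1
      exact ⟨h2, O.mul_mem _ _ h1 h2⟩
    · have h2 := h.inv_fst.wedge_div_mem hω hO h1
      have h3 : wedge v ω / jacobian u⁻¹ v = -(u ^ 2 * F) := by
        rw [jacobian_inv_left hu, hF]
        field_simp
      rw [h3, neg_mem_iff] at h2
      refine ⟨?_, ?_⟩
      · convert O.mul_mem _ _ (O.mul_mem _ _ h1 h1) h2 using 1
        field_simp
      · convert O.mul_mem _ _ h1 h2 using 1
        field_simp
  have h1 := isIntegral_of_forall_valuationSubring fun O hO => (key O hO).1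
  have h2 := isIntegral_of_forall_valuationSubring fun O hO => (key O hO).2
  refine h.not_isAlgebraic ?_
  have h3 := (h2.isAlgebraic).mul (h1.isAlgebraic.inv)
  rwa [mul_inv_cancel_right₀ hF0] at h3

lemma regularDifferentials_planeField : regularDifferentials PlaneField = ⊥ := by
  rw [eq_bot_iff]
  intro ω hω
  have hx : 𝐝 xc = differentialBasis 0 := (differentialBasis_apply 0).symm
  have hy : 𝐝 yc = differentialBasis 1 := (differentialBasis_apply 1).symm
  have h0 := isCoord_xc_yc.wedge_eq_zero hω
  have h1 := isCoord_xc_yc.symm.wedge_eq_zero hω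
  rw [wedge, hy] at h0
  rw [wedge, hx] at h1
  simp at h0 h1
  rw [Submodule.mem_bot, ← differentialBasis.repr.map_eq_zero_iff]
  ext i
  fin_cases i
  · exact h0
  · exact h1

open scoped TensorProduct in
lemma geometricGenus_intermediateField {K : Type*} [Field K] [Algebra ℂ K] (hK : regularDifferentials K = ⊥)
    (E : IntermediateField ℂ K) : geometricGenus E = 0 := by
  suffices h : regularDifferentials E = ⊥ by rw [geometricGenus, h, finrank_bot]
  rw [eq_bot_iff]
  intro η hη
  have h1 : KaehlerDifferential.map ℂ ℂ E K η ∈ regularDifferentials K := by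
    rw [mem_regularDifferentials]
    intro O hO
    have h2 := mem_regularDifferentials.mp hη (O.comap (algebraMap E K)) fun c => hO c
    clear hη
    induction h2 using Submodule.span_induction with
    | mem ω h2 =>
      obtain ⟨a, ha, g, hg, rfl⟩ := h2
      refine Submodule.subset_span ⟨a, ha, g, hg, ?_⟩
      rw [map_smul, KaehlerDifferential.map_D]
      rfl
    | zero => rw [map_zero]; exact Submodule.zero_mem _
    | add x y _ _ hx hy => rw [map_add]; exact Submodule.add_mem _ hx hy
    | smul a x _ hx =>
      rw [← algebraMap_smul E a x, map_smul, ← algebraMap_smul K, ← IsScalarTower.algebraMap_apply,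
        algebraMap_smul]
      exact Submodule.smul_mem _ a hx
  rw [hK, Submodule.mem_bot] at h1
  obtain ⟨s, hs⟩ := exists_isTranscendenceBasis E K
  have : Algebra.IsAlgebraic (adjoin E (Set.range ((↑) : s → K))) K :=
    hs.isAlgebraic_field
  have : Algebra.FormallySmooth E K := .of_algebraicIndependent_of_isSeparable hs.1
  have h2 : Function.Injective (KaehlerDifferential.mapBaseChange ℂ E K) := by
    rw [injective_iff_map_eq_zero]
    intro z hz
    obtain ⟨w, rfl⟩ := (Algebra.H1Cotangent.exact_δ_mapBaseChange ℂ E K z).mp hz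
    rw [Subsingleton.elim w 0, map_zero]
  have h3 : (1 : K) ⊗ₜ[E] η = 0 := h2 (by
    rw [KaehlerDifferential.mapBaseChange_tmul, h1, smul_zero, map_zero])
  exact Module.FaithfullyFlat.tensorProduct_mk_injective (A := E) (B := K) (Ω[E⁄ℂ])
    (h3.trans (TensorProduct.tmul_zero _ _).symm)

end RationalSurface

section Minimality

open Polynomial

variable {S R : Subalgebra ℂ PlaneField} {s t f z : PlaneField}

/-- The local ring `S` is two-dimensional, with local parameters `s`, `t`. -/
structure IsParameters (S : Subalgebra ℂ PlaneField) (s t : PlaneField) : Prop where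
  isLocalRing : IsLocalRing S
  isNoetherianRing : IsNoetherianRing S
  dim_eq_two : ringKrullDim S = 2
  vanishesAt_fst : VanishesAt s S
  vanishesAt_snd : VanishesAt t S
  exists_eq : ∀ z, VanishesAt z S → ∃ x ∈ S, ∃ y ∈ S, z = s * x + t * y

lemma exists_isParameters (hS : IsRegularLocalRing S) (hdim : ringKrullDim S = 2) :
    ∃ s t, IsParameters S s t := by
  have h1 := hS.spanFinrank_maximalIdeal
  rw [hdim] at h1
  obtain ⟨A, hA, hspan⟩ := Submodule.FG.exists_span_finset_card_eq_spanFinrank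
    (IsNoetherian.noetherian (IsLocalRing.maximalIdeal S))
  rw [show (IsLocalRing.maximalIdeal S).spanFinrank = 2 by exact_mod_cast h1] at hA
  classical
  obtain ⟨σ, τ, -, rfl⟩ := Finset.card_eq_two.mp hA
  rw [Finset.coe_pair, ← maxIdeal_eq] at hspan
  refine ⟨σ, τ, inferInstance, inferInstance, hdim, ⟨σ.2, ?_⟩, ⟨τ.2, ?_⟩, ?_⟩
  · rw [← hspan]; exact Submodule.subset_span (by simp)
  · rw [← hspan]; exact Submodule.subset_span (by simp)
  · rintro z ⟨hz, hm⟩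
    rw [← hspan] at hm
    obtain ⟨x, y, hxy⟩ := Ideal.mem_span_pair.mp hm
    refine ⟨x, x.2, y, y.2, ?_⟩
    have := congrArg Subtype.val hxy
    simp only [Subalgebra.coe_add, Subalgebra.coe_mul] at this
    linear_combination -this

namespace IsParameters

lemma symm (h : IsParameters S s t) : IsParameters S t s :=
  ⟨h.1, h.2, h.3, h.5, h.4, fun z hz => by
    obtain ⟨x, hx, y, hy, rfl⟩ := h.exists_eq z hz
    exact ⟨y, hy, x, hx, add_comm _ _⟩⟩

lemma pow_ne_mul (h : IsParameters S s t) (n : ℕ) (hz : z ∈ S) : s ^ n ≠ t * z := by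
  intro h0
  have := h.isLocalRing
  have := h.isNoetherianRing
  have ht := h.vanishesAt_snd.mem
  have hs := h.vanishesAt_fst.mem
  have hm : IsLocalRing.maximalIdeal S ∈ (Ideal.span {(⟨t, ht⟩ : S)}).minimalPrimes := by
    refine ⟨⟨inferInstance, ?_⟩, fun q ⟨hq, hle⟩ _ => ?_⟩
    · rw [Ideal.span_singleton_le_iff_mem, ← maxIdeal_eq]
      exact h.vanishesAt_snd.2
    · have htq : (⟨t, ht⟩ : S) ∈ q := hle (Ideal.mem_span_singleton_self _)
      have hsq : (⟨s, hs⟩ : S) ∈ q := by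
        refine hq.mem_of_pow_mem n ?_
        rw [show (⟨s, hs⟩ : S) ^ n = ⟨t, ht⟩ * ⟨z, hz⟩ from Subtype.ext h0]
        exact q.mul_mem_right _ htq
      intro w hw
      rw [← maxIdeal_eq] at hw
      obtain ⟨x, hx, y, hy, e⟩ := h.exists_eq w ⟨w.2, hw⟩
      rw [show w = ⟨s, hs⟩ * ⟨x, hx⟩ + ⟨t, ht⟩ * ⟨y, hy⟩ from Subtype.ext e]
      exact q.add_mem (q.mul_mem_right _ hsq) (q.mul_mem_right _ htq)
  have h1 := Ideal.height_le_one_of_isPrincipal_of_mem_minimalPrimes _ _ hm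
  have h2 := IsLocalRing.maximalIdeal_height_eq_ringKrullDim (R := S)
  rw [h.dim_eq_two] at h2
  have h3 : (IsLocalRing.maximalIdeal S).height = 2 := WithBot.coe_injective h2
  rw [h3] at h1
  exact absurd h1 (by decide)

lemma fst_ne_zero (h : IsParameters S s t) : s ≠ 0 := fun h0 =>
  h.pow_ne_mul 1 S.zero_mem (by rw [h0]; simp)

lemma snd_ne_zero (h : IsParameters S s t) : t ≠ 0 := h.symm.fst_ne_zero

lemma mem_chart (h : IsParameters S s t) (hz : z ∈ S) : z ∈ blowUpChart S s :=
  mem_blowUpChart (mul_comm s z ▸ h.vanishesAt_fst.mul_left hz)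

lemma div_mem_chart (h : IsParameters S s t) : t / s ∈ blowUpChart S s :=
  mem_blowUpChart (by rw [mul_div_cancel₀ _ h.fst_ne_zero]; exact h.vanishesAt_snd)

lemma chart_le {A : Subalgebra ℂ PlaneField} (h : IsParameters S s t) (hS : S ≤ A)
    (ht : t / s ∈ A) : blowUpChart S s ≤ A := by
  refine Algebra.adjoin_le fun z hz => ?_
  obtain ⟨x, hx, y, hy, hxy⟩ := h.exists_eq _ hz
  have hs := h.fst_ne_zero
  have : z = x + t / s * y := by
    field_simp
    linear_combination hxy
  exact this ▸ A.add_mem (hS hx) (A.mul_mem ht (hS hy))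

lemma exists_pow_mul_eq (h : IsParameters S s t) (hz : z ∈ blowUpChart S s) :
    ∃ n : ℕ, ∃ x ∈ S, ∃ y ∈ S, s ^ n * z = s ^ n * x + t * y := by
  have hs := h.vanishesAt_fst.mem
  have ht := h.vanishesAt_snd.mem
  induction hz using Algebra.adjoin_induction with
  | mem z hz =>
    obtain ⟨x, hx, y, hy, hxy⟩ := h.exists_eq _ hz
    exact ⟨1, x, hx, y, hy, by rw [pow_one, hxy]⟩
  | algebraMap c => exact ⟨0, _, cst_mem S c, 0, S.zero_mem, by ring⟩
  | add z w _ _ h1 h2 =>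
    obtain ⟨n, x, hx, y, hy, e⟩ := h1
    obtain ⟨m, x', hx', y', hy', e'⟩ := h2
    refine ⟨n + m, _, S.add_mem hx hx', _, S.add_mem (S.mul_mem (S.pow_mem hs m) hy)
      (S.mul_mem (S.pow_mem hs n) hy'), ?_⟩
    rw [pow_add]
    linear_combination s ^ m * e + s ^ n * e'
  | mul z w _ _ h1 h2 =>
    obtain ⟨n, x, hx, y, hy, e⟩ := h1
    obtain ⟨m, x', hx', y', hy', e'⟩ := h2
    refine ⟨n + m, _, S.mul_mem hx hx', s ^ n * x * y' + s ^ m * x' * y + t * y * y', ?_, ?_⟩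
    · exact S.add_mem (S.add_mem (S.mul_mem (S.mul_mem (S.pow_mem hs n) hx) hy')
        (S.mul_mem (S.mul_mem (S.pow_mem hs m) hx') hy)) (S.mul_mem (S.mul_mem ht hy) hy')
    · rw [pow_add]
      linear_combination s ^ m * w * e + (s ^ n * x + t * y) * e'

lemma add_ne_one (h : IsParameters S s t) {α β : PlaneField} (hα : α ∈ blowUpChart S s)
    (hβ : β ∈ blowUpChart S s) : s * α + t / s * β ≠ 1 := by
  intro h1
  have := h.isLocalRing
  have hs := h.fst_ne_zero
  have hsS := h.vanishesAt_fst.mem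
  have htS := h.vanishesAt_snd.mem
  obtain ⟨n, x, hx, y, hy, e⟩ := h.exists_pow_mul_eq hα
  obtain ⟨m, x', hx', y', hy', e'⟩ := h.exists_pow_mul_eq hβ
  have hu : (1 - s * x)⁻¹ ∈ S := by
    have : HasValueAt (1 - s * x) 1 S :=
      (hasValueAt_one.sub (h.vanishesAt_fst.mul_right hx).hasValueAt).congr rfl (sub_zero 1)
    exact this.inv_mem one_ne_zero
  have hu0 : (1 - s * x) ≠ 0 := by
    have : HasValueAt (1 - s * x) 1 S :=
      (hasValueAt_one.sub (h.vanishesAt_fst.mul_right hx).hasValueAt).congr rfl (sub_zero 1)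
    exact this.ne_zero one_ne_zero
  refine h.pow_ne_mul (n + m + 1) (z := (s ^ (m + 2) * y + s ^ n * (s ^ m * x' + t * y')) *
    (1 - s * x)⁻¹) ?_ ?_
  · exact S.mul_mem (S.add_mem (S.mul_mem (S.pow_mem hsS _) hy) (S.mul_mem (S.pow_mem hsS _)
      (S.add_mem (S.mul_mem (S.pow_mem hsS _) hx') (S.mul_mem htS hy')))) hu
  · have h2 : s * (s * α) + t * β = s := by
      have := congrArg (s * ·) h1
      field_simp at this
      linear_combination this
    field_simp
    rw [pow_add, pow_add] at *
    linear_combination -(s ^ n * s ^ m) * h2 + s ^ m * s ^ 2 * e + t * s ^ n * e'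

/-- Elements of the chart are polynomials in `t / s` modulo `s`, if the residue field is `ℂ`. -/
lemma exists_poly (h : IsParameters S s t) (hS : ∀ x ∈ S, ∃ c, HasValueAt x c S)
    (hz : z ∈ blowUpChart S s) :
    ∃ P : ℂ[X], ∃ w ∈ blowUpChart S s, z = aeval (t / s) P + s * w := by
  have hs := h.fst_ne_zero
  have hsA := h.mem_chart h.vanishesAt_fst.mem
  have hTA := h.div_mem_chart
  have hval : ∀ x ∈ S, ∃ c : ℂ, ∃ w ∈ blowUpChart S s, x = cst c + s * w := fun x hx => by
    obtain ⟨c, hc⟩ := hS x hx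
    refine ⟨c, (x - cst c) / s, mem_blowUpChart (by rwa [mul_div_cancel₀ _ hs]), ?_⟩
    field_simp
    ring
  induction hz using Algebra.adjoin_induction with
  | mem z hz =>
    obtain ⟨x, hx, y, hy, hxy⟩ := h.exists_eq _ hz
    obtain ⟨c, w, hw, rfl⟩ := hval x hx
    obtain ⟨d, w', hw', rfl⟩ := hval y hy
    refine ⟨C c + C d * X, w + t / s * w', Subalgebra.add_mem _ hw (Subalgebra.mul_mem _ hTA hw'), ?_⟩
    simp only [map_add, map_mul, aeval_C, aeval_X]
    field_simp
    linear_combination hxy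
  | algebraMap c => exact ⟨C c, 0, Subalgebra.zero_mem _, by rw [aeval_C]; ring⟩
  | add z w _ _ h1 h2 =>
    obtain ⟨P, x, hx, rfl⟩ := h1
    obtain ⟨Q, y, hy, rfl⟩ := h2
    exact ⟨P + Q, x + y, Subalgebra.add_mem _ hx hy, by rw [map_add]; ring⟩
  | mul z w _ _ h1 h2 =>
    obtain ⟨P, x, hx, rfl⟩ := h1
    obtain ⟨Q, y, hy, rfl⟩ := h2
    have hP := aeval_mem_of_mem hTA P
    have hQ := aeval_mem_of_mem hTA Q
    refine ⟨P * Q, aeval (t / s) P * y + x * aeval (t / s) Q + s * x * y, ?_, by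
      rw [map_mul]; ring⟩
    exact Subalgebra.add_mem _ (Subalgebra.add_mem _ (Subalgebra.mul_mem _ hP hy)
      (Subalgebra.mul_mem _ hx hQ)) (Subalgebra.mul_mem _ (Subalgebra.mul_mem _ hsA hx) hy)

lemma exists_maximalIdeal (h : IsParameters S s t) (a : ℂ) :
    ∃ (M : Ideal (blowUpChart S s)) (_ : M.IsMaximal),
      (⟨s, h.mem_chart h.vanishesAt_fst.mem⟩ : blowUpChart S s) ∈ M ∧
      HasValueAt (t / s) a (localizationAt (blowUpChart S s) M) := by
  have hs := h.fst_ne_zero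
  have hp : IsParameters S s (t - cst a * s) := by
    refine ⟨h.1, h.2, h.3, h.4, h.5.sub (h.4.mul_left (cst_mem S a)), fun z hz => ?_⟩
    obtain ⟨x, hx, y, hy, rfl⟩ := h.exists_eq z hz
    exact ⟨x + cst a * y, S.add_mem hx (S.mul_mem (cst_mem S a) hy), y, hy, by ring⟩
  have hT : (t - cst a * s) / s = t / s - cst a := by field_simp
  have hTA := hp.div_mem_chart
  rw [hT] at hTA
  let σ : blowUpChart S s := ⟨s, h.mem_chart h.vanishesAt_fst.mem⟩
  let τ : blowUpChart S s := ⟨t / s - cst a, hTA⟩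
  have hI : Ideal.span {σ, τ} ≠ ⊤ := by
    rw [Ne, Ideal.eq_top_iff_one, Ideal.mem_span_pair]
    rintro ⟨x, y, hxy⟩
    refine hp.add_ne_one x.2 y.2 ?_
    have := congrArg Subtype.val hxy
    change (x : PlaneField) * s + y * (t / s - cst a) = 1 at this
    rw [hT]
    linear_combination this
  obtain ⟨M, hM, hle⟩ := Ideal.exists_le_maximal _ hI
  have hσ : σ ∈ M := hle (Ideal.subset_span (by simp))
  have hτ : τ ∈ M := hle (Ideal.subset_span (by simp))
  exact ⟨M, hM, hσ, (vanishesAt_localizationAt_coe (a := τ)).mpr hτ⟩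

lemma exists_exceptionalPoint (h : IsParameters S s t) (a : ℂ) :
    ∃ R ∈ exceptionalPoints S, IsLocalRing R ∧ blowUpChart S s ≤ R ∧ VanishesAt s R ∧
      HasValueAt (t / s) a R := by
  obtain ⟨M, hM, hσ, ha⟩ := h.exists_maximalIdeal a
  have hσ' := vanishesAt_localizationAt_coe.mpr hσ
  exact ⟨localizationAt _ M, ⟨s, h.fst_ne_zero, h.vanishesAt_fst, ⟨M, hM, rfl⟩, hσ'⟩,
    inferInstance, le_localizationAt _ M, hσ', ha⟩

/-- On the exceptional curve, `f (∂x ∧ ∂y)²` has no zeros or poles. -/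
structure IsNonvanishingOn (f : PlaneField) (S : Subalgebra ℂ PlaneField) : Prop where
  exists_coord : ∀ R ∈ exceptionalPoints S, ∃ u v, IsCoord u v ∧ R = Pt u v ∧
    IsUnitAt (f * jacobian u v ^ 2) R

lemma exists_hasValueAt (h : IsParameters S s t) (hf : IsNonvanishingOn f S) {x : PlaneField}
    (hx : x ∈ S) : ∃ c, HasValueAt x c S := by
  obtain ⟨R, hR, hRl, hle, -, -⟩ := h.exists_exceptionalPoint 0
  obtain ⟨u, v, huv, rfl, -⟩ := hf.exists_coord R hR
  have := h.isLocalRing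
  have hSR : S ≤ Pt u v := fun z hz => hle (h.mem_chart hz)
  obtain ⟨c, hc⟩ := huv.exists_hasValueAt (hSR hx)
  refine ⟨c, ?_⟩
  by_contra hn
  have hxc := S.sub_mem hx (cst_mem S c)
  have h1 := inv_mem_of_not_vanishesAt hxc hn
  by_cases h0 : x - cst c = 0
  · exact hn (show VanishesAt (x - cst c) S from h0 ▸ vanishesAt_zero)
  · exact hc.inv_notMem h0 (hSR h1)

lemma isUnitAt (h : IsParameters S s t) (hf : IsNonvanishingOn f S)
    {M : Ideal (blowUpChart S s)} [hM : M.IsMaximal]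
    (hs : (⟨s, h.mem_chart h.vanishesAt_fst.mem⟩ : blowUpChart S s) ∈ M) :
    IsUnitAt (f * jacobian s t ^ 2 / s ^ 2) (localizationAt (blowUpChart S s) M) := by
  have hs0 := h.fst_ne_zero
  have hsR := (vanishesAt_localizationAt_coe).mpr hs
  have hle := le_localizationAt (blowUpChart S s) M
  obtain ⟨u, v, huv, hR, hu⟩ := hf.exists_coord (localizationAt (blowUpChart S s) M)
    ⟨s, hs0, h.vanishesAt_fst, ⟨M, hM, rfl⟩, hsR⟩
  obtain ⟨a, ha⟩ : ∃ a, HasValueAt (t / s) a (localizationAt (blowUpChart S s) M) := by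
    have := hle h.div_mem_chart
    rw [hR] at this ⊢
    exact huv.exists_hasValueAt this
  have hτR : VanishesAt (t / s - cst a) (localizationAt (blowUpChart S s) M) := ha
  have hspan : ∀ z, VanishesAt z (localizationAt (blowUpChart S s) M) →
      ∃ x ∈ localizationAt (blowUpChart S s) M, ∃ y ∈ localizationAt (blowUpChart S s) M,
        z = s * x + (t / s - cst a) * y := by
    intro z hz
    obtain ⟨p, q, hp, hq, rfl⟩ := vanishesAt_localizationAt.mp hz
    obtain ⟨P, w, hw, hpw⟩ := h.exists_poly (fun x => h.exists_hasValueAt hf) p.2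
    obtain ⟨Q, hQ⟩ := exists_eval_sub P a
    have hPQ : aeval (t / s) P = cst (P.eval a) + (t / s - cst a) * aeval (t / s) Q := by
      have := congrArg (aeval (t / s)) hQ
      simp only [map_sub, map_mul, aeval_C, aeval_X] at this
      linear_combination this
    have hQR := aeval_mem_of_mem (hle h.div_mem_chart) Q
    have hP0 : P.eval a = 0 := by
      have h1 : VanishesAt (p : PlaneField) (localizationAt (blowUpChart S s) M) :=
        vanishesAt_localizationAt_coe.mpr hp
      refine (hasValueAt_const (R := localizationAt (blowUpChart S s) M) (P.eval a)).eq
        (VanishesAt.hasValueAt ?_)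
      have h2 := (h1.sub (hsR.mul_right (hle hw))).sub (hτR.mul_right hQR)
      convert h2 using 1
      rw [hpw, hPQ]
      ring
    rw [hP0, cst_zero, zero_add] at hPQ
    have hq' : (q : PlaneField)⁻¹ ∈ localizationAt (blowUpChart S s) M :=
      ⟨1, q, hq, by simp⟩
    refine ⟨w * (q : PlaneField)⁻¹, Subalgebra.mul_mem _ (hle hw) hq',
      aeval (t / s) Q * (q : PlaneField)⁻¹, Subalgebra.mul_mem _ hQR hq', ?_⟩
    rw [hpw, hPQ, div_eq_mul_inv]
    ring
  generalize localizationAt (blowUpChart S s) M = R at *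
  subst hR
  have hm : Ideal.span {(⟨s, hsR.mem⟩ : Pt u v), ⟨t / s - cst a, hτR.mem⟩} = maxIdeal (Pt u v) := by
    refine le_antisymm ?_ fun z hz => ?_
    · rw [Ideal.span_le]
      rintro w (rfl | rfl)
      exacts [hsR.2, hτR.2]
    · obtain ⟨x, hx, y, hy, e⟩ := hspan z ⟨z.2, hz⟩
      exact Ideal.mem_span_pair.mpr ⟨⟨x, hx⟩, ⟨y, hy⟩, Subtype.ext (by
        rw [e]
        change x * s + y * (t / s - cst a) = _
        ring)⟩
  obtain ⟨δ, hδ, hδ0, hδ', hj⟩ := huv.exists_jacobian_eq _ _ hm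
  change jacobian s (t / s - cst a) = _ at hj
  rw [jacobian_sub_cst_right, jacobian_div_self_right hs0] at hj
  have e : f * jacobian s t ^ 2 / s ^ 2 = δ ^ 2 * (f * jacobian u v ^ 2) := by
    rw [mul_div_assoc, ← div_pow, hj]
    ring
  rw [e]
  exact ⟨mul_ne_zero (pow_ne_zero 2 hδ0) hu.1,
    Subalgebra.mul_mem _ (Subalgebra.pow_mem _ hδ 2) hu.2.1, by
      rw [mul_inv, ← inv_pow]
      exact Subalgebra.mul_mem _ (Subalgebra.pow_mem _ hδ' 2) hu.2.2⟩

lemma exists_value (h : IsParameters S s t) (hf : IsNonvanishingOn f S) :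
    ∃ c : ℂ, c ≠ 0 ∧ ∀ R : Subalgebra ℂ PlaneField, IsLocalRing R → blowUpChart S s ≤ R →
      VanishesAt s R → HasValueAt (f * jacobian s t ^ 2 / s ^ 2) c R := by
  have hs0 := h.fst_ne_zero
  set g := f * jacobian s t ^ 2 / s ^ 2 with hg
  let σ : blowUpChart S s := ⟨s, h.mem_chart h.vanishesAt_fst.mem⟩
  let J : Ideal (blowUpChart S s) :=
    { carrier := {q | (q : PlaneField) * g ∈ blowUpChart S s}
      add_mem' := fun {p q} hp hq => by
        change ((p : PlaneField) + q) * g ∈ blowUpChart S s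
        rw [add_mul]; exact Subalgebra.add_mem _ hp hq
      zero_mem' := by
        change (0 : PlaneField) * g ∈ blowUpChart S s
        rw [zero_mul]; exact Subalgebra.zero_mem _
      smul_mem' := fun p q hq => by
        change ((p : PlaneField) * q) * g ∈ blowUpChart S s
        rw [mul_assoc]; exact Subalgebra.mul_mem _ p.2 hq }
  have hJ : J ⊔ Ideal.span {σ} = ⊤ := by
    by_contra hne
    obtain ⟨M, hM, hle⟩ := Ideal.exists_le_maximal _ hne
    have hσ : σ ∈ M := hle (Ideal.mem_sup_right (Ideal.mem_span_singleton_self σ))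
    obtain ⟨-, ⟨x, y, hy, hxy⟩, -⟩ := h.isUnitAt hf hσ
    refine hy (hle (Ideal.mem_sup_left ?_))
    change (y : PlaneField) * g ∈ blowUpChart S s
    rw [hg, hxy, mul_div_cancel₀ _ (coe_ne_zero_of_notMem hy)]
    exact x.2
  obtain ⟨q, hq, r, hr, hqr⟩ := Submodule.mem_sup.mp ((Ideal.eq_top_iff_one _).mp hJ)
  obtain ⟨w, rfl⟩ := Ideal.mem_span_singleton'.mp hr
  have hqr' : (q : PlaneField) + w * s = 1 := congrArg Subtype.val hqr
  obtain ⟨P, y, hy, hP⟩ := h.exists_poly (fun x => h.exists_hasValueAt hf) hq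
  have hval : ∀ R : Subalgebra ℂ PlaneField, IsLocalRing R → blowUpChart S s ≤ R →
      VanishesAt s R → ∃ z, HasValueAt z 1 R ∧ VanishesAt (z * g - aeval (t / s) P) R := by
    intro R _ hle hsR
    refine ⟨q, ((hasValueAt_one.sub (hsR.mul_left (hle w.2)).hasValueAt).congr
      (by linear_combination -hqr') (sub_zero 1)), ?_⟩
    rw [hP, add_sub_cancel_left]
    exact hsR.mul_right (hle hy)
  have hroot : ∀ a, P.eval a ≠ 0 := fun a h0 => by
    obtain ⟨M, hM, hσ, ha⟩ := h.exists_maximalIdeal a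
    obtain ⟨hg0, hg, hg'⟩ := h.isUnitAt hf hσ
    obtain ⟨z, hz, hzg⟩ := hval (localizationAt _ M) inferInstance (le_localizationAt _ M)
      (vanishesAt_localizationAt_coe.mpr hσ)
    have h1 := (hasValueAt_aeval_poly ha P).vanishesAt_of_eq rfl h0
    have h2 := hzg.add h1
    rw [sub_add_cancel] at h2
    rcases (vanishesAt_mul_iff hz.mem hg).mp h2 with h3 | h3
    exacts [hz.not_vanishesAt one_ne_zero h3, not_vanishesAt_of_inv_mem hg0 hg' h3]
  obtain ⟨c, hc⟩ : ∃ c, P = C c := by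
    refine ⟨P.coeff 0, eq_C_of_degree_eq_zero ?_⟩
    by_contra hdeg
    obtain ⟨a, ha⟩ := IsAlgClosed.exists_root P hdeg
    exact hroot a ha
  subst hc
  refine ⟨c, by simpa using hroot 0, fun R hRl hle hsR => ?_⟩
  obtain ⟨z, hz, hzg⟩ := hval R hRl hle hsR
  rw [aeval_C] at hzg
  have h1 : HasValueAt (z * g) c R := hzg
  exact (h1.div hz one_ne_zero).congr (mul_div_cancel_left₀ g (hz.ne_zero one_ne_zero)) (div_one c)

lemma not_isNonvanishingOn (h : IsParameters S s t) : ¬ IsNonvanishingOn f S := by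
  intro hf
  have hs0 := h.fst_ne_zero
  have ht0 := h.snd_ne_zero
  obtain ⟨c, hc, H⟩ := h.exists_value hf
  obtain ⟨d, hd, H'⟩ := h.symm.exists_value hf
  have key : ∀ a : ℂ, a ≠ 0 → c = d * a ^ 2 := fun a ha => by
    obtain ⟨R, -, hRl, hle, hsR, hT⟩ := h.exists_exceptionalPoint a
    have hSR : S ≤ R := fun z hz => hle (h.mem_chart hz)
    have hT' := hT.inv ha
    rw [inv_div] at hT'
    have htR : VanishesAt t R := by
      have := hsR.mul_left hT.mem
      rwa [div_mul_cancel₀ _ hs0] at this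
    have h1 := H R hRl hle hsR
    have h2 := (H' R hRl (h.symm.chart_le hSR hT'.mem) htR).mul (hT.pow 2)
    refine h1.eq (h2.congr ?_ rfl)
    rw [jacobian_swap]
    field_simp
  have h1 := key 1 one_ne_zero
  have h2 := key 2 two_ne_zero
  apply hd
  linear_combination (h1 - h2) / 3

end IsParameters

lemma not_isExceptionalCurve_of_fibre {b : ℂ} (hb : b ≠ 0) {C : Set (Subalgebra ℂ PlaneField)}
    (hC : IsExceptionalCurve (exampleSurface b) C) :
    ¬ (∃ c : ℂ, ∀ R ∈ C, VanishesAt (pencil b - algebraMap ℂ PlaneField c) R) ∧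
      ¬ (∀ R ∈ C, VanishesAt (pencil b)⁻¹ R) := by
  obtain ⟨S, hS, hdim, -, rfl, hX⟩ := hC
  obtain ⟨s, t, h⟩ := exists_isParameters hS hdim
  constructor
  · rintro ⟨c, hc⟩
    refine h.not_isNonvanishingOn (f := f₀) ⟨fun R hR => ?_⟩
    obtain ⟨u, v, huv, rfl, hk | hk⟩ := exists_isLocalForm hb (hX hR)
    · exact ⟨u, v, huv, rfl, hk.2⟩
    · have h1 : HasValueAt (pencil b) c (Pt u v) := hc _ hR
      exact absurd h1.mem (hk.pencil_notMem huv)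
  · intro hc
    refine h.not_isNonvanishingOn (f := f₁ b) ⟨fun R hR => ?_⟩
    obtain ⟨u, v, huv, rfl, hk | hk⟩ := exists_isLocalForm hb (hX hR)
    · have := huv.isLocalRing
      refine absurd hk.1 ?_
      have := (hc _ hR).inv_notMem (inv_ne_zero (pencil_ne_zero hb))
      rwa [inv_inv] at this
    · exact ⟨u, v, huv, rfl, hk.2.2⟩

end Minimality

section

open Filter

section PhiFormulas

variable {F : Type*} [CommRing F]

def phiP (i b x y : F) : F := -i * x * (x + 1) + y * (b * x + 1)

def phiQ (i b x y : F) : F := x * (x - b) + i * b * y * (x - 1)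

def phiR (i b x y : F) : F := x * (x + 1) + i * b * y * (x - 1)

def phiS (i x y : F) : F := x * (x + 1) - i * y * (x - 1)

/-- The first factor of `f₁`. -/
def factorA (i b x y : F) : F :=
  i * x * (x + 1) ^ 2 - i * (x + i) * (x ^ 2 - 1) * y + b * (x - 1) ^ 2 * y ^ 2

/-- The second factor of `f₁`. -/
def factorB (i b x y : F) : F := -i * x * (y - 1) + y * (b * y - 1)

def phiSqNum (i b x y : F) : F :=
  -(phiP i b x y * (i * x - y) + i * y * phiQ i b x y * (i * x - b * y))

def phiSqDen (i b x y : F) : F :=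
  i * y * phiQ i b x y * (i * x - b * y) - b * phiP i b x y * (i * x - y)

/-- On the curve `factorB = 0`, the square of `φ` acts on `y` as the involution with graph
`involutionForm = 0`. -/
def involutionForm (i b y w : F) : F := 2 * b * y * w - (1 - i) * (b + i) * (y + w) + 2

/-- The cofactor of `factorB` in the pullback of `involutionForm` to the graph of `φ²`. -/
def involutionCofactor (i b x y : F) : F :=
  (2 * b) * x ^ 5 * y + ((-1 + i) * b + (-1 - i)) * x ^ 5 + (4 * i * b ^ 2 + (1 + i) * b + (-1 +
    i)) * x ^ 4 * y ^ 2 + ((-3 - i) * b ^ 2 + 4 * b + (-1 - i)) * x ^ 4 * y + ((-2 + 2 * i) * b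
    + (-2 - 2 * i)) * x ^ 4 + (-2 * b ^ 3 + (-2 + 2 * i) * b ^ 2 + (-2 - 2 * i) * b) * x ^ 3 * y
    ^ 3 + (-2 * i * b ^ 3 - 4 * b ^ 2 + (3 - i) * b + (-1 - i)) * x ^ 3 * y ^ 2 + ((-3 - 3 * i)
    * b ^ 2 - 2 * i * b + (1 - 3 * i)) * x ^ 3 * y + ((-1 + i) * b + (-1 - i)) * x ^ 3 + ((-1 -
    i) * b ^ 3 + (1 - i) * b ^ 2) * x ^ 2 * y ^ 4 + ((3 - 3 * i) * b ^ 3 + 2 * b ^ 2 + (3 + i) *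
    b) * x ^ 2 * y ^ 3 + (2 * b ^ 3 - 4 * i * b ^ 2 + (1 + 3 * i) * b + (1 - i)) * x ^ 2 * y ^ 2
    + (-2 * i * b ^ 2 + (-2 - 2 * i) * b + (2 - 2 * i)) * x ^ 2 * y + ((2 + 2 * i) * b ^ 3 + (-2
    + 2 * i) * b ^ 2) * x * y ^ 4 + ((-1 + 3 * i) * b ^ 3 - 4 * i * b ^ 2 + (-1 + i) * b) * x *
    y ^ 3 + (4 * b ^ 2 + (1 - i) * b + (1 + i)) * x * y ^ 2 + ((-1 - i) * b ^ 3 + (1 - i) * b ^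
    2) * y ^ 4 + (2 * i * b ^ 2) * y ^ 3

end PhiFormulas

section PhiIdentities

variable {F : Type*} [Field F] {i b x y X Y : F}

lemma phi_add_one (hy : y ≠ 0) (hQ : phiQ i b x y ≠ 0) (hi : i ^ 2 = -1)
    (hX : X = x * phiP i b x y / (y * phiQ i b x y)) :
    X + 1 = -(phiR i b x y * (i * x - y)) / (y * phiQ i b x y) := by
  rw [hX, eq_div_iff (mul_ne_zero hy hQ), add_mul, div_mul_cancel₀ _ (mul_ne_zero hy hQ)]
  unfold phiP phiQ phiR
  grind

lemma phi_sub_one (hy : y ≠ 0) (hQ : phiQ i b x y ≠ 0) (hi : i ^ 2 = -1)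
    (hX : X = x * phiP i b x y / (y * phiQ i b x y)) :
    X - 1 = -(phiS i x y * (i * x - b * y)) / (y * phiQ i b x y) := by
  rw [hX, eq_div_iff (mul_ne_zero hy hQ), sub_mul, div_mul_cancel₀ _ (mul_ne_zero hy hQ)]
  unfold phiP phiQ phiS
  grind

lemma factorA_eq (hi : i ^ 2 = -1) : factorA i b x y =
    i * (x + 1) * phiS i x y - i * y * phiR i b x y * (x - 1) := by
  unfold factorA phiS phiR
  grind

lemma phiR_sub_phiS (hi : i ^ 2 = -1) :
    x * phiR i b x y - b * phiS i x y = phiQ i b x y * (x + 1) ∧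
      x * phiR i b x y - phiS i x y = i * phiP i b x y * (x - 1) := by
  unfold phiR phiS phiQ phiP
  constructor <;> grind

lemma factorB_mul (hi : i ^ 2 = -1) :
    factorB i b x y * phiP i b x y * phiQ i b x y =
      i * b * phiP i b x y * (i * x - y) ^ 2
        - i * (x * phiP i b x y + i * (y * phiQ i b x y)) * (i * x - y) * (i * x - b * y)
        + x * (i * x - b * y) ^ 2 * (y * phiQ i b x y) := by
  unfold phiP phiQ factorB
  grind

lemma factorA_phi (hb : b ≠ 0) (hy : y ≠ 0) (hQ : phiQ i b x y ≠ 0) (hS : phiS i x y ≠ 0)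
    (hi : i ^ 2 = -1) (hX : X = x * phiP i b x y / (y * phiQ i b x y))
    (hY : Y = x * phiR i b x y / (b * phiS i x y)) : factorA i b X Y =
    factorB i b x y * x * phiP i b x y * phiR i b x y ^ 2 / (b * y ^ 3 * phiQ i b x y ^ 2) := by
  have e : factorA i b X Y =
      i * X * (X + 1) ^ 2 - i * (X + i) * ((X + 1) * (X - 1)) * Y + b * (X - 1) ^ 2 * Y ^ 2 := by
    unfold factorA; ring
  rw [e, phi_add_one hy hQ hi hX, phi_sub_one hy hQ hi hX, hX, hY]
  field_simp
  linear_combination (-x * phiR i b x y ^ 2) * factorB_mul (b := b) (x := x) (y := y) hi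

lemma factorB_phi (hb : b ≠ 0) (hy : y ≠ 0) (hQ : phiQ i b x y ≠ 0) (hS : phiS i x y ≠ 0)
    (hi : i ^ 2 = -1) (hX : X = x * phiP i b x y / (y * phiQ i b x y))
    (hY : Y = x * phiR i b x y / (b * phiS i x y)) : factorB i b X Y =
    -(x * phiP i b x y * factorA i b x y) / (b * y * phiS i x y ^ 2) := by
  obtain ⟨h1, h2⟩ := phiR_sub_phiS (b := b) (x := x) (y := y) hi
  have e1 : Y - 1 = phiQ i b x y * (x + 1) / (b * phiS i x y) := by
    rw [← h1, hY]; field_simp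
  have e2 : b * Y - 1 = i * phiP i b x y * (x - 1) / phiS i x y := by
    rw [← h2, hY]; field_simp
  unfold factorB
  rw [e1, e2, hX, hY, factorA_eq hi]
  field_simp
  ring

/-- `φ` exchanges the two factors of `f₁` and changes the sign of `f₁ / f₀`. -/
lemma factors_phi (hb : b ≠ 0) (hx : x ≠ 0) (hy : y ≠ 0) (hP : phiP i b x y ≠ 0)
    (hQ : phiQ i b x y ≠ 0) (hR : phiR i b x y ≠ 0) (hS : phiS i x y ≠ 0)
    (hi : i ^ 2 = -1) (hX : X = x * phiP i b x y / (y * phiQ i b x y))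
    (hY : Y = x * phiR i b x y / (b * phiS i x y)) :
    factorA i b X Y * factorB i b X Y / (X ^ 2 * Y ^ 2) =
      -(factorA i b x y * factorB i b x y / (x ^ 2 * y ^ 2)) := by
  rw [factorA_phi hb hy hQ hS hi hX hY, factorB_phi hb hy hQ hS hi hX hY, hX, hY]
  field_simp

lemma phiSq_snd (hb : b ≠ 0) (hx : x ≠ 0) (hy : y ≠ 0) (hQ : phiQ i b x y ≠ 0)
    (hR : phiR i b x y ≠ 0) (hS : phiS i x y ≠ 0) (hD : phiSqDen i b x y ≠ 0)
    (hi : i ^ 2 = -1) (hX : X = x * phiP i b x y / (y * phiQ i b x y))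
    (hY : Y = x * phiR i b x y / (b * phiS i x y)) :
    X * phiR i b X Y / (b * phiS i X Y) =
      x * phiP i b x y * phiSqNum i b x y / (y * phiQ i b x y * phiSqDen i b x y) := by
  have h1 := phi_add_one hy hQ hi hX
  have h2 := phi_sub_one hy hQ hi hX
  have e1 : phiR i b X Y = x * phiR i b x y * phiSqNum i b x y / (y * phiQ i b x y) ^ 2 := by
    unfold phiSqNum
    rw [phiR, h1, h2, hX, hY]
    field_simp
    ring
  have e2 : phiS i X Y = x * phiR i b x y * phiSqDen i b x y / (b * (y * phiQ i b x y) ^ 2) := by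
    unfold phiSqDen
    rw [phiS, h1, h2, hX, hY]
    field_simp
    ring
  rw [e1, e2, hX]
  field_simp

set_option maxRecDepth 20000 in
lemma involutionForm_phiSq (hi : i ^ 2 = -1) (hy : y ≠ 0) (hQ : phiQ i b x y ≠ 0)
    (hD : phiSqDen i b x y ≠ 0) :
    involutionForm i b y (x * phiP i b x y * phiSqNum i b x y / (y * phiQ i b x y * phiSqDen i b x y)) =
      factorB i b x y * involutionCofactor i b x y / (y * phiQ i b x y * phiSqDen i b x y) := by
  have key : 2 * b * y * (x * phiP i b x y * phiSqNum i b x y)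
      - (1 - i) * (b + i) * (y * (y * phiQ i b x y * phiSqDen i b x y)
        + x * phiP i b x y * phiSqNum i b x y) + 2 * (y * phiQ i b x y * phiSqDen i b x y) =
      factorB i b x y * involutionCofactor i b x y := by
    clear hy hQ hD
    unfold phiSqNum phiSqDen phiP phiQ factorB involutionCofactor
    grind
  unfold involutionForm
  rw [← key]
  field_simp

end PhiIdentities

end

section

open Filter

section BranchCurve

variable {F : Type*} [Field F] {i b r : F}

/-- The parametrization of the curve `factorB = 0` by `r = x / y`. -/
def curveX (i b r : F) : F := r * (1 - i * r) / (b - i * r)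

def curveY (i b r : F) : F := (1 - i * r) / (b - i * r)

/-- The involution induced by `φ²` on the curve `factorB = 0`. -/
def curveInv (i b r : F) : F := ((i - b) * r - (1 + i) * b) / ((-1 - i) * r + b - i)

def quadA (i b r : F) : F := -i * r ^ 2 + (1 - i) * r - b

def quadB (i b r : F) : F := -i * r ^ 2 + (-1 - i) * r + b

def quadC (i b r : F) : F := (1 - i) * r ^ 2 + 2 * (i * b + 1) * r - (1 - i) * b

def curveValue (i b r : F) : F :=
  ((1 - b) * r ^ 2 + (2 * (1 - i) - 2 * (1 + i) * b) * r + b ^ 2 - b) /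
    (2 * i * (r - b) * (b - i * r) * (b + 1))

structure IsGenericParam (i b r : F) : Prop where
  zero : r ≠ 0
  sub_b : r - b ≠ 0
  one_sub : 1 - i * r ≠ 0
  b_sub : b - i * r ≠ 0
  invDen : (-1 - i) * r + b - i ≠ 0
  quadA : quadA i b r ≠ 0
  quadB : quadB i b r ≠ 0
  quadC : quadC i b r ≠ 0

lemma phi_curve (hi : i ^ 2 = -1) (hB : b - i * r ≠ 0) :
    phiP i b (curveX i b r) (curveY i b r) = (r + 1) * (1 - i * r) ^ 2 / (b - i * r) ∧
    phiQ i b (curveX i b r) (curveY i b r) = i * (r - b) * (1 - i * r) ^ 2 / (b - i * r) ∧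
    phiR i b (curveX i b r) (curveY i b r) = i * (1 - i * r) * quadA i b r / (b - i * r) ∧
    phiS i (curveX i b r) (curveY i b r) =
      i * (1 - i * r) ^ 2 * quadB i b r / (b - i * r) ^ 2 := by
  unfold phiP phiQ phiR phiS curveX curveY quadA quadB
  generalize hD : b - i * r = D at *
  refine ⟨?_, ?_, ?_, ?_⟩ <;> field_simp <;> clear hB <;> subst hD <;> grind

lemma phi_curve_image (hi : i ^ 2 = -1) (hb : b ≠ 0) (h : IsGenericParam i b r) :
    phiP i b (-i * r * (r + 1) / (r - b)) (r * quadA i b r / (b * quadB i b r)) =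
      -i * r ^ 2 * (b + 1) * quadA i b r * ((i - b) * r - (1 + i) * b) /
        ((r - b) ^ 2 * b * quadB i b r) ∧
    phiQ i b (-i * r * (r + 1) / (r - b)) (r * quadA i b r / (b * quadB i b r)) =
      -i * r ^ 2 * (b + 1) * ((-1 - i) * r + b - i) / (r - b) ^ 2 ∧
    phiR i b (-i * r * (r + 1) / (r - b)) (r * quadA i b r / (b * quadB i b r)) =
      -i * r * (b + 1) * quadA i b r / (r - b) ^ 2 ∧
    phiS i (-i * r * (r + 1) / (r - b)) (r * quadA i b r / (b * quadB i b r)) =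
      -i * r ^ 2 * (b + 1) * quadA i b r / ((r - b) ^ 2 * b) := by
  have e1 : -i * r * (r + 1) / (r - b) + 1 = quadA i b r / (r - b) := by
    have := h.sub_b
    unfold quadA; field_simp; ring
  have e2 : -i * r * (r + 1) / (r - b) - 1 = quadB i b r / (r - b) := by
    have := h.sub_b
    unfold quadB; field_simp; ring
  have h1 := h.sub_b
  have h2 := h.quadB
  have hA : quadA i b r = -i * r * (r + 1) + (r - b) := by unfold quadA; ring
  have hB : quadB i b r = -i * r * (r + 1) - (r - b) := by unfold quadB; ring
  refine ⟨?_, ?_, ?_, ?_⟩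
  · unfold phiP
    rw [e1]
    field_simp
    rw [hB]
    clear hA hB e1 e2 h h1 h2
    grind
  · unfold phiQ
    rw [e2]
    field_simp
    rw [hA]
    clear hA hB e1 e2 h h1 h2
    grind
  · unfold phiR
    rw [e1, e2]
    field_simp
    clear hA hB e1 e2 h h1 h2
    grind
  · unfold phiS
    rw [e1, e2]
    field_simp
    clear hA hB e1 e2 h h1 h2
    grind

lemma curveInv_factors (hi : i ^ 2 = -1) (hD : (-1 - i) * r + b - i ≠ 0) :
    curveInv i b r - b = (1 + b) * (i * r - b) / ((-1 - i) * r + b - i) ∧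
    b - i * curveInv i b r = (1 - b) * (r - b) / ((-1 - i) * r + b - i) ∧
    1 - i * curveInv i b r = i * (b - 1) * (r + 1) / ((-1 - i) * r + b - i) := by
  unfold curveInv
  generalize hE : (-1 - i) * r + b - i = E at *
  refine ⟨?_, ?_, ?_⟩ <;> field_simp <;> clear hD <;> subst hE <;> grind

lemma curveY_inv (hi : i ^ 2 = -1) (hb : b - 1 ≠ 0) (h : IsGenericParam i b r) :
    curveY i b (curveInv i b r) = -i * (r + 1) / (r - b) ∧
    curveX i b (curveInv i b r) = curveInv i b r * (-i * (r + 1) / (r - b)) := by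
  obtain ⟨-, h2, h3⟩ := curveInv_factors hi h.invDen
  have h1 := h.sub_b
  have h4 := h.invDen
  have h5 : 1 - b ≠ 0 := fun h0 => hb (by linear_combination -h0)
  have e : curveY i b (curveInv i b r) = -i * (r + 1) / (r - b) := by
    unfold curveY
    rw [h2, h3]
    clear h2 h3
    generalize (-1 - i) * r + b - i = E at *
    field_simp
    ring
  refine ⟨e, ?_⟩
  rw [← e]
  unfold curveX curveY
  ring

lemma phiSqDen_curve (hi : i ^ 2 = -1) (hB : b - i * r ≠ 0) :
    phiSqDen i b (curveX i b r) (curveY i b r) =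
      r * (1 - i * r) ^ 4 * (b + 1) / (b - i * r) ^ 2 := by
  obtain ⟨h1, h2, -, -⟩ := phi_curve hi hB
  unfold phiSqDen
  rw [h1, h2]
  unfold curveX curveY
  field_simp
  clear h1 h2 hB
  grind

lemma factorA_curve (hi : i ^ 2 = -1) (hB : b - i * r ≠ 0) :
    factorA i b (curveX i b r) (curveY i b r) =
      2 * r * (1 - i * r) ^ 2 * quadC i b r / (b - i * r) ^ 3 := by
  obtain ⟨-, -, h1, h2⟩ := phi_curve hi hB
  rw [factorA_eq hi, h1, h2]
  unfold curveX curveY quadA quadB quadC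
  field_simp
  clear h1 h2 hB
  grind

set_option maxRecDepth 20000 in
lemma involutionCofactor_curve (hi : i ^ 2 = -1) (hB : b - i * r ≠ 0) :
    involutionCofactor i b (curveX i b r) (curveY i b r) =
      (1 - i * r) ^ 5 * quadC i b r *
        ((1 - b) * r ^ 2 + (2 * (1 - i) - 2 * (1 + i) * b) * r + b ^ 2 - b) / (b - i * r) ^ 4 := by
  unfold involutionCofactor curveX curveY quadC
  generalize hD : b - i * r = D at *
  field_simp
  clear hB
  subst hD
  grind

lemma curveValue_inv_sub (hi : i ^ 2 = -1) (h2 : (2 : F) ≠ 0) (hb1 : b + 1 ≠ 0) (hb2 : b - 1 ≠ 0)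
    (h : IsGenericParam i b r) : curveValue i b (curveInv i b r) - curveValue i b r =
      -(1 + i) * quadC i b r / ((b + 1) * (b - 1) * (r - b) * (b - i * r)) := by
  obtain ⟨e1, e2, -⟩ := curveInv_factors hi h.invDen
  have h1 := h.sub_b
  have h3 := h.b_sub
  have h4 := h.invDen
  have h5 : 1 - b ≠ 0 := fun h0 => hb2 (by linear_combination -h0)
  have h6 : i * r - b ≠ 0 := fun h0 => h3 (by linear_combination -h0)
  have h7 : 1 + b ≠ 0 := by rwa [add_comm]
  have h8 : i ≠ 0 := by rintro rfl; simp at hi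
  unfold curveValue
  rw [e1, e2]
  unfold curveInv quadC
  rw [show i * r - b = -(b - i * r) by ring, show 1 - b = -(b - 1) by ring, add_comm 1 b]
  clear e1 e2 h h5 h6 h7
  generalize hE : (-1 - i) * r + b - i = E at *
  generalize hD : b - i * r = D at *
  generalize hG : r - b = G at *
  field_simp
  clear h1 h3 h4 h8 h2 hb1 hb2
  subst hE hD hG
  grind

lemma curveInv_curveInv (h : IsGenericParam i b r)
    (h' : (-1 - i) * curveInv i b r + b - i ≠ 0) : curveInv i b (curveInv i b r) = r := by
  rw [curveInv, div_eq_iff h']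
  have h4 := h.invDen
  clear h' h
  unfold curveInv
  generalize hE : (-1 - i) * r + b - i = E at *
  field_simp
  clear h4
  subst hE
  grind

lemma curveInv_injOn (hi : i ^ 2 = -1) (hb1 : b + 1 ≠ 0) (hb2 : b - 1 ≠ 0) :
    Set.InjOn (curveInv i b) {r | (-1 - i) * r + b - i ≠ 0} := by
  intro r hr s hs h
  have hr' : (-1 - i) * r + b - i ≠ 0 := hr
  have hs' : (-1 - i) * s + b - i ≠ 0 := hs
  unfold curveInv at h
  rw [div_eq_div_iff hr' hs'] at h
  have h1 : (b + 1) * (b - 1) * (r - s) = 0 := by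
    clear hr hs hr' hs' hb1 hb2
    grind
  have := (mul_eq_zero.mp h1).resolve_left (mul_ne_zero hb1 hb2)
  exact sub_eq_zero.mp this

end BranchCurve

open Polynomial in
lemma finite_quadratic_eq_zero {α β γ : ℂ} (h : α ≠ 0 ∨ β ≠ 0 ∨ γ ≠ 0) :
    {r : ℂ | α * r ^ 2 + β * r + γ = 0}.Finite := by
  have hp : (C α * X ^ 2 + C β * X + C γ : ℂ[X]) ≠ 0 := by
    intro h0
    have h1 := congrArg (fun p => coeff p 0) h0
    have h2 := congrArg (fun p => coeff p 1) h0
    have h3 := congrArg (fun p => coeff p 2) h0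
    simp [coeff_X, coeff_C] at h1 h2 h3
    rcases h with h | h | h
    exacts [h h3, h h2, h h1]
  refine (finite_setOfPred_isRoot hp).subset fun r hr => ?_
  simpa [IsRoot] using hr

lemma finite_not_isGenericParam (b : ℂ) :
    {r : ℂ | ¬ IsGenericParam I b r}.Finite := by
  have hI := I_ne_zero
  have h1 : (1 : ℂ) - I ≠ 0 := fun h => by simpa using congrArg Complex.re h
  have h2 : (-1 : ℂ) - I ≠ 0 := fun h => by simpa using congrArg Complex.re h
  have key := fun {α β γ : ℂ} (h : α ≠ 0 ∨ β ≠ 0 ∨ γ ≠ 0) {f : ℂ → ℂ}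
    (hf : ∀ r, f r = α * r ^ 2 + β * r + γ) =>
    show ∀ᶠ r in cofinite, f r ≠ 0 by
      simpa [Filter.eventually_cofinite, hf] using finite_quadratic_eq_zero h
  have k1 := key (α := 0) (β := 1) (γ := 0) (by simp) (f := fun r => r) (by intro r; ring)
  have k3 := key (α := 0) (β := 1) (γ := -b) (by simp) (f := fun r => r - b) (by intro r; ring)
  have k4 := key (α := 0) (β := -I) (γ := 1) (by simp) (f := fun r => 1 - I * r)
    (by intro r; ring)
  have k5 := key (α := 0) (β := -I) (γ := b) (by simp) (f := fun r => b - I * r)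
    (by intro r; ring)
  have k7 := key (α := 0) (β := -1 - I) (γ := b - I) (.inr (.inl h2))
    (f := fun r => (-1 - I) * r + b - I) (by intro r; ring)
  have k8 := key (α := -I) (β := 1 - I) (γ := -b) (by simp)
    (f := quadA I b) (by intro r; unfold quadA; ring)
  have k9 := key (α := -I) (β := -1 - I) (γ := b) (by simp)
    (f := quadB I b) (by intro r; unfold quadB; ring)
  have k10 := key (α := 1 - I) (β := 2 * (I * b + 1)) (γ := -((1 - I) * b))
    (.inl h1) (f := quadC I b) (by intro r; unfold quadC; ring)
  rw [← Set.compl_ofPred, ← Filter.mem_cofinite]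
  filter_upwards [k1, k3, k4, k5, k7, k8, k9, k10] with r a1 a2 a3 a4 a5 a6 a7 a8
  exact ⟨a1, a2, a3, a4, a5, a6, a7, a8⟩

lemma exists_isGenericParam {b : ℂ} (hb1 : b + 1 ≠ 0) (hb2 : b - 1 ≠ 0) :
    ∃ r, IsGenericParam I b r ∧ IsGenericParam I b (curveInv I b r) := by
  have h1 := finite_not_isGenericParam b
  have h4 : ({r | (-1 - I) * r + b - I ≠ 0} ∩
      curveInv I b ⁻¹' {r : ℂ | ¬ IsGenericParam I b r}).Finite :=
    Set.Finite.of_injOn (f := curveInv I b) (fun r hr => hr.2) ((curveInv_injOn I_sq hb1 hb2).mono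
      Set.inter_subset_left) h1
  obtain ⟨r, hr⟩ := (h1.union h4).infinite_compl.nonempty
  simp only [Set.mem_compl_iff, Set.mem_union, not_or] at hr
  have hr1 : IsGenericParam I b r := not_not.mp hr.1
  exact ⟨r, hr1, not_not.mp fun h => hr.2 ⟨hr1.invDen, h⟩⟩

end

section

variable {b r : ℂ} {z : PlaneField} {c : ℂ}

section Values

variable {R : Subalgebra ℂ PlaneField} {x₀ y₀ : ℂ} (hx : HasValueAt xc x₀ R) (hy : HasValueAt yc y₀ R)
include hx hy

lemma hasValueAt_phi (b : ℂ) :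
    HasValueAt (phiP (cst I) (cst b) xc yc) (phiP I b x₀ y₀) R ∧
    HasValueAt (phiQ (cst I) (cst b) xc yc) (phiQ I b x₀ y₀) R ∧
    HasValueAt (phiR (cst I) (cst b) xc yc) (phiR I b x₀ y₀) R ∧
    HasValueAt (phiS (cst I) xc yc) (phiS I x₀ y₀) R := by
  have hI := hasValueAt_const (R := R) I
  have hb := hasValueAt_const (R := R) b
  have h1 := hasValueAt_one (R := R)
  exact ⟨((hI.neg.mul hx).mul (hx.add h1)).add (hy.mul ((hb.mul hx).add h1)),
    (hx.mul (hx.sub hb)).add (((hI.mul hb).mul hy).mul (hx.sub h1)),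
    (hx.mul (hx.add h1)).add (((hI.mul hb).mul hy).mul (hx.sub h1)),
    (hx.mul (hx.add h1)).sub ((hI.mul hy).mul (hx.sub h1))⟩

lemma hasValueAt_phiSqDen (b : ℂ) : HasValueAt (phiSqDen (cst I) (cst b) xc yc)
    (phiSqDen I b x₀ y₀) R := by
  have hI := hasValueAt_const (R := R) I
  have hb := hasValueAt_const (R := R) b
  obtain ⟨hP, hQ, -, -⟩ := hasValueAt_phi hx hy b
  exact (((hI.mul hy).mul hQ).mul ((hI.mul hx).sub (hb.mul hy))).sub
    ((hb.mul hP).mul ((hI.mul hx).sub hy))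

lemma hasValueAt_factorA (b : ℂ) : HasValueAt (factorA (cst I) (cst b) xc yc)
    (factorA I b x₀ y₀) R := by
  have hI := hasValueAt_const (R := R) I
  obtain ⟨-, -, hR, hS⟩ := hasValueAt_phi hx hy b
  have h1 := hasValueAt_one (R := R)
  rw [factorA_eq cst_I_sq, factorA_eq I_sq]
  exact ((hI.mul (hx.add h1)).mul hS).sub (((hI.mul hy).mul hR).mul (hx.sub h1))

lemma hasValueAt_involutionCofactor (b : ℂ) :
    HasValueAt (involutionCofactor (cst I) (cst b) xc yc)
      (involutionCofactor I b x₀ y₀) R := by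
  have hI := hasValueAt_const (R := R) I
  have hb := hasValueAt_const (R := R) b
  have h1 := hasValueAt_one (R := R)
  have h2 : HasValueAt (2 : PlaneField) 2 R := (h1.add h1).congr (by norm_num) (by norm_num)
  have h3 : HasValueAt (3 : PlaneField) 3 R := (h2.add h1).congr (by norm_num) (by norm_num)
  have h4 : HasValueAt (4 : PlaneField) 4 R := (h3.add h1).congr (by norm_num) (by norm_num)
  unfold involutionCofactor
  repeat' with_reducible first
    | exact hx | exact hy | exact hI | exact hb | exact h1 | exact h2 | exact h3 | exact h4
    | refine HasValueAt.add ?_ ?_ | refine HasValueAt.sub ?_ ?_ | refine HasValueAt.mul ?_ ?_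
    | refine HasValueAt.neg ?_ | refine HasValueAt.pow ?_ _

end Values

/-- The local ring of the point `(x₀, y₀)` of the affine plane. -/
abbrev planePt (x₀ y₀ : ℂ) : Subalgebra ℂ PlaneField := Pt (xc - cst x₀) (yc - cst y₀)

instance isLocalRing_planePt (x₀ y₀ : ℂ) : IsLocalRing (planePt x₀ y₀) :=
  (isCoord_xc_yc.sub_const x₀ y₀).isLocalRing

lemma hasValueAt_planePt (x₀ y₀ : ℂ) :
    HasValueAt xc x₀ (planePt x₀ y₀) ∧ HasValueAt yc y₀ (planePt x₀ y₀) :=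
  ⟨(isCoord_xc_yc.sub_const x₀ y₀).vanishesAt_fst, (isCoord_xc_yc.sub_const x₀ y₀).vanishesAt_snd⟩

lemma HasValueAt.map_planePt {Φ : PlaneField ≃ₐ[ℂ] PlaneField} {x₀ y₀ x₁ y₁ : ℂ}
    (hX : HasValueAt (Φ xc) x₁ (planePt x₀ y₀)) (hY : HasValueAt (Φ yc) y₁ (planePt x₀ y₀))
    (h : HasValueAt z c (planePt x₁ y₁)) : HasValueAt (Φ z) c (planePt x₀ y₀) := by
  have hc := (isCoord_xc_yc.sub_const x₁ y₁).map Φ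
  have := hc.isLocalRing
  have h1 : VanishesAt (Φ (z - cst c)) (Pt (Φ (xc - cst x₁)) (Φ (yc - cst y₁))) := by
    obtain ⟨h1, h2⟩ := vanishesAt_iff.mp h.vanishesAt_sub_const
    rw [vanishesAt_iff, ← transport_Pt]
    refine ⟨(map_mem_transport _).mpr h1, fun h0 hi => h2 (fun h => h0 ?_) ?_⟩
    · exact (congrArg Φ h).trans (map_zero Φ)
    · rw [← map_inv₀] at hi
      exact (map_mem_transport _).mp hi
  have hcst : ∀ a, Φ (cst a) = cst a := fun a => Φ.commutes a
  have h2 := (hc.dominates (S := planePt x₀ y₀) (by rw [map_sub, hcst]; exact hX)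
    (by rw [map_sub, hcst]; exact hY)).2 _ h1
  rw [map_sub, hcst] at h2
  exact h2

variable {Φ : PlaneField ≃ₐ[ℂ] PlaneField}

lemma HasValueAt.map_phi (hb : b ≠ 0) (hΦ : Φ xc = phiX b ∧ Φ yc = phiY b) {x₀ y₀ x₁ y₁ : ℂ}
    (hy : y₀ ≠ 0) (hQ : phiQ I b x₀ y₀ ≠ 0) (hS : phiS I x₀ y₀ ≠ 0)
    (hx₁ : x₀ * phiP I b x₀ y₀ / (y₀ * phiQ I b x₀ y₀) = x₁)
    (hy₁ : x₀ * phiR I b x₀ y₀ / (b * phiS I x₀ y₀) = y₁)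
    (h : HasValueAt z c (planePt x₁ y₁)) : HasValueAt (Φ z) c (planePt x₀ y₀) := by
  obtain ⟨vx, vy⟩ := hasValueAt_planePt x₀ y₀
  obtain ⟨vP, vQ, vR, vS⟩ := hasValueAt_phi vx vy b
  subst hx₁ hy₁
  refine HasValueAt.map_planePt ?_ ?_ h
  · rw [hΦ.1]
    exact (vx.mul vP).div (vy.mul vQ) (mul_ne_zero hy hQ)
  · rw [hΦ.2]
    exact (vx.mul vR).div ((hasValueAt_const b).mul vS) (mul_ne_zero hb hS)

/-- The local ring of the point with parameter `r` on the curve `factorB = 0`. -/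
abbrev curvePt (b r : ℂ) : Subalgebra ℂ PlaneField :=
  planePt (curveX I b r) (curveY I b r)

lemma HasValueAt.map_phi_sq (hb : b ≠ 0) (hb1 : b + 1 ≠ 0) (hb2 : b - 1 ≠ 0)
    (hΦ : Φ xc = phiX b ∧ Φ yc = phiY b) (hr : IsGenericParam I b r)
    (h : HasValueAt z c (curvePt b (curveInv I b r))) :
    HasValueAt (Φ (Φ z)) c (curvePt b r) := by
  have hI := I_ne_zero
  obtain ⟨p1, p2, p3, p4⟩ := phi_curve (i := I) I_sq hr.b_sub
  obtain ⟨q1, q2, q3, q4⟩ := phi_curve_image (i := I) I_sq hb hr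
  obtain ⟨e2, e1⟩ := curveY_inv I_sq hb2 hr
  obtain ⟨g1, g3, g4, g5, g7, g8, g9, g10⟩ := hr
  refine HasValueAt.map_phi hb hΦ (x₁ := -I * r * (r + 1) / (r - b))
    (y₁ := r * quadA I b r / (b * quadB I b r)) ?_ ?_ ?_ ?_ ?_
    (HasValueAt.map_phi hb hΦ ?_ ?_ ?_ ?_ ?_ h)
  · exact div_ne_zero g4 g5
  · rw [p2]
    exact div_ne_zero (mul_ne_zero (mul_ne_zero hI g3) (pow_ne_zero 2 g4)) g5
  · rw [p4]
    exact div_ne_zero (mul_ne_zero (mul_ne_zero hI (pow_ne_zero 2 g4)) g9) (pow_ne_zero 2 g5)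
  · rw [p1, p2]
    unfold curveX curveY
    generalize b - I * r = D at *
    generalize 1 - I * r = E at *
    field_simp
    rw [I_sq]; ring
  · rw [p3, p4]
    unfold curveX
    generalize b - I * r = D at *
    generalize 1 - I * r = E at *
    field_simp
  · exact div_ne_zero (mul_ne_zero g1 g8) (mul_ne_zero hb g9)
  · rw [q2]
    exact div_ne_zero (mul_ne_zero (mul_ne_zero (mul_ne_zero (neg_ne_zero.mpr hI)
      (pow_ne_zero 2 g1)) hb1) g7) (pow_ne_zero 2 g3)
  · rw [q4]
    exact div_ne_zero (mul_ne_zero (mul_ne_zero (mul_ne_zero (neg_ne_zero.mpr hI)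
      (pow_ne_zero 2 g1)) hb1) g8) (mul_ne_zero (pow_ne_zero 2 g3) hb)
  · rw [q1, q2, e1]
    unfold curveInv
    generalize (-1 - I) * r + b - I = D at *
    field_simp
  · rw [q3, q4, e2]
    field_simp

lemma hasValueAt_cofactor (hb1 : b + 1 ≠ 0) (hr : IsGenericParam I b r) :
    HasValueAt (involutionCofactor (cst I) (cst b) xc yc * xc ^ 2 * yc /
      (factorA (cst I) (cst b) xc yc * phiQ (cst I) (cst b) xc yc *
        phiSqDen (cst I) (cst b) xc yc)) (curveValue I b r) (curvePt b r) := by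
  have hI := I_ne_zero
  obtain ⟨vx, vy⟩ := hasValueAt_planePt (curveX I b r) (curveY I b r)
  obtain ⟨-, p2, -, -⟩ := phi_curve (i := I) I_sq hr.b_sub
  have h1 := factorA_curve (i := I) I_sq hr.b_sub
  have h2 := phiSqDen_curve (i := I) I_sq hr.b_sub
  have h3 := involutionCofactor_curve (i := I) I_sq hr.b_sub
  obtain ⟨g1, g3, g4, g5, g7, g8, g9, g10⟩ := hr
  refine ((((hasValueAt_involutionCofactor vx vy b).mul (vx.pow 2)).mul vy).div
    (((hasValueAt_factorA vx vy b).mul (hasValueAt_phi vx vy b).2.1).mul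
      (hasValueAt_phiSqDen vx vy b)) ?_).congr rfl ?_
  · rw [h1, p2, h2]
    exact mul_ne_zero (mul_ne_zero
      (div_ne_zero (mul_ne_zero (mul_ne_zero (mul_ne_zero two_ne_zero g1) (pow_ne_zero 2 g4)) g10)
        (pow_ne_zero 3 g5))
      (div_ne_zero (mul_ne_zero (mul_ne_zero hI g3) (pow_ne_zero 2 g4)) g5))
      (div_ne_zero (mul_ne_zero (mul_ne_zero g1 (pow_ne_zero 4 g4)) hb1) (pow_ne_zero 2 g5))
  · rw [h1, p2, h2, h3]
    unfold curveX curveY curveValue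
    generalize b - I * r = D at *
    generalize 1 - I * r = E at *
    field_simp

/-- The group law in the direction transverse to the curve `factorB = 0`: `φ⁴` fixes the curve
pointwise, but not its first order neighbourhood. -/
lemma exists_phi_pow_four (hb : b ≠ 0) (hb1 : b + 1 ≠ 0) (hb2 : b - 1 ≠ 0)
    (hΦ : Φ xc = phiX b ∧ Φ yc = phiY b) (hk : Φ (pencil b) = -pencil b)
    (hr : IsGenericParam I b r)
    (hr' : IsGenericParam I b (curveInv I b r)) :
    ∃ (G : PlaneField) (β : ℂ), β ≠ 0 ∧ HasValueAt G β (curvePt b r) ∧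
      (Φ ^ 4) yc = yc + pencil b * G := by
  have hcst : ∀ a, Φ (cst a) = cst a := fun a => Φ.commutes a
  have hb' := cst_ne_zero hb
  obtain ⟨-, -, n1, n2, n3, n4⟩ := phi_denominators hb
  have hD : phiSqDen (cst I) (cst b) xc yc ≠ 0 := by
    obtain ⟨vx, vy⟩ := hasValueAt_planePt (curveX I b r) (curveY I b r)
    refine (hasValueAt_phiSqDen vx vy b).ne_zero ?_
    rw [phiSqDen_curve I_sq hr.b_sub]
    exact div_ne_zero (mul_ne_zero (mul_ne_zero hr.zero (pow_ne_zero 4 hr.one_sub)) hb1)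
      (pow_ne_zero 2 hr.b_sub)
  have hA : factorA (cst I) (cst b) xc yc ≠ 0 := by
    have := pencil_ne_zero hb
    contrapose! this
    change factorA (cst I) (cst b) xc yc * _ / _ = _
    rw [this, zero_mul, zero_div]
  set W := Φ (Φ yc) with hW
  set q := involutionCofactor (cst I) (cst b) xc yc * xc ^ 2 * yc /
      (factorA (cst I) (cst b) xc yc * phiQ (cst I) (cst b) xc yc *
        phiSqDen (cst I) (cst b) xc yc) with hq
  have e1 : involutionForm (cst I) (cst b) yc W = pencil b * q := by
    have e : W = phiX b * phiR (cst I) (cst b) (phiX b) (phiY b) /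
        (cst b * phiS (cst I) (phiX b) (phiY b)) := by
      rw [hW, hΦ.2]
      simp only [phiY, phiR, phiS, map_div₀, map_mul, map_add, map_sub, map_one, hcst, hΦ.1]
      rw [hΦ.2]
      rfl
    rw [e, phiSq_snd (x := xc) (y := yc) (X := phiX b) (Y := phiY b) hb' isCoord_xc_yc.fst_ne_zero isCoord_xc_yc.snd_ne_zero n2 n4 n3 hD cst_I_sq rfl rfl,
      involutionForm_phiSq cst_I_sq isCoord_xc_yc.snd_ne_zero n2 hD, hq]
    change _ = factorA (cst I) (cst b) xc yc * factorB (cst I) (cst b) xc yc /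
      (xc ^ 2 * yc ^ 2) * _
    have hx := isCoord_xc_yc.fst_ne_zero
    have hy := isCoord_xc_yc.snd_ne_zero
    have n2' : phiQ (cst I) (cst b) xc yc ≠ 0 := n2
    field_simp
  have h2 : Φ 2 = 2 := map_ofNat Φ 2
  have e2 : involutionForm (cst I) (cst b) W (Φ (Φ W)) = pencil b * Φ (Φ q) := by
    have := congrArg (fun z => Φ (Φ z)) e1
    simpa [involutionForm, hcst, hk, h2, ← hW] using this
  have vq := hasValueAt_cofactor hb1 hr
  have vq' := HasValueAt.map_phi_sq hb hb1 hb2 hΦ hr (hasValueAt_cofactor hb1 hr')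
  have vW : HasValueAt W _ (curvePt b r) := HasValueAt.map_phi_sq hb hb1 hb2 hΦ hr
    (hasValueAt_planePt (curveX I b (curveInv I b r)) _).2
  have v2 : HasValueAt (2 : PlaneField) 2 (curvePt b r) :=
    (hasValueAt_one.add hasValueAt_one).congr (by norm_num) (by norm_num)
  have hI' := hasValueAt_const (R := curvePt b r) I
  have hbv := hasValueAt_const (R := curvePt b r) b
  have vD := ((v2.mul hbv).mul vW).sub ((hasValueAt_one.sub hI').mul (hbv.add hI'))
  have h3 : 2 * b * curveY I b (curveInv I b r) -
      (1 - I) * (b + I) ≠ 0 := by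
    have h := hr.sub_b
    have e : 2 * b * (-I * (r + 1) / (r - b)) - (1 - I) * (b + I) =
        (1 - I) * (b - I * r) * (b + 1) / (r - b) := by
      field_simp
      linear_combination (-b - r * b) * I_sq
    have h1 : (1 : ℂ) - I ≠ 0 := fun h => by simpa using congrArg Complex.re h
    rw [(curveY_inv I_sq hb2 hr).1, e]
    exact div_ne_zero (mul_ne_zero (mul_ne_zero h1 hr.b_sub) hb1) h
  refine ⟨_, _, ?_, (vq'.sub vq).div vD h3, ?_⟩
  · refine div_ne_zero ?_ h3
    rw [curveValue_inv_sub I_sq two_ne_zero hb1 hb2 hr]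
    have : (1 : ℂ) + I ≠ 0 := fun h => by simpa using congrArg Complex.re h
    exact div_ne_zero (mul_ne_zero (neg_ne_zero.mpr this) hr.quadC)
      (mul_ne_zero (mul_ne_zero (mul_ne_zero hb1 hb2) hr.sub_b) hr.b_sub)
  · have h0 := vD.ne_zero h3
    have e3 : (Φ ^ 4) yc = Φ (Φ W) := rfl
    rw [e3]
    change 2 * cst b * W - (1 - cst I) * (cst b + cst I) ≠ 0 at h0
    change Φ (Φ W) = yc + pencil b * ((Φ (Φ q) - q) /
      (2 * cst b * W - (1 - cst I) * (cst b + cst I)))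
    rw [mul_div_assoc', mul_sub, ← e1, ← e2, eq_comm, ← eq_sub_iff_add_eq', div_eq_iff h0]
    unfold involutionForm
    ring

lemma phi_pow_ne_one (hb : b ≠ 0) (hb' : b ^ 2 ≠ 1) (hΦ : Φ xc = phiX b ∧ Φ yc = phiY b)
    (hk : Φ (pencil b) = -pencil b) {n : ℕ} (hn : 0 < n) : Φ ^ n ≠ 1 := by
  have hb1 : b + 1 ≠ 0 := fun h => hb' (by linear_combination (b - 1) * h)
  have hb2 : b - 1 ≠ 0 := fun h => hb' (by linear_combination (b + 1) * h)
  obtain ⟨r, hr, hr'⟩ := exists_isGenericParam hb1 hb2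
  obtain ⟨G, β, hβ, hG, hy⟩ := exists_phi_pow_four hb hb1 hb2 hΦ hk hr hr'
  have hk4 : (Φ ^ 4) (pencil b) = pencil b := by
    change Φ (Φ (Φ (Φ (pencil b)))) = _
    simp [hk]
  have hval : ∀ {z c}, HasValueAt z c (curvePt b r) → HasValueAt ((Φ ^ 4) z) c (curvePt b r) := by
    intro z c h
    refine HasValueAt.map_phi_sq (z := Φ (Φ z)) hb hb1 hb2 hΦ hr
      (HasValueAt.map_phi_sq hb hb1 hb2 hΦ hr' ?_)
    rwa [curveInv_curveInv hr hr'.invDen]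
  have key : ∀ m : ℕ, ∃ H, HasValueAt H (m * β) (curvePt b r) ∧
      ((Φ ^ 4) ^ m) yc = yc + pencil b * H := by
    intro m
    induction m with
    | zero => exact ⟨0, by simpa using hasValueAt_const (R := curvePt b r) (0 : ℂ), by simp⟩
    | succ m ih =>
      obtain ⟨H, hH, e⟩ := ih
      refine ⟨G + (Φ ^ 4) H, (hG.add (hval hH)).congr rfl (by push_cast; ring), ?_⟩
      rw [pow_succ', AlgEquiv.mul_apply, e, map_add, map_mul, hk4, hy]
      ring
  intro h1
  obtain ⟨H, hH, e⟩ := key n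
  rw [← pow_mul, mul_comm, pow_mul, h1, one_pow, AlgEquiv.one_apply, left_eq_add] at e
  exact hH.ne_zero (mul_ne_zero (by exact_mod_cast hn.ne') hβ)
    ((mul_eq_zero.mp e).resolve_left (pencil_ne_zero hb))

lemma phi_pencil (hb : b ≠ 0) (hΦ : Φ xc = phiX b ∧ Φ yc = phiY b) :
    Φ (pencil b) = -pencil b := by
  have hcst : ∀ a, Φ (cst a) = cst a := fun a => Φ.commutes a
  obtain ⟨-, -, n1, n2, n3, n4⟩ := phi_denominators hb
  refine Eq.trans ?_ (factors_phi (x := xc) (y := yc) (cst_ne_zero hb) isCoord_xc_yc.fst_ne_zero isCoord_xc_yc.snd_ne_zero n1 n2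
    n4 n3 cst_I_sq rfl rfl)
  change Φ (factorA (cst I) (cst b) xc yc * factorB (cst I) (cst b) xc yc /
    (xc ^ 2 * yc ^ 2)) = _
  simp only [factorA, factorB, map_div₀, map_mul, map_add, map_sub, map_neg, map_pow, map_one, hcst,
    hΦ.1, hΦ.2]
  rfl

end

end HalphenSurface

end

theorem mainTheorem3 (b : ℂ) (hb : b ≠ 0) :
    (∃ Φ : PlaneField ≃ₐ[ℂ] PlaneField,
      (Φ xc = phiX b ∧ Φ yc = phiY b) ∧
      LiftsToIso Φ (exampleSurface b) (exampleSurface b) ∧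
      antiPluricanonicalDim (exampleSurface b) 1 = 0 ∧
      antiPluricanonicalDim (exampleSurface b) 2 = 1 ∧
      antiPluricanonical (exampleSurface b) 2 = Submodule.span ℂ {f₀, f₁ b} ∧
      IsEllipticFibration (exampleSurface b) (f₁ b / f₀) ∧
      Φ (f₁ b / f₀) = -(f₁ b / f₀) ∧
      Φ ((f₁ b / f₀) ^ 2) = (f₁ b / f₀) ^ 2 ∧
      IsTypeII 2 (exampleSurface b) Φ ∧
      (b ^ 2 ≠ 1 → ∀ n : ℕ, 0 < n → Φ ^ n ≠ 1)) ∧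
    (∀ b₀ b₁ b₂ c : ℂ, b₀ ≠ 0 → b₁ ≠ 0 → b₂ ≠ 0 → c ≠ 0 →
      ∃ Ψ : PlaneField ≃ₐ[ℂ] PlaneField,
        Ψ xc = (familyMap ⟨xc, yc, b₀, b₁, b₂, c⟩).x ∧
        Ψ yc = (familyMap ⟨xc, yc, b₀, b₁, b₂, c⟩).y ∧
        LiftsToIso Ψ (familySurface b₀ b₁ b₂ c)
          (familySurface (familyMap ⟨xc, yc, b₀, b₁, b₂, c⟩).b₀
            (familyMap ⟨xc, yc, b₀, b₁, b₂, c⟩).b₁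
            (familyMap ⟨xc, yc, b₀, b₁, b₂, c⟩).b₂
            (familyMap ⟨xc, yc, b₀, b₁, b₂, c⟩).c)) ∧
    (∀ b₀ b₁ b₂ : ℂ, (b₀ * b₁ * b₂)⁻¹ = -1 →
      (familyMap ⟨xc, yc, b₀, b₁, b₂, Complex.I⟩).b₀ = b₀ ∧
      (familyMap ⟨xc, yc, b₀, b₁, b₂, Complex.I⟩).b₁ = b₁ ∧
      (familyMap ⟨xc, yc, b₀, b₁, b₂, Complex.I⟩).b₂ = b₂ ∧
      (familyMap ⟨xc, yc, b₀, b₁, b₂, Complex.I⟩).c = Complex.I) ∧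
    ((1 / b) * (-1) * b)⁻¹ = -1 ∧
    exampleSurface b = familySurface (1 / b) (-1) b Complex.I ∧
    familyMap ⟨xc, yc, 1 / b, -1, b, Complex.I⟩ =
      ⟨phiX b, phiY b, 1 / b, -1, b, Complex.I⟩ := by
  have hIso := (isIsoFrom_familySurface (one_div_ne_zero hb) (neg_ne_zero.mpr one_ne_zero) hb
    Complex.I_ne_zero).familyMap
  rw [familyMap_example hb] at hIso
  obtain ⟨-, Φ, hx, hy, hΦ⟩ := hIso
  simp only [] at hx hy hΦ
  rw [← exampleSurface_eq_familySurface hb] at hΦ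
  have hk := phi_pencil hb ⟨hx, hy⟩
  have hfib : IsEllipticFibration (exampleSurface b) (f₁ b / f₀) :=
    { morphism := fun R hR => pencil_mem_or_inv_mem hb hR
      elliptic := finite_not_isEllipticFibre hb
      not_product := fun ⟨E, _, hE, _⟩ => zero_ne_one
        ((geometricGenus_intermediateField regularDifferentials_planeField E).symm.trans hE)
      minimal := fun C hC => not_isExceptionalCurve_of_fibre hb hC }
  have hpar : ((1 / b) * (-1) * b)⁻¹ = -1 := by field_simp
  refine ⟨⟨Φ, ⟨hx, hy⟩, hΦ, antiPluricanonicalDim_one hb, antiPluricanonicalDim_two hb,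
    antiPluricanonical_two hb, hfib, hk, ?_, ⟨two_pos, hΦ, ?_, antiPluricanonicalDim_two hb,
      f₀, f₁ b, antiPluricanonical_two hb, hfib, ⟨-1, 0, 0, 1, by norm_num, ?_⟩, ?_⟩, ?_⟩,
    ?_, fun b₀ b₁ b₂ h => familyMap_parameters h xc yc, hpar,
    exampleSurface_eq_familySurface hb, familyMap_example hb⟩
  · rw [map_pow, hk, neg_sq]
  · intro j h0 h2
    obtain rfl : j = 1 := by omega
    exact antiPluricanonicalDim_one hb
  · rw [cst_zero, cst_neg, cst_one, zero_mul, zero_add, add_zero, div_one, neg_one_mul]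
    exact hk
  · intro h
    exact pencil_ne_zero hb (self_eq_neg.mp (h.symm.trans hk))
  · intro h n hn
    exact phi_pow_ne_one hb h ⟨hx, hy⟩ hk hn
  · intro b₀ b₁ b₂ c h0 h1 h2 hc
    exact ((isIsoFrom_familySurface h0 h1 h2 hc).familyMap).2
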